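/- Consider one branch of a double null sheet in vacuum general relativity (no symmetry assumed) whose generators meet at a caustic. A point of the branch is given by $(v,\theta)$, where $\theta=(\theta^1,\theta^2)$ ranges over an open set $D\subseteq\mathbb R^2$ and labels the generator, and $v\in[0,1]$ is the area parameter: $v=1$ on the intersection surface $S_0$ and $v=0$ at the caustic, and the area density is $\rho(v,\theta)=\rho_0(\theta)v^2$ with $\rho_0>0$ smooth on $D$. The conformal metric $e$ on the branch is given by the Beltrami coefficient $\mu$, through $e_{ab}d\theta^ad\theta^b=(1-\mu\bar\mu)^{-1}(dz+\mu\,d\bar z)(d\bar z+\bar\mu\,dz)$, $z=\theta^1+i\theta^2$. Assume that $\mu$ is regular at the caustic: $\mu$ is smooth on $[0,1]\times D$, with $|\mu|<1$ there (including $v=0$). Any such $\mu,\rho_0$ are allowed. The Poisson bracket of functionals of $\mu,\bar\mu$ and $\rho_0$ is determined by $\{\mu,\mu\}=\{\bar\mu,\bar\mu\}=0$, by the vanishing of all brackets with $\rho_0$, and by $$\{\mu(\mathbf 1),\bar\mu(\mathbf 2)\}=4\pi G\,\delta^2(\theta_{\mathbf 2}-\theta_{\mathbf 1})\,H(\mathbf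 1,\mathbf 2)\left[\frac{1-\mu\bar\mu}{\sqrt\rho}\right]_{\mathbf 1}\left[\frac{1-\mu\bar\mu}{\sqrt\rho}\right]_{\mathbf 2}\exp\int_{\mathbf 1}^{\mathbf 2}\frac{\bar\mu\,d\mu-\mu\,d\bar\mu}{1-\mu\bar\mu},$$ with the integral along the generator, $H(\mathbf 1,\mathbf 2)=1$ if $v_{\mathbf 2}\le v_{\mathbf 1}$ and $H=0$ otherwise. For functionals $F_1,F_2$ with functional derivatives, $$\{F_1,F_2\}=\iint\left(\tfrac{\delta F_1}{\delta\mu(\mathbf 1)}\{\mu(\mathbf 1),\bar\mu(\mathbf 2)\}\tfrac{\delta F_2}{\delta\bar\mu(\mathbf 2)}+\tfrac{\delta F_1}{\delta\bar\mu(\mathbf 1)}\{\bar\mu(\mathbf 1),\mu(\mathbf 2)\}\tfrac{\delta F_2}{\delta\mu(\mathbf 2)}\right).$$ On each generator let $V$ be a real $2\times2$ matrix valued field ($C^1$ on $[0,1]$) with $VV^t=e$, $\det V=1$; let $P$ and $Q$ be the symmetric and antisymmetric parts of $J=V^{-1}dV$, and for $r\in(0,1]$ put $$\hat J(q;r)=Q(q)+\frac{1}{\sqrt{1-\rho(q)/\rho(r)}}\,P(q),\qquad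 U(r)=V(0)\,\mathcal P\exp\int_0^r\hat J(\cdot\,;r),\qquad E(r)=U(r)U(r)^t,$$ where $\mathcal P\exp$ is the path ordered exponential, ordered from left to right, defined by its series of iterated integrals. Then: 1. On every generator and for every $r\in(0,1]$, $\hat J(\cdot\,;r)$ is integrable on $[0,r]$, the series converges, and $E(r)$ does not depend on the choice of $V$. $E$ is real, symmetric, positive definite, of determinant $1$, and continuous in $(v,\theta)\in(0,1]\times D$. 2. As distributions on pairs of points of $(0,1)\times D$, $$\{\overset{1}{E},\overset{2}{E}\}=\mathrm{p.v.}\left(\frac{16\pi G}{\rho(\mathbf 1)-\rho(\mathbf 2)}\right)\delta^2(\theta_{\mathbf 2}-\theta_{\mathbf 1})\left(\Omega\,\overset{1}{E}\overset{2}{E}+\overset{1}{E}\,{}^t\Omega\,\overset{2}{E}+\overset{2}{E}\,\Omega^t\,\overset{1}{E}+\overset{1}{E}\overset{2}{E}\,{}^t\Omega^t\right),$$ with $\Omega_a{}^b{}_c{}^d=\frac14\left(\delta_a^d\delta_c^b-\frac12\delta_a^b\delta_c^d\right)$, the left (right) superscript $t$ denoting transposition in the first (second) pair of indices; and equivalently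 $$\{E_{ab}(\mathbf 1),E_{cd}(\mathbf 2)\}=\mathrm{p.v.}\left(\frac{16\pi G}{\rho(\mathbf 1)-\rho(\mathbf 2)}\right)\delta^2(\theta_{\mathbf 2}-\theta_{\mathbf 1})\,\mathrm{Sym}_{(ab),(cd)}\left(E_{ad}(\mathbf 1)E_{cb}(\mathbf 2)-\tfrac12E_{ab}(\mathbf 1)E_{cd}(\mathbf 2)\right).$$ That is, for all real test functions $\varphi,\psi\in C_c^\infty((0,1)\times D)$ and all indices, the functionals $\int\varphi E_{ab}\,dv\,d^2\theta$ and $\int\psi E_{cd}\,dv\,d^2\theta$ have functional derivatives with respect to $\mu$ and $\bar\mu$, the integral defining their bracket converges absolutely, and it equals the limit for $\epsilon\to0^+$ of the integral of the coefficient of $\delta^2(\theta_{\mathbf 2}-\theta_{\mathbf 1})$ on the right side, times $\varphi(v_1,\theta)\psi(v_2,\theta)$, over all $\theta\in D$, $v_1,v_2\in[0,1]$ with $|\rho(v_1,\theta)-\rho(v_2,\theta)|>\epsilon$. -/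

import Mathlib

open Set Filter Topology MeasureTheory
open scoped ContDiff ComplexConjugate

noncomputable section

namespace NullSheet

/-- Real `2 × 2` matrices. -/
abbrev Mat2 : Type := Matrix (Fin 2) (Fin 2) ℝ

/-- The space of the transverse coordinates `θ = (θ¹, θ²)` that label the generators. -/
abbrev Transverse : Type := EuclideanSpace ℝ (Fin 2)

/-! ### Path ordered exponentials and the deformed conformal metric on one generator -/

/-- The order `s` term of the path ordered exponential (ordered from left to right) of `A` from
`a` to `b`:  `∫_a^b dz₁ ∫_{z₁}^b dz₂ ⋯ ∫_{z_{s-1}}^b dz_s A(z₁) A(z₂) ⋯ A(z_s)`. -/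
def pathOrderedTerm (A : ℝ → Mat2) : ℕ → ℝ → ℝ → Mat2
  | 0, _, _ => 1
  | s + 1, a, b =>
      Matrix.of fun i j => ∫ z in a..b, (A z * pathOrderedTerm A s z b) i j

/-- The path ordered exponential `P exp ∫_a^b A dz`. -/
def pathOrderedExp (A : ℝ → Mat2) (a b : ℝ) : Mat2 :=
  ∑' s : ℕ, pathOrderedTerm A s a b

/-- The component along the generator of the connection `J = V⁻¹ dV` of a zweibein field `V`. -/
def connection (V : ℝ → Mat2) (x : ℝ) : Mat2 :=
  (V x)⁻¹ * Matrix.of fun i j => deriv (fun y => V y i j) x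

/-- The symmetric part `P` of `J`. -/
def connectionP (V : ℝ → Mat2) (x : ℝ) : Mat2 :=
  (1 / 2 : ℝ) • (connection V x + (connection V x).transpose)

/-- The antisymmetric part `Q` of `J`. -/
def connectionQ (V : ℝ → Mat2) (x : ℝ) : Mat2 :=
  (1 / 2 : ℝ) • (connection V x - (connection V x).transpose)

/-- The deformed connection `Q(q) + (1 - ρ(q)/ρ(r))^(-1/2) P(q)` at the field point `q`, with
deformation point `r`. -/
def deformedConnection (V : ℝ → Mat2) (ρ : ℝ → ℝ) (r q : ℝ) : Mat2 :=
  connectionQ V q + (1 / Real.sqrt (1 - ρ q / ρ r)) • connectionP V q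

/-- The deformed zweibein at the field point `p` with deformation point `r`; the parameter value
`0` on the generator is the caustic. -/
def deformedZweibein (V : ℝ → Mat2) (ρ : ℝ → ℝ) (p r : ℝ) : Mat2 :=
  V 0 * pathOrderedExp (deformedConnection V ρ r) 0 p

/-- The deformed conformal metric `E(r) = U(r) U(r)ᵗ`, where `U(r)` is the deformed zweibein at
`r` with deformation point `r`. -/
def deformedMetric (V : ℝ → Mat2) (ρ : ℝ → ℝ) (r : ℝ) : Mat2 :=
  deformedZweibein V ρ r r * (deformedZweibein V ρ r r).transpose

/-! ### Beltrami coefficient, conformal metric, zweibein -/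

/-- The components with respect to `dθ¹, dθ²` of the `1`-form `dz + m dz̄`, `z = θ¹ + iθ²`. -/
def beltramiForm (m : ℂ) : Fin 2 → ℂ := ![1 + m, Complex.I * (1 - m)]

/-- The conformal metric `e_{ab}` with Beltrami coefficient `m`:
`e_{ab} dθ^a dθ^b = (1 - m m̄)⁻¹ (dz + m dz̄)(dz̄ + m̄ dz)`. -/
def conformalMetric (m : ℂ) : Mat2 :=
  Matrix.of fun a b => (beltramiForm m a * conj (beltramiForm m b)).re / (1 - ‖m‖ ^ 2)

/-- `W` is a positively oriented, unit determinant zweibein of the conformal metric `e`. -/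
def IsZweibein (W e : Mat2) : Prop :=
  W * W.transpose = e ∧ W.det = 1

/-- The symmetric zweibein of positive trace of the conformal metric with Beltrami
coefficient `m`. -/
def symZweibein (m : ℂ) : Mat2 :=
  (1 / Real.sqrt (1 - ‖m‖ ^ 2)) • !![1 + m.re, m.im; m.im, 1 - m.re]

/-- Consistency check: `symZweibein m` is indeed a zweibein of `conformalMetric m`. -/
theorem isZweibein_symZweibein (m : ℂ) (hm : ‖m‖ < 1) :
    IsZweibein (symZweibein m) (conformalMetric m) := by
  have h1 : 0 < 1 - ‖m‖ ^ 2 := by nlinarith [norm_nonneg m]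
  have hs : Real.sqrt (1 - ‖m‖ ^ 2) ^ 2 = 1 - ‖m‖ ^ 2 := Real.sq_sqrt h1.le
  have hn : ‖m‖ ^ 2 = m.re ^ 2 + m.im ^ 2 := by
    rw [← Complex.normSq_eq_norm_sq, Complex.normSq_apply]; ring
  have h0 : Real.sqrt (1 - ‖m‖ ^ 2) ≠ 0 := (Real.sqrt_pos.2 h1).ne'
  constructor
  · ext a b
    fin_cases a <;> fin_cases b <;>
      simp [symZweibein, conformalMetric, beltramiForm, Matrix.mul_apply, Fin.sum_univ_two] <;>
      (rw [eq_div_iff h1.ne']; field_simp; rw [hs]; try ring)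
  · simp only [symZweibein, Matrix.det_smul, Matrix.det_fin_two_of, Fintype.card_fin]
    rw [div_pow, hs, one_pow, div_mul_eq_mul_div, div_eq_one_iff_eq h1.ne', hn]
    ring

/-! ### Regular data on a branch swept out by generators that meet at a caustic

A point of the branch is given by the coordinates `(v, θ)`, where `θ ∈ D` labels the generator
and `v ∈ [0, 1]` is the area parameter: `v = 1` on `S₀`, `v = 0` on the caustic, and the area
density is `ρ = ρ₀(θ) v²`. -/

/-- The area density `ρ = ρ₀ v²`. -/
def areaDensity (ρ₀ : Transverse → ℝ) (θ : Transverse) (v : ℝ) : ℝ := ρ₀ θ * v ^ 2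

/-- Smooth data on the branch, with `μ` regular up to the caustic. -/
structure IsRegularBranch (D : Set Transverse) (μ : ℝ × Transverse → ℂ)
    (ρ₀ : Transverse → ℝ) : Prop where
  smooth_mu : ContDiffOn ℝ ∞ μ (Icc 0 1 ×ˢ D)
  norm_mu_lt : ∀ p ∈ Icc (0 : ℝ) 1 ×ˢ D, ‖μ p‖ < 1
  smooth_rho : ContDiffOn ℝ ∞ ρ₀ D
  rho_pos : ∀ θ ∈ D, 0 < ρ₀ θ

/-- The map `μ ↦ E`, applied generator by generator: the value of `E` at the point `(v, θ)`. -/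
def fieldE (ρ₀ : Transverse → ℝ) (μ : ℝ × Transverse → ℂ) (p : ℝ × Transverse) : Mat2 :=
  deformedMetric (fun x => symZweibein (μ (x, p.2))) (areaDensity ρ₀ p.2) p.1

/-! ### The Poisson bracket of functionals of `μ` and `μ̄` -/

/-- Test functions on the branch minus the caustic and `S₀`. -/
structure IsTestFunction (D : Set Transverse) (φ : ℝ × Transverse → ℝ) : Prop where
  smooth : ContDiff ℝ ∞ φ
  compact : HasCompactSupport φ
  support : tsupport φ ⊆ Ioo 0 1 ×ˢ D

/-- Variations of `μ`: smooth up to the caustic and `S₀`, and vanishing outside a compact set of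
generators. -/
structure IsVariation (D : Set Transverse) (η : ℝ × Transverse → ℂ) : Prop where
  smooth : ContDiff ℝ ∞ η
  compact : HasCompactSupport η
  support : tsupport η ⊆ univ ×ˢ D

/-- `f` and `g` are the functional derivatives `δF/δμ` and `δF/δμ̄` of the functional `F` at `μ`:
`δF = ∫ (f δμ + g δμ̄) dv d²θ`. -/
def HasFunctionalDerivs (D : Set Transverse) (F : (ℝ × Transverse → ℂ) → ℝ)
    (μ f g : ℝ × Transverse → ℂ) : Prop :=
  ∀ η : ℝ × Transverse → ℂ, IsVariation D η →
    IntegrableOn (fun p => f p * η p) (Icc 0 1 ×ˢ D) ∧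
    IntegrableOn (fun p => g p * conj (η p)) (Icc 0 1 ×ˢ D) ∧
    HasDerivAt (fun t : ℝ => ((F (fun p => μ p + (t : ℂ) * η p) : ℝ) : ℂ))
      (∫ p in Icc 0 1 ×ˢ D, (f p * η p + g p * conj (η p))) 0

/-- The phase integral `∫_{v₁}^{v₂} (1 - μμ̄)⁻¹ (μ̄ dμ - μ dμ̄)` along the generator `θ`. -/
def phaseIntegral (μ : ℝ × Transverse → ℂ) (θ : Transverse) (v₁ v₂ : ℝ) : ℂ :=
  ∫ v in v₁..v₂,
    (conj (μ (v, θ)) * deriv (fun x => μ (x, θ)) v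
      - μ (v, θ) * conj (deriv (fun x => μ (x, θ)) v)) / ((1 - ‖μ (v, θ)‖ ^ 2 : ℝ) : ℂ)

/-- The coefficient of `δ²(θ₂ - θ₁)` in the bracket `{μ(v₁, θ₁), μ̄(v₂, θ₂)}`:
`4πG H(1,2) [(1 - μμ̄)/√ρ]₁ [(1 - μμ̄)/√ρ]₂ exp ∫₁² (1 - μμ̄)⁻¹ (μ̄ dμ - μ dμ̄)`.
The step function `H(1,2)` is `1` if the point `1` lies on `S₀` (`v = 1`) or between `S₀` and the
point `2`, that is, if `v₂ ≤ v₁`, and it is `0` otherwise. -/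
def bracketKernel (G : ℝ) (ρ₀ : Transverse → ℝ) (μ : ℝ × Transverse → ℂ) (θ : Transverse)
    (v₁ v₂ : ℝ) : ℂ :=
  if v₂ ≤ v₁ then
    ((4 * Real.pi * G
        * ((1 - ‖μ (v₁, θ)‖ ^ 2) / Real.sqrt (areaDensity ρ₀ θ v₁))
        * ((1 - ‖μ (v₂, θ)‖ ^ 2) / Real.sqrt (areaDensity ρ₀ θ v₂)) : ℝ) : ℂ)
      * Complex.exp (phaseIntegral μ θ v₁ v₂)
  else 0

/-- The domain of `(θ, v₁, v₂)`: pairs of points on the same generator. -/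
def pairDomain (D : Set Transverse) : Set (Transverse × ℝ × ℝ) :=
  D ×ˢ (Icc 0 1 ×ˢ Icc 0 1)

/-- The bracket `{F₁, F₂}` at `μ` of two functionals of `μ`, `μ̄` (and the fixed `ρ₀`, which
commutes with everything) exists and equals `c`:
`{F₁, F₂} = ∫∫ (δF₁/δμ(1) {μ(1), μ̄(2)} δF₂/δμ̄(2) + δF₁/δμ̄(1) {μ̄(1), μ(2)} δF₂/δμ(2))`,
where `{μ̄(1), μ(2)} = - {μ(2), μ̄(1)}`, the brackets `{μ, μ}` and `{μ̄, μ̄}` vanish, and the factor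
`δ²(θ₂ - θ₁)` in `{μ(1), μ̄(2)}` has been used to carry out the integral over `θ₂`. -/
def HasPoissonBracket (G : ℝ) (D : Set Transverse) (ρ₀ : Transverse → ℝ)
    (μ : ℝ × Transverse → ℂ) (F₁ F₂ : (ℝ × Transverse → ℂ) → ℝ) (c : ℂ) : Prop :=
  ∃ f₁ g₁ f₂ g₂ : ℝ × Transverse → ℂ,
    HasFunctionalDerivs D F₁ μ f₁ g₁ ∧ HasFunctionalDerivs D F₂ μ f₂ g₂ ∧
    IntegrableOn (fun q : Transverse × ℝ × ℝ =>
      f₁ (q.2.1, q.1) * bracketKernel G ρ₀ μ q.1 q.2.1 q.2.2 * g₂ (q.2.2, q.1)) (pairDomain D) ∧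
    IntegrableOn (fun q : Transverse × ℝ × ℝ =>
      g₁ (q.2.1, q.1) * bracketKernel G ρ₀ μ q.1 q.2.2 q.2.1 * f₂ (q.2.2, q.1)) (pairDomain D) ∧
    c = ∫ q in pairDomain D,
      (f₁ (q.2.1, q.1) * bracketKernel G ρ₀ μ q.1 q.2.1 q.2.2 * g₂ (q.2.2, q.1)
        - g₁ (q.2.1, q.1) * bracketKernel G ρ₀ μ q.1 q.2.2 q.2.1 * f₂ (q.2.2, q.1))

/-- The smeared field `∫ φ E_{ab} dv d²θ` as a functional of `μ`. -/
def smearedE (D : Set Transverse) (ρ₀ : Transverse → ℝ) (φ : ℝ × Transverse → ℝ)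
    (a b : Fin 2) (μ : ℝ × Transverse → ℂ) : ℝ :=
  ∫ p in Icc 0 1 ×ˢ D, φ p * fieldE ρ₀ μ p a b

/-! ### The right side of the bracket -/

/-- Pairs of points on the same generator with `|ρ(1) - ρ(2)| > ε`. -/
def excisedDomain (D : Set Transverse) (ρ₀ : Transverse → ℝ) (ε : ℝ) :
    Set (Transverse × ℝ × ℝ) :=
  pairDomain D ∩ {q | ε < |areaDensity ρ₀ q.1 q.2.1 - areaDensity ρ₀ q.1 q.2.2|}

/-- The distribution
`p.v.(coef / (ρ(1) - ρ(2))) δ²(θ₂ - θ₁) K(1,2)` on pairs of points, applied to `φ(1) ψ(2)`, exists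
and equals `c`.  Here `K` is a function of two points and `p.v.` is the Cauchy principal value. -/
def HasPrincipalValue (D : Set Transverse) (ρ₀ : Transverse → ℝ) (coef : ℝ)
    (K : ℝ × Transverse → ℝ × Transverse → ℝ) (φ ψ : ℝ × Transverse → ℝ) (c : ℝ) : Prop :=
  let I : Transverse × ℝ × ℝ → ℝ := fun q =>
    coef / (areaDensity ρ₀ q.1 q.2.1 - areaDensity ρ₀ q.1 q.2.2)
      * K (q.2.1, q.1) (q.2.2, q.1) * (φ (q.2.1, q.1) * ψ (q.2.2, q.1))
  (∀ ε > 0, IntegrableOn I (excisedDomain D ρ₀ ε)) ∧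
    Tendsto (fun ε : ℝ => ∫ q in excisedDomain D ρ₀ ε, I q) (𝓝[>] 0) (𝓝 c)

/-- Kronecker delta. -/
def kron (a b : Fin 2) : ℝ := if a = b then 1 else 0

/-- The tensor `Ω_a{}^b{}_c{}^d = ¼ (δ_a^d δ_c^b - ½ δ_a^b δ_c^d)`, as `omegaTensor a b c d`. -/
def omegaTensor (a b c d : Fin 2) : ℝ :=
  (1 / 4) * (kron a d * kron c b - (1 / 2) * kron a b * kron c d)

/-- The components with indices `a, b` in space `1` and `c, d` in space `2` of
`Ω E₁ E₂ + E₁ ᵗΩ E₂ + E₂ Ωᵗ E₁ + E₁ E₂ ᵗΩᵗ`; a left (right) superscript `t` is transposition in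
space `1` (`2`). -/
def quadraticTensor (E₁ E₂ : Mat2) (a b c d : Fin 2) : ℝ :=
  (∑ i, ∑ j, omegaTensor a i c j * E₁ i b * E₂ j d)
    + (∑ i, ∑ j, E₁ a i * omegaTensor b i c j * E₂ j d)
    + (∑ i, ∑ j, E₂ c j * omegaTensor a i d j * E₁ i b)
    + (∑ i, ∑ j, E₁ a i * E₂ c j * omegaTensor b i d j)

/-- Symmetrization in the pairs of indices `a, b` and `c, d`. -/
def symPairs (X : Fin 2 → Fin 2 → Fin 2 → Fin 2 → ℝ) (a b c d : Fin 2) : ℝ :=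
  (1 / 4) * (X a b c d + X b a c d + X a b d c + X b a d c)

/-- `Sym_{(ab),(cd)} (E₁_{ad} E₂_{cb} - ½ E₁_{ab} E₂_{cd})`. -/
def quadraticExplicit (E₁ E₂ : Mat2) (a b c d : Fin 2) : ℝ :=
  symPairs (fun a b c d => E₁ a d * E₂ c b - (1 / 2) * E₁ a b * E₂ c d) a b c d

end NullSheet

end

noncomputable section

set_option linter.unusedSectionVars false

namespace NullSheet

/-! On one generator the substitution q = r sin t turns 1 - ρ(q)/ρ(r) into cos² t, and the factor
cos t in dq removes the inverse square root. The deformed connection becomes r (cos t Q + P) dt on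
[0, π/2], which is continuous (`IsRegularConnection.isPullback`, `pathOrderedTerm_eq`). Convergence,
positivity, unit determinant and continuity are then facts about ordered exponentials of continuous
traceless matrices. Two zweibeine of one metric differ by a rotation R acting from the right; P
transforms covariantly and the inhomogeneous term falls into Q alone, so U(r) changes to U(r) R(r)
and U Uᵗ does not change (`orderedMetric_gauge`).

For the bracket the zweibein is rotated by an angle χ that makes Q vanish; the connection is then
one complex function p. Under a variation η of μ the connection changes, up to one extra term, by a
covariant derivative. Integration by parts (`integral_varConnDeriv`, `varEDeriv_zero`) cancels the
boundary term at the caustic against the variation of V(0), the boundary term at r is an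
infinitesimal rotation, and there remains δE(r) = ∫ sin t ⟨c(r,t), y'(r sin t)⟩ dt, y(v) = v e^{2iχ}
η / (1 - |μ|²). The amplitude c and a real companion d are the components of the response of E in
the basis of sl(2). They obey ∂c/∂t = 2i r p d and ∂d/∂t = 2r Im(p̄ c), with d = 0 at t = π/2
(`IsParallel.isAmplitude`).

Smearing in r and passing to q = r sin t, s = r cos t, which are polar coordinates, gives a kernel
κ(q) = ∫ q/(q² + s²) c ds, where c now includes the test function. A second integration by parts
shows that the functional derivative with respect to μ is -½ v κ̄' e^{2iχ}/(1 - |μ|²)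
(`hasFunctionalDerivs_smearedE`). In the bracket the weights and the phase of the given kernel
cancel these factors exactly. What is left is πG/ρ₀ times a step function, hence (πG/ρ₀) · 2∫⟨κ₁',
κ₂⟩ dq on each generator (`branchDeriv_bracketKernel`, `IsUnitPrimitive.integral_antisymm`).

The heart of the proof is the evaluation of this integral. Written as an integral over two
deformation points r₁, r₂, its antisymmetric part contains the Wronskian in q of two kernels, and by
the linear system for c and d this Wronskian is an exact q-derivative
(`hasDerivAt_wronskianPrimitive`). Only boundary values survive. At the caustic they are 2/(r₂² -
r₁²) · (⟨c₁,c₂⟩ - d₁d₂) at t = 0; at the other end, which is singular and needs a cutoff s ≥ δ, they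
vanish in the limit δ → 0 (`two_mul_pairing`). The form ⟨c₁,c₂⟩ - d₁d₂ is built from the Casimir of
sl(2), which is invariant under conjugation, so that V(0) disappears and the tensor Ω contracted
with E(r₁) and E(r₂) appears (`casimir`, `causticPairing_eq`).

Antisymmetrization in r₁, r₂ lowers the singularity on the diagonal to (r₂ - r₁)^(-1/2), which is
integrable (`abs_closedForm_sub_le`). The excised integral in the principal value, folded along the
diagonal, has the same density, and dominated convergence identifies its limit with the bracket
(`tendsto_integral_cutIntegrand`). -/

/-! ### Ordered exponentials in a Banach algebra -/

section OrderedExponential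

variable {X : Type*} [TopologicalSpace X]
  {𝔸 : Type*} [NormedRing 𝔸] [NormedAlgebra ℝ 𝔸]

/-- The terms of the ordered exponential of `A` from `t` to `T`. -/
def orderedTerm (A : ℝ → 𝔸) (T : ℝ) : ℕ → ℝ → 𝔸
  | 0, _ => 1
  | s + 1, t => ∫ z in t..T, A z * orderedTerm A T s z

/-- The ordered exponential of `A` from `t` to `T`. -/
def orderedExp (A : ℝ → 𝔸) (T t : ℝ) : 𝔸 := ∑' s : ℕ, orderedTerm A T s t

/-- The parameter and the lower endpoint are treated jointly because the next term integrates over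
that endpoint. Rewriting the integral from the fixed endpoint `T` puts the moving endpoint on top.
-/
theorem continuous_orderedTerm_param [FirstCountableTopology X] {A : X → ℝ → 𝔸}
    (hA : Continuous fun y : X × ℝ => A y.1 y.2) (T : ℝ) (s : ℕ) :
    Continuous fun y : X × ℝ => orderedTerm (A y.1) T s y.2 := by
  induction s with
  | zero => exact continuous_const
  | succ s ih =>
    have h : (fun y : X × ℝ => orderedTerm (A y.1) T (s + 1) y.2) =
        fun y => - ∫ z in T..y.2, A y.1 z * orderedTerm (A y.1) T s z := by
      ext y; rw [← intervalIntegral.integral_symm]; rfl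
    rw [h]
    refine (intervalIntegral.continuous_parametric_intervalIntegral_of_continuous
      (f := fun (y : X × ℝ) z => A y.1 z * orderedTerm (A y.1) T s z) ?_ continuous_snd).neg
    have h1 : Continuous fun y : (X × ℝ) × ℝ => (y.1.1, y.2) := by fun_prop
    exact (hA.comp h1).mul (ih.comp h1)

theorem continuous_orderedTerm {A : ℝ → 𝔸} (hA : Continuous A) (T : ℝ) (s : ℕ) :
    Continuous (orderedTerm A T s) := by
  have := continuous_orderedTerm_param (X := Unit) (A := fun _ => A) (by fun_prop) T s
  exact this.comp (f := fun t => ((), t)) (by fun_prop)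

theorem hasDerivAt_orderedTerm_succ [CompleteSpace 𝔸] {A : ℝ → 𝔸} (hA : Continuous A)
    (T : ℝ) (s : ℕ) (t : ℝ) :
    HasDerivAt (orderedTerm A T (s + 1)) (-(A t * orderedTerm A T s t)) t := by
  have hc : Continuous fun z => A z * orderedTerm A T s z := hA.mul (continuous_orderedTerm hA T s)
  exact intervalIntegral.integral_hasDerivAt_left (hc.intervalIntegrable _ _)
    (hc.stronglyMeasurableAtFilter _ _) hc.continuousAt

/-- The usual iterated-integral estimate. Both orders of `t` and `T` are covered, since derivatives
are later taken at `T` itself, and ‖1‖ stays in the bound because the norm of the unit is not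
assumed to be 1. -/
theorem norm_orderedTerm_le {A : ℝ → 𝔸} {T R C : ℝ}
    (hC : ∀ z, |T - z| ≤ R → ‖A z‖ ≤ C) (s : ℕ) :
    ∀ t, |T - t| ≤ R → ‖orderedTerm A T s t‖ ≤ ‖(1 : 𝔸)‖ * (C * |T - t|) ^ s / s.factorial := by
  induction s with
  | zero => intro t _; simp [orderedTerm]
  | succ s ih =>
    intro t ht
    have hC0 : 0 ≤ C := (norm_nonneg _).trans (hC t ht)
    have key : ∀ z, |T - z| ≤ |T - t| → ‖A z * orderedTerm A T s z‖ ≤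
        C * (‖(1 : 𝔸)‖ * (C * |T - z|) ^ s / s.factorial) := by
      intro z hz
      exact (norm_mul_le _ _).trans (mul_le_mul (hC z (hz.trans ht)) (ih z (hz.trans ht))
        (norm_nonneg _) hC0)
    have hint : ∀ u : ℝ, 0 ≤ u → ∫ x in (0 : ℝ)..u, C * (‖(1 : 𝔸)‖ * (C * x) ^ s / s.factorial)
        = ‖(1 : 𝔸)‖ * (C * u) ^ (s + 1) / (s + 1).factorial := by
      intro u _
      have : (fun x : ℝ => C * (‖(1 : 𝔸)‖ * (C * x) ^ s / s.factorial)) =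
          fun x => (C * (‖(1 : 𝔸)‖ * C ^ s / s.factorial)) * x ^ s := by
        ext x; rw [mul_pow]; ring
      rw [this, intervalIntegral.integral_const_mul, integral_pow, Nat.factorial_succ]
      push_cast
      have h1 : (s.factorial : ℝ) ≠ 0 := by positivity
      have h2 : (s : ℝ) + 1 ≠ 0 := by positivity
      field_simp
      ring
    rcases le_total t T with h | h
    · rw [abs_of_nonneg (sub_nonneg.2 h), ← hint _ (sub_nonneg.2 h)]
      have e := intervalIntegral.integral_comp_sub_left
        (fun x : ℝ => C * (‖(1 : 𝔸)‖ * (C * x) ^ s / s.factorial)) T (a := t) (b := T)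
      rw [sub_self] at e
      rw [← e]
      refine intervalIntegral.norm_integral_le_of_norm_le h (ae_of_all _ fun z hz => ?_)
        (Continuous.intervalIntegrable (by fun_prop) _ _)
      have := key z (by
        rw [abs_of_nonneg (sub_nonneg.2 hz.2), abs_of_nonneg (sub_nonneg.2 h)]; linarith [hz.1])
      rwa [abs_of_nonneg (sub_nonneg.2 hz.2)] at this
    · have e0 : orderedTerm A T (s + 1) t = - ∫ z in T..t, A z * orderedTerm A T s z := by
        rw [← intervalIntegral.integral_symm]; rfl
      rw [e0, norm_neg, abs_of_nonpos (sub_nonpos.2 h), neg_sub, ← hint _ (sub_nonneg.2 h)]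
      have e := intervalIntegral.integral_comp_sub_right
        (fun x : ℝ => C * (‖(1 : 𝔸)‖ * (C * x) ^ s / s.factorial)) T (a := T) (b := t)
      rw [sub_self] at e
      rw [← e]
      refine intervalIntegral.norm_integral_le_of_norm_le h (ae_of_all _ fun z hz => ?_)
        (Continuous.intervalIntegrable (by fun_prop) _ _)
      have := key z (by
        rw [abs_of_nonpos (sub_nonpos.2 hz.1.le), abs_of_nonpos (sub_nonpos.2 h)]; linarith [hz.2])
      rwa [abs_of_nonpos (sub_nonpos.2 hz.1.le), neg_sub] at this

/-- The tube lemma applied to a compact interval: local uniformity in the parameter without local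
compactness of `X`. -/
theorem exists_bound_near [FirstCountableTopology X] {A : X → ℝ → 𝔸}
    (hA : Continuous fun y : X × ℝ => A y.1 y.2) (x : X) (T R : ℝ) :
    ∃ C, ∃ N ∈ 𝓝 x, ∀ y ∈ N, ∀ z, |T - z| ≤ R → ‖A y z‖ ≤ C := by
  have hK : IsCompact (Metric.closedBall T R) := isCompact_closedBall T R
  obtain ⟨C, hC⟩ := hK.exists_bound_of_continuousOn (f := fun z => A x z)
    ((hA.comp (f := fun z => (x, z)) (by fun_prop)).continuousOn)
  have hU : IsOpen {y : X × ℝ | ‖A y.1 y.2‖ < C + 1} := isOpen_lt hA.norm continuous_const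
  obtain ⟨u, v, hu, _, hxu, hKv, huv⟩ := generalized_tube_lemma (s := {x}) isCompact_singleton hK hU
    (by
      rintro ⟨y, z⟩ ⟨hy, hz⟩
      obtain rfl : y = x := hy
      have := hC z hz
      simp only [mem_ofPred_eq]; linarith)
  refine ⟨C + 1, u, hu.mem_nhds (hxu rfl), fun y hy z hz => ?_⟩
  have hz' : z ∈ Metric.closedBall T R := by
    rw [Metric.mem_closedBall, Real.dist_eq, abs_sub_comm]; exact hz
  have h2 : ((y, z) : X × ℝ) ∈ {y : X × ℝ | ‖A y.1 y.2‖ < C + 1} := huv ⟨hy, hKv hz'⟩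
  exact le_of_lt h2

theorem summable_bound (c x : ℝ) : Summable fun s : ℕ => c * x ^ s / s.factorial := by
  simpa only [mul_div_assoc] using (Real.summable_pow_div_factorial x).mul_left c

variable [CompleteSpace 𝔸]

theorem summable_norm_orderedTerm {A : ℝ → 𝔸} (hA : Continuous A) (T t : ℝ) :
    Summable fun s => ‖orderedTerm A T s t‖ := by
  obtain ⟨C, N, hN, hC⟩ := exists_bound_near (X := Unit) (A := fun _ => A) (by fun_prop) () T |T - t|
  exact Summable.of_nonneg_of_le (fun _ => norm_nonneg _)
    (fun s => norm_orderedTerm_le (hC () (mem_of_mem_nhds hN)) s t le_rfl) (summable_bound _ _)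

theorem summable_orderedTerm {A : ℝ → 𝔸} (hA : Continuous A) (T t : ℝ) :
    Summable fun s => orderedTerm A T s t :=
  (summable_norm_orderedTerm hA T t).of_norm

/-- Near a point the series is dominated by an exponential series; widening the radius by 1 leaves
room for a neighbourhood of `t`. -/
theorem continuous_orderedExp_param [FirstCountableTopology X] {A : X → ℝ → 𝔸}
    (hA : Continuous fun y : X × ℝ => A y.1 y.2) (T : ℝ) :
    Continuous fun y : X × ℝ => orderedExp (A y.1) T y.2 := by
  rw [continuous_iff_continuousAt]
  rintro ⟨x, t⟩
  obtain ⟨C, N, hN, hC⟩ := exists_bound_near hA x T (|T - t| + 1)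
  have hN2 : N ×ˢ Metric.closedBall t 1 ∈ 𝓝 (x, t) :=
    prod_mem_nhds hN (Metric.closedBall_mem_nhds t one_pos)
  have hC0 : 0 ≤ C := (norm_nonneg _).trans
    (hC x (mem_of_mem_nhds hN) T (by rw [sub_self, abs_zero]; positivity))
  refine (continuousOn_tsum (u := fun s : ℕ => ‖(1 : 𝔸)‖ * (C * (|T - t| + 1)) ^ s / s.factorial)
    (fun s => (continuous_orderedTerm_param hA T s).continuousOn) (summable_bound _ _)
    ?_).continuousAt hN2
  rintro s ⟨y, z⟩ ⟨hy, hz⟩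
  rw [Metric.mem_closedBall, Real.dist_eq] at hz
  have hz' : |T - z| ≤ |T - t| + 1 := by
    have := abs_sub_le T t z
    rw [abs_sub_comm t z] at this
    linarith
  refine (norm_orderedTerm_le (hC y hy) s z hz').trans ?_
  gcongr

theorem continuous_orderedExp {A : ℝ → 𝔸} (hA : Continuous A) (T : ℝ) :
    Continuous (orderedExp A T) := by
  have := continuous_orderedExp_param (X := Unit) (A := fun _ => A) (by fun_prop) T
  exact this.comp (f := fun t => ((), t)) (by fun_prop)

theorem orderedExp_self {A : ℝ → 𝔸} (T : ℝ) : orderedExp A T T = 1 := by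
  rw [orderedExp, tsum_eq_single 0]
  · rfl
  · intro s hs
    obtain ⟨k, rfl⟩ := Nat.exists_eq_succ_of_ne_zero hs
    exact intervalIntegral.integral_same

theorem hasDerivAt_orderedExp {A : ℝ → 𝔸} (hA : Continuous A) (T t : ℝ) :
    HasDerivAt (orderedExp A T) (-(A t * orderedExp A T t)) t := by
  obtain ⟨C, N, hN, hC⟩ := exists_bound_near (X := Unit) (A := fun _ => A) (by fun_prop) ()
    T (|T - t| + 1)
  replace hC := hC () (mem_of_mem_nhds hN)
  have hC0 : 0 ≤ C := (norm_nonneg _).trans (hC T (by rw [sub_self, abs_zero]; positivity))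
  -- The constant zeroth term is split off, so that the derivative of term s + 1 reproduces term s
  -- and the differentiated series resums to the exponential.
  have e : orderedExp A T = fun z => 1 + ∑' s : ℕ, orderedTerm A T (s + 1) z := by
    ext z
    rw [orderedExp, (summable_orderedTerm hA T z).tsum_eq_zero_add]
    rfl
  have key : HasDerivAt (fun z => ∑' s : ℕ, orderedTerm A T (s + 1) z)
      (∑' s : ℕ, -(A t * orderedTerm A T s t)) t := by
    refine hasDerivAt_tsum_of_isPreconnected (t := Metric.ball t 1) (y₀ := t)
      (u := fun s : ℕ => C * (‖(1 : 𝔸)‖ * (C * (|T - t| + 1)) ^ s / s.factorial))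
      ((summable_bound _ _).mul_left _) Metric.isOpen_ball
      (convex_ball t 1).isPreconnected
      (fun s z _ => hasDerivAt_orderedTerm_succ hA T s z) ?_ (Metric.mem_ball_self one_pos)
      ((summable_nat_add_iff 1).2 (summable_orderedTerm hA T t)) (Metric.mem_ball_self one_pos)
    intro s z hz
    rw [Metric.mem_ball, Real.dist_eq] at hz
    have hz' : |T - z| ≤ |T - t| + 1 := by
      have := abs_sub_le T t z
      rw [abs_sub_comm t z] at this
      linarith
    rw [norm_neg]
    refine (norm_mul_le _ _).trans (mul_le_mul (hC z hz') ?_ (norm_nonneg _) hC0)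
    refine (norm_orderedTerm_le hC s z hz').trans ?_
    gcongr
  rw [e]
  have h2 : ∑' s : ℕ, -(A t * orderedTerm A T s t) = -(A t * orderedExp A T t) := by
    rw [tsum_neg, (summable_orderedTerm hA T t).tsum_mul_left]
    rfl
  rw [h2, e] at key
  exact key.const_add (1 : 𝔸)

end OrderedExponential

/-! ### Ordered exponentials of traceless `2 × 2` matrices -/

section MatrixOrderedExp

attribute [local instance] Matrix.linftyOpNormedRing Matrix.linftyOpNormedAlgebra
  Matrix.linftyOpNormedAddCommGroup Matrix.linftyOpNormedSpace

theorem hasDerivAt_matrix {M : ℝ → Mat2} {M' : Mat2} {t : ℝ} :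
    HasDerivAt M M' t ↔ ∀ i j, HasDerivAt (fun x => M x i j) (M' i j) t := by
  constructor
  · intro h i j
    exact hasDerivAt_pi.1 (hasDerivAt_pi.1 h i) j
  · intro h
    exact hasDerivAt_pi.2 fun i => hasDerivAt_pi.2 (h i)

/-- For 2 × 2 matrices the adjugate is linear. It replaces the inverse throughout, as all
determinants that occur are 1. -/
theorem hasDerivAt_adjugate {M : ℝ → Mat2} {M' : Mat2} {t : ℝ} (h : HasDerivAt M M' t) :
    HasDerivAt (fun x => (M x).adjugate) M'.adjugate t := by
  rw [hasDerivAt_matrix] at h ⊢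
  intro i j
  simp only [Matrix.adjugate_fin_two]
  fin_cases i <;> fin_cases j
  · simpa using h 1 1
  · exact (h 0 1).fun_neg
  · exact (h 1 0).fun_neg
  · simpa using h 0 0

theorem adjugate_of_trace_eq_zero {M : Mat2} (h : M.trace = 0) : M.adjugate = -M := by
  rw [Matrix.trace_fin_two] at h
  rw [Matrix.adjugate_fin_two]
  ext i j
  fin_cases i <;> fin_cases j <;> simp <;> linarith

theorem hasDerivAt_adjugate_orderedExp {A : ℝ → Mat2} (hA : Continuous A)
    (htr : ∀ t, (A t).trace = 0) (T t : ℝ) :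
    HasDerivAt (fun x => (orderedExp A T x).adjugate) ((orderedExp A T t).adjugate * A t) t := by
  have h := hasDerivAt_adjugate (hasDerivAt_orderedExp hA T t)
  have e : (-(A t * orderedExp A T t)).adjugate = (orderedExp A T t).adjugate * A t := by
    rw [← neg_mul, Matrix.adjugate_mul_distrib, ← adjugate_of_trace_eq_zero (htr t)]
    congr 1
    rw [Matrix.adjugate_adjugate' (A t)]
    simp
  rwa [e] at h

/-- A traceless `A` satisfies adj A = -A, so adj Y and Y obey adjoint equations, the product has
zero derivative, and it equals 1 at `T`. -/
theorem adjugate_orderedExp_mul {A : ℝ → Mat2} (hA : Continuous A)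
    (htr : ∀ t, (A t).trace = 0) (T t : ℝ) :
    (orderedExp A T t).adjugate * orderedExp A T t = 1 := by
  have h : ∀ x, HasDerivAt (fun x => (orderedExp A T x).adjugate * orderedExp A T x) 0 x := by
    intro x
    refine ((hasDerivAt_adjugate_orderedExp hA htr T x).mul
      (hasDerivAt_orderedExp hA T x)).congr_deriv ?_
    rw [mul_assoc, mul_neg, add_neg_cancel]
  have := is_const_of_deriv_eq_zero (fun x => (h x).differentiableAt) (fun x => (h x).deriv) t T
  rw [this, orderedExp_self]
  simp

theorem det_orderedExp {A : ℝ → Mat2} (hA : Continuous A)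
    (htr : ∀ t, (A t).trace = 0) (T t : ℝ) : (orderedExp A T t).det = 1 := by
  have h := adjugate_orderedExp_mul hA htr T t
  rw [Matrix.adjugate_mul] at h
  simpa using congrFun (congrFun h 0) 0

theorem orderedExp_mul_adjugate {A : ℝ → Mat2} (hA : Continuous A)
    (htr : ∀ t, (A t).trace = 0) (T t : ℝ) :
    orderedExp A T t * (orderedExp A T t).adjugate = 1 := by
  rw [Matrix.mul_adjugate, det_orderedExp hA htr, one_smul]

/-- Solutions of `Z' = Z A` are transported by the ordered exponential. -/
theorem mul_orderedExp_eq {A Z : ℝ → Mat2} (hA : Continuous A) {a T : ℝ} (haT : a ≤ T)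
    (hZ : ContinuousOn Z (Icc a T)) (hZ' : ∀ t ∈ Ioo a T, HasDerivAt Z (Z t * A t) t) :
    Z a * orderedExp A T a = Z T := by
  have h := intervalIntegral.integral_eq_sub_of_hasDerivAt_of_le (a := a) (b := T)
    (f := fun t => Z t * orderedExp A T t) (f' := fun _ => (0 : Mat2)) haT
    (hZ.mul (continuous_orderedExp hA T).continuousOn)
    (fun t ht => by
      refine ((hZ' t ht).mul (hasDerivAt_orderedExp hA T t)).congr_deriv ?_
      rw [mul_assoc, mul_neg, add_neg_cancel])
    (by simp)
  simp only [intervalIntegral.integral_zero, orderedExp_self, mul_one] at h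
  exact (sub_eq_zero.1 h.symm).symm

/-- Differentiating Y_A⁻¹ Y_B leaves only B - A between the two factors; integrating up to `T`,
where both exponentials are 1, gives the formula. -/
theorem duhamel {A B : ℝ → Mat2} (hA : Continuous A) (hB : Continuous B)
    (htr : ∀ t, (A t).trace = 0) (T t : ℝ) :
    orderedExp B T t = orderedExp A T t + orderedExp A T t * ∫ z in t..T,
      (orderedExp A T z).adjugate * (B z - A z) * orderedExp B T z := by
  have hcA := continuous_orderedExp hA T
  have hcB := continuous_orderedExp hB T
  have h := intervalIntegral.integral_eq_sub_of_hasDerivAt (a := t) (b := T)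
    (f := fun t => (orderedExp A T t).adjugate * orderedExp B T t)
    (f' := fun z => -((orderedExp A T z).adjugate * (B z - A z) * orderedExp B T z))
    (fun z _ => by
      refine ((hasDerivAt_adjugate_orderedExp hA htr T z).mul
        (hasDerivAt_orderedExp hB T z)).congr_deriv ?_
      noncomm_ring)
    (Continuous.intervalIntegrable
      (((hcA.matrix_adjugate.mul (hB.sub hA)).mul hcB).neg) _ _)
  rw [intervalIntegral.integral_neg] at h
  have h2 : ∫ z in t..T, (orderedExp A T z).adjugate * (B z - A z) * orderedExp B T z =
      (orderedExp A T t).adjugate * orderedExp B T t - 1 := by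
    rw [neg_eq_iff_eq_neg.1 h]
    simp [orderedExp_self]
  rw [h2, mul_sub, ← mul_assoc, orderedExp_mul_adjugate hA htr]
  simp

variable {X : Type*} [TopologicalSpace X] [FirstCountableTopology X]

/-- The derivative of the ordered exponential with respect to a parameter. -/
def orderedExpDeriv (A A' : ℝ → Mat2) (T t : ℝ) : Mat2 :=
  orderedExp A T t * ∫ z in t..T, (orderedExp A T z).adjugate * A' z * orderedExp A T z

theorem continuous_orderedExpDeriv {A A' : X → ℝ → Mat2}
    (hA : Continuous fun y : X × ℝ => A y.1 y.2) (hA' : Continuous fun y : X × ℝ => A' y.1 y.2)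
    (T : ℝ) : Continuous fun y : X × ℝ => orderedExpDeriv (A y.1) (A' y.1) T y.2 := by
  have hY := continuous_orderedExp_param hA T
  refine hY.mul ?_
  have e : (fun y : X × ℝ => ∫ z in y.2..T, (orderedExp (A y.1) T z).adjugate * A' y.1 z *
      orderedExp (A y.1) T z) = fun y => -∫ z in T..y.2, (orderedExp (A y.1) T z).adjugate *
        A' y.1 z * orderedExp (A y.1) T z := by
    ext1 y; rw [intervalIntegral.integral_symm]
  rw [e]
  refine (intervalIntegral.continuous_parametric_intervalIntegral_of_continuous
      (f := fun (y : X × ℝ) z => (orderedExp (A y.1) T z).adjugate *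
        A' y.1 z * orderedExp (A y.1) T z) ?_ continuous_snd).neg
  have h1 : Continuous fun y : (X × ℝ) × ℝ => (y.1.1, y.2) := by fun_prop
  exact (((hY.comp h1).matrix_adjugate).mul (hA'.comp h1)).mul (hY.comp h1)

theorem hasDerivAt_of_sub_eq_smul {E : Type*} [NormedAddCommGroup E] [NormedSpace ℝ E]
    {f c : ℝ → E} {s : ℝ} (hc : ContinuousAt c s) (h : ∀ x, f x - f s = (x - s) • c x) :
    HasDerivAt f (c s) s := by
  rw [hasDerivAt_iff_tendsto_slope]
  refine (hc.tendsto.mono_left nhdsWithin_le_nhds).congr' ?_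
  filter_upwards [self_mem_nhdsWithin] with x hx
  rw [slope_def_module, h, smul_smul, inv_mul_cancel₀ (sub_ne_zero.2 hx), one_smul]

/-- Hadamard's argument: A x - A s = (x - s) M x, where `M` averages the derivative over the
segment. Duhamel's formula transfers this factorization to the exponentials, with a second factor
that is continuous in x, so no estimate of a remainder is needed. -/
theorem hasDerivAt_orderedExp_param {A A' : ℝ → ℝ → Mat2}
    (hA : Continuous fun y : ℝ × ℝ => A y.1 y.2) (hA' : Continuous fun y : ℝ × ℝ => A' y.1 y.2)
    (hd : ∀ s t, HasDerivAt (fun s => A s t) (A' s t) s) (htr : ∀ s t, (A s t).trace = 0)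
    (T s t : ℝ) :
    HasDerivAt (fun s => orderedExp (A s) T t) (orderedExpDeriv (A s) (A' s) T t) s := by
  have hAs : ∀ s, Continuous (A s) := fun s => hA.comp (f := fun z => (s, z)) (by fun_prop)
  have hY := continuous_orderedExp_param hA T
  let M : ℝ → ℝ → Mat2 := fun x z => ∫ u in (0 : ℝ)..1, A' (s + u * (x - s)) z
  have hM : Continuous fun y : ℝ × ℝ => M y.1 y.2 := by
    refine intervalIntegral.continuous_parametric_intervalIntegral_of_continuous'
      (f := fun (y : ℝ × ℝ) u => A' (s + u * (y.1 - s)) y.2) ?_ 0 1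
    exact hA'.comp (f := fun y : (ℝ × ℝ) × ℝ => (s + y.2 * (y.1.1 - s), y.1.2)) (by fun_prop)
  have hMs : ∀ z, M s z = A' s z := fun z => by simp [M]
  have hsub : ∀ x z, A x z - A s z = (x - s) • M x z := by
    intro x z
    have h0 : Continuous fun u : ℝ => A' (s + u * (x - s)) z :=
      hA'.comp (f := fun u : ℝ => (s + u * (x - s), z)) (by fun_prop)
    have h1 : Continuous fun u : ℝ => (x - s) • A' (s + u * (x - s)) z := by fun_prop
    have h := intervalIntegral.integral_eq_sub_of_hasDerivAt (a := 0) (b := 1)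
      (f := fun u : ℝ => A (s + u * (x - s)) z) (f' := fun u => (x - s) • A' (s + u * (x - s)) z)
      (fun u _ => by
        have h1 : HasDerivAt (fun u : ℝ => s + u * (x - s)) (x - s) u := by
          simpa using ((hasDerivAt_id u).mul_const (x - s)).const_add s
        exact (hd _ z).scomp u h1)
      (h1.intervalIntegrable _ _)
    rw [intervalIntegral.integral_smul] at h
    rw [h]
    simp
  let c : ℝ → Mat2 := fun x => orderedExp (A s) T t * ∫ z in t..T,
    (orderedExp (A s) T z).adjugate * M x z * orderedExp (A x) T z
  have hc : Continuous c := by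
    refine continuous_const.mul
      (intervalIntegral.continuous_parametric_intervalIntegral_of_continuous'
      (f := fun x z => (orderedExp (A s) T z).adjugate * M x z * orderedExp (A x) T z) ?_ t T)
    have h1 : Continuous fun y : ℝ × ℝ => (orderedExp (A s) T y.2).adjugate :=
      ((continuous_orderedExp (hAs s) T).comp continuous_snd).matrix_adjugate
    exact (h1.mul hM).mul hY
  have hcs : c s = orderedExpDeriv (A s) (A' s) T t := by simp only [c, hMs, orderedExpDeriv]
  rw [← hcs]
  refine hasDerivAt_of_sub_eq_smul hc.continuousAt fun x => ?_
  rw [duhamel (hAs s) (hAs x) (htr s) T t, add_sub_cancel_left]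
  simp only [hsub, c, mul_smul_comm, smul_mul_assoc, intervalIntegral.integral_smul]

end MatrixOrderedExp

/-! ### The deformed metric as an ordered exponential of a regular connection -/

section Regularization

attribute [local instance] Matrix.linftyOpNormedRing Matrix.linftyOpNormedAlgebra
  Matrix.linftyOpNormedAddCommGroup Matrix.linftyOpNormedSpace

theorem image_mul_sin_Ioo {r t : ℝ} (hr : 0 < r) (ht : t ∈ Icc 0 (Real.pi / 2)) :
    (fun u => r * Real.sin u) '' Ioo t (Real.pi / 2) = Ioo (r * Real.sin t) r := by
  have hmono : StrictMonoOn (fun u => r * Real.sin u) (Icc t (Real.pi / 2)) := by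
    intro a ha b hb hab
    have := Real.strictMonoOn_sin ⟨by linarith [ha.1, ht.1, Real.pi_pos], ha.2⟩
      ⟨by linarith [hb.1, ht.1, Real.pi_pos], hb.2⟩ hab
    exact mul_lt_mul_of_pos_left this hr
  have hc : ContinuousOn (fun u => r * Real.sin u) (Icc t (Real.pi / 2)) := by fun_prop
  apply Subset.antisymm
  · rintro _ ⟨u, hu, rfl⟩
    have h1 := hmono ⟨le_rfl, ht.2⟩ ⟨hu.1.le, hu.2.le⟩ hu.1
    have h2 := hmono ⟨hu.1.le, hu.2.le⟩ ⟨ht.2, le_rfl⟩ hu.2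
    simp only [Real.sin_pi_div_two, mul_one] at h1 h2
    exact ⟨h1, h2⟩
  · have := intermediate_value_Ioo ht.2 hc
    simpa only [Real.sin_pi_div_two, mul_one] using this

theorem injOn_mul_sin {r t : ℝ} (hr : 0 < r) (ht : t ∈ Icc 0 (Real.pi / 2)) :
    InjOn (fun u => r * Real.sin u) (Ioo t (Real.pi / 2)) := by
  intro a ha b hb hab
  exact Real.strictMonoOn_sin.injOn ⟨by linarith [ha.1, ht.1, Real.pi_pos], ha.2.le⟩
      ⟨by linarith [hb.1, ht.1, Real.pi_pos], hb.2.le⟩ (mul_left_cancel₀ hr.ne' hab)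

theorem hasDerivAt_mul_sin (r u : ℝ) :
    HasDerivAt (fun u => r * Real.sin u) (r * Real.cos u) u :=
  (Real.hasDerivAt_sin u).const_mul r

theorem abs_mul_cos {r t u : ℝ} (hr : 0 < r) (ht : t ∈ Icc 0 (Real.pi / 2))
    (hu : u ∈ Ioo t (Real.pi / 2)) : |r * Real.cos u| = r * Real.cos u :=
  abs_of_pos (mul_pos hr (Real.cos_pos_of_mem_Ioo ⟨by linarith [hu.1, ht.1, Real.pi_pos], hu.2⟩))

/-- The change of variables for an injective map holds for every `f`, integrable or not, so the
singular endpoint needs no separate treatment. -/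
theorem integral_mul_sin_subst (f : ℝ → ℝ) {r t : ℝ} (hr : 0 < r) (ht : t ∈ Icc 0 (Real.pi / 2)) :
    ∫ z in (r * Real.sin t)..r, f z =
      ∫ u in t..(Real.pi / 2), r * Real.cos u * f (r * Real.sin u) := by
  have hle : r * Real.sin t ≤ r := mul_le_of_le_one_right hr.le (Real.sin_le_one t)
  rw [intervalIntegral.integral_of_le hle, intervalIntegral.integral_of_le ht.2,
    integral_Ioc_eq_integral_Ioo, integral_Ioc_eq_integral_Ioo, ← image_mul_sin_Ioo hr ht,
    integral_image_eq_integral_abs_deriv_smul measurableSet_Ioo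
      (fun u _ => (hasDerivAt_mul_sin r u).hasDerivWithinAt) (injOn_mul_sin hr ht)]
  refine setIntegral_congr_fun measurableSet_Ioo fun u hu => ?_
  simp only [abs_mul_cos hr ht hu, smul_eq_mul]

theorem intervalIntegrable_mul_sin_subst {f : ℝ → ℝ} {r : ℝ} (hr : 0 < r)
    (hf : IntervalIntegrable (fun u => r * Real.cos u * f (r * Real.sin u)) volume 0
      (Real.pi / 2)) : IntervalIntegrable f volume 0 r := by
  have ht : (0 : ℝ) ∈ Icc 0 (Real.pi / 2) := ⟨le_rfl, by positivity⟩
  have e := image_mul_sin_Ioo hr ht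
  rw [Real.sin_zero, mul_zero] at e
  rw [intervalIntegrable_iff_integrableOn_Ioo_of_le hr.le, ← e,
    integrableOn_image_iff_integrableOn_abs_deriv_smul measurableSet_Ioo
      (fun u _ => (hasDerivAt_mul_sin r u).hasDerivWithinAt) (injOn_mul_sin hr ht)]
  rw [intervalIntegrable_iff_integrableOn_Ioo_of_le ht.2] at hf
  refine hf.congr_fun (fun u hu => ?_) measurableSet_Ioo
  simp only [abs_mul_cos hr ht hu, smul_eq_mul]

theorem intervalIntegral_apply {M : ℝ → Mat2} (hM : Continuous M) (a b : ℝ) (i j : Fin 2) :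
    (∫ z in a..b, M z) i j = ∫ z in a..b, M z i j := by
  let L : Mat2 →L[ℝ] ℝ := LinearMap.toContinuousLinearMap (Matrix.entryLinearMap ℝ ℝ i j)
  exact (L.intervalIntegral_comp_comm (hM.intervalIntegrable a b)).symm

/-- `C` is the pull back of the singular connection `A` by the substitution `q = r sin t`. -/
def IsPullback (A C : ℝ → Mat2) (r : ℝ) : Prop :=
  ∀ u ∈ Ioo 0 (Real.pi / 2), C u = (r * Real.cos u) • A (r * Real.sin u)

/-- The induction runs over all lower limits r sin t at once, because each term contains the
previous one at the integration variable. -/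
theorem pathOrderedTerm_eq {A C : ℝ → Mat2} {r : ℝ} (hr : 0 < r) (hC : Continuous C)
    (hAC : IsPullback A C r) (s : ℕ) : ∀ t ∈ Icc 0 (Real.pi / 2),
      pathOrderedTerm A s (r * Real.sin t) r = orderedTerm C (Real.pi / 2) s t := by
  induction s with
  | zero => intro t _; rfl
  | succ s ih =>
    intro t ht
    ext i j
    have h1 : orderedTerm C (Real.pi / 2) (s + 1) t i j =
        ∫ z in t..(Real.pi / 2), (C z * orderedTerm C (Real.pi / 2) s z) i j :=
      intervalIntegral_apply (hC.mul (continuous_orderedTerm hC _ s)) _ _ i j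
    have h2 : pathOrderedTerm A (s + 1) (r * Real.sin t) r i j =
        ∫ z in (r * Real.sin t)..r, (A z * pathOrderedTerm A s z r) i j := rfl
    rw [h1, h2, integral_mul_sin_subst _ hr ht, intervalIntegral.integral_of_le ht.2,
      intervalIntegral.integral_of_le ht.2, integral_Ioc_eq_integral_Ioo,
      integral_Ioc_eq_integral_Ioo]
    refine setIntegral_congr_fun measurableSet_Ioo fun u hu => ?_
    rw [ih u ⟨ht.1.trans hu.1.le, hu.2.le⟩, hAC u ⟨ht.1.trans_lt hu.1, hu.2⟩, smul_mul_assoc]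
    rfl

theorem pathOrderedTerm_zero_eq {A C : ℝ → Mat2} {r : ℝ} (hr : 0 < r) (hC : Continuous C)
    (hAC : IsPullback A C r) (s : ℕ) :
    pathOrderedTerm A s 0 r = orderedTerm C (Real.pi / 2) s 0 := by
  simpa using pathOrderedTerm_eq hr hC hAC s 0 ⟨le_rfl, by positivity⟩

theorem summable_pathOrderedTerm {A C : ℝ → Mat2} {r : ℝ} (hr : 0 < r) (hC : Continuous C)
    (hAC : IsPullback A C r) : Summable fun s => pathOrderedTerm A s 0 r := by
  simp only [pathOrderedTerm_zero_eq hr hC hAC]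
  exact summable_orderedTerm hC _ _

theorem pathOrderedExp_eq {A C : ℝ → Mat2} {r : ℝ} (hr : 0 < r) (hC : Continuous C)
    (hAC : IsPullback A C r) : pathOrderedExp A 0 r = orderedExp C (Real.pi / 2) 0 := by
  simp only [pathOrderedExp, pathOrderedTerm_zero_eq hr hC hAC]
  rfl

theorem intervalIntegrable_of_isPullback {A C : ℝ → Mat2} {r : ℝ} (hr : 0 < r)
    (hC : Continuous C) (hAC : IsPullback A C r) (i j : Fin 2) :
    IntervalIntegrable (fun x => A x i j) volume 0 r := by
  refine intervalIntegrable_mul_sin_subst hr ?_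
  have h : IntervalIntegrable (fun u => C u i j) volume 0 (Real.pi / 2) :=
    Continuous.intervalIntegrable (by fun_prop) _ _
  rw [intervalIntegrable_iff_integrableOn_Ioo_of_le (by positivity)] at h ⊢
  refine h.congr_fun (fun u hu => ?_) measurableSet_Ioo
  simp only [hAC u hu]
  rfl

/-- The regular connection on `[0, π/2]` for the deformation point `r`. -/
def IsRegularConnection (W C : ℝ → Mat2) (r : ℝ) : Prop :=
  ∀ u ∈ Ioo 0 (Real.pi / 2),
    C u = r • (Real.cos u • connectionQ W (r * Real.sin u) + connectionP W (r * Real.sin u))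

/-- With q = r sin t the quotient of the area densities is sin² t. The Jacobian r cos t cancels the
singular factor in front of P and becomes a harmless weight on Q. -/
theorem IsRegularConnection.isPullback {W C : ℝ → Mat2} {r c : ℝ} (hr : 0 < r) (hc : 0 < c)
    (h : IsRegularConnection W C r) :
    IsPullback (deformedConnection W (fun v => c * v ^ 2) r) C r := by
  intro u hu
  have hcos : 0 < Real.cos u :=
    Real.cos_pos_of_mem_Ioo ⟨by linarith [hu.1, Real.pi_pos], hu.2⟩
  have e : 1 - c * (r * Real.sin u) ^ 2 / (c * r ^ 2) = Real.cos u ^ 2 := by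
    have := Real.sin_sq_add_cos_sq u
    have : c * (r * Real.sin u) ^ 2 / (c * r ^ 2) = Real.sin u ^ 2 := by
      field_simp
    linarith
  rw [h u hu, deformedConnection, e, Real.sqrt_sq hcos.le, smul_add, smul_add, smul_smul, smul_smul]
  congr 2
  field_simp

/-- `U Uᵗ` with `U = V Pexp C`. -/
def orderedMetric (V : Mat2) (C : ℝ → Mat2) : Mat2 :=
  V * orderedExp C (Real.pi / 2) 0 * (V * orderedExp C (Real.pi / 2) 0).transpose

theorem deformedMetric_eq {W C : ℝ → Mat2} {r c : ℝ} (hr : 0 < r) (hc : 0 < c)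
    (hC : Continuous C) (h : IsRegularConnection W C r) :
    deformedMetric W (fun v => c * v ^ 2) r = orderedMetric (W 0) C := by
  rw [deformedMetric, deformedZweibein, pathOrderedExp_eq hr hC (h.isPullback hr hc), orderedMetric]

theorem inv_eq_adjugate {M : Mat2} (h : M.det = 1) : M⁻¹ = M.adjugate := by
  rw [Matrix.inv_def, h]; simp

/-- Orthogonality makes Rᵗ R' antisymmetric, so the inhomogeneous term of the gauge transformation
does not reach the symmetric part. -/
theorem connectionP_gauge {R R' J₁ J₂ : Mat2} (hR' : R' = -(J₁ * R) + R * J₂) (horth : R.transpose * R = 1)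
    (hanti : R'.transpose * R + R.transpose * R' = 0) :
    (J₁ + J₁.transpose) * R = R * (J₂ + J₂.transpose) := by
  have horth' : R * R.transpose = 1 := mul_eq_one_comm.1 horth
  have h : R * (R'.transpose * R + R.transpose * R') = 0 := by rw [hanti, mul_zero]
  rw [hR'] at h
  simp only [Matrix.transpose_add, Matrix.transpose_neg, Matrix.transpose_mul] at h
  have e : R * ((-(R.transpose * J₁.transpose) + J₂.transpose * R.transpose) * R +
      R.transpose * (-(J₁ * R) + R * J₂)) =
      -((R * R.transpose) * J₁.transpose * R) + R * J₂.transpose * (R.transpose * R)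
       - (R * R.transpose) * J₁ * R + (R * R.transpose) * R * J₂ := by noncomm_ring
  rw [e, horth, horth'] at h
  simp only [one_mul, mul_one] at h
  rw [add_mul, mul_add, ← sub_eq_zero, ← neg_eq_zero, ← h]
  abel

theorem connection_decomp (W : ℝ → Mat2) (x : ℝ) :
    connectionP W x + connectionQ W x = connection W x := by
  rw [connectionP, connectionQ, ← smul_add]
  have : connection W x + (connection W x).transpose + (connection W x - (connection W x).transpose)
      = (2 : ℝ) • connection W x := by rw [two_smul]; abel
  rw [this, smul_smul]; norm_num

/-- The deformed metric does not depend on the zweibein. -/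
theorem orderedMetric_gauge {W₁ W₂ C₁ C₂ : ℝ → Mat2} {r : ℝ} (hr : r ∈ Ioc (0 : ℝ) 1)
    (hW₁ : ContinuousOn W₁ (Icc 0 1)) (hW₂ : ContinuousOn W₂ (Icc 0 1))
    (hd₁ : ∀ x ∈ Ioo (0 : ℝ) 1, DifferentiableAt ℝ W₁ x)
    (hd₂ : ∀ x ∈ Ioo (0 : ℝ) 1, DifferentiableAt ℝ W₂ x)
    (hdet₁ : ∀ x ∈ Icc (0 : ℝ) 1, (W₁ x).det = 1) (hdet₂ : ∀ x ∈ Icc (0 : ℝ) 1, (W₂ x).det = 1)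
    (he : ∀ x ∈ Icc (0 : ℝ) 1, W₁ x * (W₁ x).transpose = W₂ x * (W₂ x).transpose)
    (hC₁ : Continuous C₁) (hC₂ : Continuous C₂) (htr : ∀ t, (C₁ t).trace = 0)
    (h₁ : IsRegularConnection W₁ C₁ r) (h₂ : IsRegularConnection W₂ C₂ r) :
    orderedMetric (W₁ 0) C₁ = orderedMetric (W₂ 0) C₂ := by
  have hpi : (0 : ℝ) ≤ Real.pi / 2 := by positivity
  set R : ℝ → Mat2 := fun x => (W₁ x).adjugate * W₂ x with hR
  -- Equality of the metrics gives R Rᵗ = 1; the order of the factors is then exchanged by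
  -- `mul_eq_one_comm`.
  have horth : ∀ x ∈ Icc (0 : ℝ) 1, (R x).transpose * R x = 1 := by
    intro x hx
    rw [mul_eq_one_comm]
    simp only [hR, Matrix.transpose_mul]
    have e : (W₁ x).adjugate * W₂ x * ((W₂ x).transpose * (W₁ x).adjugate.transpose) =
        (W₁ x).adjugate * (W₂ x * (W₂ x).transpose) * (W₁ x).adjugate.transpose := by
      noncomm_ring
    rw [e, ← he x hx]
    have e2 : (W₁ x).adjugate * (W₁ x * (W₁ x).transpose) * (W₁ x).adjugate.transpose =
        ((W₁ x).adjugate * W₁ x) * ((W₁ x).adjugate * W₁ x).transpose := by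
      rw [Matrix.transpose_mul]; noncomm_ring
    rw [e2, Matrix.adjugate_mul, hdet₁ x hx]; simp
  have hWd : ∀ (W : ℝ → Mat2) x, DifferentiableAt ℝ W x → (W x).det = 1 →
      HasDerivAt W (W x * connection W x) x := by
    intro W x hW hdet
    have h1 : deriv W x = Matrix.of fun i j => deriv (fun y => W y i j) x := by
      ext i j
      exact ((hasDerivAt_matrix.1 hW.hasDerivAt i j).deriv).symm
    have h2 : W x * connection W x = deriv W x := by
      rw [connection, ← h1, inv_eq_adjugate hdet, ← mul_assoc, Matrix.mul_adjugate, hdet]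
      simp
    rw [h2]; exact hW.hasDerivAt
  have hRd : ∀ x ∈ Ioo (0 : ℝ) 1,
      HasDerivAt R (-(connection W₁ x * R x) + R x * connection W₂ x) x := by
    intro x hx
    have hx' := Ioo_subset_Icc_self hx
    refine ((hasDerivAt_adjugate (hWd W₁ x (hd₁ x hx) (hdet₁ x hx'))).mul
      (hWd W₂ x (hd₂ x hx) (hdet₂ x hx'))).congr_deriv ?_
    -- The constant determinant forces a traceless connection. This is read off from adj(W) W = 1,
    -- whose derivative is the trace times the identity.
    have hJ : (connection W₁ x).trace = 0 := by
      have hdet : HasDerivAt (fun y => (W₁ y).adjugate * W₁ y)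
          ((W₁ x * connection W₁ x).adjugate * W₁ x
            + (W₁ x).adjugate * (W₁ x * connection W₁ x)) x :=
        (hasDerivAt_adjugate (hWd W₁ x (hd₁ x hx) (hdet₁ x hx'))).mul
          (hWd W₁ x (hd₁ x hx) (hdet₁ x hx'))
      have hconst : HasDerivAt (fun y => (W₁ y).adjugate * W₁ y) 0 x := by
        refine (hasDerivAt_const x (1 : Mat2)).congr_of_eventuallyEq ?_
        filter_upwards [Icc_mem_nhds hx.1 hx.2] with y hy
        rw [Matrix.adjugate_mul, hdet₁ y hy, one_smul]
      have h0 := hdet.unique hconst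
      rw [Matrix.adjugate_mul_distrib, mul_assoc, ← mul_assoc (W₁ x).adjugate,
        Matrix.adjugate_mul, hdet₁ x hx'] at h0
      have h1 : (connection W₁ x).adjugate + connection W₁ x = (connection W₁ x).trace • 1 := by
        rw [Matrix.adjugate_fin_two, Matrix.trace_fin_two]
        ext i j
        fin_cases i <;> fin_cases j <;> simp [add_comm]
      simp only [one_smul, mul_one, one_mul, h1] at h0
      simpa using congrFun (congrFun h0 0) 0
    rw [Matrix.adjugate_mul_distrib, adjugate_of_trace_eq_zero hJ, neg_mul, neg_mul, mul_assoc,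
      mul_assoc]
  have hP : ∀ x ∈ Ioo (0 : ℝ) 1, connectionP W₁ x * R x = R x * connectionP W₂ x := by
    intro x hx
    have hx' := Ioo_subset_Icc_self hx
    have hanti : (-(connection W₁ x * R x) + R x * connection W₂ x).transpose * R x
        + (R x).transpose * (-(connection W₁ x * R x) + R x * connection W₂ x) = 0 := by
      have hT : HasDerivAt (fun y => (R y).transpose)
          (-(connection W₁ x * R x) + R x * connection W₂ x).transpose x := by
        rw [hasDerivAt_matrix]
        intro i j
        exact hasDerivAt_matrix.1 (hRd x hx) j i
      have hconst : HasDerivAt (fun y => (R y).transpose * R y) 0 x := by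
        refine (hasDerivAt_const x (1 : Mat2)).congr_of_eventuallyEq ?_
        filter_upwards [Icc_mem_nhds hx.1 hx.2] with y hy
        exact horth y hy
      exact (hT.mul (hRd x hx)).unique hconst
    have := connectionP_gauge rfl (horth x hx') hanti
    rw [connectionP, connectionP, smul_mul_assoc, mul_smul_comm, this]
  have hmem : ∀ u ∈ Icc 0 (Real.pi / 2), r * Real.sin u ∈ Icc (0 : ℝ) 1 := fun u hu =>
    ⟨mul_nonneg hr.1.le (Real.sin_nonneg_of_nonneg_of_le_pi hu.1 (by linarith [hu.2])),
      (mul_le_of_le_one_right hr.1.le (Real.sin_le_one u)).trans hr.2⟩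
  have hmem' : ∀ u ∈ Ioo 0 (Real.pi / 2), r * Real.sin u ∈ Ioo (0 : ℝ) 1 := fun u hu => by
    have h1 : (fun u => r * Real.sin u) u ∈ Ioo (r * Real.sin 0) r := by
      rw [← image_mul_sin_Ioo hr.1 ⟨le_rfl, hpi⟩]; exact mem_image_of_mem _ hu
    rw [Real.sin_zero, mul_zero] at h1
    exact ⟨h1.1, h1.2.trans_le hr.2⟩
  set U₁ : Mat2 := W₁ 0 * orderedExp C₁ (Real.pi / 2) 0 with hU₁
  -- `Z` joins W₂(0) at t = 0 to U₁ R(r) at t = π/2 and is transported by the second connection. The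
  -- derivative of R along q = r sin t carries the factor r cos t, exactly the weight of Q in the
  -- regular connection, while P is covariant by `hP`; hence Z' = Z C₂.
  set Z : ℝ → Mat2 := fun t =>
    U₁ * ((orderedExp C₁ (Real.pi / 2) t).adjugate * R (r * Real.sin t)) with hZ
  have hZ0 : Z 0 = W₂ 0 := by
    simp only [hZ, hU₁, hR, Real.sin_zero, mul_zero]
    rw [← mul_assoc, mul_assoc (W₁ 0), orderedExp_mul_adjugate hC₁ htr, mul_one, ← mul_assoc,
      Matrix.mul_adjugate, hdet₁ 0 ⟨le_rfl, zero_le_one⟩, one_smul, one_mul]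
  have hZT : Z (Real.pi / 2) = U₁ * R r := by
    simp only [hZ, orderedExp_self, Real.sin_pi_div_two, mul_one]
    simp
  have hRc : ContinuousOn R (Icc 0 1) :=
    ((continuous_id.matrix_adjugate).comp_continuousOn hW₁).mul hW₂
  have key := mul_orderedExp_eq (Z := Z) hC₂ hpi
    (continuousOn_const.mul (((continuous_orderedExp hC₁ _).matrix_adjugate.continuousOn).mul
      (hRc.comp (by fun_prop) hmem)))
    (fun t ht => by
      have h1 := HasDerivAt.scomp t (hRd _ (hmem' t ht)) (hasDerivAt_mul_sin r t)
      refine (((hasDerivAt_adjugate_orderedExp hC₁ htr (Real.pi / 2) t).mul h1).const_mul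
        U₁).congr_deriv ?_
      have hPt := hP _ (hmem' t ht)
      simp only [hZ]
      rw [h₁ t ht, h₂ t ht, ← connection_decomp W₁, ← connection_decomp W₂]
      simp only [mul_assoc, ← mul_add]
      congr 2
      simp only [smul_mul_assoc, mul_smul_comm, add_mul, mul_add, smul_add, smul_neg, hPt,
        smul_smul, neg_add, Function.comp]
      abel)
  rw [hZ0, hZT] at key
  -- The second deformed zweibein is the first times R(r), and R(r) R(r)ᵗ = 1.
  have horthr : R r * (R r).transpose = 1 := mul_eq_one_comm.1 (horth r ⟨hr.1.le, hr.2⟩)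
  have e : (U₁ * R r) * (U₁ * R r).transpose = U₁ * U₁.transpose := by
    rw [Matrix.transpose_mul, mul_assoc, ← mul_assoc (R r), horthr, one_mul]
  rw [orderedMetric, orderedMetric, key, e]

end Regularization

/-! ### Functional kernels in the plane of `q = r sin t` and `s = r cos t` -/

/-- Chain rule for a function of two real variables with continuous partial derivatives. -/
theorem hasDerivAt_comp_two {E : Type*} [NormedAddCommGroup E] [NormedSpace ℝ E]
    {f f₁ f₂ : ℝ → ℝ → E} (h₁ : Continuous fun y : ℝ × ℝ => f₁ y.1 y.2)
    (h₂ : Continuous fun y : ℝ × ℝ => f₂ y.1 y.2)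
    (hd₁ : ∀ r t, HasDerivAt (fun x => f x t) (f₁ r t) r)
    (hd₂ : ∀ r t, HasDerivAt (fun x => f r x) (f₂ r t) t)
    {u v : ℝ → ℝ} {u' v' x : ℝ} (hu : HasDerivAt u u' x) (hv : HasDerivAt v v' x) :
    HasDerivAt (fun x => f (u x) (v x)) (u' • f₁ (u x) (v x) + v' • f₂ (u x) (v x)) x := by
  have hc : ∀ g : ℝ → ℝ → E, Continuous (fun y : ℝ × ℝ => g y.1 y.2) →
      Continuous (fun y : ℝ × ℝ => ContinuousLinearMap.toSpanSingleton ℝ (g y.1 y.2)) := by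
    intro g hg
    have := (ContinuousLinearMap.toSpanSingletonCLE (𝕜 := ℝ) (E := E)).continuous
    exact this.comp hg
  have h := hasStrictFDerivAt_uncurry_coprod (𝕜 := ℝ) (u := (u x, v x)) (f := f)
    (f₁ := fun r t => ContinuousLinearMap.toSpanSingleton ℝ (f₁ r t))
    (f₂ := fun r t => ContinuousLinearMap.toSpanSingleton ℝ (f₂ r t))
    (Eventually.of_forall fun y => (hd₁ y.1 y.2).hasFDerivAt)
    (Eventually.of_forall fun y => (hd₂ y.1 y.2).hasFDerivAt)
    (hc f₁ h₁).continuousAt (hc f₂ h₂).continuousAt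
  have h3 := h.hasFDerivAt.comp_hasDerivAt x (hu.prodMk hv)
  refine h3.congr_deriv ?_
  simp [Function.HasUncurry.uncurry]

/-- The kernel of the smeared field in the coordinates `q`, `s`. -/
def kern (c : ℝ → ℝ → ℂ) (q s : ℝ) : ℂ :=
  (q / (q ^ 2 + s ^ 2)) • c (√(q ^ 2 + s ^ 2)) (Real.arcsin (q / √(q ^ 2 + s ^ 2)))

/-- The derivative of `kern` with respect to `q`; `cr`, `ct` are the partial derivatives of `c`. -/
def kernDeriv (c cr ct : ℝ → ℝ → ℂ) (q s : ℝ) : ℂ :=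
  ((s ^ 2 - q ^ 2) / (q ^ 2 + s ^ 2) ^ 2) •
      c (√(q ^ 2 + s ^ 2)) (Real.arcsin (q / √(q ^ 2 + s ^ 2))) +
    (q / (q ^ 2 + s ^ 2)) •
      ((q / √(q ^ 2 + s ^ 2)) • cr (√(q ^ 2 + s ^ 2)) (Real.arcsin (q / √(q ^ 2 + s ^ 2))) +
        (s / (q ^ 2 + s ^ 2)) • ct (√(q ^ 2 + s ^ 2)) (Real.arcsin (q / √(q ^ 2 + s ^ 2))))

theorem hasDerivAt_kern {c cr ct : ℝ → ℝ → ℂ} (hcr : Continuous fun y : ℝ × ℝ => cr y.1 y.2)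
    (hct : Continuous fun y : ℝ × ℝ => ct y.1 y.2)
    (hr : ∀ r t, HasDerivAt (fun x => c x t) (cr r t) r)
    (ht : ∀ r t, HasDerivAt (fun x => c r x) (ct r t) t) {q s : ℝ} (hq : 0 < q) (hs : 0 < s) :
    HasDerivAt (fun x => kern c x s) (kernDeriv c cr ct q s) q := by
  have hpos : 0 < q ^ 2 + s ^ 2 := by positivity
  set r := √(q ^ 2 + s ^ 2) with hrdef
  have hr2 : r ^ 2 = q ^ 2 + s ^ 2 := Real.sq_sqrt hpos.le
  have hr0 : 0 < r := Real.sqrt_pos.2 hpos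
  have hsq : HasDerivAt (fun x : ℝ => x ^ 2 + s ^ 2) (2 * q) q := by
    simpa using (hasDerivAt_pow 2 q).add_const (s ^ 2)
  have hu : HasDerivAt (fun x : ℝ => √(x ^ 2 + s ^ 2)) (q / r) q := by
    refine (hsq.sqrt hpos.ne').congr_deriv ?_
    rw [← hrdef]
    field_simp
  have hquot : HasDerivAt (fun x : ℝ => x / √(x ^ 2 + s ^ 2)) (s ^ 2 / r ^ 3) q := by
    refine ((hasDerivAt_id q).div hu hr0.ne').congr_deriv ?_
    simp only [id, ← hrdef]
    field_simp
    rw [hr2]; ring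
  have hlt : q / r < 1 := by
    rw [div_lt_one hr0]
    exact Real.lt_sqrt_of_sq_lt (by nlinarith)
  have hcos : √(1 - (q / r) ^ 2) = s / r := by
    rw [show 1 - (q / r) ^ 2 = (s / r) ^ 2 by field_simp; rw [hr2]; ring,
      Real.sqrt_sq (by positivity)]
  have hv : HasDerivAt (fun x : ℝ => Real.arcsin (x / √(x ^ 2 + s ^ 2))) (s / r ^ 2) q := by
    have h1 : q / r ≠ -1 := by
      have : 0 < q / r := by positivity
      linarith
    refine ((Real.hasDerivAt_arcsin h1 hlt.ne).comp q hquot).congr_deriv ?_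
    rw [hcos]
    field_simp
  have hf : HasDerivAt (fun x : ℝ => x / (x ^ 2 + s ^ 2)) ((s ^ 2 - q ^ 2) / (r ^ 2) ^ 2) q := by
    refine ((hasDerivAt_id q).div hsq hpos.ne').congr_deriv ?_
    simp only [id, hr2]
    congr 1
    ring
  have := hf.smul (hasDerivAt_comp_two hcr hct hr ht hu hv)
  refine this.congr_deriv ?_
  rw [kernDeriv, ← hrdef, ← hr2]
  abel

/-! ### Bounds for the kernel and its derivative -/

section Bounds

variable {c cr ct : ℝ → ℝ → ℂ} {a b M : ℝ}

theorem radius_angle_mem {q s : ℝ} (hq : 0 ≤ q) :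
    Real.arcsin (q / √(q ^ 2 + s ^ 2)) ∈ Icc 0 (Real.pi / 2) :=
  ⟨Real.arcsin_nonneg.2 (by positivity), Real.arcsin_le_pi_div_two _⟩

/-- The support condition r ≥ a keeps the kernel away from the origin of the (q, s) plane; the
explicit factor q makes it vanish at the caustic. -/
theorem norm_kern_le (ha : 0 < a) (hM0 : 0 ≤ M) (h0 : ∀ r, r ∉ Icc a b → ∀ t, c r t = 0)
    (hM : ∀ r ∈ Icc a b, ∀ t ∈ Icc 0 (Real.pi / 2), ‖c r t‖ ≤ M)
    {q s : ℝ} (hq : 0 ≤ q) : ‖kern c q s‖ ≤ M / a ^ 2 * q := by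
  by_cases hr : √(q ^ 2 + s ^ 2) ∈ Icc a b
  · have hM' := hM _ hr _ (radius_angle_mem (s := s) hq)
    have hr2 : a ^ 2 ≤ q ^ 2 + s ^ 2 := by
      have := Real.sq_sqrt (show 0 ≤ q ^ 2 + s ^ 2 by positivity)
      nlinarith [hr.1]
    have hpos : 0 < q ^ 2 + s ^ 2 := lt_of_lt_of_le (by positivity) hr2
    rw [kern, norm_smul, Real.norm_of_nonneg (by positivity)]
    calc q / (q ^ 2 + s ^ 2) * _ ≤ q / a ^ 2 * M := by gcongr
      _ = M / a ^ 2 * q := by ring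
  · rw [kern, h0 _ hr, smul_zero, norm_zero]
    positivity

theorem norm_kernDeriv_le (ha : 0 < a) (hM0 : 0 ≤ M) (h0 : ∀ r, r ∉ Icc a b → ∀ t, c r t = 0)
    (h1 : ∀ r, r ∉ Icc a b → ∀ t, cr r t = 0) (h2 : ∀ r, r ∉ Icc a b → ∀ t, ct r t = 0)
    (hM : ∀ r ∈ Icc a b, ∀ t ∈ Icc 0 (Real.pi / 2), ‖c r t‖ ≤ M ∧ ‖cr r t‖ ≤ M ∧ ‖ct r t‖ ≤ M)
    {q s : ℝ} (hq : 0 ≤ q) (hs : 0 ≤ s) :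
    ‖kernDeriv c cr ct q s‖ ≤ M * (2 / a ^ 2 + 1 / a) := by
  by_cases hr : √(q ^ 2 + s ^ 2) ∈ Icc a b
  · obtain ⟨hc, hcr, hct⟩ := hM _ hr _ (radius_angle_mem (s := s) hq)
    rw [kernDeriv]
    set r := √(q ^ 2 + s ^ 2) with hrdef
    have hr2 : r ^ 2 = q ^ 2 + s ^ 2 := Real.sq_sqrt (by positivity)
    rw [← hr2]
    have hr0 : 0 < r := ha.trans_le hr.1
    have hqr : q ≤ r := Real.le_sqrt_of_sq_le (by nlinarith)
    have hsr : s ≤ r := Real.le_sqrt_of_sq_le (by nlinarith)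
    have e1 : ‖(s ^ 2 - q ^ 2) / (r ^ 2) ^ 2‖ ≤ 1 / a ^ 2 := by
      rw [Real.norm_eq_abs, abs_div, abs_of_nonneg (show (0 : ℝ) ≤ (r ^ 2) ^ 2 by positivity)]
      calc |s ^ 2 - q ^ 2| / (r ^ 2) ^ 2 ≤ r ^ 2 / (r ^ 2) ^ 2 := by
            gcongr
            rw [abs_le]; constructor <;> nlinarith [sq_nonneg s, sq_nonneg q]
        _ = 1 / r ^ 2 := by field_simp
        _ ≤ 1 / a ^ 2 := by gcongr; exact hr.1
    have e2 : ‖q / r ^ 2‖ ≤ 1 / a := by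
      rw [Real.norm_of_nonneg (by positivity)]
      calc q / r ^ 2 ≤ r / r ^ 2 := by gcongr
        _ = 1 / r := by field_simp
        _ ≤ 1 / a := by gcongr; exact hr.1
    have e3 : ‖q / r‖ ≤ 1 := by
      rw [Real.norm_of_nonneg (by positivity), div_le_one hr0]; exact hqr
    have e4 : ‖s / r ^ 2‖ ≤ 1 / a := by
      rw [Real.norm_of_nonneg (by positivity)]
      calc s / r ^ 2 ≤ r / r ^ 2 := by gcongr
        _ = 1 / r := by field_simp
        _ ≤ 1 / a := by gcongr; exact hr.1
    calc _ ≤ 1 / a ^ 2 * M + 1 / a * (1 * M + 1 / a * M) := by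
          refine (norm_add_le _ _).trans ?_
          rw [norm_smul, norm_smul]
          gcongr
          refine (norm_add_le _ _).trans ?_
          rw [norm_smul, norm_smul]
          gcongr
      _ = M * (2 / a ^ 2 + 1 / a) := by field_simp; ring
  · rw [kernDeriv, h0 _ hr, h1 _ hr, h2 _ hr]
    simp only [smul_zero, add_zero, norm_zero]
    positivity

end Bounds

/-! ### Joint continuity of the kernel away from the caustic -/

section Continuity

variable {X : Type*} [TopologicalSpace X]

/-- Restricting q to the subtype of positive reals excludes the one singular point q = s = 0,
whatever the sign of s. -/
theorem continuous_kern {c : X → ℝ → ℝ → ℂ}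
    (hc : Continuous fun y : X × ℝ × ℝ => c y.1 y.2.1 y.2.2) :
    Continuous fun y : (X × Ioi (0 : ℝ)) × ℝ => kern (c y.1.1) y.1.2 y.2 := by
  have h0 : ∀ y : (X × Ioi (0 : ℝ)) × ℝ, (y.1.2 : ℝ) ^ 2 + y.2 ^ 2 ≠ 0 := fun y => by
    have := y.1.2.2; simp only [mem_Ioi] at this; positivity
  have h1 : ∀ y : (X × Ioi (0 : ℝ)) × ℝ, √((y.1.2 : ℝ) ^ 2 + y.2 ^ 2) ≠ 0 := fun y =>
    (Real.sqrt_pos.2 (lt_of_le_of_ne (by positivity) (h0 y).symm)).ne'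
  have hsq : Continuous fun y : (X × Ioi (0 : ℝ)) × ℝ => (y.1.2 : ℝ) ^ 2 + y.2 ^ 2 := by fun_prop
  have hq : Continuous fun y : (X × Ioi (0 : ℝ)) × ℝ => (y.1.2 : ℝ) := by fun_prop
  have harc := Real.continuous_arcsin.comp (hq.div hsq.sqrt h1)
  refine (hq.div hsq h0).smul (hc.comp (f := fun y : (X × Ioi (0 : ℝ)) × ℝ => (y.1.1,
    √((y.1.2 : ℝ) ^ 2 + y.2 ^ 2), Real.arcsin (y.1.2 / √((y.1.2 : ℝ) ^ 2 + y.2 ^ 2)))) ?_)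
  exact (by fun_prop : Continuous fun y : (X × Ioi (0 : ℝ)) × ℝ => y.1.1).prodMk
    (hsq.sqrt.prodMk harc)

theorem continuous_kernDeriv {c cr ct : X → ℝ → ℝ → ℂ}
    (hc : Continuous fun y : X × ℝ × ℝ => c y.1 y.2.1 y.2.2)
    (hcr : Continuous fun y : X × ℝ × ℝ => cr y.1 y.2.1 y.2.2)
    (hct : Continuous fun y : X × ℝ × ℝ => ct y.1 y.2.1 y.2.2) :
    Continuous fun y : (X × Ioi (0 : ℝ)) × ℝ =>
      kernDeriv (c y.1.1) (cr y.1.1) (ct y.1.1) y.1.2 y.2 := by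
  have h0 : ∀ y : (X × Ioi (0 : ℝ)) × ℝ, (y.1.2 : ℝ) ^ 2 + y.2 ^ 2 ≠ 0 := fun y => by
    have := y.1.2.2; simp only [mem_Ioi] at this; positivity
  have h1 : ∀ y : (X × Ioi (0 : ℝ)) × ℝ, √((y.1.2 : ℝ) ^ 2 + y.2 ^ 2) ≠ 0 := fun y =>
    (Real.sqrt_pos.2 (lt_of_le_of_ne (by positivity) (h0 y).symm)).ne'
  have hsq : Continuous fun y : (X × Ioi (0 : ℝ)) × ℝ => (y.1.2 : ℝ) ^ 2 + y.2 ^ 2 := by fun_prop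
  have hq : Continuous fun y : (X × Ioi (0 : ℝ)) × ℝ => (y.1.2 : ℝ) := by fun_prop
  have hs : Continuous fun y : (X × Ioi (0 : ℝ)) × ℝ => (y.2 : ℝ) := by fun_prop
  have harc := Real.continuous_arcsin.comp (hq.div hsq.sqrt h1)
  have hcomp : Continuous (fun y : (X × Ioi (0 : ℝ)) × ℝ => (y.1.1,
    √((y.1.2 : ℝ) ^ 2 + y.2 ^ 2), Real.arcsin (y.1.2 / √((y.1.2 : ℝ) ^ 2 + y.2 ^ 2)))) :=
    (by fun_prop : Continuous fun y : (X × Ioi (0 : ℝ)) × ℝ => y.1.1).prodMk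
      (hsq.sqrt.prodMk harc)
  exact ((((hs.pow 2).sub (hq.pow 2)).div (hsq.pow 2) fun y => pow_ne_zero _ (h0 y)).smul
    (hc.comp hcomp)).add ((hq.div hsq h0).smul (((hq.div hsq.sqrt h1).smul (hcr.comp hcomp)).add
      ((hs.div hsq h0).smul (hct.comp hcomp))))

end Continuity

/-! ### Amplitudes -/

/-- A family of functions `c`, `d` of the deformation point `r` and the angle `t`, supported in
`a ≤ r ≤ b`, that solve the linear system along the generator in a parallel frame. -/
structure IsAmplitude {X : Type*} [TopologicalSpace X] (p : X → ℝ → ℂ) (a b : ℝ)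
    (c cr : X → ℝ → ℝ → ℂ) (d dr : X → ℝ → ℝ → ℝ) : Prop where
  a_pos : 0 < a
  b_lt : b < 1
  cont_p : Continuous fun y : X × ℝ => p y.1 y.2
  cont_c : Continuous fun y : X × ℝ × ℝ => c y.1 y.2.1 y.2.2
  cont_cr : Continuous fun y : X × ℝ × ℝ => cr y.1 y.2.1 y.2.2
  cont_d : Continuous fun y : X × ℝ × ℝ => d y.1 y.2.1 y.2.2
  cont_dr : Continuous fun y : X × ℝ × ℝ => dr y.1 y.2.1 y.2.2
  deriv_c : ∀ x r t, HasDerivAt (fun r => c x r t) (cr x r t) r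
  deriv_d : ∀ x r t, HasDerivAt (fun r => d x r t) (dr x r t) r
  ode_c : ∀ x r t, HasDerivAt (fun t => c x r t)
    (2 * Complex.I * r * p x (r * Real.sin t) * d x r t) t
  ode_d : ∀ x r t, HasDerivAt (fun t => d x r t)
    (2 * r * (conj (p x (r * Real.sin t)) * c x r t).im) t
  d_end : ∀ x r, d x r (Real.pi / 2) = 0
  c_zero : ∀ x r, r ∉ Icc a b → ∀ t, c x r t = 0
  cr_zero : ∀ x r, r ∉ Icc a b → ∀ t, cr x r t = 0
  d_zero : ∀ x r, r ∉ Icc a b → ∀ t, d x r t = 0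

namespace IsAmplitude

variable {X : Type*} [TopologicalSpace X] {p : X → ℝ → ℂ} {a b : ℝ}
  {c cr : X → ℝ → ℝ → ℂ} {d dr : X → ℝ → ℝ → ℝ}

/-- The derivative of `c` with respect to the angle. -/
def angleDeriv (p : X → ℝ → ℂ) (d : X → ℝ → ℝ → ℝ) (x : X) (r t : ℝ) : ℂ :=
  2 * Complex.I * r * p x (r * Real.sin t) * d x r t

/-- The derivative of `d` with respect to the angle. -/
def angleDerivIm (p : X → ℝ → ℂ) (c : X → ℝ → ℝ → ℂ) (x : X) (r t : ℝ) : ℝ :=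
  2 * r * (conj (p x (r * Real.sin t)) * c x r t).im

theorem cont_angleDeriv (h : IsAmplitude p a b c cr d dr) :
    Continuous fun y : X × ℝ × ℝ => angleDeriv p d y.1 y.2.1 y.2.2 := by
  have h1 := h.cont_p.comp (f := fun y : X × ℝ × ℝ => (y.1, y.2.1 * Real.sin y.2.2)) (by fun_prop)
  have h2 := h.cont_d
  have h3 : Continuous fun y : X × ℝ × ℝ => (2 * Complex.I * (y.2.1 : ℂ)) := by fun_prop
  exact (h3.mul h1).mul (Complex.continuous_ofReal.comp h2)

theorem cont_angleDerivIm (h : IsAmplitude p a b c cr d dr) :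
    Continuous fun y : X × ℝ × ℝ => angleDerivIm p c y.1 y.2.1 y.2.2 := by
  have h1 := h.cont_p.comp (f := fun y : X × ℝ × ℝ => (y.1, y.2.1 * Real.sin y.2.2)) (by fun_prop)
  have h3 : Continuous fun y : X × ℝ × ℝ => 2 * y.2.1 := by fun_prop
  exact h3.mul (Complex.continuous_im.comp ((Complex.continuous_conj.comp h1).mul h.cont_c))

theorem angleDeriv_zero (h : IsAmplitude p a b c cr d dr) (x : X) (r : ℝ) (hr : r ∉ Icc a b)
    (t : ℝ) : angleDeriv p d x r t = 0 := by
  simp [angleDeriv, h.d_zero x r hr]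

/-- A common bound on a compact set of generators. -/
theorem exists_bound (h : IsAmplitude p a b c cr d dr) {K : Set X} (hK : IsCompact K) :
    ∃ M, 0 ≤ M ∧ ∀ x ∈ K, (∀ q ∈ Icc (0 : ℝ) 1, ‖p x q‖ ≤ M) ∧
      ∀ r ∈ Icc (0 : ℝ) 1, ∀ t ∈ Icc 0 (Real.pi / 2),
      ‖c x r t‖ ≤ M ∧ ‖cr x r t‖ ≤ M ∧ ‖angleDeriv p d x r t‖ ≤ M ∧ |d x r t| ≤ M ∧
        |dr x r t| ≤ M ∧ |angleDerivIm p c x r t| ≤ M := by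
  have hK' : IsCompact (K ×ˢ (Icc (0 : ℝ) 1 ×ˢ Icc (0 : ℝ) (Real.pi / 2))) :=
    hK.prod (isCompact_Icc.prod isCompact_Icc)
  have hK'' : IsCompact (K ×ˢ Icc (0 : ℝ) 1) := hK.prod isCompact_Icc
  obtain ⟨M₀, h₀⟩ := hK''.exists_bound_of_continuousOn h.cont_p.continuousOn
  obtain ⟨M₁, h₁⟩ := hK'.exists_bound_of_continuousOn h.cont_c.continuousOn
  obtain ⟨M₂, h₂⟩ := hK'.exists_bound_of_continuousOn h.cont_cr.continuousOn
  obtain ⟨M₃, h₃⟩ := hK'.exists_bound_of_continuousOn h.cont_angleDeriv.continuousOn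
  obtain ⟨M₄, h₄⟩ := hK'.exists_bound_of_continuousOn h.cont_d.continuousOn
  obtain ⟨M₅, h₅⟩ := hK'.exists_bound_of_continuousOn h.cont_dr.continuousOn
  obtain ⟨M₆, h₆⟩ := hK'.exists_bound_of_continuousOn h.cont_angleDerivIm.continuousOn
  refine ⟨|M₀| + |M₁| + |M₂| + |M₃| + |M₄| + |M₅| + |M₆|, by positivity, fun x hx =>
    ⟨fun q hq => (h₀ (x, q) ⟨hx, hq⟩).trans ?_, fun r hr t ht =>
    ⟨(h₁ (x, r, t) ⟨hx, hr, ht⟩).trans ?_, (h₂ (x, r, t) ⟨hx, hr, ht⟩).trans ?_,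
      (h₃ (x, r, t) ⟨hx, hr, ht⟩).trans ?_, (h₄ (x, r, t) ⟨hx, hr, ht⟩).trans ?_,
      (h₅ (x, r, t) ⟨hx, hr, ht⟩).trans ?_, (h₆ (x, r, t) ⟨hx, hr, ht⟩).trans ?_⟩⟩⟩ <;>
  linarith [le_abs_self M₀, le_abs_self M₁, le_abs_self M₂, le_abs_self M₃, le_abs_self M₄,
    le_abs_self M₅, le_abs_self M₆, abs_nonneg M₀, abs_nonneg M₁, abs_nonneg M₂, abs_nonneg M₃,
    abs_nonneg M₄, abs_nonneg M₅, abs_nonneg M₆]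

end IsAmplitude

/-- The functional kernel, with the cutoff `s ≥ δ`. -/
def funKernel (c : ℝ → ℝ → ℂ) (δ q : ℝ) : ℂ := ∫ s in δ..1, kern c q s

/-- The derivative of `funKernel` with respect to `q`. -/
def funKernelDeriv (c cr ct : ℝ → ℝ → ℂ) (δ q : ℝ) : ℂ := ∫ s in δ..1, kernDeriv c cr ct q s

/-! ### Regularity and boundary values of the functional kernel -/

namespace IsAmplitude

variable {X : Type*} [TopologicalSpace X] {p : X → ℝ → ℂ} {a b : ℝ}
  {c cr : X → ℝ → ℝ → ℂ} {d dr : X → ℝ → ℝ → ℝ}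

theorem continuous_funKernel [FirstCountableTopology X] (h : IsAmplitude p a b c cr d dr) (δ : ℝ) :
    Continuous fun y : X × Ioi (0 : ℝ) => funKernel (c y.1) δ y.2 :=
  intervalIntegral.continuous_parametric_intervalIntegral_of_continuous'
    (f := fun (y : X × Ioi (0 : ℝ)) s => kern (c y.1) y.2 s) (continuous_kern h.cont_c) _ _

theorem continuous_funKernelDeriv [FirstCountableTopology X] (h : IsAmplitude p a b c cr d dr)
    (δ : ℝ) : Continuous fun y : X × Ioi (0 : ℝ) =>
      funKernelDeriv (c y.1) (cr y.1) (angleDeriv p d y.1) δ y.2 :=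
  intervalIntegral.continuous_parametric_intervalIntegral_of_continuous'
    (f := fun (y : X × Ioi (0 : ℝ)) s => kernDeriv (c y.1) (cr y.1) (angleDeriv p d y.1) y.2 s)
    (continuous_kernDeriv h.cont_c h.cont_cr h.cont_angleDeriv) _ _

theorem continuousOn_funKernel [FirstCountableTopology X] (h : IsAmplitude p a b c cr d dr)
    (δ : ℝ) (x : X) : ContinuousOn (funKernel (c x) δ) (Ioi 0) := by
  rw [continuousOn_iff_continuous_domRestrict]
  exact (h.continuous_funKernel δ).comp (f := fun q : Ioi (0 : ℝ) => (x, q)) (by fun_prop)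

theorem continuousOn_funKernelDeriv [FirstCountableTopology X] (h : IsAmplitude p a b c cr d dr)
    (δ : ℝ) (x : X) :
    ContinuousOn (funKernelDeriv (c x) (cr x) (angleDeriv p d x) δ) (Ioi 0) := by
  rw [continuousOn_iff_continuous_domRestrict]
  exact (h.continuous_funKernelDeriv δ).comp (f := fun q : Ioi (0 : ℝ) => (x, q)) (by fun_prop)

/-- Uniform bounds on the kernels and their derivatives. -/
theorem exists_kern_bound (h : IsAmplitude p a b c cr d dr) {K : Set X} (hK : IsCompact K) :
    ∃ C, 0 ≤ C ∧ ∀ x ∈ K, ∀ q s, 0 ≤ q → 0 ≤ s → ‖kern (c x) q s‖ ≤ C * q ∧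
      ‖kernDeriv (c x) (cr x) (angleDeriv p d x) q s‖ ≤ C := by
  obtain ⟨M, hM0, hM⟩ := h.exists_bound hK
  have ha := h.a_pos
  have hsub : Icc a b ⊆ Icc 0 1 := Icc_subset_Icc h.a_pos.le h.b_lt.le
  refine ⟨M / a ^ 2 + M * (2 / a ^ 2 + 1 / a), by positivity, fun x hx q s hq hs => ⟨?_, ?_⟩⟩
  · refine (norm_kern_le ha hM0 (h.c_zero x) (fun r hr t ht =>
      ((hM x hx).2 r (hsub hr) t ht).1) hq).trans ?_
    gcongr
    have : 0 ≤ M * (2 / a ^ 2 + 1 / a) := by positivity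
    linarith
  · refine (norm_kernDeriv_le ha hM0 (h.c_zero x) (h.cr_zero x) (h.angleDeriv_zero x)
      (fun r hr t ht => ?_) hq hs).trans ?_
    · have := (hM x hx).2 r (hsub hr) t ht
      exact ⟨this.1, this.2.1, this.2.2.1⟩
    · have : 0 ≤ M / a ^ 2 := by positivity
      linarith

theorem continuous_kern_right (h : IsAmplitude p a b c cr d dr) (x : X) {q : ℝ} (hq : 0 < q) :
    Continuous (kern (c x) q) :=
  (continuous_kern h.cont_c).comp (f := fun s : ℝ => ((x, (⟨q, hq⟩ : Ioi (0 : ℝ))), s))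
    (by fun_prop)

theorem continuous_kernDeriv_right (h : IsAmplitude p a b c cr d dr) (x : X) {q : ℝ} (hq : 0 < q) :
    Continuous (kernDeriv (c x) (cr x) (angleDeriv p d x) q) :=
  (continuous_kernDeriv h.cont_c h.cont_cr h.cont_angleDeriv).comp
    (f := fun s : ℝ => ((x, (⟨q, hq⟩ : Ioi (0 : ℝ))), s)) (by fun_prop)

/-- In the coordinates q, s the cutoff is a fixed endpoint of integration, so no boundary term
arises, and the derivative of the integrand is bounded up to δ = 0. -/
theorem hasDerivAt_funKernel (h : IsAmplitude p a b c cr d dr) (x : X) {δ q : ℝ}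
    (hδ : δ ∈ Icc (0 : ℝ) 1) (hq : 0 < q) :
    HasDerivAt (funKernel (c x) δ) (funKernelDeriv (c x) (cr x) (angleDeriv p d x) δ q) q := by
  obtain ⟨C, hC0, hC⟩ := h.exists_kern_bound (isCompact_singleton (x := x))
  have hcx : ∀ {f : X → ℝ → ℝ → ℂ}, (Continuous fun y : X × ℝ × ℝ => f y.1 y.2.1 y.2.2) →
      Continuous fun y : ℝ × ℝ => f x y.1 y.2 := fun hf =>
    hf.comp (f := fun y : ℝ × ℝ => (x, y)) (by fun_prop)
  refine (intervalIntegral.hasDerivAt_integral_of_dominated_loc_of_deriv_le (s := Ioi 0)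
    (F := fun q s => kern (c x) q s) (bound := fun _ => C)
    (F' := fun q s => kernDeriv (c x) (cr x) (angleDeriv p d x) q s) (Ioi_mem_nhds hq) ?_ ?_ ?_ ?_
    ?_ ?_).2
  · filter_upwards [Ioi_mem_nhds hq] with y hy
    exact (h.continuous_kern_right x hy).aestronglyMeasurable
  · exact (h.continuous_kern_right x hq).intervalIntegrable _ _
  · exact (h.continuous_kernDeriv_right x hq).aestronglyMeasurable
  · refine ae_of_all _ fun s hs y hy => (hC x rfl y s (le_of_lt hy) ?_).2
    rw [uIoc_of_le hδ.2] at hs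
    exact hδ.1.trans hs.1.le
  · exact intervalIntegrable_const
  · refine ae_of_all _ fun s hs y hy => ?_
    rw [uIoc_of_le hδ.2] at hs
    exact hasDerivAt_kern (hcx h.cont_cr) (hcx h.cont_angleDeriv) (h.deriv_c x) (h.ode_c x) hy
      (hδ.1.trans_lt hs.1)

theorem norm_funKernel_le {C : ℝ} {x : X} (hC : ∀ q s, 0 ≤ q → 0 ≤ s → ‖kern (c x) q s‖ ≤ C * q)
    {δ q : ℝ} (hδ : δ ∈ Icc (0 : ℝ) 1) (hq : 0 ≤ q) : ‖funKernel (c x) δ q‖ ≤ C * q := by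
  have h0 : 0 ≤ C * q := (norm_nonneg _).trans (hC q 0 hq le_rfl)
  have := intervalIntegral.norm_integral_le_of_norm_le_const (a := δ) (b := 1)
    (f := kern (c x) q) (C := C * q) fun s hs => by
      rw [uIoc_of_le hδ.2] at hs
      exact hC q s hq (hδ.1.trans hs.1.le)
  refine this.trans ?_
  rw [abs_of_nonneg (sub_nonneg.2 hδ.2)]
  nlinarith [hδ.1]

theorem norm_funKernelDeriv_le {C : ℝ} {x : X}
    (hC : ∀ q s, 0 ≤ q → 0 ≤ s → ‖kernDeriv (c x) (cr x) (angleDeriv p d x) q s‖ ≤ C)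
    {δ q : ℝ} (hδ : δ ∈ Icc (0 : ℝ) 1) (hq : 0 ≤ q) :
    ‖funKernelDeriv (c x) (cr x) (angleDeriv p d x) δ q‖ ≤ C := by
  have h0 : 0 ≤ C := (norm_nonneg _).trans (hC q 0 hq le_rfl)
  have := intervalIntegral.norm_integral_le_of_norm_le_const (a := δ) (b := 1)
    (f := kernDeriv (c x) (cr x) (angleDeriv p d x) q) (C := C) fun s hs => by
      rw [uIoc_of_le hδ.2] at hs
      exact hC q s hq (hδ.1.trans hs.1.le)
  refine this.trans ?_
  rw [abs_of_nonneg (sub_nonneg.2 hδ.2)]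
  nlinarith [hδ.1]

theorem funKernel_eq_zero (h : IsAmplitude p a b c cr d dr) (x : X) {δ q : ℝ} (hq : b < q) : funKernel (c x) δ q = 0 := by
  rw [funKernel]
  have : ∀ s, kern (c x) q s = 0 := fun s => by
    rw [kern, h.c_zero x, smul_zero]
    intro hmem
    have : q ≤ √(q ^ 2 + s ^ 2) := Real.le_sqrt_of_sq_le (by nlinarith)
    linarith [hmem.2]
  simp [this]

theorem funKernel_zero {δ : ℝ} (x : X) : funKernel (c x) δ 0 = 0 := by
  simp [funKernel, kern]

/-- Continuity at the caustic, where the integrand is not jointly continuous, comes from the linear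
bound C q. -/
theorem continuousOn_funKernel_Icc [FirstCountableTopology X] (h : IsAmplitude p a b c cr d dr)
    (x : X) {δ : ℝ} (hδ : δ ∈ Icc (0 : ℝ) 1) : ContinuousOn (funKernel (c x) δ) (Ici 0) := by
  obtain ⟨C, hC0, hC⟩ := h.exists_kern_bound (isCompact_singleton (x := x))
  intro q hq
  rcases eq_or_lt_of_le (show (0 : ℝ) ≤ q from hq) with rfl | hq
  · rw [ContinuousWithinAt, funKernel_zero]
    refine squeeze_zero_norm' (a := fun q => C * q) ?_ ?_
    · filter_upwards [self_mem_nhdsWithin] with y hy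
      exact norm_funKernel_le (fun q s hq hs => (hC x rfl q s hq hs).1) hδ hy
    · have : Continuous fun q : ℝ => C * q := by fun_prop
      simpa using (this.tendsto 0).mono_left nhdsWithin_le_nhds
  · exact ((h.continuousOn_funKernel δ x).continuousAt (Ioi_mem_nhds hq)).continuousWithinAt

end IsAmplitude

/-! ### The kernels as functions of the deformation point -/

/-- The kernel of the smeared field in the coordinates `q`, `r`. -/
def radKern (c : ℝ → ℝ → ℂ) (q r : ℝ) : ℂ :=
  (q / (r * √(r ^ 2 - q ^ 2))) • c r (Real.arcsin (q / r))

/-- The derivative of `radKern` with respect to `q`. -/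
def radKernDeriv (p : ℝ → ℂ) (c : ℝ → ℝ → ℂ) (d : ℝ → ℝ → ℝ) (q r : ℝ) : ℂ :=
  (r / √(r ^ 2 - q ^ 2) ^ 3) • c r (Real.arcsin (q / r)) +
    (2 * q / (r ^ 2 - q ^ 2) * d r (Real.arcsin (q / r))) • (Complex.I * p q)

/-- `radKern` with the cutoff `q² + δ² < r²`. -/
def cutKern (c : ℝ → ℝ → ℂ) (δ q r : ℝ) : ℂ :=
  if q ^ 2 + δ ^ 2 < r ^ 2 then radKern c q r else 0

/-- `radKernDeriv` with the cutoff `q² + δ² < r²`. -/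
def cutKernDeriv (p : ℝ → ℂ) (c : ℝ → ℝ → ℂ) (d : ℝ → ℝ → ℝ) (δ q r : ℝ) : ℂ :=
  if q ^ 2 + δ ^ 2 < r ^ 2 then radKernDeriv p c d q r else 0

theorem hasDerivAt_arcsin_div {q r : ℝ} (hr : 0 < r) (hq : |q| < r) :
    HasDerivAt (fun x => Real.arcsin (x / r)) (1 / √(r ^ 2 - q ^ 2)) q := by
  obtain ⟨h1, h2⟩ := abs_lt.1 hq
  have h3 : q / r ≠ -1 := by
    intro h; rw [div_eq_iff hr.ne'] at h; linarith
  have h4 : q / r ≠ 1 := by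
    intro h; rw [div_eq_iff hr.ne'] at h; linarith
  have h5 : √(1 - (q / r) ^ 2) = √(r ^ 2 - q ^ 2) / r := by
    rw [show 1 - (q / r) ^ 2 = (r ^ 2 - q ^ 2) / r ^ 2 by field_simp, Real.sqrt_div' _ (by positivity),
      Real.sqrt_sq hr.le]
  have h6 : 0 < √(r ^ 2 - q ^ 2) := Real.sqrt_pos.2 (by nlinarith)
  refine ((Real.hasDerivAt_arcsin h3 h4).comp q ((hasDerivAt_id q).div_const r)).congr_deriv ?_
  rw [h5]
  field_simp

theorem mul_sin_arcsin_div {q r : ℝ} (hr : 0 < r) (hq : |q| < r) :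
    r * Real.sin (Real.arcsin (q / r)) = q := by
  obtain ⟨h1, h2⟩ := abs_lt.1 hq
  rw [Real.sin_arcsin (by rw [le_div_iff₀ hr]; linarith) (by rw [div_le_iff₀ hr]; linarith)]
  field_simp

theorem hasDerivAt_sqrt_sq_sub {q r : ℝ} (hq : |q| < r) :
    HasDerivAt (fun x => √(r ^ 2 - x ^ 2)) (-(q / √(r ^ 2 - q ^ 2))) q := by
  obtain ⟨h1, h2⟩ := abs_lt.1 hq
  have h6 : 0 < r ^ 2 - q ^ 2 := by nlinarith
  have h : HasDerivAt (fun x : ℝ => r ^ 2 - x ^ 2) (-(2 * q)) q := by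
    simpa using (hasDerivAt_pow 2 q).const_sub (r ^ 2)
  refine (h.sqrt h6.ne').congr_deriv ?_
  have := Real.sqrt_pos.2 h6
  field_simp

namespace IsAmplitude

variable {X : Type*} [TopologicalSpace X] {p : X → ℝ → ℂ} {a b : ℝ}
  {c cr : X → ℝ → ℝ → ℂ} {d dr : X → ℝ → ℝ → ℝ}

theorem hasDerivAt_c (h : IsAmplitude p a b c cr d dr) (x : X) {q r : ℝ} (hr : 0 < r)
    (hq : |q| < r) : HasDerivAt (fun q => c x r (Real.arcsin (q / r)))
      ((2 * r / √(r ^ 2 - q ^ 2) * d x r (Real.arcsin (q / r))) • (Complex.I * p x q)) q := by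
  refine ((h.ode_c x r _).scomp q (hasDerivAt_arcsin_div hr hq)).congr_deriv ?_
  rw [mul_sin_arcsin_div hr hq, Complex.real_smul, Complex.real_smul]
  push_cast
  ring

theorem hasDerivAt_d (h : IsAmplitude p a b c cr d dr) (x : X) {q r : ℝ} (hr : 0 < r)
    (hq : |q| < r) : HasDerivAt (fun q => d x r (Real.arcsin (q / r)))
      (2 * r / √(r ^ 2 - q ^ 2) * (conj (p x q) * c x r (Real.arcsin (q / r))).im) q := by
  refine ((h.ode_d x r _).scomp q (hasDerivAt_arcsin_div hr hq)).congr_deriv ?_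
  rw [mul_sin_arcsin_div hr hq, smul_eq_mul]
  ring

/-- Here q moves at fixed r instead of fixed s, so the linear system for c and d enters. The price
is a singularity of order (r² - q²)^(-3/2) at q = r, which is not integrable in general; this is the
reason for the cutoff. -/
theorem hasDerivAt_radKern (h : IsAmplitude p a b c cr d dr) (x : X) {q r : ℝ} (hr : 0 < r)
    (hq : |q| < r) :
    HasDerivAt (fun q => radKern (c x) q r) (radKernDeriv (p x) (c x) (d x) q r) q := by
  obtain ⟨h1, h2⟩ := abs_lt.1 hq
  have hpos : 0 < r ^ 2 - q ^ 2 := by nlinarith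
  have hs : 0 < √(r ^ 2 - q ^ 2) := Real.sqrt_pos.2 hpos
  have hs2 : √(r ^ 2 - q ^ 2) ^ 2 = r ^ 2 - q ^ 2 := Real.sq_sqrt hpos.le
  have hf : HasDerivAt (fun q => q / (r * √(r ^ 2 - q ^ 2))) (r / √(r ^ 2 - q ^ 2) ^ 3) q := by
    refine ((hasDerivAt_id q).div ((hasDerivAt_sqrt_sq_sub hq).const_mul r)
      (by positivity)).congr_deriv ?_
    simp only [id]
    field_simp
    rw [hs2]; ring
  refine (hf.smul (h.hasDerivAt_c x hr hq)).congr_deriv ?_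
  rw [radKernDeriv, smul_smul, add_comm]
  congr 2
  have hs4 : q / (r * √(r ^ 2 - q ^ 2)) * (2 * r / √(r ^ 2 - q ^ 2)) = 2 * q / (r ^ 2 - q ^ 2) := by
    rw [← hs2, Real.sqrt_sq hs.le]
    field_simp
  rw [← hs4]
  ring

theorem measurable_c (h : IsAmplitude p a b c cr d dr) (x : X) :
    Measurable fun y : ℝ × ℝ => c x y.1 y.2 :=
  (h.cont_c.comp (f := fun y : ℝ × ℝ => (x, y)) (by fun_prop)).measurable

theorem measurable_d (h : IsAmplitude p a b c cr d dr) (x : X) :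
    Measurable fun y : ℝ × ℝ => d x y.1 y.2 :=
  (h.cont_d.comp (f := fun y : ℝ × ℝ => (x, y)) (by fun_prop)).measurable

theorem measurable_p (h : IsAmplitude p a b c cr d dr) (x : X) : Measurable (p x) :=
  (h.cont_p.comp (f := fun y : ℝ => (x, y)) (by fun_prop)).measurable

theorem measurable_radKern (h : IsAmplitude p a b c cr d dr) (x : X) :
    Measurable fun y : ℝ × ℝ => radKern (c x) y.1 y.2 := by
  have h1 : Measurable fun y : ℝ × ℝ => c x y.2 (Real.arcsin (y.1 / y.2)) :=
    (h.measurable_c x).comp (g := fun y : ℝ × ℝ => c x y.1 y.2)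
      (f := fun y : ℝ × ℝ => (y.2, Real.arcsin (y.1 / y.2)))
      (measurable_snd.prodMk (Real.continuous_arcsin.measurable.comp
        (measurable_fst.div measurable_snd)))
  exact Measurable.smul (f := fun y : ℝ × ℝ => y.1 / (y.2 * √(y.2 ^ 2 - y.1 ^ 2)))
    (by fun_prop) h1

theorem measurable_radKernDeriv (h : IsAmplitude p a b c cr d dr) (x : X) :
    Measurable fun y : ℝ × ℝ => radKernDeriv (p x) (c x) (d x) y.1 y.2 := by
  have h0 : Measurable fun y : ℝ × ℝ => (y.2, Real.arcsin (y.1 / y.2)) :=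
    measurable_snd.prodMk (Real.continuous_arcsin.measurable.comp
        (measurable_fst.div measurable_snd))
  have h1 : Measurable fun y : ℝ × ℝ => c x y.2 (Real.arcsin (y.1 / y.2)) :=
    (h.measurable_c x).comp (g := fun y : ℝ × ℝ => c x y.1 y.2) h0
  have h2 : Measurable fun y : ℝ × ℝ => d x y.2 (Real.arcsin (y.1 / y.2)) :=
    (h.measurable_d x).comp (g := fun y : ℝ × ℝ => d x y.1 y.2) h0
  have h3 : Measurable fun y : ℝ × ℝ => p x y.1 := (h.measurable_p x).comp measurable_fst
  exact (Measurable.smul (f := fun y : ℝ × ℝ => y.2 / √(y.2 ^ 2 - y.1 ^ 2) ^ 3)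
    (by fun_prop) h1).add ((Measurable.mul (f := fun y : ℝ × ℝ => 2 * y.1 / (y.2 ^ 2 - y.1 ^ 2))
      (by fun_prop) h2).smul (h3.const_mul Complex.I))

theorem measurableSet_cut (δ : ℝ) : MeasurableSet {y : ℝ × ℝ | y.1 ^ 2 + δ ^ 2 < y.2 ^ 2} :=
  measurableSet_lt (by fun_prop) (by fun_prop)

theorem measurable_cutKern (h : IsAmplitude p a b c cr d dr) (x : X) (δ : ℝ) :
    Measurable fun y : ℝ × ℝ => cutKern (c x) δ y.1 y.2 :=
  Measurable.ite (measurableSet_cut δ) (h.measurable_radKern x) measurable_const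

theorem measurable_cutKernDeriv (h : IsAmplitude p a b c cr d dr) (x : X) (δ : ℝ) :
    Measurable fun y : ℝ × ℝ => cutKernDeriv (p x) (c x) (d x) δ y.1 y.2 :=
  Measurable.ite (measurableSet_cut δ) (h.measurable_radKernDeriv x) measurable_const

/-- Behind the cutoff √(r² - q²) ≥ δ, so every denominator is controlled by a power of δ. The bound
on `radKern` includes the edge itself, where the boundary term of an integration by parts is
evaluated. -/
theorem exists_cut_bound (h : IsAmplitude p a b c cr d dr) (x : X) {δ : ℝ} (hδ : 0 < δ) :
    ∃ C, 0 ≤ C ∧ ∀ q ∈ Icc (0 : ℝ) 1, ∀ r ∈ Ioo (0 : ℝ) 1,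
      (q ^ 2 + δ ^ 2 ≤ r ^ 2 → ‖radKern (c x) q r‖ ≤ C) ∧ ‖cutKern (c x) δ q r‖ ≤ C ∧
        ‖cutKernDeriv (p x) (c x) (d x) δ q r‖ ≤ C := by
  obtain ⟨M, hM0, hM⟩ := h.exists_bound (isCompact_singleton (x := x))
  obtain ⟨hp, hM⟩ := hM x rfl
  have key : ∀ q ∈ Icc (0 : ℝ) 1, ∀ r ∈ Ioo (0 : ℝ) 1, q ^ 2 + δ ^ 2 ≤ r ^ 2 →
      ‖radKern (c x) q r‖ ≤ 1 / δ * M ∧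
      ‖radKernDeriv (p x) (c x) (d x) q r‖ ≤ 1 / δ ^ 3 * M + 2 / δ ^ 2 * M * M := by
    intro q hq r hr hqr
    have hs : δ ≤ √(r ^ 2 - q ^ 2) := Real.le_sqrt_of_sq_le (by linarith)
    have hs2 : δ ^ 2 ≤ r ^ 2 - q ^ 2 := by linarith
    have hs0 : 0 < √(r ^ 2 - q ^ 2) := hδ.trans_le hs
    have hq' : q ≤ r := by nlinarith [hr.1, hq.1]
    have ht : Real.arcsin (q / r) ∈ Icc 0 (Real.pi / 2) :=
      ⟨Real.arcsin_nonneg.2 (div_nonneg hq.1 hr.1.le), Real.arcsin_le_pi_div_two _⟩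
    have hb := hM r ⟨hr.1.le, hr.2.le⟩ _ ht
    have hr0 := hr.1
    constructor
    · rw [radKern, norm_smul, Real.norm_of_nonneg (div_nonneg hq.1 (by positivity))]
      refine mul_le_mul ?_ hb.1 (norm_nonneg _) (by positivity)
      rw [div_le_div_iff₀ (by positivity) hδ]
      nlinarith [hq.1]
    · refine (norm_add_le _ _).trans (add_le_add ?_ ?_)
      · rw [norm_smul, Real.norm_of_nonneg (by positivity)]
        refine mul_le_mul ?_ hb.1 (norm_nonneg _) (by positivity)
        have : δ ^ 3 ≤ √(r ^ 2 - q ^ 2) ^ 3 := by gcongr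
        exact div_le_div₀ zero_le_one hr.2.le (by positivity) this
      · rw [norm_smul, norm_mul, norm_mul, Complex.norm_I, one_mul,
          Real.norm_of_nonneg (div_nonneg (by linarith [hq.1]) (by linarith [sq_nonneg δ]))]
        refine mul_le_mul (mul_le_mul ?_ hb.2.2.2.1 (norm_nonneg _) (by positivity)) (hp q hq)
          (norm_nonneg _) (by positivity)
        exact div_le_div₀ (by norm_num) (by linarith [hq.2]) (by positivity) hs2
  refine ⟨1 / δ * M + (1 / δ ^ 3 * M + 2 / δ ^ 2 * M * M), by positivity, fun q hq r hr => ?_⟩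
  have h1 : 0 ≤ 1 / δ * M := by positivity
  have h2 : 0 ≤ 1 / δ ^ 3 * M + 2 / δ ^ 2 * M * M := by positivity
  refine ⟨fun hqr => (key q hq r hr hqr).1.trans (by linarith), ?_, ?_⟩
  · rw [cutKern]
    split_ifs with hlt
    · exact (key q hq r hr hlt.le).1.trans (by linarith)
    · rw [norm_zero]; positivity
  · rw [cutKernDeriv]
    split_ifs with hlt
    · exact (key q hq r hr hlt.le).2.trans (by linarith)
    · rw [norm_zero]; positivity

/-- The functional kernel as an integral over the deformation point. -/
theorem funKernel_eq_integral (h : IsAmplitude p a b c cr d dr) (x : X) {δ q : ℝ} (hδ : 0 < δ)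
    (hδ1 : δ ≤ 1) (hq : 0 ≤ q) :
    funKernel (c x) δ q = ∫ r in Ioo (0 : ℝ) 1, cutKern (c x) δ q r := by
  set f : ℝ → ℝ := fun s => √(q ^ 2 + s ^ 2) with hf
  have hfpos : ∀ s, 0 < s → 0 < f s := fun s hs => Real.sqrt_pos.2 (by positivity)
  have hfsq : ∀ s, f s ^ 2 = q ^ 2 + s ^ 2 := fun s => Real.sq_sqrt (by positivity)
  have hf' : ∀ s, 0 < s → HasDerivAt f (s / f s) s := by
    intro s hs
    have h1 : HasDerivAt (fun s : ℝ => q ^ 2 + s ^ 2) (2 * s) s := by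
      simpa using (hasDerivAt_pow 2 s).const_add (q ^ 2)
    refine (h1.sqrt (by positivity)).congr_deriv ?_
    have := hfpos s hs
    simp only [hf] at this ⊢
    field_simp
  have hmono : f δ ≤ f 1 := Real.sqrt_le_sqrt (by nlinarith)
  have hfc : Continuous f := by fun_prop
  have hfδ : q < f δ := Real.lt_sqrt_of_sq_lt (by nlinarith)
  have hsub := intervalIntegral.integral_deriv_smul_comp'' (a := δ) (b := 1) (f := f)
    (f' := fun s => s / f s) (g := radKern (c x) q) hfc.continuousOn
    (fun s hs => by
      rw [min_eq_left hδ1, max_eq_right hδ1] at hs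
      exact (hf' s (hδ.trans hs.1)).hasDerivWithinAt)
    (by
      rw [uIcc_of_le hδ1]
      exact continuousOn_id.div hfc.continuousOn fun s hs => (hfpos s (hδ.trans_le hs.1)).ne')
    (by
      rw [uIcc_of_le hδ1]
      have hmaps : ∀ r ∈ f '' Icc δ 1, q < r := by
        rintro _ ⟨s, hs, rfl⟩
        exact Real.lt_sqrt_of_sq_lt (by nlinarith [hs.1])
      intro r hr
      have hqr := hmaps r hr
      have hr0 : 0 < r := hq.trans_lt hqr
      have h2 : 0 < r ^ 2 - q ^ 2 := by nlinarith
      refine ContinuousAt.continuousWithinAt ?_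
      have hc1 : ContinuousAt (fun r : ℝ => q / (r * √(r ^ 2 - q ^ 2))) r :=
        continuousAt_const.div (by fun_prop) (mul_pos hr0 (Real.sqrt_pos.2 h2)).ne'
      have hc2 : ContinuousAt (fun r : ℝ => Real.arcsin (q / r)) r :=
        Real.continuous_arcsin.continuousAt.comp (continuousAt_const.div continuousAt_id hr0.ne')
      have hcc : Continuous fun y : ℝ × ℝ => c x y.1 y.2 :=
        h.cont_c.comp (f := fun y : ℝ × ℝ => (x, y)) (by fun_prop)
      exact hc1.smul (hcc.continuousAt.comp (f := fun r => (r, Real.arcsin (q / r)))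
        (continuousAt_id.prodMk hc2)))
  have hlhs : funKernel (c x) δ q = ∫ s in δ..1, (s / f s) • (radKern (c x) q ∘ f) s := by
    refine intervalIntegral.integral_congr fun s hs => ?_
    rw [uIcc_of_le hδ1] at hs
    have hs0 := hδ.trans_le hs.1
    have hfs := hfpos s hs0
    have e : √(f s ^ 2 - q ^ 2) = s := by
      rw [hfsq, add_sub_cancel_left, Real.sqrt_sq hs0.le]
    simp only [Function.comp, radKern, kern, e, smul_smul, ← hfsq s]
    rw [Real.sqrt_sq hfs.le]
    congr 1
    field_simp
  rw [hlhs, hsub, intervalIntegral.integral_of_le hmono, ← integral_indicator measurableSet_Ioc,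
    ← integral_indicator measurableSet_Ioo]
  refine integral_congr_ae (ae_of_all _ fun r => ?_)
  -- The substitution r = √(q² + s²) ends at √(q² + 1), beyond 1. The support of c in [a, b] makes
  -- this end and the end of the unit interval interchangeable.
  have hzero : ∀ r, r ∉ Icc a b → radKern (c x) q r = 0 := fun r hr => by
    rw [radKern, h.c_zero x r hr, smul_zero]
  have hcut : ∀ r, 0 < r → (q ^ 2 + δ ^ 2 < r ^ 2 ↔ f δ < r) := fun r hr => by
    rw [← hfsq δ]; exact pow_lt_pow_iff_left₀ (hfpos δ hδ).le hr.le two_ne_zero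
  have hf1 : 1 ≤ f 1 := Real.le_sqrt_of_sq_le (by nlinarith)
  simp only [indicator, cutKern]
  by_cases hr0 : 0 < r
  · by_cases hrb : r ≤ b
    · have hr1 := hrb.trans_lt h.b_lt
      simp only [mem_Ioc, mem_Ioo, hr0, hr1, hcut r hr0, hr1.le.trans hf1, and_true, if_true]
    · have := hzero r (fun hh => hrb hh.2)
      simp [this]
  · have := hzero r (fun hh => hr0 (h.a_pos.trans_le hh.1))
    simp [this]

end IsAmplitude

/-! ### The pairing of two kernels as a double integral -/

/-- Lebesgue measure on the unit interval. -/
def unitMeasure : Measure ℝ := volume.restrict (Ioo (0 : ℝ) 1)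

instance : IsFiniteMeasure unitMeasure := by
  unfold unitMeasure; infer_instance

theorem ae_unitMeasure : ∀ᵐ q ∂unitMeasure, q ∈ Ioo (0 : ℝ) 1 :=
  ae_restrict_mem measurableSet_Ioo

theorem ae_unitMeasure_prod :
    ∀ᵐ y ∂unitMeasure.prod unitMeasure, y.1 ∈ Ioo (0 : ℝ) 1 ∧ y.2 ∈ Ioo (0 : ℝ) 1 :=
  (Measure.quasiMeasurePreserving_fst.ae ae_unitMeasure).and
    (Measure.quasiMeasurePreserving_snd.ae ae_unitMeasure)

theorem measurable_inner_complex {α : Type*} [MeasurableSpace α] {f g : α → ℂ}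
    (hf : Measurable f) (hg : Measurable g) : Measurable fun y => inner ℝ (f y) (g y) :=
  hf.inner hg

namespace IsAmplitude

variable {X : Type*} [TopologicalSpace X] {p : X → ℝ → ℂ} {a b : ℝ}
  {c cr : X → ℝ → ℝ → ℂ} {d dr : X → ℝ → ℝ → ℝ}

theorem norm_inner_le_mul {u v : ℂ} {A B : ℝ} (hA : ‖u‖ ≤ A) (hB : ‖v‖ ≤ B) :
    ‖inner ℝ u v‖ ≤ A * B :=
  (norm_inner_le_norm u v).trans
    (mul_le_mul hA hB (norm_nonneg _) ((norm_nonneg _).trans hA))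

/-- Integration by parts at a fixed deformation point. -/
theorem integral_inner_cutKern (h : IsAmplitude p a b c cr d dr) (x : X) {δ r : ℝ} (hδ : 0 < δ)
    (hr : r ∈ Ioo (0 : ℝ) 1) {κ κ' : ℝ → ℂ} {C : ℝ} (hκ : ContinuousOn κ (Ici 0))
    (hκ' : ContinuousOn κ' (Ioi 0)) (hd : ∀ q, 0 < q → HasDerivAt κ (κ' q) q) (h0 : κ 0 = 0)
    (hb : ∀ q ∈ Ioo (0 : ℝ) 1, ‖κ q‖ ≤ C ∧ ‖κ' q‖ ≤ C) :
    ∫ q, inner ℝ (cutKern (c x) δ q r) (κ' q) ∂unitMeasure =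
      inner ℝ (radKern (c x) (√(r ^ 2 - δ ^ 2)) r) (κ (√(r ^ 2 - δ ^ 2)))
        - ∫ q, inner ℝ (cutKernDeriv (p x) (c x) (d x) δ q r) (κ q) ∂unitMeasure := by
  obtain ⟨B, hB0, hB⟩ := h.exists_cut_bound x hδ
  -- If r ≤ δ the cutoff removes everything; the real square root of a nonpositive number is 0,
  -- where κ vanishes, so the formula still holds.
  rcases le_or_gt r δ with hrδ | hrδ
  · have e : √(r ^ 2 - δ ^ 2) = 0 := Real.sqrt_eq_zero_of_nonpos (by nlinarith [hr.1])
    have hn : ∀ q : ℝ, ¬ (q ^ 2 + δ ^ 2 < r ^ 2) := fun q => by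
      have : 0 < r := hr.1
      have : r ^ 2 ≤ δ ^ 2 := by gcongr
      nlinarith [sq_nonneg q]
    simp [e, h0, cutKern, cutKernDeriv, hn]
  · set qs := √(r ^ 2 - δ ^ 2) with hqs
    have hpos : 0 < r ^ 2 - δ ^ 2 := by nlinarith
    have hqs2 : qs ^ 2 = r ^ 2 - δ ^ 2 := Real.sq_sqrt hpos.le
    have hqs0 : 0 < qs := Real.sqrt_pos.2 hpos
    have hqsr : qs < r := by nlinarith [hr.1]
    have hsub : Ioo 0 qs ⊆ Ioo (0 : ℝ) 1 := Ioo_subset_Ioo_right (hqsr.trans hr.2).le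
    have hcut : ∀ q ∈ Ioo (0 : ℝ) 1, (q ^ 2 + δ ^ 2 < r ^ 2 ↔ q < qs) := fun q hq => by
      rw [← lt_sub_iff_add_lt, ← hqs2]
      exact pow_lt_pow_iff_left₀ hq.1.le hqs0.le two_ne_zero
    have hmκ : AEStronglyMeasurable κ unitMeasure :=
      (hκ.mono fun q hq => le_of_lt hq.1).aestronglyMeasurable measurableSet_Ioo
    have hmκ' : AEStronglyMeasurable κ' unitMeasure :=
      (hκ'.mono fun q hq => hq.1).aestronglyMeasurable measurableSet_Ioo
    have hr1 : Measurable fun q : ℝ => (q, r) := by fun_prop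
    have hm1 : Measurable fun q => cutKern (c x) δ q r :=
      (h.measurable_cutKern x δ).comp hr1
    have hm2 : Measurable fun q => cutKernDeriv (p x) (c x) (d x) δ q r :=
      (h.measurable_cutKernDeriv x δ).comp hr1
    have hi1 : Integrable (fun q => inner ℝ (cutKern (c x) δ q r) (κ' q)) unitMeasure := by
      refine Integrable.of_bound (hm1.aestronglyMeasurable.inner hmκ') (B * C) ?_
      filter_upwards [ae_unitMeasure] with q hq
      exact norm_inner_le_mul (hB q ⟨hq.1.le, hq.2.le⟩ r hr).2.1 (hb q hq).2
    have hi2 : Integrable (fun q => inner ℝ (cutKernDeriv (p x) (c x) (d x) δ q r) (κ q))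
        unitMeasure := by
      refine Integrable.of_bound (hm2.aestronglyMeasurable.inner hmκ) (B * C) ?_
      filter_upwards [ae_unitMeasure] with q hq
      exact norm_inner_le_mul (hB q ⟨hq.1.le, hq.2.le⟩ r hr).2.2 (hb q hq).1
    have habs : ∀ q ∈ Ico 0 r, |q| < r := fun q hq => by rw [abs_of_nonneg hq.1]; exact hq.2
    have hftc := intervalIntegral.integral_eq_sub_of_hasDerivAt_of_le (a := 0) (b := qs)
      (f := fun q => inner ℝ (radKern (c x) q r) (κ q))
      (f' := fun q => inner ℝ (cutKern (c x) δ q r) (κ' q) +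
        inner ℝ (cutKernDeriv (p x) (c x) (d x) δ q r) (κ q)) hqs0.le
      (ContinuousOn.inner (𝕜 := ℝ) (fun q hq => (h.hasDerivAt_radKern x hr.1 (habs q ⟨hq.1,
        hq.2.trans_lt hqsr⟩)).continuousAt.continuousWithinAt) (hκ.mono fun q hq => hq.1))
      (fun q hq => by
        have hlt := (hcut q (hsub hq)).2 hq.2
        rw [cutKern, cutKernDeriv, if_pos hlt, if_pos hlt]
        exact (h.hasDerivAt_radKern x hr.1 (habs q ⟨hq.1.le, hq.2.trans hqsr⟩)).inner ℝ
          (hd q hq.1))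
      (by
        rw [intervalIntegrable_iff_integrableOn_Ioo_of_le hqs0.le]
        exact IntegrableOn.mono_set (hi1.add hi2) hsub)
    -- The cutoff in q at fixed r is the sharp edge q = √(r² - δ²), so integrals over the unit
    -- interval may be cut there and the fundamental theorem applied below the edge.
    have hrw : ∀ f : ℝ → ℝ, (∀ q ∈ Ioo (0 : ℝ) 1, qs ≤ q → f q = 0) →
        ∫ q, f q ∂unitMeasure = ∫ q in (0 : ℝ)..qs, f q := by
      intro f hf
      rw [intervalIntegral.integral_of_le hqs0.le, integral_Ioc_eq_integral_Ioo]
      refine setIntegral_eq_of_subset_of_forall_sdiff_eq_zero measurableSet_Ioo hsub fun q hq => ?_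
      exact hf q hq.1 (not_lt.1 fun hlt => hq.2 ⟨hq.1.1, hlt⟩)
    have hz1 : ∀ q ∈ Ioo (0 : ℝ) 1, qs ≤ q → inner ℝ (cutKern (c x) δ q r) (κ' q) = 0 := by
      intro q hq hle
      rw [cutKern, if_neg (by rw [hcut q hq]; exact not_lt.2 hle), inner_zero_left]
    have hz2 : ∀ q ∈ Ioo (0 : ℝ) 1, qs ≤ q →
        inner ℝ (cutKernDeriv (p x) (c x) (d x) δ q r) (κ q) = 0 := by
      intro q hq hle
      rw [cutKernDeriv, if_neg (by rw [hcut q hq]; exact not_lt.2 hle), inner_zero_left]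
    have hsum : ∫ q, (inner ℝ (cutKern (c x) δ q r) (κ' q) +
        inner ℝ (cutKernDeriv (p x) (c x) (d x) δ q r) (κ q)) ∂unitMeasure =
        inner ℝ (radKern (c x) qs r) (κ qs) := by
      rw [hrw _ fun q hq hle => by rw [hz1 q hq hle, hz2 q hq hle, add_zero], hftc, h0]
      simp
    rw [integral_add hi1 hi2] at hsum
    linarith

/-- The integrand of the double integral that represents the pairing of two kernels. -/
def pairIntegrand (p : ℝ → ℂ) (c₁ : ℝ → ℝ → ℂ) (d₁ : ℝ → ℝ → ℝ) (c₂ : ℝ → ℝ → ℂ) (δ : ℝ)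
    (y : ℝ × ℝ) : ℝ :=
  (∫ q, inner ℝ (cutKernDeriv p c₁ d₁ δ q y.1) (cutKern c₂ δ q y.2) ∂unitMeasure)
    - inner ℝ (radKern c₁ (√(y.1 ^ 2 - δ ^ 2)) y.1) (cutKern c₂ δ (√(y.1 ^ 2 - δ ^ 2)) y.2)

variable {c₂ cr₂ : X → ℝ → ℝ → ℂ} {d₂ dr₂ : X → ℝ → ℝ → ℝ}

theorem sqrt_mem_unit {r δ : ℝ} (hr : r ∈ Ioo (0 : ℝ) 1) : √(r ^ 2 - δ ^ 2) ∈ Icc (0 : ℝ) 1 := by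
  refine ⟨Real.sqrt_nonneg _, Real.sqrt_le_one.2 ?_⟩
  nlinarith [hr.1, hr.2, sq_nonneg δ]

theorem radKern_sqrt_bound {δ r B : ℝ} (x : X) (hB0 : 0 ≤ B) (hr : r ∈ Ioo (0 : ℝ) 1)
    (hδ : 0 < δ)
    (hB : ∀ q ∈ Icc (0 : ℝ) 1, ∀ r ∈ Ioo (0 : ℝ) 1,
      (q ^ 2 + δ ^ 2 ≤ r ^ 2 → ‖radKern (c x) q r‖ ≤ B)) :
    ‖radKern (c x) (√(r ^ 2 - δ ^ 2)) r‖ ≤ B := by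
  rcases le_total δ r with hle | hle
  · refine hB _ (sqrt_mem_unit hr) r hr ?_
    rw [Real.sq_sqrt (by nlinarith)]; linarith
  · rw [Real.sqrt_eq_zero_of_nonpos (by nlinarith [hr.1])]
    simpa [radKern] using hB0

/-- With the cutoff present all factors are bounded on a finite measure space, which justifies every
exchange of integrals that follows. -/
theorem integrable_pairIntegrand (h : IsAmplitude p a b c cr d dr)
    (h₂ : IsAmplitude p a b c₂ cr₂ d₂ dr₂) (x : X) {δ : ℝ} (hδ : 0 < δ) :
    Integrable (pairIntegrand (p x) (c x) (d x) (c₂ x) δ) (unitMeasure.prod unitMeasure) := by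
  obtain ⟨B, hB0, hB⟩ := h.exists_cut_bound x hδ
  obtain ⟨B₂, hB0₂, hB₂⟩ := h₂.exists_cut_bound x hδ
  have hs : Measurable fun y : ℝ × ℝ => √(y.1 ^ 2 - δ ^ 2) := by fun_prop
  have hm1 : Measurable fun z : (ℝ × ℝ) × ℝ => inner ℝ (cutKernDeriv (p x) (c x) (d x) δ z.2 z.1.1)
      (cutKern (c₂ x) δ z.2 z.1.2) :=
    measurable_inner_complex
      ((h.measurable_cutKernDeriv x δ).comp (f := fun z : (ℝ × ℝ) × ℝ => (z.2, z.1.1)) (by fun_prop))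
      ((h₂.measurable_cutKern x δ).comp (f := fun z : (ℝ × ℝ) × ℝ => (z.2, z.1.2)) (by fun_prop))
  have hm2 : Measurable fun y : ℝ × ℝ => inner ℝ (radKern (c x) (√(y.1 ^ 2 - δ ^ 2)) y.1)
      (cutKern (c₂ x) δ (√(y.1 ^ 2 - δ ^ 2)) y.2) :=
    measurable_inner_complex
      ((h.measurable_radKern x).comp (f := fun y : ℝ × ℝ => (√(y.1 ^ 2 - δ ^ 2), y.1)) (by fun_prop))
      ((h₂.measurable_cutKern x δ).comp (f := fun y : ℝ × ℝ => (√(y.1 ^ 2 - δ ^ 2), y.2))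
        (by fun_prop))
  have hm3 := hm1.stronglyMeasurable.integral_prod_right' (ν := unitMeasure)
  refine Integrable.sub (Integrable.of_bound hm3.aestronglyMeasurable
    (B * B₂ * unitMeasure.real univ) ?_)
    (Integrable.of_bound hm2.aestronglyMeasurable (B * B₂) ?_)
  · filter_upwards [ae_unitMeasure_prod] with y hy
    refine norm_integral_le_of_norm_le_const ?_
    filter_upwards [ae_unitMeasure] with q hq
    exact norm_inner_le_mul (hB q ⟨hq.1.le, hq.2.le⟩ _ hy.1).2.2
      (hB₂ q ⟨hq.1.le, hq.2.le⟩ _ hy.2).2.1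
  · filter_upwards [ae_unitMeasure_prod] with y hy
    exact norm_inner_le_mul (radKern_sqrt_bound x hB0 hy.1 hδ fun q hq r hr => (hB q hq r hr).1)
      (hB₂ _ (sqrt_mem_unit hy.1) _ hy.2).2.1

theorem integrable_cutKern (h : IsAmplitude p a b c cr d dr) (x : X) {δ : ℝ} (hδ : 0 < δ) {q : ℝ}
    (hq : q ∈ Icc (0 : ℝ) 1) : Integrable (cutKern (c x) δ q) unitMeasure := by
  obtain ⟨B, hB0, hB⟩ := h.exists_cut_bound x hδ
  refine Integrable.of_bound ((h.measurable_cutKern x δ).comp (f := fun r : ℝ => (q, r))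
    (by fun_prop)).aestronglyMeasurable B ?_
  filter_upwards [ae_unitMeasure] with r hr
  exact (hB q hq r hr).2.1

/-- The pairing of a kernel with the derivative of another one. -/
theorem integral_inner_funKernelDeriv [FirstCountableTopology X] (h : IsAmplitude p a b c cr d dr)
    (h₂ : IsAmplitude p a b c₂ cr₂ d₂ dr₂) (x : X) {δ : ℝ} (hδ : 0 < δ) (hδ1 : δ ≤ 1) :
    ∫ q, inner ℝ (funKernel (c x) δ q)
        (funKernelDeriv (c₂ x) (cr₂ x) (angleDeriv p d₂ x) δ q) ∂unitMeasure =
      -∫ y, pairIntegrand (p x) (c x) (d x) (c₂ x) δ y ∂unitMeasure.prod unitMeasure := by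
  obtain ⟨B, hB0, hB⟩ := h.exists_cut_bound x hδ
  obtain ⟨B₂, hB0₂, hB₂⟩ := h₂.exists_cut_bound x hδ
  obtain ⟨C, hC0, hC⟩ := h₂.exists_kern_bound (isCompact_singleton (x := x))
  have hδm : δ ∈ Icc (0 : ℝ) 1 := ⟨hδ.le, hδ1⟩
  set κ := funKernel (c₂ x) δ with hκdef
  set κ' := funKernelDeriv (c₂ x) (cr₂ x) (angleDeriv p d₂ x) δ with hκ'def
  have hκ : ContinuousOn κ (Ici 0) := h₂.continuousOn_funKernel_Icc x hδm
  have hκ' : ContinuousOn κ' (Ioi 0) := h₂.continuousOn_funKernelDeriv δ x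
  have hκb : ∀ q ∈ Icc (0 : ℝ) 1, ‖κ q‖ ≤ C := fun q hq =>
    (norm_funKernel_le (fun q s hq hs => (hC x rfl q s hq hs).1) hδm hq.1).trans
      (mul_le_of_le_one_right hC0 hq.2)
  have hb : ∀ q ∈ Ioo (0 : ℝ) 1, ‖κ q‖ ≤ C ∧ ‖κ' q‖ ≤ C := fun q hq =>
    ⟨hκb q ⟨hq.1.le, hq.2.le⟩, norm_funKernelDeriv_le (fun q s hq hs => (hC x rfl q s hq hs).2) hδm hq.1.le⟩
  have hmκ' : AEStronglyMeasurable κ' unitMeasure :=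
    (hκ'.mono fun q hq => hq.1).aestronglyMeasurable measurableSet_Ioo
  have hKint : ∀ q ∈ Icc (0 : ℝ) 1, κ q = ∫ r, cutKern (c₂ x) δ q r ∂unitMeasure := fun q hq =>
    h₂.funKernel_eq_integral x hδ hδ1 hq.1
  -- expand the first kernel
  have hexpand : ∫ q, inner ℝ (funKernel (c x) δ q) (κ' q) ∂unitMeasure =
      ∫ q, ∫ r, inner ℝ (cutKern (c x) δ q r) (κ' q) ∂unitMeasure ∂unitMeasure := by
    refine integral_congr_ae ?_
    filter_upwards [ae_unitMeasure] with q hq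
    have hq' : q ∈ Icc (0 : ℝ) 1 := ⟨hq.1.le, hq.2.le⟩
    rw [h.funKernel_eq_integral x hδ hδ1 hq.1.le, real_inner_comm]
    simp only [real_inner_comm (κ' q)]
    exact (integral_inner (h.integrable_cutKern x hδ hq') (κ' q)).symm
  have hint1 : Integrable (fun y : ℝ × ℝ => inner ℝ (cutKern (c x) δ y.1 y.2) (κ' y.1))
      (unitMeasure.prod unitMeasure) := by
    refine Integrable.of_bound ((h.measurable_cutKern x δ).aestronglyMeasurable.inner
      hmκ'.comp_fst) (B * C) ?_
    filter_upwards [ae_unitMeasure_prod] with y hy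
    exact norm_inner_le_mul (hB _ ⟨hy.1.1.le, hy.1.2.le⟩ _ hy.2).2.1 (hb _ hy.1).2
  -- Fubini brings the q-integral inside. At fixed r the derivative is moved off the second kernel,
  -- and only then is the second kernel expanded over its own deformation point.
  rw [hexpand, integral_integral_swap hint1, integral_prod _ (h.integrable_pairIntegrand h₂ x hδ),
    ← integral_neg]
  refine integral_congr_ae ?_
  filter_upwards [ae_unitMeasure] with r hr
  rw [h.integral_inner_cutKern x hδ hr hκ hκ'
    (fun q hq => h₂.hasDerivAt_funKernel x hδm hq) (funKernel_zero x) hb]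
  set qs := √(r ^ 2 - δ ^ 2) with hqs
  have hqsm : qs ∈ Icc (0 : ℝ) 1 := sqrt_mem_unit hr
  have e1 : inner ℝ (radKern (c x) qs r) (κ qs) =
      ∫ r', inner ℝ (radKern (c x) qs r) (cutKern (c₂ x) δ qs r') ∂unitMeasure := by
    rw [hKint qs hqsm]
    exact (integral_inner (h₂.integrable_cutKern x hδ hqsm) _).symm
  have e2 : ∫ q, inner ℝ (cutKernDeriv (p x) (c x) (d x) δ q r) (κ q) ∂unitMeasure =
      ∫ q, ∫ r', inner ℝ (cutKernDeriv (p x) (c x) (d x) δ q r) (cutKern (c₂ x) δ q r')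
        ∂unitMeasure ∂unitMeasure := by
    refine integral_congr_ae ?_
    filter_upwards [ae_unitMeasure] with q hq
    have hq' : q ∈ Icc (0 : ℝ) 1 := ⟨hq.1.le, hq.2.le⟩
    rw [hKint q hq']
    exact (integral_inner (h₂.integrable_cutKern x hδ hq') _).symm
  have hint2 : Integrable (fun y : ℝ × ℝ => inner ℝ (cutKernDeriv (p x) (c x) (d x) δ y.1 r)
      (cutKern (c₂ x) δ y.1 y.2)) (unitMeasure.prod unitMeasure) := by
    refine Integrable.of_bound (measurable_inner_complex
      ((h.measurable_cutKernDeriv x δ).comp (f := fun y : ℝ × ℝ => (y.1, r)) (by fun_prop))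
      (h₂.measurable_cutKern x δ)).aestronglyMeasurable (B * B₂) ?_
    filter_upwards [ae_unitMeasure_prod] with y hy
    exact norm_inner_le_mul (hB _ ⟨hy.1.1.le, hy.1.2.le⟩ _ hr).2.2
      (hB₂ _ ⟨hy.1.1.le, hy.1.2.le⟩ _ hy.2).2.1
  rw [e1, e2, integral_integral_swap hint2]
  simp only [pairIntegrand]
  rw [integral_sub hint2.integral_prod_right]
  · rw [neg_sub]
  · refine Integrable.const_inner _ (h₂.integrable_cutKern x hδ hqsm)

/-- Integration by parts for the pairing. -/
theorem integral_inner_funKernel_symm [FirstCountableTopology X] (h : IsAmplitude p a b c cr d dr)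
    (h₂ : IsAmplitude p a b c₂ cr₂ d₂ dr₂) (x : X) {δ : ℝ} (hδm : δ ∈ Icc (0 : ℝ) 1) :
    ∫ q, inner ℝ (funKernelDeriv (c x) (cr x) (angleDeriv p d x) δ q)
        (funKernel (c₂ x) δ q) ∂unitMeasure =
      -∫ q, inner ℝ (funKernel (c x) δ q)
        (funKernelDeriv (c₂ x) (cr₂ x) (angleDeriv p d₂ x) δ q) ∂unitMeasure := by
  have main : ∀ {c cr : X → ℝ → ℝ → ℂ} {d dr : X → ℝ → ℝ → ℝ} {c₂ cr₂ : X → ℝ → ℝ → ℂ}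
      {d₂ dr₂ : X → ℝ → ℝ → ℝ}, IsAmplitude p a b c cr d dr → IsAmplitude p a b c₂ cr₂ d₂ dr₂ →
      Integrable (fun q => inner ℝ (funKernelDeriv (c x) (cr x) (angleDeriv p d x) δ q)
        (funKernel (c₂ x) δ q)) unitMeasure := by
    intro c cr d dr c₂ cr₂ d₂ dr₂ h h₂
    obtain ⟨C, hC0, hC⟩ := h.exists_kern_bound (isCompact_singleton (x := x))
    obtain ⟨C₂, hC0₂, hC₂⟩ := h₂.exists_kern_bound (isCompact_singleton (x := x))
    refine Integrable.of_bound (AEStronglyMeasurable.inner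
      (((h.continuousOn_funKernelDeriv δ x).mono fun q hq => hq.1).aestronglyMeasurable
        measurableSet_Ioo)
      (((h₂.continuousOn_funKernel δ x).mono fun q hq => hq.1).aestronglyMeasurable
        measurableSet_Ioo)) (C * (C₂ * 1)) ?_
    filter_upwards [ae_unitMeasure] with q hq
    refine norm_inner_le_mul (norm_funKernelDeriv_le (fun q s hq hs => (hC x rfl q s hq hs).2)
      hδm hq.1.le) ((norm_funKernel_le (fun q s hq hs => (hC₂ x rfl q s hq hs).1) hδm
      hq.1.le).trans ?_)
    gcongr
    exact hq.2.le
  have hi1 := main h h₂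
  have hi2 := main h₂ h
  simp only [real_inner_comm (funKernel (c x) δ _)] at hi2
  -- There are no boundary terms: the kernels vanish at the caustic through their factor q, and at q
  -- = 1 because their support has b < 1.
  have hftc := intervalIntegral.integral_eq_sub_of_hasDerivAt_of_le (a := 0) (b := 1)
      (f := fun q => inner ℝ (funKernel (c x) δ q) (funKernel (c₂ x) δ q))
      (f' := fun q => inner ℝ (funKernel (c x) δ q)
          (funKernelDeriv (c₂ x) (cr₂ x) (angleDeriv p d₂ x) δ q) +
        inner ℝ (funKernelDeriv (c x) (cr x) (angleDeriv p d x) δ q) (funKernel (c₂ x) δ q))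
      zero_le_one
      (ContinuousOn.inner (𝕜 := ℝ) ((h.continuousOn_funKernel_Icc x hδm).mono fun q hq => hq.1)
        ((h₂.continuousOn_funKernel_Icc x hδm).mono fun q hq => hq.1))
      (fun q hq => (h.hasDerivAt_funKernel x hδm hq.1).inner ℝ (h₂.hasDerivAt_funKernel x hδm hq.1))
      (by
        rw [intervalIntegrable_iff_integrableOn_Ioo_of_le zero_le_one]
        exact hi2.add hi1)
  rw [intervalIntegral.integral_of_le zero_le_one, integral_Ioc_eq_integral_Ioo,
    h.funKernel_eq_zero x h.b_lt, funKernel_zero, inner_zero_left, inner_zero_left, sub_zero] at hftc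
  have := integral_add hi2 hi1
  change ∫ q in Ioo (0 : ℝ) 1, _ = _ at this
  rw [hftc] at this
  linarith

end IsAmplitude

/-! ### Evaluation of the double integral -/

/-- Pairs of points in increasing order. -/
def orderedPairs : Set (ℝ × ℝ) := {y | y.1 < y.2}

theorem measurableSet_orderedPairs : MeasurableSet orderedPairs :=
  measurableSet_lt measurable_fst measurable_snd

theorem ae_ne_unitMeasure_prod : ∀ᵐ y ∂unitMeasure.prod unitMeasure, y.1 ≠ y.2 := by
  have hm : MeasurableSet {y : ℝ × ℝ | y.1 = y.2} :=
    measurableSet_eq_fun measurable_fst measurable_snd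
  have h0 : unitMeasure.prod unitMeasure {y : ℝ × ℝ | y.1 = y.2} = 0 := by
    rw [Measure.measure_prod_null hm]
    refine ae_of_all _ fun x => ?_
    have : Prod.mk x ⁻¹' {y : ℝ × ℝ | y.1 = y.2} = {x} := by ext z; simp [eq_comm]
    change unitMeasure (Prod.mk x ⁻¹' {y : ℝ × ℝ | y.1 = y.2}) = 0
    rw [this, unitMeasure]
    simp
  rw [ae_iff]
  simpa using h0

/-- The square is folded along its diagonal, which is a null set. -/
theorem integral_eq_orderedPairs {F : ℝ × ℝ → ℝ} (hF : Integrable F (unitMeasure.prod unitMeasure)) :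
    ∫ y, F y ∂unitMeasure.prod unitMeasure =
      ∫ y in orderedPairs, (F y + F y.swap) ∂unitMeasure.prod unitMeasure := by
  have hswap := Measure.measurePreserving_swap (μ := unitMeasure) (ν := unitMeasure)
  have hFs : Integrable (fun y => F y.swap) (unitMeasure.prod unitMeasure) := hF.swap
  rw [integral_add hF.integrableOn hFs.integrableOn,
    ← integral_add_compl measurableSet_orderedPairs hF]
  congr 1
  have h1 := hswap.setIntegral_preimage_emb MeasurableEquiv.prodComm.measurableEmbedding
    (fun y => F y.swap) orderedPairs
  rw [← h1]
  simp only [Prod.swap_swap]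
  refine setIntegral_congr_set ?_
  filter_upwards [ae_ne_unitMeasure_prod] with y hy
  refine propext ?_
  change ¬ (y.1 < y.2) ↔ y.2 < y.1
  exact ⟨fun h => lt_of_le_of_ne (not_lt.1 h) hy.symm, fun h => not_lt.2 h.le⟩

/-- The scalar coefficients in the derivative of the Wronskian. -/
theorem wronskian_coeff {q r₁ r₂ s₁ s₂ : ℝ} (hr₁ : r₁ ≠ 0) (hr₂ : r₂ ≠ 0) (hs₁ : s₁ ≠ 0)
    (hs₂ : s₂ ≠ 0) (h₁ : s₁ ^ 2 = r₁ ^ 2 - q ^ 2) (h₂ : s₂ ^ 2 = r₂ ^ 2 - q ^ 2)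
    (hΔ : r₂ ^ 2 - r₁ ^ 2 ≠ 0) :
    (1 / (r₂ ^ 2 - r₁ ^ 2) * (r₁ * s₂ / (s₁ * r₂) + r₂ * s₁ / (r₁ * s₂))) * (2 * r₁ / s₁)
      - 2 / (r₂ ^ 2 - r₁ ^ 2) * (2 * r₂ / s₂) = (2 * q / s₁ ^ 2) * (q / (r₂ * s₂)) := by
  field_simp
  linear_combination r₁ ^ 2 * h₂ - r₂ ^ 2 * h₁

namespace IsAmplitude

variable {X : Type*} [TopologicalSpace X] {p : X → ℝ → ℂ} {a b : ℝ}
  {c cr : X → ℝ → ℝ → ℂ} {d dr : X → ℝ → ℝ → ℝ}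
  {c₂ cr₂ : X → ℝ → ℝ → ℂ} {d₂ dr₂ : X → ℝ → ℝ → ℝ}

/-- An antiderivative of the Wronskian of two kernels. -/
def wronskianPrimitive (c₁ : ℝ → ℝ → ℂ) (d₁ : ℝ → ℝ → ℝ) (c₂ : ℝ → ℝ → ℂ) (d₂ : ℝ → ℝ → ℝ)
    (r₁ r₂ q : ℝ) : ℝ :=
  1 / (r₂ ^ 2 - r₁ ^ 2) *
      (r₁ * √(r₂ ^ 2 - q ^ 2) / (√(r₁ ^ 2 - q ^ 2) * r₂)
        + r₂ * √(r₁ ^ 2 - q ^ 2) / (r₁ * √(r₂ ^ 2 - q ^ 2))) *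
      inner ℝ (c₁ r₁ (Real.arcsin (q / r₁))) (c₂ r₂ (Real.arcsin (q / r₂)))
    - 2 / (r₂ ^ 2 - r₁ ^ 2) *
      (d₁ r₁ (Real.arcsin (q / r₁)) * d₂ r₂ (Real.arcsin (q / r₂)))

/-- Differentiating the coefficient of ⟨c₁,c₂⟩ yields the c-c part of the Wronskian. The linear
system turns the derivatives of ⟨c₁,c₂⟩ and d₁d₂ into the same two mixed terms, d₁⟨ip,c₂⟩ and
d₂⟨c₁,ip⟩, whose coefficients match by `wronskian_coeff` used once in each order. The function p
enters only as a common factor, so no property of it is needed. -/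
theorem hasDerivAt_wronskianPrimitive (h : IsAmplitude p a b c cr d dr)
    (h₂ : IsAmplitude p a b c₂ cr₂ d₂ dr₂) (x : X) {q r₁ r₂ : ℝ} (hr₁ : 0 < r₁) (hr₂ : 0 < r₂)
    (hq₁ : |q| < r₁) (hq₂ : |q| < r₂) (hne : r₁ ≠ r₂) :
    HasDerivAt (wronskianPrimitive (c x) (d x) (c₂ x) (d₂ x) r₁ r₂)
      (inner ℝ (radKernDeriv (p x) (c x) (d x) q r₁) (radKern (c₂ x) q r₂) -
        inner ℝ (radKern (c x) q r₁) (radKernDeriv (p x) (c₂ x) (d₂ x) q r₂)) q := by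
  have hp₁ : 0 < r₁ ^ 2 - q ^ 2 := sub_pos.2 (sq_lt_sq' (neg_lt_of_abs_lt hq₁) (lt_of_abs_lt hq₁))
  have hp₂ : 0 < r₂ ^ 2 - q ^ 2 := sub_pos.2 (sq_lt_sq' (neg_lt_of_abs_lt hq₂) (lt_of_abs_lt hq₂))
  have hΔ : r₂ ^ 2 - r₁ ^ 2 ≠ 0 := fun hh => hne (by
    have : r₁ ^ 2 = r₂ ^ 2 := by linarith
    exact (pow_left_inj₀ hr₁.le hr₂.le two_ne_zero).1 this)
  have hs₁ := hasDerivAt_sqrt_sq_sub hq₁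
  have hs₂ := hasDerivAt_sqrt_sq_sub hq₂
  have hC₁ := h.hasDerivAt_c x hr₁ hq₁
  have hC₂ := h₂.hasDerivAt_c x hr₂ hq₂
  have hD₁ := h.hasDerivAt_d x hr₁ hq₁
  have hD₂ := h₂.hasDerivAt_d x hr₂ hq₂
  have hsp₁ := Real.sqrt_pos.2 hp₁
  have hsp₂ := Real.sqrt_pos.2 hp₂
  have hsq₁ := Real.sq_sqrt hp₁.le
  have hsq₂ := Real.sq_sqrt hp₂.le
  simp only [radKernDeriv, radKern]
  have hα := ((((hs₂.const_mul r₁).div (hs₁.mul_const r₂) (by positivity)).add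
    ((hs₁.const_mul r₂).div (hs₂.const_mul r₁) (by positivity))).const_mul
      (1 / (r₂ ^ 2 - r₁ ^ 2)))
  have hW := (hα.mul (hC₁.inner ℝ hC₂)).sub ((hD₁.mul hD₂).const_mul (2 / (r₂ ^ 2 - r₁ ^ 2)))
  refine hW.congr_deriv ?_
  simp only [Pi.add_apply, Pi.div_apply]
  rw [← hsq₁, ← hsq₂, Real.sqrt_sq hsp₁.le, Real.sqrt_sq hsp₂.le]
  set s₁ := √(r₁ ^ 2 - q ^ 2)
  set s₂ := √(r₂ ^ 2 - q ^ 2)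
  set C₁ := c x r₁ (Real.arcsin (q / r₁))
  set C₂ := c₂ x r₂ (Real.arcsin (q / r₂))
  set D₁ := d x r₁ (Real.arcsin (q / r₁))
  set D₂ := d₂ x r₂ (Real.arcsin (q / r₂))
  have e1 := wronskian_coeff hr₁.ne' hr₂.ne' hsp₁.ne' hsp₂.ne' hsq₁ hsq₂ hΔ
  have e2 := wronskian_coeff hr₂.ne' hr₁.ne' hsp₂.ne' hsp₁.ne' hsq₂ hsq₁
    (fun hh => hΔ (by linarith))
  -- The c-c part: the derivative of the coefficient in front of ⟨c₁,c₂⟩.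
  have e3 : 1 / (r₂ ^ 2 - r₁ ^ 2) *
      ((r₁ * -(q / s₂) * (s₁ * r₂) - r₁ * s₂ * (-(q / s₁) * r₂)) / (s₁ * r₂) ^ 2 +
        (r₂ * -(q / s₁) * (r₁ * s₂) - r₂ * s₁ * (r₁ * -(q / s₂))) / (r₁ * s₂) ^ 2) =
      r₁ / s₁ ^ 3 * (q / (r₂ * s₂)) - q / (r₁ * s₁) * (r₂ / s₂ ^ 3) := by
    have hΔ' : s₂ ^ 2 - s₁ ^ 2 = r₂ ^ 2 - r₁ ^ 2 := by linarith
    field_simp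
    linear_combination (q * (r₁ ^ 2 * s₂ ^ 2 - r₂ ^ 2 * s₁ ^ 2)) * hΔ'
  have e4 : (conj (p x q) * C₂).im = inner ℝ (Complex.I * p x q) C₂ := by
    rw [Complex.inner]; simp; ring
  have e5 : (conj (p x q) * C₁).im = inner ℝ C₁ (Complex.I * p x q) := by
    rw [real_inner_comm, Complex.inner]; simp; ring
  have e6 : 1 / (r₁ ^ 2 - r₂ ^ 2) = -(1 / (r₂ ^ 2 - r₁ ^ 2)) := by
    rw [← neg_sub, one_div, inv_neg, one_div]
  have e7 : 2 / (r₁ ^ 2 - r₂ ^ 2) = -(2 / (r₂ ^ 2 - r₁ ^ 2)) := by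
    rw [← neg_sub, div_neg]
  rw [e6, e7] at e2
  rw [e3, e4, e5]
  simp only [inner_add_left, inner_add_right, inner_smul_left, inner_smul_right,
    RCLike.conj_to_real]
  linear_combination (D₁ * inner ℝ (Complex.I * p x q) C₂) * e1
    - (D₂ * inner ℝ C₁ (Complex.I * p x q)) * e2

end IsAmplitude

/-! ### Boundary terms of the integrated Wronskian -/

namespace IsAmplitude

variable {X : Type*} [TopologicalSpace X] {p : X → ℝ → ℂ} {a b : ℝ}
  {c cr : X → ℝ → ℝ → ℂ} {d dr : X → ℝ → ℝ → ℝ}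
  {c₂ cr₂ : X → ℝ → ℝ → ℂ} {d₂ dr₂ : X → ℝ → ℝ → ℝ}

/-- The invariant pairing of two amplitudes at the caustic. -/
def causticPairing (c₁ : ℝ → ℝ → ℂ) (d₁ : ℝ → ℝ → ℝ) (c₂ : ℝ → ℝ → ℂ) (d₂ : ℝ → ℝ → ℝ)
    (r₁ r₂ : ℝ) : ℝ :=
  inner ℝ (c₁ r₁ 0) (c₂ r₂ 0) - d₁ r₁ 0 * d₂ r₂ 0

/-- The integrated Wronskian with its boundary terms. -/
def closedForm (c₁ : ℝ → ℝ → ℂ) (d₁ : ℝ → ℝ → ℝ) (c₂ : ℝ → ℝ → ℂ) (d₂ : ℝ → ℝ → ℝ)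
    (r₁ r₂ δ : ℝ) : ℝ :=
  2 / (r₂ ^ 2 - r₁ ^ 2) *
    (r₂ * δ / (r₁ * √(r₂ ^ 2 - r₁ ^ 2 + δ ^ 2)) *
        inner ℝ (c₁ r₁ (Real.arcsin (√(r₁ ^ 2 - δ ^ 2) / r₁)))
          (c₂ r₂ (Real.arcsin (√(r₁ ^ 2 - δ ^ 2) / r₂)))
      - d₁ r₁ (Real.arcsin (√(r₁ ^ 2 - δ ^ 2) / r₁)) *
          d₂ r₂ (Real.arcsin (√(r₁ ^ 2 - δ ^ 2) / r₂))
      - causticPairing c₁ d₁ c₂ d₂ r₁ r₂)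

theorem wronskianPrimitive_zero {c₁ : ℝ → ℝ → ℂ} {d₁ : ℝ → ℝ → ℝ} {c₂ : ℝ → ℝ → ℂ}
    {d₂ : ℝ → ℝ → ℝ} {r₁ r₂ : ℝ} (hr₁ : 0 < r₁) (hr₂ : 0 < r₂) :
    wronskianPrimitive c₁ d₁ c₂ d₂ r₁ r₂ 0 =
      2 / (r₂ ^ 2 - r₁ ^ 2) * causticPairing c₁ d₁ c₂ d₂ r₁ r₂ := by
  have e : ∀ r : ℝ, 0 < r → √(r ^ 2 - 0 ^ 2) = r := fun r hr => by
    rw [zero_pow two_ne_zero, sub_zero, Real.sqrt_sq hr.le]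
  rw [wronskianPrimitive, causticPairing, e r₁ hr₁, e r₂ hr₂]
  simp only [zero_div, Real.arcsin_zero]
  field_simp
  ring

/-- At the cutoff the primitive contains a term of order 1/δ. The boundary term left by the
integration by parts in q cancels it and leaves a term with a factor δ in the numerator. -/
theorem wronskianPrimitive_cut {c₁ : ℝ → ℝ → ℂ} {d₁ : ℝ → ℝ → ℝ} {c₂ : ℝ → ℝ → ℂ}
    {d₂ : ℝ → ℝ → ℝ} {r₁ r₂ δ : ℝ} (hδ : 0 < δ) (hδr : δ < r₁) (hr : r₁ < r₂) :
    wronskianPrimitive c₁ d₁ c₂ d₂ r₁ r₂ (√(r₁ ^ 2 - δ ^ 2)) -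
      wronskianPrimitive c₁ d₁ c₂ d₂ r₁ r₂ 0 -
      inner ℝ (radKern c₁ (√(r₁ ^ 2 - δ ^ 2)) r₁) (radKern c₂ (√(r₁ ^ 2 - δ ^ 2)) r₂) =
      closedForm c₁ d₁ c₂ d₂ r₁ r₂ δ := by
  have hr₁ : 0 < r₁ := hδ.trans hδr
  have hr₂ : 0 < r₂ := hr₁.trans hr
  have hΔ : 0 < r₂ ^ 2 - r₁ ^ 2 := by nlinarith
  rw [wronskianPrimitive_zero hr₁ hr₂, wronskianPrimitive, closedForm, radKern, radKern]
  set q := √(r₁ ^ 2 - δ ^ 2) with hq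
  have hq2 : q ^ 2 = r₁ ^ 2 - δ ^ 2 := Real.sq_sqrt (by nlinarith)
  have e1 : √(r₁ ^ 2 - q ^ 2) = δ := by rw [hq2, sub_sub_cancel, Real.sqrt_sq hδ.le]
  have e2 : r₂ ^ 2 - q ^ 2 = r₂ ^ 2 - r₁ ^ 2 + δ ^ 2 := by rw [hq2]; ring
  rw [e1, e2]
  set s := √(r₂ ^ 2 - r₁ ^ 2 + δ ^ 2) with hs
  have hspos : 0 < s := Real.sqrt_pos.2 (by positivity)
  have hs2 : s ^ 2 = r₂ ^ 2 - r₁ ^ 2 + δ ^ 2 := Real.sq_sqrt (by positivity)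
  rw [real_inner_smul_left, real_inner_smul_right]
  set A := inner ℝ (c₁ r₁ (Real.arcsin (q / r₁))) (c₂ r₂ (Real.arcsin (q / r₂)))
  have e3 : 1 / (r₂ ^ 2 - r₁ ^ 2) * (r₁ * s / (δ * r₂) + r₂ * δ / (r₁ * s)) -
      q / (r₁ * δ) * (q / (r₂ * s)) = 2 / (r₂ ^ 2 - r₁ ^ 2) * (r₂ * δ / (r₁ * s)) := by
    field_simp
    rw [hq2, hs2]
    ring
  linear_combination A * e3

/-- The symmetrized pair integrand in closed form. -/
theorem pairIntegrand_symm_eq (h : IsAmplitude p a b c cr d dr)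
    (h₂ : IsAmplitude p a b c₂ cr₂ d₂ dr₂) (x : X) {δ r₁ r₂ : ℝ} (hδ : 0 < δ) (hδa : δ < a)
    (hr₁ : r₁ ∈ Ioo (0 : ℝ) 1) (hr₂ : r₂ ∈ Ioo (0 : ℝ) 1) (hr : r₁ < r₂) :
    (pairIntegrand (p x) (c x) (d x) (c₂ x) δ (r₁, r₂) -
      pairIntegrand (p x) (c₂ x) (d₂ x) (c x) δ (r₁, r₂)) +
    (pairIntegrand (p x) (c x) (d x) (c₂ x) δ (r₂, r₁) -
      pairIntegrand (p x) (c₂ x) (d₂ x) (c x) δ (r₂, r₁)) =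
    closedForm (c x) (d x) (c₂ x) (d₂ x) r₁ r₂ δ - closedForm (c₂ x) (d₂ x) (c x) (d x) r₁ r₂ δ := by
  -- For r₁ < a all amplitudes at r₁ vanish; otherwise δ < a ≤ r₁ and the edge of the cutoff is a
  -- positive number.
  rcases lt_or_ge r₁ a with hra | hra
  · have hz : r₁ ∉ Icc a b := fun hm => absurd hm.1 (not_le.2 hra)
    simp [pairIntegrand, closedForm, causticPairing, cutKern, cutKernDeriv, radKern, radKernDeriv,
      h.c_zero x r₁ hz, h.d_zero x r₁ hz, h₂.c_zero x r₁ hz, h₂.d_zero x r₁ hz]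
  · have hδr : δ < r₁ := hδa.trans_le hra
    set qs := √(r₁ ^ 2 - δ ^ 2) with hqs
    have hpos : 0 < r₁ ^ 2 - δ ^ 2 := by nlinarith
    have hqs2 : qs ^ 2 = r₁ ^ 2 - δ ^ 2 := Real.sq_sqrt hpos.le
    have hqs0 : 0 < qs := Real.sqrt_pos.2 hpos
    have hqsr : qs < r₁ := by nlinarith [hr₁.1]
    have hsub : Ioo 0 qs ⊆ Ioo (0 : ℝ) 1 := Ioo_subset_Ioo_right (hqsr.trans hr₁.2).le
    have hcut : ∀ q ∈ Ioo (0 : ℝ) 1, (q ^ 2 + δ ^ 2 < r₁ ^ 2 ↔ q < qs) := fun q hq => by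
      rw [← lt_sub_iff_add_lt, ← hqs2]
      exact pow_lt_pow_iff_left₀ hq.1.le hqs0.le two_ne_zero
    have hrr : r₁ ^ 2 < r₂ ^ 2 := by nlinarith [hr₁.1]
    -- Of the two cutoffs the one of the smaller point r₁ is decisive, so both integrals stop at the
    -- same edge. The boundary term survives only in the order (r₁, r₂): in the other order it sits
    -- at the edge of r₂, where the kernel of r₁ has already been cut off.
    have key : ∀ {c cr : X → ℝ → ℝ → ℂ} {d dr : X → ℝ → ℝ → ℝ} {c₂ cr₂ : X → ℝ → ℝ → ℂ}
        {d₂ dr₂ : X → ℝ → ℝ → ℝ}, IsAmplitude p a b c cr d dr → IsAmplitude p a b c₂ cr₂ d₂ dr₂ →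
        (IntegrableOn (fun q => inner ℝ (radKernDeriv (p x) (c x) (d x) q r₁)
          (radKern (c₂ x) q r₂)) (Ioo 0 qs) ∧
        IntegrableOn (fun q => inner ℝ (radKernDeriv (p x) (c x) (d x) q r₂)
          (radKern (c₂ x) q r₁)) (Ioo 0 qs)) ∧
        pairIntegrand (p x) (c x) (d x) (c₂ x) δ (r₁, r₂) =
          (∫ q in Ioo 0 qs, inner ℝ (radKernDeriv (p x) (c x) (d x) q r₁) (radKern (c₂ x) q r₂))
            - inner ℝ (radKern (c x) qs r₁) (radKern (c₂ x) qs r₂) ∧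
        pairIntegrand (p x) (c x) (d x) (c₂ x) δ (r₂, r₁) =
          ∫ q in Ioo 0 qs, inner ℝ (radKernDeriv (p x) (c x) (d x) q r₂) (radKern (c₂ x) q r₁) := by
      intro c cr d dr c₂ cr₂ d₂ dr₂ h h₂
      obtain ⟨B, hB0, hB⟩ := h.exists_cut_bound x hδ
      obtain ⟨B₂, hB0₂, hB₂⟩ := h₂.exists_cut_bound x hδ
      have hint : ∀ r ∈ Ioo (0 : ℝ) 1, ∀ r' ∈ Ioo (0 : ℝ) 1,
          Integrable (fun q => inner ℝ (cutKernDeriv (p x) (c x) (d x) δ q r)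
            (cutKern (c₂ x) δ q r')) unitMeasure := by
        intro r hr r' hr'
        refine Integrable.of_bound (measurable_inner_complex
          ((h.measurable_cutKernDeriv x δ).comp (f := fun q : ℝ => (q, r)) (by fun_prop))
          ((h₂.measurable_cutKern x δ).comp (f := fun q : ℝ => (q, r'))
            (by fun_prop))).aestronglyMeasurable (B * B₂) ?_
        filter_upwards [ae_unitMeasure] with q hq
        exact norm_inner_le_mul (hB _ ⟨hq.1.le, hq.2.le⟩ _ hr).2.2 (hB₂ _ ⟨hq.1.le, hq.2.le⟩ _ hr').2.1
      have e1 : ∀ q ∈ Ioo 0 qs, inner ℝ (cutKernDeriv (p x) (c x) (d x) δ q r₁)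
          (cutKern (c₂ x) δ q r₂) =
          inner ℝ (radKernDeriv (p x) (c x) (d x) q r₁) (radKern (c₂ x) q r₂) := by
        intro q hq
        have hlt := (hcut q (hsub hq)).2 hq.2
        rw [cutKernDeriv, cutKern, if_pos hlt, if_pos (hlt.trans hrr)]
      have e2 : ∀ q ∈ Ioo 0 qs, inner ℝ (cutKernDeriv (p x) (c x) (d x) δ q r₂)
          (cutKern (c₂ x) δ q r₁) =
          inner ℝ (radKernDeriv (p x) (c x) (d x) q r₂) (radKern (c₂ x) q r₁) := by
        intro q hq
        have hlt := (hcut q (hsub hq)).2 hq.2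
        rw [cutKernDeriv, cutKern, if_pos hlt, if_pos (hlt.trans hrr)]
      refine ⟨⟨?_, ?_⟩, ?_, ?_⟩
      · exact ((IntegrableOn.mono_set (hint r₁ hr₁ r₂ hr₂) hsub).congr_fun e1 measurableSet_Ioo)
      · exact ((IntegrableOn.mono_set (hint r₂ hr₂ r₁ hr₁) hsub).congr_fun e2 measurableSet_Ioo)
      · rw [pairIntegrand]
        congr 1
        · rw [← setIntegral_congr_fun measurableSet_Ioo e1]
          refine setIntegral_eq_of_subset_of_forall_sdiff_eq_zero measurableSet_Ioo hsub
            fun q hq => ?_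
          rw [cutKernDeriv, if_neg, inner_zero_left]
          rw [hcut q hq.1]
          exact fun hlt => hq.2 ⟨hq.1.1, hlt⟩
        · simp only
          rw [← hqs, cutKern, if_pos]
          rw [hqs2]; linarith
      · rw [pairIntegrand, ← setIntegral_congr_fun measurableSet_Ioo e2]
        have e3 : cutKern (c₂ x) δ (√(r₂ ^ 2 - δ ^ 2)) r₁ = 0 := by
          rw [cutKern, if_neg]
          rw [Real.sq_sqrt (by linarith)]
          linarith
        simp only [e3, inner_zero_right, sub_zero]
        refine setIntegral_eq_of_subset_of_forall_sdiff_eq_zero measurableSet_Ioo hsub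
            fun q hq => ?_
        rw [cutKern, if_neg, inner_zero_right]
        rw [hcut q hq.1]
        exact fun hlt => hq.2 ⟨hq.1.1, hlt⟩
    -- The integral of the pair in one order minus that of the exchanged pair in the other order is
    -- a Wronskian, integrated from the caustic to the common edge.
    have ftc : ∀ {c cr : X → ℝ → ℝ → ℂ} {d dr : X → ℝ → ℝ → ℝ} {c₂ cr₂ : X → ℝ → ℝ → ℂ}
        {d₂ dr₂ : X → ℝ → ℝ → ℝ}, IsAmplitude p a b c cr d dr → IsAmplitude p a b c₂ cr₂ d₂ dr₂ →
        (∫ q in Ioo 0 qs, inner ℝ (radKernDeriv (p x) (c x) (d x) q r₁) (radKern (c₂ x) q r₂))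
          - (∫ q in Ioo 0 qs, inner ℝ (radKernDeriv (p x) (c₂ x) (d₂ x) q r₂) (radKern (c x) q r₁))
          - inner ℝ (radKern (c x) qs r₁) (radKern (c₂ x) qs r₂) =
        closedForm (c x) (d x) (c₂ x) (d₂ x) r₁ r₂ δ := by
      intro c cr d dr c₂ cr₂ d₂ dr₂ h h₂
      have i1 := (key h h₂).1.1
      have i2 := (key h₂ h).1.2
      rw [← wronskianPrimitive_cut hδ hδr hr, ← integral_sub i1 i2]
      congr 1
      have habs : ∀ q ∈ Icc 0 qs, |q| < r₁ := fun q hq => by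
        rw [abs_of_nonneg hq.1]; exact hq.2.trans_lt hqsr
      have hd : ∀ q ∈ Icc 0 qs, _ := fun q hq =>
        h.hasDerivAt_wronskianPrimitive h₂ x hr₁.1 hr₂.1 (habs q hq) ((habs q hq).trans hr) hr.ne
      have := intervalIntegral.integral_eq_sub_of_hasDerivAt_of_le (a := 0) (b := qs) hqs0.le
        (fun q hq => (hd q hq).continuousAt.continuousWithinAt)
        (fun q hq => hd q (Ioo_subset_Icc_self hq))
        (by
          rw [intervalIntegrable_iff_integrableOn_Ioo_of_le hqs0.le]
          refine (i1.sub i2).congr_fun (fun q _ => ?_) measurableSet_Ioo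
          simp only [Pi.sub_apply]
          rw [real_inner_comm (radKern (c x) q r₁)])
      rw [← this, intervalIntegral.integral_of_le hqs0.le, integral_Ioc_eq_integral_Ioo]
      refine setIntegral_congr_fun measurableSet_Ioo fun q _ => ?_
      rw [real_inner_comm (radKern (c x) q r₁)]
    rw [← ftc h h₂, ← ftc h₂ h, (key h h₂).2.1, (key h h₂).2.2, (key h₂ h).2.1, (key h₂ h).2.2]
    ring

/-- The pairing as an integral over ordered pairs. -/
theorem two_mul_pairing_cut [FirstCountableTopology X] (h : IsAmplitude p a b c cr d dr)
    (h₂ : IsAmplitude p a b c₂ cr₂ d₂ dr₂) (x : X) {δ : ℝ} (hδ : 0 < δ) (hδa : δ < a)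
    (hδ1 : δ ≤ 1) :
    2 * ∫ q, inner ℝ (funKernelDeriv (c x) (cr x) (angleDeriv p d x) δ q)
        (funKernel (c₂ x) δ q) ∂unitMeasure =
      ∫ y in orderedPairs, (closedForm (c x) (d x) (c₂ x) (d₂ x) y.1 y.2 δ -
        closedForm (c₂ x) (d₂ x) (c x) (d x) y.1 y.2 δ) ∂unitMeasure.prod unitMeasure := by
  have hδm : δ ∈ Icc (0 : ℝ) 1 := ⟨hδ.le, hδ1⟩
  have e1 := h.integral_inner_funKernel_symm h₂ x hδm
  have e2 := h.integral_inner_funKernelDeriv h₂ x hδ hδ1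
  have e3 := h₂.integral_inner_funKernelDeriv h x hδ hδ1
  simp only [real_inner_comm _ (funKernel (c₂ x) δ _)] at e3
  have i1 := h.integrable_pairIntegrand h₂ x hδ
  have i2 := h₂.integrable_pairIntegrand h x hδ
  have e4 := integral_eq_orderedPairs (i1.sub i2)
  rw [integral_sub' i1 i2] at e4
  -- Integration by parts in both roles of the two kernels represents twice the pairing by the
  -- difference of the two double integrals.
  have e5 : 2 * ∫ q, inner ℝ (funKernelDeriv (c x) (cr x) (angleDeriv p d x) δ q)
        (funKernel (c₂ x) δ q) ∂unitMeasure =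
      ∫ y, pairIntegrand (p x) (c x) (d x) (c₂ x) δ y ∂unitMeasure.prod unitMeasure -
      ∫ y, pairIntegrand (p x) (c₂ x) (d₂ x) (c x) δ y ∂unitMeasure.prod unitMeasure := by
    linarith
  rw [e5, e4]
  refine setIntegral_congr_ae measurableSet_orderedPairs ?_
  filter_upwards [ae_unitMeasure_prod] with y hy hlt
  exact h.pairIntegrand_symm_eq h₂ x hδ hδa hy.1 hy.2 hlt

end IsAmplitude

/-! ### Removal of the cutoff -/

/-- In sin y - sin x = 2 sin((y-x)/2) cos((y+x)/2) both factors are at least (y - x)/π: the first by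
Jordan's inequality, the second because y ≤ π/2 makes the cosine no smaller than the first factor.
-/
theorem sq_le_sin_sub_sin {x y : ℝ} (hx : 0 ≤ x) (hxy : x ≤ y) (hy : y ≤ Real.pi / 2) :
    2 * ((y - x) / Real.pi) ^ 2 ≤ Real.sin y - Real.sin x := by
  have hpi := Real.pi_pos
  rw [Real.sin_sub_sin]
  have h1 : 2 / Real.pi * ((y - x) / 2) ≤ Real.sin ((y - x) / 2) :=
    Real.mul_le_sin (by linarith) (by linarith)
  have h2 : Real.sin ((y - x) / 2) ≤ Real.cos ((y + x) / 2) := by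
    rw [← Real.sin_pi_div_two_sub]
    exact Real.sin_le_sin_of_le_of_le_pi_div_two (by linarith) (by linarith) (by linarith)
  have h3 : 0 ≤ (y - x) / Real.pi := div_nonneg (by linarith) hpi.le
  have h4 : (y - x) / Real.pi ≤ Real.sin ((y - x) / 2) := by
    refine le_trans (le_of_eq ?_) h1
    field_simp
  nlinarith

/-- The arcsine is Hölder continuous with exponent one half. -/
theorem arcsin_sub_arcsin_le {u v : ℝ} (hu : 0 ≤ u) (huv : u ≤ v) (hv : v ≤ 1) :
    Real.arcsin v - Real.arcsin u ≤ Real.pi * √(v - u) := by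
  have hpi := Real.pi_pos
  have h := sq_le_sin_sub_sin (Real.arcsin_nonneg.2 hu) (Real.monotone_arcsin huv)
    (Real.arcsin_le_pi_div_two v)
  rw [Real.sin_arcsin (by linarith) hv, Real.sin_arcsin (by linarith) (by linarith)] at h
  have h2 : (Real.arcsin v - Real.arcsin u) / Real.pi ≤ √(v - u) :=
    Real.le_sqrt_of_sq_le (by nlinarith [sq_nonneg ((Real.arcsin v - Real.arcsin u) / Real.pi)])
  rw [div_le_iff₀ hpi] at h2
  linarith

/-- Mean value inequality for a function with bounded partial derivatives on a rectangle. -/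
theorem norm_sub_le_of_partial {E : Type*} [NormedAddCommGroup E] [NormedSpace ℝ E]
    {f f₁ f₂ : ℝ → ℝ → E} {M : ℝ} {s t : Set ℝ} (hs : Convex ℝ s) (ht : Convex ℝ t)
    (h₁ : ∀ r y, HasDerivAt (fun x => f x y) (f₁ r y) r)
    (h₂ : ∀ r y, HasDerivAt (fun x => f r x) (f₂ r y) y)
    (hM : ∀ r ∈ s, ∀ y ∈ t, ‖f₁ r y‖ ≤ M ∧ ‖f₂ r y‖ ≤ M) {r r' y y' : ℝ}
    (hr : r ∈ s) (hr' : r' ∈ s) (hy : y ∈ t) (hy' : y' ∈ t) :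
    ‖f r' y' - f r y‖ ≤ M * (|r' - r| + |y' - y|) := by
  have e1 : ‖f r' y' - f r y'‖ ≤ M * |r' - r| :=
    hs.norm_image_sub_le_of_norm_hasDerivWithin_le (f := fun x => f x y')
      (fun x _ => (h₁ x y').hasDerivWithinAt) (fun x hx => (hM x hx y' hy').1) hr hr'
  have e2 : ‖f r y' - f r y‖ ≤ M * |y' - y| :=
    ht.norm_image_sub_le_of_norm_hasDerivWithin_le (f := fun x => f r x)
      (fun x _ => (h₂ r x).hasDerivWithinAt) (fun x hx => (hM r hr x hx).2) hy hy'
  calc ‖f r' y' - f r y‖ = ‖(f r' y' - f r y') + (f r y' - f r y)‖ := by abel_nf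
    _ ≤ _ := (norm_add_le _ _).trans (by linarith)

/-- An antisymmetrized product of two functions at two points. -/
theorem abs_inner_sub_inner_le {E : Type*} [NormedAddCommGroup E] [InnerProductSpace ℝ E]
    {u₁ u₂ v₁ v₂ : E} {M L : ℝ} (hu : ‖u₁‖ ≤ M) (hv : ‖v₁‖ ≤ M) (hu' : ‖u₂ - u₁‖ ≤ L)
    (hv' : ‖v₂ - v₁‖ ≤ L) : |inner ℝ u₁ v₂ - inner ℝ v₁ u₂| ≤ 2 * M * L := by
  have e : inner ℝ u₁ v₂ - inner ℝ v₁ u₂ = inner ℝ u₁ (v₂ - v₁) - inner ℝ v₁ (u₂ - u₁) := by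
    rw [inner_sub_right, inner_sub_right, real_inner_comm u₁ v₁]
    ring
  rw [e]
  have hM : 0 ≤ M := (norm_nonneg _).trans hu
  have h1 : |inner ℝ u₁ (v₂ - v₁)| ≤ M * L :=
    (abs_real_inner_le_norm _ _).trans (mul_le_mul hu hv' (norm_nonneg _) hM)
  have h2 : |inner ℝ v₁ (u₂ - u₁)| ≤ M * L :=
    (abs_real_inner_le_norm _ _).trans (mul_le_mul hv hu' (norm_nonneg _) hM)
  rw [abs_le] at *
  constructor <;> linarith

theorem integrableOn_inv_sqrt : IntegrableOn (fun w : ℝ => (√w)⁻¹) (Ioo 0 1) := by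
  have h : IntervalIntegrable (fun w : ℝ => w ^ (-(1 / 2) : ℝ)) volume 0 1 :=
    intervalIntegral.intervalIntegrable_rpow' (by norm_num)
  rw [intervalIntegrable_iff_integrableOn_Ioo_of_le zero_le_one] at h
  refine h.congr_fun (fun w hw => ?_) measurableSet_Ioo
  simp only
  rw [Real.sqrt_eq_rpow, Real.rpow_neg hw.1.le]

/-- The integrand of a convolution of two integrable functions is integrable. For y.2 ≤ y.1 the
square root, and with it the inverse, is 0 by convention, in agreement with the indicator. -/
theorem integrable_inv_sqrt_sub :
    Integrable (fun y : ℝ × ℝ => (√(y.2 - y.1))⁻¹) (unitMeasure.prod unitMeasure) := by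
  have h1 : Integrable ((Ioo (0 : ℝ) 1).indicator fun w : ℝ => (√w)⁻¹) :=
    integrableOn_inv_sqrt.integrable_indicator measurableSet_Ioo
  have h2 : Integrable ((Ioo (0 : ℝ) 1).indicator fun _ : ℝ => (1 : ℝ)) :=
    (integrable_indicator_iff measurableSet_Ioo).2 (integrableOn_const (by simp))
  have h3 := (Integrable.convolution_integrand (ContinuousLinearMap.mul ℝ ℝ) h2 h1).swap
  have h4 : ((volume : Measure ℝ).prod volume).restrict (Ioo 0 1 ×ˢ Ioo 0 1) =
      unitMeasure.prod unitMeasure := by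
    rw [unitMeasure, Measure.prod_restrict]
  rw [← h4]
  refine IntegrableOn.congr_fun (h3.integrableOn (s := Ioo 0 1 ×ˢ Ioo 0 1)) (fun y hy => ?_)
    (measurableSet_Ioo.prod measurableSet_Ioo)
  simp only [Function.comp, Prod.swap, ContinuousLinearMap.mul_apply', indicator_of_mem hy.1, one_mul]
  rcases lt_or_ge y.1 y.2 with hlt | hge
  · rw [indicator_of_mem]
    exact ⟨by linarith, by linarith [hy.1.1, hy.2.2]⟩
  · rw [Real.sqrt_eq_zero_of_nonpos (by linarith), inv_zero, indicator_of_notMem]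
    exact fun hm => absurd hm.1 (by linarith)

/-! ### The limit of vanishing cutoff -/

namespace IsAmplitude

variable {X : Type*} [TopologicalSpace X] {p : X → ℝ → ℂ} {a b : ℝ}
  {c cr : X → ℝ → ℝ → ℂ} {d dr : X → ℝ → ℝ → ℝ}
  {c₂ cr₂ : X → ℝ → ℝ → ℂ} {d₂ dr₂ : X → ℝ → ℝ → ℝ}

/-- As δ → 0 the edge tends to q = r₁, the angle π/2 for the first amplitude. There d₁ vanishes,
while the term with ⟨c₁,c₂⟩ carries an explicit factor δ; only the value at the caustic remains. -/
theorem tendsto_closedForm (h : IsAmplitude p a b c cr d dr)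
    (h₂ : IsAmplitude p a b c₂ cr₂ d₂ dr₂) (x : X) {r₁ r₂ : ℝ} (hr₁ : 0 < r₁) (hr : r₁ < r₂) :
    Tendsto (closedForm (c x) (d x) (c₂ x) (d₂ x) r₁ r₂) (𝓝[>] 0)
      (𝓝 (-(2 / (r₂ ^ 2 - r₁ ^ 2) * causticPairing (c x) (d x) (c₂ x) (d₂ x) r₁ r₂))) := by
  have hr₂ := hr₁.trans hr
  have hΔ : 0 < r₂ ^ 2 - r₁ ^ 2 := by nlinarith
  have hcont : Continuous (closedForm (c x) (d x) (c₂ x) (d₂ x) r₁ r₂) := by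
    have hc : ∀ {E : Type} [TopologicalSpace E] {f : X → ℝ → ℝ → E} (r : ℝ),
        (Continuous fun y : X × ℝ × ℝ => f y.1 y.2.1 y.2.2) →
        Continuous fun δ : ℝ => f x r (Real.arcsin (√(r₁ ^ 2 - δ ^ 2) / r)) := fun r hf => by
      have h1 : Continuous fun δ : ℝ => Real.arcsin (√(r₁ ^ 2 - δ ^ 2) / r) :=
        Real.continuous_arcsin.comp (by fun_prop)
      exact hf.comp (f := fun δ : ℝ => (x, r, Real.arcsin (√(r₁ ^ 2 - δ ^ 2) / r))) (by fun_prop)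
    have h1 : Continuous fun δ : ℝ => r₂ * δ / (r₁ * √(r₂ ^ 2 - r₁ ^ 2 + δ ^ 2)) := by
      refine Continuous.div (by fun_prop) (by fun_prop) fun δ => ?_
      have : 0 < √(r₂ ^ 2 - r₁ ^ 2 + δ ^ 2) := Real.sqrt_pos.2 (by positivity)
      positivity
    exact continuous_const.mul (((h1.mul ((hc r₁ h.cont_c).inner (hc r₂ h₂.cont_c))).sub
      ((hc r₁ h.cont_d).mul (hc r₂ h₂.cont_d))).sub continuous_const)
  have h0 := (hcont.tendsto 0).mono_left (nhdsWithin_le_nhds (s := Ioi 0))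
  convert h0 using 2
  rw [closedForm, zero_pow two_ne_zero, sub_zero, Real.sqrt_sq hr₁.le, div_self hr₁.ne',
    Real.arcsin_one, h.d_end]
  ring

/-- The prefactor is of order 1/(r₂ - r₁), but an antisymmetrized product of two functions at
neighbouring points is bounded by their increments. The increments are of order (r₂ - r₁)^(1/2), the
exponent being that of the arcsine at its endpoint. Uniformity in δ permits dominated convergence,
uniformity over a compact set of generators permits the integration over θ. -/
theorem abs_closedForm_sub_le (h : IsAmplitude p a b c cr d dr)
    (h₂ : IsAmplitude p a b c₂ cr₂ d₂ dr₂) {K : Set X} (hK : IsCompact K) :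
    ∃ C, 0 ≤ C ∧ ∀ x ∈ K, ∀ δ ∈ Ioo 0 a, ∀ r₁ ∈ Ioo (0 : ℝ) 1, ∀ r₂ ∈ Ioo (0 : ℝ) 1, r₁ < r₂ →
      |closedForm (c x) (d x) (c₂ x) (d₂ x) r₁ r₂ δ - closedForm (c₂ x) (d₂ x) (c x) (d x) r₁ r₂ δ|
        ≤ C * (√(r₂ - r₁))⁻¹ := by
  obtain ⟨M₁, hM₁0, hM₁⟩ := h.exists_bound hK
  obtain ⟨M₂, hM₂0, hM₂⟩ := h₂.exists_bound hK
  have ha := h.a_pos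
  have hpi := Real.pi_pos
  set M := M₁ + M₂ with hM
  set L := M * (1 + Real.pi * √(1 / a)) with hL
  have hM0 : 0 ≤ M := by positivity
  have hL0 : 0 ≤ L := by positivity
  refine ⟨1 / a * ((1 / a + 3) * (2 * M * L)), by positivity, ?_⟩
  intro x hx δ hδ r₁ hr₁ r₂ hr₂ hr
  have hw : 0 < r₂ - r₁ := sub_pos.2 hr
  have hsw : 0 < √(r₂ - r₁) := Real.sqrt_pos.2 hw
  rcases lt_or_ge r₁ a with hra | hra
  · have hz : r₁ ∉ Icc a b := fun hm => absurd hm.1 (not_le.2 hra)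
    simp only [closedForm, causticPairing, h.c_zero x r₁ hz, h.d_zero x r₁ hz, h₂.c_zero x r₁ hz,
      h₂.d_zero x r₁ hz, inner_zero_left, zero_mul, mul_zero, sub_zero, abs_zero]
    positivity
  have hws : r₂ - r₁ ≤ √(r₂ - r₁) := by
    refine Real.le_sqrt_of_sq_le ?_
    nlinarith [hr₁.1, hr₂.2]
  -- the distance of the two points
  have hIcc : ∀ {r : ℝ}, r ∈ Ioo (0 : ℝ) 1 → r ∈ Icc (0 : ℝ) 1 := fun hr => Ioo_subset_Icc_self hr
  have lip : ∀ {t₁ t₂ : ℝ}, t₁ ∈ Icc 0 (Real.pi / 2) → t₂ ∈ Icc 0 (Real.pi / 2) →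
      |t₂ - t₁| ≤ Real.pi * √(1 / a) * √(r₂ - r₁) →
      |inner ℝ (c x r₁ t₁) (c₂ x r₂ t₂) - inner ℝ (c₂ x r₁ t₁) (c x r₂ t₂)|
        ≤ 2 * M * (L * √(r₂ - r₁)) ∧
      |d x r₁ t₁ * d₂ x r₂ t₂ - d₂ x r₁ t₁ * d x r₂ t₂| ≤ 2 * M * (L * √(r₂ - r₁)) := by
    intro t₁ t₂ ht₁ ht₂ ht
    have hdist : |r₂ - r₁| + |t₂ - t₁| ≤ (1 + Real.pi * √(1 / a)) * √(r₂ - r₁) := by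
      rw [abs_of_pos hw]; linarith
    have up : ∀ {z : ℝ}, z ≤ M₁ * (|r₂ - r₁| + |t₂ - t₁|) → z ≤ L * √(r₂ - r₁) := fun hz => by
      refine hz.trans ?_
      calc _ ≤ M * ((1 + Real.pi * √(1 / a)) * √(r₂ - r₁)) := by
            gcongr; rw [hM]; linarith
        _ = _ := by rw [hL]; ring
    have up₂ : ∀ {z : ℝ}, z ≤ M₂ * (|r₂ - r₁| + |t₂ - t₁|) → z ≤ L * √(r₂ - r₁) := fun hz => by
      refine hz.trans ?_
      calc _ ≤ M * ((1 + Real.pi * √(1 / a)) * √(r₂ - r₁)) := by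
            gcongr; rw [hM]; linarith
        _ = _ := by rw [hL]; ring
    have b₁ := (hM₁ x hx).2
    have b₂ := (hM₂ x hx).2
    have l₁ := up (norm_sub_le_of_partial (convex_Icc 0 1) (convex_Icc 0 (Real.pi / 2))
      (h.deriv_c x) (h.ode_c x) (fun r hr t ht => ⟨(b₁ r hr t ht).2.1, (b₁ r hr t ht).2.2.1⟩)
      (hIcc hr₁) (hIcc hr₂) ht₁ ht₂)
    have l₂ := up₂ (norm_sub_le_of_partial (convex_Icc 0 1) (convex_Icc 0 (Real.pi / 2))
      (h₂.deriv_c x) (h₂.ode_c x) (fun r hr t ht => ⟨(b₂ r hr t ht).2.1, (b₂ r hr t ht).2.2.1⟩)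
      (hIcc hr₁) (hIcc hr₂) ht₁ ht₂)
    have l₃ := up (norm_sub_le_of_partial (convex_Icc 0 1) (convex_Icc 0 (Real.pi / 2))
      (h.deriv_d x) (h.ode_d x) (fun r hr t ht => ⟨(b₁ r hr t ht).2.2.2.2.1,
        (b₁ r hr t ht).2.2.2.2.2⟩) (hIcc hr₁) (hIcc hr₂) ht₁ ht₂)
    have l₄ := up₂ (norm_sub_le_of_partial (convex_Icc 0 1) (convex_Icc 0 (Real.pi / 2))
      (h₂.deriv_d x) (h₂.ode_d x) (fun r hr t ht => ⟨(b₂ r hr t ht).2.2.2.2.1,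
        (b₂ r hr t ht).2.2.2.2.2⟩) (hIcc hr₁) (hIcc hr₂) ht₁ ht₂)
    have m₁ := b₁ r₁ (hIcc hr₁) t₁ ht₁
    have m₂ := b₂ r₁ (hIcc hr₁) t₁ ht₁
    have g₁ : M₁ ≤ M := by rw [hM]; linarith
    have g₂ : M₂ ≤ M := by rw [hM]; linarith
    refine ⟨abs_inner_sub_inner_le (m₁.1.trans g₁) (m₂.1.trans g₂) l₁ l₂, ?_⟩
    have := abs_inner_sub_inner_le (E := ℝ) (m₁.2.2.2.1.trans g₁) (m₂.2.2.2.1.trans g₂) l₃ l₄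
    simpa [mul_comm] using this
  set q := √(r₁ ^ 2 - δ ^ 2) with hq
  have hq0 : 0 ≤ q := Real.sqrt_nonneg _
  have hqr : q ≤ r₁ := Real.sqrt_le_iff.2 ⟨hr₁.1.le, by nlinarith [sq_nonneg δ]⟩
  -- The arguments q/r₁ and q/r₂ differ by at most (r₂ - r₁)/a. Since q/r₁ may be arbitrarily close
  -- to 1, only the Hölder estimate of the arcsine is available.
  have hang : |Real.arcsin (q / r₂) - Real.arcsin (q / r₁)| ≤
      Real.pi * √(1 / a) * √(r₂ - r₁) := by
    have h1 : q / r₂ ≤ q / r₁ := div_le_div_of_nonneg_left hq0 hr₁.1 hr.le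
    rw [abs_sub_comm, abs_of_nonneg (sub_nonneg.2 (Real.monotone_arcsin h1))]
    refine (arcsin_sub_arcsin_le (div_nonneg hq0 hr₂.1.le) h1
      ((div_le_one hr₁.1).2 hqr)).trans ?_
    rw [mul_assoc, ← Real.sqrt_mul (by positivity)]
    gcongr
    have h2 : q / r₁ - q / r₂ = q / r₁ * (1 / r₂) * (r₂ - r₁) := by
      have := hr₁.1.ne'; have := hr₂.1.ne'
      field_simp
    rw [h2]
    have h3 : q / r₁ ≤ 1 := (div_le_one hr₁.1).2 hqr
    have h4 : 1 / r₂ ≤ 1 / a := one_div_le_one_div_of_le ha (hra.trans hr.le)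
    have h5 : 0 ≤ 1 / r₂ := by have := hr₂.1; positivity
    gcongr
    calc q / r₁ * (1 / r₂) ≤ 1 * (1 / a) := by gcongr
      _ = 1 / a := one_mul _
  have hmem : ∀ r : ℝ, 0 < r → Real.arcsin (q / r) ∈ Icc 0 (Real.pi / 2) := fun r hr =>
    ⟨Real.arcsin_nonneg.2 (by positivity), Real.arcsin_le_pi_div_two _⟩
  obtain ⟨e1, e2⟩ := lip (hmem r₁ hr₁.1) (hmem r₂ hr₂.1) hang
  obtain ⟨e3, e4⟩ := lip (t₁ := 0) (t₂ := 0) ⟨le_rfl, by positivity⟩ ⟨le_rfl, by positivity⟩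
    (by simp; positivity)
  set ε := r₂ * δ / (r₁ * √(r₂ ^ 2 - r₁ ^ 2 + δ ^ 2)) with hε
  have hΔ : 2 * a * (r₂ - r₁) ≤ r₂ ^ 2 - r₁ ^ 2 := by nlinarith
  have hΔ0 : 0 < r₂ ^ 2 - r₁ ^ 2 := lt_of_lt_of_le (by positivity) hΔ
  have hε0 : 0 ≤ ε := by
    have := hr₁.1; have := hr₂.1; have := hδ.1
    positivity
  -- The factor δ/√(r₂² - r₁² + δ²) is at most 1, uniformly in δ, and r₂/r₁ ≤ 1/a.
  have hε1 : ε ≤ 1 / a := by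
    have hsq : δ ≤ √(r₂ ^ 2 - r₁ ^ 2 + δ ^ 2) := Real.le_sqrt_of_sq_le (by linarith)
    have := hδ.1
    rw [hε, div_le_div_iff₀ (mul_pos hr₁.1 (hδ.1.trans_le hsq)) ha]
    have h1 : r₂ * δ ≤ 1 * √(r₂ ^ 2 - r₁ ^ 2 + δ ^ 2) :=
      mul_le_mul hr₂.2.le hsq hδ.1.le zero_le_one
    nlinarith
  have hexp : closedForm (c x) (d x) (c₂ x) (d₂ x) r₁ r₂ δ -
      closedForm (c₂ x) (d₂ x) (c x) (d x) r₁ r₂ δ =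
      2 / (r₂ ^ 2 - r₁ ^ 2) * (ε * (inner ℝ (c x r₁ (Real.arcsin (q / r₁)))
          (c₂ x r₂ (Real.arcsin (q / r₂))) - inner ℝ (c₂ x r₁ (Real.arcsin (q / r₁)))
          (c x r₂ (Real.arcsin (q / r₂)))) -
        (d x r₁ (Real.arcsin (q / r₁)) * d₂ x r₂ (Real.arcsin (q / r₂)) -
          d₂ x r₁ (Real.arcsin (q / r₁)) * d x r₂ (Real.arcsin (q / r₂))) -
        ((inner ℝ (c x r₁ 0) (c₂ x r₂ 0) - inner ℝ (c₂ x r₁ 0) (c x r₂ 0)) -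
          (d x r₁ 0 * d₂ x r₂ 0 - d₂ x r₁ 0 * d x r₂ 0))) := by
    simp only [closedForm, causticPairing]
    ring
  rw [hexp, abs_mul, abs_of_pos (by positivity)]
  set B := 2 * M * (L * √(r₂ - r₁)) with hB
  have hsum : ∀ {u v w z : ℝ}, |u| ≤ B → |v| ≤ B → |w| ≤ B → |z| ≤ B →
      |ε * u - v - (w - z)| ≤ (1 / a + 3) * B := by
    intro u v w z hu hv hw hz
    have h1 : |ε * u| ≤ 1 / a * B := by
      rw [abs_mul, abs_of_nonneg hε0]
      exact mul_le_mul hε1 hu (abs_nonneg _) (by positivity)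
    rw [abs_le] at *
    constructor <;> linarith
  calc _ ≤ 2 / (2 * a * (r₂ - r₁)) * ((1 / a + 3) * B) := by
        gcongr
        exact hsum e1 e2 e3 e4
    _ = _ := by
        have hs2 : r₂ - r₁ = √(r₂ - r₁) * √(r₂ - r₁) := (Real.mul_self_sqrt hw.le).symm
        rw [hB]
        rw [show 2 / (2 * a * (r₂ - r₁)) = 1 / a * (1 / (√(r₂ - r₁) * √(r₂ - r₁))) by
          rw [← hs2]; field_simp]
        field_simp

theorem measurable_closedForm (h : IsAmplitude p a b c cr d dr)
    (h₂ : IsAmplitude p a b c₂ cr₂ d₂ dr₂) (x : X) (δ : ℝ) :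
    Measurable fun y : ℝ × ℝ => closedForm (c x) (d x) (c₂ x) (d₂ x) y.1 y.2 δ := by
  have hm : ∀ {f : ℝ × ℝ → ℝ}, Measurable f → Measurable fun y : ℝ × ℝ =>
      Real.arcsin (√(y.1 ^ 2 - δ ^ 2) / f y) := fun hf =>
    Real.continuous_arcsin.measurable.comp (Measurable.div (by fun_prop) hf)
  have h1 := (h.measurable_c x).comp (measurable_fst.prodMk (hm measurable_fst))
  have h2 := (h₂.measurable_c x).comp (measurable_snd.prodMk (hm measurable_snd))
  have h3 := (h.measurable_d x).comp (measurable_fst.prodMk (hm measurable_fst))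
  have h4 := (h₂.measurable_d x).comp (measurable_snd.prodMk (hm measurable_snd))
  have h5 := (h.measurable_c x).comp (g := fun y : ℝ × ℝ => c x y.1 y.2)
    (f := fun y : ℝ × ℝ => (y.1, (0 : ℝ))) (by fun_prop)
  have h6 := (h₂.measurable_c x).comp (g := fun y : ℝ × ℝ => c₂ x y.1 y.2)
    (f := fun y : ℝ × ℝ => (y.2, (0 : ℝ))) (by fun_prop)
  have h7 := (h.measurable_d x).comp (g := fun y : ℝ × ℝ => d x y.1 y.2)
    (f := fun y : ℝ × ℝ => (y.1, (0 : ℝ))) (by fun_prop)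
  have h8 := (h₂.measurable_d x).comp (g := fun y : ℝ × ℝ => d₂ x y.1 y.2)
    (f := fun y : ℝ × ℝ => (y.2, (0 : ℝ))) (by fun_prop)
  exact Measurable.mul (f := fun y : ℝ × ℝ => 2 / (y.2 ^ 2 - y.1 ^ 2)) (by fun_prop)
    (((Measurable.mul (f := fun y : ℝ × ℝ => y.2 * δ / (y.1 * √(y.2 ^ 2 - y.1 ^ 2 + δ ^ 2)))
      (by fun_prop) (h1.inner h2)).sub (h3.mul h4)).sub ((h5.inner h6).sub (h7.mul h8)))

theorem tendsto_intervalIntegral_left {f : ℝ → ℂ} (hf : Continuous f) :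
    Tendsto (fun δ => ∫ s in δ..1, f s) (𝓝[>] 0) (𝓝 (∫ s in (0 : ℝ)..1, f s)) := by
  have h := intervalIntegral.continuous_primitive (μ := volume)
    (fun a b => hf.intervalIntegrable a b) 1
  have h2 := (h.neg.tendsto 0).mono_left (nhdsWithin_le_nhds (s := Ioi 0))
  rw [intervalIntegral.integral_symm]
  exact h2.congr fun δ => (intervalIntegral.integral_symm 1 δ).symm

/-- The pairing of the functional kernels as an integral over pairs of deformation points. -/
theorem two_mul_pairing [FirstCountableTopology X] (h : IsAmplitude p a b c cr d dr)
    (h₂ : IsAmplitude p a b c₂ cr₂ d₂ dr₂) (x : X) :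
    2 * ∫ q, inner ℝ (funKernelDeriv (c x) (cr x) (angleDeriv p d x) 0 q)
        (funKernel (c₂ x) 0 q) ∂unitMeasure =
      ∫ y in orderedPairs, -(2 / (y.2 ^ 2 - y.1 ^ 2)) *
        (causticPairing (c x) (d x) (c₂ x) (d₂ x) y.1 y.2 -
          causticPairing (c₂ x) (d₂ x) (c x) (d x) y.1 y.2) ∂unitMeasure.prod unitMeasure := by
  have ha := h.a_pos
  have hev : ∀ᶠ δ in 𝓝[>] (0 : ℝ), δ ∈ Ioo 0 (min a 1) :=
    Ioo_mem_nhdsGT (lt_min ha one_pos)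
  obtain ⟨C₁, hC₁0, hC₁⟩ := h.exists_kern_bound (isCompact_singleton (x := x))
  obtain ⟨C₂, hC₂0, hC₂⟩ := h₂.exists_kern_bound (isCompact_singleton (x := x))
  have hl : Tendsto (fun δ => ∫ q, inner ℝ (funKernelDeriv (c x) (cr x) (angleDeriv p d x) δ q)
        (funKernel (c₂ x) δ q) ∂unitMeasure) (𝓝[>] 0)
      (𝓝 (∫ q, inner ℝ (funKernelDeriv (c x) (cr x) (angleDeriv p d x) 0 q)
        (funKernel (c₂ x) 0 q) ∂unitMeasure)) := by
    refine tendsto_integral_filter_of_dominated_convergence (fun _ => C₁ * C₂) ?_ ?_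
      (integrable_const _) ?_
    · filter_upwards with δ
      have h1 : AEStronglyMeasurable (funKernelDeriv (c x) (cr x) (angleDeriv p d x) δ) unitMeasure :=
        ((h.continuousOn_funKernelDeriv δ x).mono fun q hq => hq.1).aestronglyMeasurable
          measurableSet_Ioo
      have h2 : AEStronglyMeasurable (funKernel (c₂ x) δ) unitMeasure :=
        ((h₂.continuousOn_funKernel δ x).mono fun q hq => hq.1).aestronglyMeasurable
          measurableSet_Ioo
      exact h1.inner h2
    · filter_upwards [hev] with δ hδ
      filter_upwards [ae_unitMeasure] with q hq
      have hδ1 : δ ∈ Icc (0 : ℝ) 1 := ⟨hδ.1.le, (hδ.2.trans_le (min_le_right _ _)).le⟩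
      refine norm_inner_le_mul (norm_funKernelDeriv_le (fun q s hq hs => (hC₁ x rfl q s hq hs).2)
        hδ1 hq.1.le) ((norm_funKernel_le (fun q s hq hs => (hC₂ x rfl q s hq hs).1)
        hδ1 hq.1.le).trans ?_)
      exact mul_le_of_le_one_right hC₂0 hq.2.le
    · filter_upwards [ae_unitMeasure] with q hq
      exact (tendsto_intervalIntegral_left (h.continuous_kernDeriv_right x hq.1)).inner
        (tendsto_intervalIntegral_left (h₂.continuous_kern_right x hq.1))
  obtain ⟨C, hC0, hC⟩ := h.abs_closedForm_sub_le h₂ (isCompact_singleton (x := x))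
  have hrt : Tendsto (fun δ => ∫ y in orderedPairs, (closedForm (c x) (d x) (c₂ x) (d₂ x) y.1 y.2 δ -
        closedForm (c₂ x) (d₂ x) (c x) (d x) y.1 y.2 δ) ∂unitMeasure.prod unitMeasure) (𝓝[>] 0)
      (𝓝 (∫ y in orderedPairs, -(2 / (y.2 ^ 2 - y.1 ^ 2)) *
        (causticPairing (c x) (d x) (c₂ x) (d₂ x) y.1 y.2 -
          causticPairing (c₂ x) (d₂ x) (c x) (d x) y.1 y.2) ∂unitMeasure.prod unitMeasure)) := by
    refine tendsto_integral_filter_of_dominated_convergence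
      (fun y : ℝ × ℝ => C * (√(y.2 - y.1))⁻¹) ?_ ?_
      ((integrable_inv_sqrt_sub.const_mul C).integrableOn) ?_
    · filter_upwards with δ
      exact ((h.measurable_closedForm h₂ x δ).sub
        (h₂.measurable_closedForm h x δ)).aestronglyMeasurable
    · filter_upwards [hev] with δ hδ
      filter_upwards [ae_restrict_mem measurableSet_orderedPairs,
        ae_restrict_of_ae ae_unitMeasure_prod] with y hy hy1
      exact hC x rfl δ ⟨hδ.1, hδ.2.trans_le (min_le_left _ _)⟩ _ hy1.1 _ hy1.2 hy
    · filter_upwards [ae_restrict_mem measurableSet_orderedPairs,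
        ae_restrict_of_ae ae_unitMeasure_prod] with y hy hy1
      have := (h.tendsto_closedForm h₂ x hy1.1.1 hy).sub (h₂.tendsto_closedForm h x hy1.1.1 hy)
      refine this.congr' (Eventually.of_forall fun _ => rfl) |>.trans (le_of_eq ?_)
      congr 1
      ring
  -- The identity with cutoff equates two functions of δ that converge separately: the left one by
  -- boundedness of the kernels, the right one by domination with (r₂ - r₁)^(-1/2).
  refine tendsto_nhds_unique (hl.const_mul 2) (hrt.congr' ?_)
  filter_upwards [hev] with δ hδ
  exact (h.two_mul_pairing_cut h₂ x hδ.1 (hδ.2.trans_le (min_le_left _ _))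
    (hδ.2.trans_le (min_le_right _ _)).le).symm

end IsAmplitude

/-! ### The connection of the rotated symmetric zweibein -/

/-- Symmetric traceless matrices. -/
def symMat (z : ℂ) : Mat2 := !![z.re, z.im; z.im, -z.re]

/-- The generator of rotations. -/
def epsMat : Mat2 := !![0, 1; -1, 0]

/-- Rotations. -/
def rotMat (χ : ℝ) : Mat2 := !![Real.cos χ, Real.sin χ; -Real.sin χ, Real.cos χ]

/-- The symmetric zweibein rotated by the angle `χ`. -/
def gaugeZweibein (m : ℂ) (χ : ℝ) : Mat2 := symZweibein m * rotMat χ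

/-- The symmetric part of the connection of `gaugeZweibein`, as a complex number. -/
def gaugeP (m m' : ℂ) (χ : ℝ) : ℂ :=
  Complex.exp (2 * χ * Complex.I) * m' / ((1 - ‖m‖ ^ 2 : ℝ) : ℂ)

/-- The rotation rate of the symmetric zweibein. -/
def gaugeQ (m m' : ℂ) : ℝ := (conj m * m').im / (1 - ‖m‖ ^ 2)

theorem symMat_transpose (z : ℂ) : (symMat z).transpose = symMat z := by
  ext i j; fin_cases i <;> fin_cases j <;> rfl

theorem symMat_trace (z : ℂ) : (symMat z).trace = 0 := by
  simp [symMat, Matrix.trace_fin_two]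

theorem epsMat_transpose : epsMat.transpose = -epsMat := by
  ext i j; fin_cases i <;> fin_cases j <;> simp [epsMat]

theorem epsMat_trace : epsMat.trace = 0 := by
  simp [epsMat, Matrix.trace_fin_two]

theorem symMat_smul (r : ℝ) (z : ℂ) : symMat (r * z) = r • symMat z := by
  ext i j; fin_cases i <;> fin_cases j <;> simp [symMat]

theorem symMat_eq_sum (z : ℂ) : symMat z = z.re • symMat 1 + z.im • symMat Complex.I := by
  ext i j; fin_cases i <;> fin_cases j <;> simp [symMat]

theorem commutator_symMat (z w : ℂ) :
    symMat z * symMat w - symMat w * symMat z = (2 * (conj z * w).im) • epsMat := by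
  ext i j; fin_cases i <;> fin_cases j <;>
    simp [symMat, epsMat] <;> ring

theorem commutator_symMat_eps (z : ℂ) :
    symMat z * epsMat - epsMat * symMat z = (2 : ℝ) • symMat (Complex.I * z) := by
  ext i j; fin_cases i <;> fin_cases j <;>
    simp [symMat, epsMat] <;> ring

theorem continuous_symMat : Continuous symMat := by
  unfold symMat
  fun_prop

theorem continuous_rotMat : Continuous rotMat := by
  unfold rotMat
  fun_prop

theorem det_rotMat (χ : ℝ) : (rotMat χ).det = 1 := by
  rw [rotMat, Matrix.det_fin_two_of]
  nlinarith [Real.sin_sq_add_cos_sq χ]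

theorem rotMat_mul_transpose (χ : ℝ) : rotMat χ * (rotMat χ).transpose = 1 := by
  have := Real.sin_sq_add_cos_sq χ
  ext i j; fin_cases i <;> fin_cases j <;>
    simp [rotMat, Matrix.mul_apply, Fin.sum_univ_two] <;> nlinarith

theorem isZweibein_gaugeZweibein {m : ℂ} (hm : ‖m‖ < 1) (χ : ℝ) :
    IsZweibein (gaugeZweibein m χ) (conformalMetric m) := by
  obtain ⟨h1, h2⟩ := isZweibein_symZweibein m hm
  constructor
  · rw [gaugeZweibein, Matrix.transpose_mul, Matrix.mul_assoc, ← Matrix.mul_assoc (rotMat χ),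
      rotMat_mul_transpose, Matrix.one_mul, h1]
  · rw [gaugeZweibein, Matrix.det_mul, h2, det_rotMat, mul_one]

theorem gaugeZweibein_zero (m : ℂ) : gaugeZweibein m 0 = symZweibein m := by
  have : rotMat 0 = 1 := by
    ext i j; fin_cases i <;> fin_cases j <;> simp [rotMat]
  rw [gaugeZweibein, this, mul_one]

theorem one_sub_norm_sq_pos {m : ℂ} (hm : ‖m‖ < 1) : 0 < 1 - ‖m‖ ^ 2 := by
  nlinarith [norm_nonneg m]

/-- Symmetric traceless matrices have spin two under rotations, hence the doubled angle. -/
theorem symMat_mul_rotMat (p : ℂ) (χ : ℝ) :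
    symMat p * rotMat χ = rotMat χ * symMat (Complex.exp (2 * χ * Complex.I) * p) := by
  have e : Complex.exp (2 * χ * Complex.I) = (Real.cos (2 * χ) : ℂ) + Real.sin (2 * χ) * Complex.I := by
    rw [Complex.exp_mul_I]; push_cast; rfl
  rw [e, Real.cos_two_mul, Real.sin_two_mul]
  have := Real.sin_sq_add_cos_sq χ
  ext i j; fin_cases i <;> fin_cases j <;>
    simp [symMat, rotMat, Matrix.mul_apply, Fin.sum_univ_two, -Complex.ofReal_cos,
      -Complex.ofReal_sin, -Complex.ofReal_pow] <;> grind

theorem epsMat_mul_rotMat (χ : ℝ) : epsMat * rotMat χ = rotMat χ * epsMat := by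
  ext i j; fin_cases i <;> fin_cases j <;>
    simp [epsMat, rotMat, Matrix.mul_apply, Fin.sum_univ_two]

/-! ### Derivatives of the rotated zweibein and its deformed connection -/

section

attribute [local instance] Matrix.linftyOpNormedRing Matrix.linftyOpNormedAlgebra
  Matrix.linftyOpNormedAddCommGroup Matrix.linftyOpNormedSpace

theorem hasDerivAt_norm_sq {m : ℝ → ℂ} {m' : ℂ} {v : ℝ} (hm : HasDerivAt m m' v) :
    HasDerivAt (fun x => ‖m x‖ ^ 2) (2 * (conj (m v) * m').re) v := by
  refine hm.norm_sq.congr_deriv ?_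
  simp [Complex.inner]
  ring

theorem hasDerivAt_symZweibein {m : ℝ → ℂ} {m' : ℂ} {v : ℝ} (hm : HasDerivAt m m' v)
    (h1 : ‖m v‖ < 1) :
    HasDerivAt (fun x => symZweibein (m x)) (symZweibein (m v) *
      (symMat (m' / ((1 - ‖m v‖ ^ 2 : ℝ) : ℂ)) - gaugeQ (m v) m' • epsMat)) v := by
  have hg := one_sub_norm_sq_pos h1
  have hs : 0 < √(1 - ‖m v‖ ^ 2) := Real.sqrt_pos.2 hg
  have hs2 : √(1 - ‖m v‖ ^ 2) ^ 2 = 1 - ‖m v‖ ^ 2 := Real.sq_sqrt hg.le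
  have hn : ‖m v‖ ^ 2 = (m v).re ^ 2 + (m v).im ^ 2 := by
    rw [← Complex.normSq_eq_norm_sq, Complex.normSq_apply]; ring
  have hinv : HasDerivAt (fun x => 1 / √(1 - ‖m x‖ ^ 2))
      ((conj (m v) * m').re / √(1 - ‖m v‖ ^ 2) ^ 3) v := by
    have h2 := ((hasDerivAt_norm_sq hm).const_sub 1).sqrt hg.ne'
    refine ((hasDerivAt_const v (1 : ℝ)).div h2 hs.ne').congr_deriv ?_
    field_simp
    ring
  have hre : HasDerivAt (fun x => (m x).re) m'.re v :=
    Complex.reCLM.hasFDerivAt.comp_hasDerivAt v hm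
  have him : HasDerivAt (fun x => (m x).im) m'.im v :=
    Complex.imCLM.hasFDerivAt.comp_hasDerivAt v hm
  have hmat : HasDerivAt (fun x => !![1 + (m x).re, (m x).im; (m x).im, 1 - (m x).re])
      !![m'.re, m'.im; m'.im, -m'.re] v := by
    rw [hasDerivAt_matrix]
    intro i j
    fin_cases i <;> fin_cases j
    · simpa using hre.const_add 1
    · simpa using him
    · simpa using him
    · simpa using hre.const_sub 1
  refine (hinv.smul hmat).congr_deriv ?_
  have e3 : √(1 - ‖m v‖ ^ 2) ^ 3 = √(1 - ‖m v‖ ^ 2) * (1 - ‖m v‖ ^ 2) := by rw [pow_succ', hs2]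
  rw [e3, symZweibein, symMat, epsMat, gaugeQ]
  set s := √(1 - ‖m v‖ ^ 2)
  set g := 1 - ‖m v‖ ^ 2 with hgdef
  rw [hn] at hgdef
  have hgne := hg.ne'
  have hsne := hs.ne'
  ext i j
  fin_cases i <;> fin_cases j <;>
    simp [Matrix.mul_apply, Fin.sum_univ_two, Complex.div_ofReal_re, Complex.div_ofReal_im] <;>
    field_simp <;> rw [hgdef] <;> ring

/-- The rotation shifts the antisymmetric part by χ' and turns the symmetric part by a phase, so the
choice χ' = `gaugeQ` makes the connection symmetric. -/
theorem hasDerivAt_gaugeZweibein {m : ℝ → ℂ} {χ : ℝ → ℝ} {m' : ℂ} {χ' v : ℝ}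
    (hm : HasDerivAt m m' v) (hχ : HasDerivAt χ χ' v) (h1 : ‖m v‖ < 1) :
    HasDerivAt (fun x => gaugeZweibein (m x) (χ x)) (gaugeZweibein (m v) (χ v) *
      (symMat (gaugeP (m v) m' (χ v)) + (χ' - gaugeQ (m v) m') • epsMat)) v := by
  have hrot : HasDerivAt (fun x => rotMat (χ x)) (χ' • (rotMat (χ v) * epsMat)) v := by
    rw [hasDerivAt_matrix]
    intro i j
    fin_cases i <;> fin_cases j <;>
      simp [rotMat, epsMat]
    · simpa [mul_comm] using hχ.cos
    · simpa [mul_comm] using hχ.sin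
    · simpa [mul_comm] using hχ.sin.fun_neg
    · simpa [mul_comm] using hχ.cos
  refine ((hasDerivAt_symZweibein hm h1).mul hrot).congr_deriv ?_
  rw [gaugeZweibein, gaugeP, mul_div_assoc, mul_assoc, mul_assoc, ← mul_add]
  congr 1
  rw [sub_mul, symMat_mul_rotMat, smul_mul_assoc, epsMat_mul_rotMat, mul_add, mul_smul_comm, sub_smul]
  abel

theorem connection_eq {W : ℝ → Mat2} {J : Mat2} {x : ℝ} (hW : HasDerivAt W (W x * J) x)
    (hdet : (W x).det = 1) : connection W x = J := by
  have h1 : (Matrix.of fun i j => deriv (fun y => W y i j) x) = W x * J := by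
    ext i j
    exact (hasDerivAt_matrix.1 hW i j).deriv
  rw [connection, h1, inv_eq_adjugate hdet, ← mul_assoc, Matrix.adjugate_mul, hdet, one_smul,
    one_mul]

theorem connectionP_eq {W : ℝ → Mat2} {z : ℂ} {k x : ℝ}
    (h : connection W x = symMat z + k • epsMat) : connectionP W x = symMat z := by
  rw [connectionP, h, Matrix.transpose_add, Matrix.transpose_smul, symMat_transpose,
    epsMat_transpose]
  rw [show symMat z + k • epsMat + (symMat z + k • -epsMat) = (2 : ℝ) • symMat z by
    rw [two_smul, smul_neg]; abel, smul_smul]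
  norm_num

theorem connectionQ_eq {W : ℝ → Mat2} {z : ℂ} {k x : ℝ}
    (h : connection W x = symMat z + k • epsMat) : connectionQ W x = k • epsMat := by
  rw [connectionQ, h, Matrix.transpose_add, Matrix.transpose_smul, symMat_transpose,
    epsMat_transpose]
  rw [show symMat z + k • epsMat - (symMat z + k • -epsMat) = (2 : ℝ) • k • epsMat by
    rw [two_smul, smul_neg]; abel, smul_smul]
  norm_num

/-- The regular connection of a rotated symmetric zweibein. -/
def gaugeConn (P : ℝ → ℂ) (k : ℝ → ℝ) (r t : ℝ) : Mat2 :=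
  r • (Real.cos t • k (r * Real.sin t) • epsMat + symMat (P (r * Real.sin t)))

theorem gaugeConn_trace (P : ℝ → ℂ) (k : ℝ → ℝ) (r t : ℝ) : (gaugeConn P k r t).trace = 0 := by
  simp only [gaugeConn, Matrix.trace_smul, Matrix.trace_add, epsMat_trace, symMat_trace,
    smul_zero, add_zero]

theorem mul_sin_mem_Ioo {r t : ℝ} (hr : r ∈ Ioc (0 : ℝ) 1) (ht : t ∈ Ioo 0 (Real.pi / 2)) :
    r * Real.sin t ∈ Ioo (0 : ℝ) 1 := by
  have h1 : 0 < Real.sin t := Real.sin_pos_of_pos_of_lt_pi ht.1 (by linarith [ht.2, Real.pi_pos])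
  have h2 : Real.sin t < 1 := by
    rw [← Real.sin_pi_div_two]
    exact Real.sin_lt_sin_of_lt_of_le_pi_div_two (by linarith [ht.1, Real.pi_pos]) le_rfl ht.2
  exact ⟨mul_pos hr.1 h1, by nlinarith [hr.1, hr.2]⟩

theorem mul_sin_mem_Icc {r t : ℝ} (hr : r ∈ Icc (0 : ℝ) 1) (ht : t ∈ Icc 0 (Real.pi / 2)) :
    r * Real.sin t ∈ Icc (0 : ℝ) 1 :=
  ⟨mul_nonneg hr.1 (Real.sin_nonneg_of_nonneg_of_le_pi ht.1 (by linarith [ht.2, Real.pi_pos])),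
    mul_le_one₀ hr.2 (Real.sin_nonneg_of_nonneg_of_le_pi ht.1 (by linarith [ht.2, Real.pi_pos]))
      (Real.sin_le_one t)⟩

theorem isRegularConnection_gauge {m : ℝ → ℂ} {χ : ℝ → ℝ} {P : ℝ → ℂ} {k : ℝ → ℝ} {m' : ℝ → ℂ}
    {χ' : ℝ → ℝ} {r : ℝ} (hr : r ∈ Ioc (0 : ℝ) 1)
    (hm : ∀ v ∈ Ioo (0 : ℝ) 1, HasDerivAt m (m' v) v)
    (hχ : ∀ v ∈ Ioo (0 : ℝ) 1, HasDerivAt χ (χ' v) v) (h1 : ∀ v ∈ Ioo (0 : ℝ) 1, ‖m v‖ < 1)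
    (hP : ∀ v ∈ Ioo (0 : ℝ) 1, P v = gaugeP (m v) (m' v) (χ v))
    (hk : ∀ v ∈ Ioo (0 : ℝ) 1, k v = χ' v - gaugeQ (m v) (m' v)) :
    IsRegularConnection (fun v => gaugeZweibein (m v) (χ v)) (gaugeConn P k r) r := by
  intro t ht
  have hv := mul_sin_mem_Ioo hr ht
  have hc := connection_eq (hasDerivAt_gaugeZweibein (hm _ hv) (hχ _ hv) (h1 _ hv))
    (isZweibein_gaugeZweibein (h1 _ hv) _).2
  rw [connectionP_eq hc, connectionQ_eq hc, ← hP _ hv, ← hk _ hv, gaugeConn]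

/-- The field `E` of a generator, in terms of a rotated symmetric zweibein. -/
theorem deformedMetric_eq_gauge {m : ℝ → ℂ} {χ : ℝ → ℝ} {P P₀ : ℝ → ℂ} {k k₀ : ℝ → ℝ}
    {m' : ℝ → ℂ} {χ' : ℝ → ℝ} {r ρ : ℝ} (hr : r ∈ Ioc (0 : ℝ) 1) (hρ : 0 < ρ)
    (hmc : ContinuousOn m (Icc 0 1)) (hχc : ContinuousOn χ (Icc 0 1))
    (hm : ∀ v ∈ Ioo (0 : ℝ) 1, HasDerivAt m (m' v) v)
    (hχ : ∀ v ∈ Ioo (0 : ℝ) 1, HasDerivAt χ (χ' v) v) (h1 : ∀ v ∈ Icc (0 : ℝ) 1, ‖m v‖ < 1)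
    (hPc : Continuous P) (hkc : Continuous k) (hP₀c : Continuous P₀) (hk₀c : Continuous k₀)
    (hP : ∀ v ∈ Ioo (0 : ℝ) 1, P v = gaugeP (m v) (m' v) (χ v))
    (hk : ∀ v ∈ Ioo (0 : ℝ) 1, k v = χ' v - gaugeQ (m v) (m' v))
    (hP₀ : ∀ v ∈ Ioo (0 : ℝ) 1, P₀ v = gaugeP (m v) (m' v) 0)
    (hk₀ : ∀ v ∈ Ioo (0 : ℝ) 1, k₀ v = - gaugeQ (m v) (m' v)) :
    deformedMetric (fun x => symZweibein (m x)) (fun v => ρ * v ^ 2) r =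
      orderedMetric (gaugeZweibein (m 0) (χ 0)) (gaugeConn P k r) := by
  have hsub : Ioo (0 : ℝ) 1 ⊆ Icc 0 1 := Ioo_subset_Icc_self
  have hcont : ∀ {P : ℝ → ℂ} {k : ℝ → ℝ}, Continuous P → Continuous k →
      Continuous (gaugeConn P k r) := by
    intro P k hP hk
    have h1 : Continuous fun t => r * Real.sin t := by fun_prop
    exact ((Real.continuous_cos.smul ((hk.comp h1).smul continuous_const)).add
      (continuous_symMat.comp (hP.comp h1))).const_smul r
  -- The symmetric zweibein in the definition of the field is the rotated one with angle 0, so that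
  -- gauge independence compares two members of a single family.
  have e0 : (fun x => symZweibein (m x)) = fun x => gaugeZweibein (m x) 0 := by
    ext1 x; rw [gaugeZweibein_zero]
  have hsq : ContinuousOn (fun x => symZweibein (m x)) (Icc 0 1) := by
    have h2 : ContinuousOn (fun x => 1 / √(1 - ‖m x‖ ^ 2)) (Icc 0 1) :=
      continuousOn_const.div (by fun_prop) fun x hx =>
        (Real.sqrt_pos.2 (one_sub_norm_sq_pos (h1 x hx))).ne'
    have h3 : Continuous fun z : ℂ => !![1 + z.re, z.im; z.im, 1 - z.re] := by fun_prop
    exact h2.smul (h3.comp_continuousOn hmc)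
  have hreg₀ := isRegularConnection_gauge (χ := fun _ => 0) (χ' := fun _ => 0) (k := k₀) hr hm
    (fun v _ => hasDerivAt_const v 0) (fun v hv => h1 v (hsub hv)) hP₀
    (fun v hv => by rw [hk₀ v hv, zero_sub])
  have hreg := isRegularConnection_gauge hr hm hχ (fun v hv => h1 v (hsub hv)) hP hk
  have hz : ∀ (χ : ℝ) x, x ∈ Icc (0 : ℝ) 1 → IsZweibein (gaugeZweibein (m x) χ) (conformalMetric (m x)) :=
    fun χ x hx => isZweibein_gaugeZweibein (h1 x hx) χ
  rw [e0, deformedMetric_eq hr.1 hρ (hcont hP₀c hk₀c) hreg₀]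
  exact orderedMetric_gauge (W₁ := fun x => gaugeZweibein (m x) 0)
    (W₂ := fun x => gaugeZweibein (m x) (χ x)) hr (e0 ▸ hsq)
    (hsq.mul (continuous_rotMat.comp_continuousOn hχc))
    (fun x hx => (hasDerivAt_gaugeZweibein (χ := fun _ => 0) (hm x hx) (hasDerivAt_const x 0)
      (h1 x (hsub hx))).differentiableAt)
    (fun x hx => (hasDerivAt_gaugeZweibein (hm x hx) (hχ x hx) (h1 x (hsub hx))).differentiableAt)
    (fun x hx => (hz 0 x hx).2) (fun x hx => (hz (χ x) x hx).2)
    (fun x hx => (hz 0 x hx).1.trans (hz (χ x) x hx).1.symm)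
    (hcont hP₀c hk₀c) (hcont hPc hkc) (gaugeConn_trace _ _ _) hreg₀ hreg

end

/-! ### Regular data in the parallel gauge -/

/-- The derivative of `gaugeP (m v) (f v) (χ v)` along a generator. -/
def gaugePDeriv (m m' f f' : ℂ) (χ χ' : ℝ) : ℂ :=
  gaugeP m f' χ + (2 * (χ' : ℂ) * Complex.I + ((2 * (conj m * m').re / (1 - ‖m‖ ^ 2) : ℝ) : ℂ)) *
    gaugeP m f χ

/-- The derivative of `gaugeQ (m v) (f v)` along a generator. -/
def gaugeQDeriv (m m' f f' : ℂ) : ℝ :=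
  ((conj m' * f).im + (conj m * f').im) / (1 - ‖m‖ ^ 2) +
    2 * (conj m * m').re / (1 - ‖m‖ ^ 2) * gaugeQ m f

/-- `f` need not be the derivative of `m`. The formula therefore serves along the generator as well
as along a variation, where `m` and its generator derivative vary together. -/
theorem hasDerivAt_gaugeP {m f : ℝ → ℂ} {χ : ℝ → ℝ} {m' f' : ℂ} {χ' v : ℝ}
    (hm : HasDerivAt m m' v) (hf : HasDerivAt f f' v) (hχ : HasDerivAt χ χ' v) (h1 : ‖m v‖ < 1) :
    HasDerivAt (fun v => gaugeP (m v) (f v) (χ v)) (gaugePDeriv (m v) m' (f v) f' (χ v) χ') v := by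
  have hg := one_sub_norm_sq_pos h1
  have hgc : ((1 - ‖m v‖ ^ 2 : ℝ) : ℂ) ≠ 0 := by exact_mod_cast hg.ne'
  have h2 := ((hasDerivAt_norm_sq hm).const_sub 1).ofReal_comp
  have h3 : HasDerivAt (fun v => Complex.exp (2 * (χ v : ℂ) * Complex.I))
      (Complex.exp (2 * (χ v : ℂ) * Complex.I) * (2 * (χ' : ℂ) * Complex.I)) v :=
    ((hχ.ofReal_comp.const_mul 2).mul_const Complex.I).cexp
  refine ((h3.mul hf).div h2 hgc).congr_deriv ?_
  rw [gaugePDeriv, gaugeP, gaugeP]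
  push_cast at hgc ⊢
  simp only [Pi.mul_apply]
  field_simp
  ring

theorem hasDerivAt_gaugeQ {m f : ℝ → ℂ} {m' f' : ℂ} {v : ℝ}
    (hm : HasDerivAt m m' v) (hf : HasDerivAt f f' v) (h1 : ‖m v‖ < 1) :
    HasDerivAt (fun v => gaugeQ (m v) (f v)) (gaugeQDeriv (m v) m' (f v) f') v := by
  have hg := one_sub_norm_sq_pos h1
  have h2 := (hasDerivAt_norm_sq hm).const_sub 1
  have h3 : HasDerivAt (fun v => (conj (m v) * f v).im) ((conj m' * f v).im + (conj (m v) * f').im)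
      v := by
    have h4 : HasDerivAt (fun v => conj (m v)) (conj m') v :=
      Complex.conjCLE.toContinuousLinearMap.hasFDerivAt.comp_hasDerivAt v hm
    have h5 := h4.mul hf
    refine (Complex.imCLM.hasFDerivAt.comp_hasDerivAt v h5).congr_deriv ?_
    simp
  refine (h3.div h2 hg.ne').congr_deriv ?_
  rw [gaugeQDeriv, gaugeQ]
  field_simp
  ring

theorem continuous_gaugeP {Y : Type*} [TopologicalSpace Y] {m f : Y → ℂ} {χ : Y → ℝ}
    (hm : Continuous m) (hf : Continuous f) (hχ : Continuous χ) (h1 : ∀ y, ‖m y‖ < 1) :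
    Continuous fun y => gaugeP (m y) (f y) (χ y) := by
  unfold gaugeP
  refine Continuous.div (by fun_prop) (by fun_prop) fun y => ?_
  exact_mod_cast (one_sub_norm_sq_pos (h1 y)).ne'

theorem continuous_gaugeQ {Y : Type*} [TopologicalSpace Y] {m f : Y → ℂ}
    (hm : Continuous m) (hf : Continuous f) (h1 : ∀ y, ‖m y‖ < 1) :
    Continuous fun y => gaugeQ (m y) (f y) := by
  unfold gaugeQ
  refine Continuous.div ?_ (by fun_prop) fun y => (one_sub_norm_sq_pos (h1 y)).ne'
  exact Complex.continuous_im.comp ((Complex.continuous_conj.comp hm).mul hf)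

theorem continuous_re_conj_div {Y : Type*} [TopologicalSpace Y] {m m' : Y → ℂ}
    (hm : Continuous m) (hm' : Continuous m') (h1 : ∀ y, ‖m y‖ < 1) :
    Continuous fun y => 2 * (conj (m y) * m' y).re / (1 - ‖m y‖ ^ 2) := by
  refine Continuous.div ?_ (by fun_prop) fun y => (one_sub_norm_sq_pos (h1 y)).ne'
  exact continuous_const.mul (Complex.continuous_re.comp ((Complex.continuous_conj.comp hm).mul hm'))

theorem continuous_gaugePDeriv {Y : Type*} [TopologicalSpace Y] {m m' f f' : Y → ℂ} {χ χ' : Y → ℝ}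
    (hm : Continuous m) (hm' : Continuous m') (hf : Continuous f) (hf' : Continuous f')
    (hχ : Continuous χ) (hχ' : Continuous χ') (h1 : ∀ y, ‖m y‖ < 1) :
    Continuous fun y => gaugePDeriv (m y) (m' y) (f y) (f' y) (χ y) (χ' y) := by
  have h2 := continuous_re_conj_div hm hm' h1
  have h3 : Continuous fun y => 2 * (χ' y : ℂ) * Complex.I := by fun_prop
  exact (continuous_gaugeP hm hf' hχ h1).add
    ((h3.add (Complex.continuous_ofReal.comp h2)).mul (continuous_gaugeP hm hf hχ h1))

theorem continuous_gaugeQDeriv {Y : Type*} [TopologicalSpace Y] {m m' f f' : Y → ℂ}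
    (hm : Continuous m) (hm' : Continuous m') (hf : Continuous f) (hf' : Continuous f')
    (h1 : ∀ y, ‖m y‖ < 1) :
    Continuous fun y => gaugeQDeriv (m y) (m' y) (f y) (f' y) := by
  refine Continuous.add (Continuous.div ?_ (by fun_prop) fun y => (one_sub_norm_sq_pos (h1 y)).ne')
    ((continuous_re_conj_div hm hm' h1).mul (continuous_gaugeQ hm hf h1))
  exact (Complex.continuous_im.comp ((Complex.continuous_conj.comp hm').mul hf)).add
    (Complex.continuous_im.comp ((Complex.continuous_conj.comp hm).mul hf'))

/-- The nearest point of the unit interval. -/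
def clamp (v : ℝ) : ℝ := projIcc (0 : ℝ) 1 zero_le_one v

theorem continuous_clamp : Continuous clamp := continuous_subtype_val.comp continuous_projIcc

theorem clamp_mem (v : ℝ) : clamp v ∈ Icc (0 : ℝ) 1 := (projIcc (0 : ℝ) 1 zero_le_one v).2

theorem clamp_of_mem {v : ℝ} (hv : v ∈ Icc (0 : ℝ) 1) : clamp v = v := by
  rw [clamp, projIcc_of_mem _ hv]

theorem clamp_eventuallyEq {v : ℝ} (hv : v ∈ Ioo (0 : ℝ) 1) : clamp =ᶠ[𝓝 v] id := by
  filter_upwards [Icc_mem_nhds hv.1 hv.2] with x hx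
  exact clamp_of_mem hx

theorem hasDerivAt_comp_clamp {f : ℝ → ℂ} {f' : ℂ} {v : ℝ} (hv : v ∈ Ioo (0 : ℝ) 1)
    (h : HasDerivAt f f' v) : HasDerivAt (fun x => f (clamp x)) f' v := by
  refine h.congr_of_eventuallyEq ?_
  filter_upwards [clamp_eventuallyEq hv] with x hx
  rw [hx, id]

/-- The derivative along the generators of a function that is smooth on the branch. -/
theorem exists_generator_deriv {D : Set Transverse} (hD : IsOpen D) {f : ℝ × Transverse → ℂ}
    (hf : ContDiffOn ℝ ∞ f (Icc 0 1 ×ˢ D)) :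
    ∃ f₁, ContDiffOn ℝ ∞ f₁ (Icc 0 1 ×ˢ D) ∧ ∀ θ ∈ D, ∀ v ∈ Ioo (0 : ℝ) 1,
      HasDerivAt (fun x => f (x, θ)) (f₁ (v, θ)) v := by
  -- The branch includes v = 0 and v = 1, so derivatives are taken within it; unique
  -- differentiability makes them smooth up to these ends.
  have hu : UniqueDiffOn ℝ (Icc (0 : ℝ) 1 ×ˢ D) :=
    (uniqueDiffOn_Icc zero_lt_one).prod hD.uniqueDiffOn
  refine ⟨fun q => fderivWithin ℝ f (Icc 0 1 ×ˢ D) q (1, 0),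
    (hf.fderivWithin hu (by simp)).clm_apply contDiffOn_const, fun θ hθ v hv => ?_⟩
  have hn : Icc (0 : ℝ) 1 ×ˢ D ∈ 𝓝 (v, θ) :=
    prod_mem_nhds (Icc_mem_nhds hv.1 hv.2) (hD.mem_nhds hθ)
  have h1 : HasFDerivAt f (fderivWithin ℝ f (Icc 0 1 ×ˢ D) (v, θ)) (v, θ) :=
    ((hf.differentiableOn (by simp) _ ⟨Ioo_subset_Icc_self hv, hθ⟩).hasFDerivWithinAt).hasFDerivAt hn
  exact h1.comp_hasDerivAt v ((hasDerivAt_id v).prodMk (hasDerivAt_const v θ))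

theorem continuous_clamp_comp {D : Set Transverse} {E : Type*} [TopologicalSpace E]
    {f : ℝ × Transverse → E} (hf : ContinuousOn f (Icc 0 1 ×ˢ D)) :
    Continuous fun y : D × ℝ => f (clamp y.2, y.1) := by
  refine hf.comp_continuous (f := fun y : D × ℝ => (clamp y.2, (y.1 : Transverse))) ?_
    fun y => ⟨clamp_mem _, y.1.2⟩
  exact (continuous_clamp.comp continuous_snd).prodMk (by fun_prop)

/-- A family of Beltrami coefficients `m` on generators, with the angle `χ` of a zweibein whose
connection is symmetric, and this connection `p`. -/
structure IsParallel {X : Type*} [TopologicalSpace X] (m m₁ : X → ℝ → ℂ) (χ : X → ℝ → ℝ)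
    (p p₁ : X → ℝ → ℂ) : Prop where
  cont_m : Continuous fun y : X × ℝ => m y.1 y.2
  cont_m₁ : Continuous fun y : X × ℝ => m₁ y.1 y.2
  cont_χ : Continuous fun y : X × ℝ => χ y.1 y.2
  cont_p : Continuous fun y : X × ℝ => p y.1 y.2
  cont_p₁ : Continuous fun y : X × ℝ => p₁ y.1 y.2
  norm_lt : ∀ x v, ‖m x v‖ < 1
  deriv_m : ∀ x, ∀ v ∈ Ioo (0 : ℝ) 1, HasDerivAt (m x) (m₁ x v) v
  deriv_χ : ∀ x v, HasDerivAt (χ x) (gaugeQ (m x v) (m₁ x v)) v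
  deriv_p : ∀ x v, HasDerivAt (p x) (p₁ x v) v
  p_eq : ∀ x, ∀ v ∈ Icc (0 : ℝ) 1, p x v = gaugeP (m x v) (m₁ x v) (χ x v)

/-- The coefficient is continued past [0, 1] by clamping, which destroys differentiability at the
ends. χ and p are therefore defined as primitives: they are differentiable at every real v and have
the geometric values on [0, 1]. Two derivatives of μ along the generator are used, the second one
for the derivative of p. -/
theorem exists_isParallel {D : Set Transverse} (hD : IsOpen D) {μ : ℝ × Transverse → ℂ}
    {ρ₀ : Transverse → ℝ} (h : IsRegularBranch D μ ρ₀) :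
    ∃ (m₁ : D → ℝ → ℂ) (χ : D → ℝ → ℝ) (p p₁ : D → ℝ → ℂ),
      IsParallel (fun (θ : D) v => μ (clamp v, θ)) m₁ χ p p₁ := by
  obtain ⟨f₁, hf₁, hd₁⟩ := exists_generator_deriv hD h.smooth_mu
  obtain ⟨f₂, hf₂, hd₂⟩ := exists_generator_deriv hD hf₁
  set m : D → ℝ → ℂ := fun θ v => μ (clamp v, θ) with hm
  set m₁ : D → ℝ → ℂ := fun θ v => f₁ (clamp v, θ) with hm₁
  set m₂ : D → ℝ → ℂ := fun θ v => f₂ (clamp v, θ) with hm₂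
  have cm : Continuous fun y : D × ℝ => m y.1 y.2 := continuous_clamp_comp h.smooth_mu.continuousOn
  have cm₁ : Continuous fun y : D × ℝ => m₁ y.1 y.2 := continuous_clamp_comp hf₁.continuousOn
  have cm₂ : Continuous fun y : D × ℝ => m₂ y.1 y.2 := continuous_clamp_comp hf₂.continuousOn
  have hn : ∀ θ v, ‖m θ v‖ < 1 := fun θ v => h.norm_mu_lt _ ⟨clamp_mem v, θ.2⟩
  have dm : ∀ θ, ∀ v ∈ Ioo (0 : ℝ) 1, HasDerivAt (m θ) (m₁ θ v) v := fun θ v hv => by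
    have := hasDerivAt_comp_clamp hv (hd₁ θ θ.2 v hv)
    simpa only [hm₁, clamp_of_mem (Ioo_subset_Icc_self hv)] using this
  have dm₁ : ∀ θ, ∀ v ∈ Ioo (0 : ℝ) 1, HasDerivAt (m₁ θ) (m₂ θ v) v := fun θ v hv => by
    have := hasDerivAt_comp_clamp hv (hd₂ θ θ.2 v hv)
    simpa only [hm₂, clamp_of_mem (Ioo_subset_Icc_self hv)] using this
  have cQ : Continuous fun y : D × ℝ => gaugeQ (m y.1 y.2) (m₁ y.1 y.2) :=
    continuous_gaugeQ cm cm₁ fun y => hn _ _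
  set χ : D → ℝ → ℝ := fun θ v => ∫ x in (0 : ℝ)..v, gaugeQ (m θ x) (m₁ θ x) with hχ
  have cχ : Continuous fun y : D × ℝ => χ y.1 y.2 :=
    intervalIntegral.continuous_parametric_intervalIntegral_of_continuous
      (f := fun (y : D × ℝ) x => gaugeQ (m y.1 x) (m₁ y.1 x))
      (cQ.comp (f := fun y : (D × ℝ) × ℝ => (y.1.1, y.2)) (by fun_prop)) continuous_snd
  have dχ : ∀ θ v, HasDerivAt (χ θ) (gaugeQ (m θ v) (m₁ θ v)) v := fun θ v => by
    have hc : Continuous fun x => gaugeQ (m θ x) (m₁ θ x) :=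
      cQ.comp (f := fun x : ℝ => (θ, x)) (by fun_prop)
    exact intervalIntegral.integral_hasDerivAt_right (hc.intervalIntegrable _ _)
      (hc.stronglyMeasurableAtFilter _ _) hc.continuousAt
  set p₁ : D → ℝ → ℂ := fun θ v => gaugePDeriv (m θ v) (m₁ θ v) (m₁ θ v) (m₂ θ v) (χ θ v)
    (gaugeQ (m θ v) (m₁ θ v)) with hp₁
  have cp₁ : Continuous fun y : D × ℝ => p₁ y.1 y.2 :=
    continuous_gaugePDeriv cm cm₁ cm₁ cm₂ cχ cQ fun y => hn _ _
  have cP : Continuous fun y : D × ℝ => gaugeP (m y.1 y.2) (m₁ y.1 y.2) (χ y.1 y.2) :=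
    continuous_gaugeP cm cm₁ cχ fun y => hn _ _
  set p : D → ℝ → ℂ := fun θ v => gaugeP (m θ 0) (m₁ θ 0) (χ θ 0) + ∫ x in (0 : ℝ)..v, p₁ θ x
    with hp
  have cp₁' : ∀ θ, Continuous (p₁ θ) := fun θ => cp₁.comp (f := fun x : ℝ => (θ, x)) (by fun_prop)
  refine ⟨m₁, χ, p, p₁, cm, cm₁, cχ, ?_, cp₁, hn, dm, dχ, fun θ v => ?_, fun θ v hv => ?_⟩
  · refine Continuous.add (cP.comp (f := fun y : D × ℝ => (y.1, (0 : ℝ))) (by fun_prop)) ?_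
    exact intervalIntegral.continuous_parametric_intervalIntegral_of_continuous
      (f := fun (y : D × ℝ) x => p₁ y.1 x)
      (cp₁.comp (f := fun y : (D × ℝ) × ℝ => (y.1.1, y.2)) (by fun_prop)) continuous_snd
  · exact (intervalIntegral.integral_hasDerivAt_right ((cp₁' θ).intervalIntegrable _ _)
      ((cp₁' θ).stronglyMeasurableAtFilter _ _) (cp₁' θ).continuousAt).const_add _
  · have := intervalIntegral.integral_eq_sub_of_hasDerivAt_of_le (a := 0) (b := v)
      (f := fun v => gaugeP (m θ v) (m₁ θ v) (χ θ v)) (f' := p₁ θ) hv.1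
      ((cP.comp (f := fun x : ℝ => (θ, x)) (by fun_prop)).continuousOn)
      (fun x hx => by
        have hx' : x ∈ Ioo (0 : ℝ) 1 := ⟨hx.1, hx.2.trans_le hv.2⟩
        exact hasDerivAt_gaugeP (dm θ x hx') (dm₁ θ x hx') (dχ θ x) (hn θ x))
      ((cp₁' θ).intervalIntegrable _ _)
    simp only [hp, this]
    ring

/-! ### The field in the parallel gauge; independence of the zweibein -/

section

attribute [local instance] Matrix.linftyOpNormedRing Matrix.linftyOpNormedAlgebra
  Matrix.linftyOpNormedAddCommGroup Matrix.linftyOpNormedSpace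

theorem continuous_gaugeConn {Y : Type*} [TopologicalSpace Y] {P : Y → ℝ → ℂ} {k : Y → ℝ → ℝ}
    (hP : Continuous fun y : Y × ℝ => P y.1 y.2) (hk : Continuous fun y : Y × ℝ => k y.1 y.2) :
    Continuous fun y : Y × ℝ × ℝ => gaugeConn (P y.1) (k y.1) y.2.1 y.2.2 := by
  have h1 : Continuous fun y : Y × ℝ × ℝ => (y.1, y.2.1 * Real.sin y.2.2) := by fun_prop
  have h2 : Continuous fun y : Y × ℝ × ℝ => Real.cos y.2.2 := by fun_prop
  have h3 : Continuous fun y : Y × ℝ × ℝ => y.2.1 := by fun_prop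
  exact h3.smul ((h2.smul ((hk.comp h1).smul continuous_const)).add
    (continuous_symMat.comp (hP.comp h1)))

/-- The angle χ is arbitrary here. The varied field will be computed with the angle that is parallel
for the unvaried data only. -/
theorem fieldE_eq_gauge {ρ₀ : Transverse → ℝ} {μ : ℝ × Transverse → ℂ} {θ : Transverse}
    {m m₁ P : ℝ → ℂ} {χ χ' k : ℝ → ℝ} {r : ℝ} (hr : r ∈ Ioc (0 : ℝ) 1) (hρ : 0 < ρ₀ θ)
    (hmc : Continuous m) (hmc₁ : Continuous m₁) (hn : ∀ v, ‖m v‖ < 1)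
    (hμ : ∀ v ∈ Icc (0 : ℝ) 1, μ (v, θ) = m v) (hd : ∀ v ∈ Ioo (0 : ℝ) 1, HasDerivAt m (m₁ v) v)
    (hχc : ContinuousOn χ (Icc 0 1)) (hχ : ∀ v ∈ Ioo (0 : ℝ) 1, HasDerivAt χ (χ' v) v)
    (hPc : Continuous P) (hkc : Continuous k)
    (hP : ∀ v ∈ Ioo (0 : ℝ) 1, P v = gaugeP (m v) (m₁ v) (χ v))
    (hk : ∀ v ∈ Ioo (0 : ℝ) 1, k v = χ' v - gaugeQ (m v) (m₁ v)) :
    fieldE ρ₀ μ (r, θ) = orderedMetric (gaugeZweibein (m 0) (χ 0)) (gaugeConn P k r) := by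
  have hsub : Ioo (0 : ℝ) 1 ⊆ Icc 0 1 := Ioo_subset_Icc_self
  have := deformedMetric_eq_gauge (m := fun v => μ (v, θ)) (m' := m₁) (P := P) (k := k) (χ := χ)
    (χ' := χ') (P₀ := fun v => gaugeP (m v) (m₁ v) 0) (k₀ := fun v => -gaugeQ (m v) (m₁ v)) hr hρ
    (hmc.continuousOn.congr hμ) hχc
    (fun v hv => (hd v hv).congr_of_eventuallyEq (by
      filter_upwards [Icc_mem_nhds hv.1 hv.2] with x hx using hμ x hx)) hχ
    (fun v hv => by simp only [hμ v hv]; exact hn v) hPc hkc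
    (continuous_gaugeP hmc hmc₁ continuous_const hn) (continuous_gaugeQ hmc hmc₁ hn).neg
    (fun v hv => by simp only [hμ v (hsub hv)]; exact hP v hv)
    (fun v hv => by simp only [hμ v (hsub hv)]; exact hk v hv)
    (fun v hv => by simp only [hμ v (hsub hv)])
    (fun v hv => by simp only [hμ v (hsub hv)])
  rw [fieldE]
  simp only [hμ 0 ⟨le_rfl, zero_le_one⟩] at this
  exact this

theorem gaugeConn_zero (P : ℝ → ℂ) (r t : ℝ) :
    gaugeConn P (fun _ => 0) r t = r • symMat (P (r * Real.sin t)) := by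
  simp [gaugeConn]

/-- `E` at the deformation point `r`, in the parallel gauge. -/
def parallelE {X : Type*} (m : X → ℝ → ℂ) (χ : X → ℝ → ℝ) (p : X → ℝ → ℂ) (x : X) (r : ℝ) : Mat2 :=
  orderedMetric (gaugeZweibein (m x 0) (χ x 0)) (gaugeConn (p x) (fun _ => 0) r)

theorem continuous_gaugeZweibein {Y : Type*} [TopologicalSpace Y] {m : Y → ℂ} {χ : Y → ℝ}
    (hm : Continuous m) (hχ : Continuous χ) (hn : ∀ y, ‖m y‖ < 1) :
    Continuous fun y => gaugeZweibein (m y) (χ y) := by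
  have h2 : Continuous (fun y => 1 / √(1 - ‖m y‖ ^ 2)) :=
    continuous_const.div (by fun_prop) fun y =>
        (Real.sqrt_pos.2 (one_sub_norm_sq_pos (hn y))).ne'
  have h3 : Continuous fun z : ℂ => !![1 + z.re, z.im; z.im, 1 - z.re] := by fun_prop
  exact Continuous.mul (f := fun y => symZweibein (m y)) (h2.smul (h3.comp hm))
    (continuous_rotMat.comp hχ)

theorem continuous_orderedMetric {Y : Type*} [TopologicalSpace Y] [FirstCountableTopology Y]
    {V : Y → Mat2} {C : Y → ℝ → Mat2} (hV : Continuous V)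
    (hC : Continuous fun y : Y × ℝ => C y.1 y.2) :
    Continuous fun y => orderedMetric (V y) (C y) := by
  have h := (continuous_orderedExp_param hC (Real.pi / 2)).comp
    (f := fun y : Y => (y, (0 : ℝ))) (by fun_prop)
  exact (hV.mul h).mul (hV.mul h).matrix_transpose

namespace IsParallel

variable {X : Type*} [TopologicalSpace X] {m m₁ p p₁ : X → ℝ → ℂ} {χ : X → ℝ → ℝ}

theorem continuous_conn (h : IsParallel m m₁ χ p p₁) :
    Continuous fun y : X × ℝ × ℝ => gaugeConn (p y.1) (fun _ => 0) y.2.1 y.2.2 :=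
  continuous_gaugeConn (k := fun _ _ => 0) h.cont_p continuous_const

theorem continuous_parallelE [FirstCountableTopology X] (h : IsParallel m m₁ χ p p₁) :
    Continuous fun y : X × ℝ => parallelE m χ p y.1 y.2 := by
  refine continuous_orderedMetric (V := fun y : X × ℝ => gaugeZweibein (m y.1 0) (χ y.1 0))
    (C := fun y : X × ℝ => gaugeConn (p y.1) (fun _ => 0) y.2) ?_ ?_
  · exact continuous_gaugeZweibein
      (h.cont_m.comp (f := fun y : X × ℝ => (y.1, (0 : ℝ))) (by fun_prop))
      (h.cont_χ.comp (f := fun y : X × ℝ => (y.1, (0 : ℝ))) (by fun_prop)) fun y => h.norm_lt _ _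
  · exact h.continuous_conn.comp (f := fun y : (X × ℝ) × ℝ => (y.1.1, y.1.2, y.2)) (by fun_prop)

theorem det_zweibein (h : IsParallel m m₁ χ p p₁) (x : X) :
    (gaugeZweibein (m x 0) (χ x 0)).det = 1 :=
  (isZweibein_gaugeZweibein (h.norm_lt x 0) _).2

theorem continuous_conn_right (h : IsParallel m m₁ χ p p₁) (x : X) (r : ℝ) :
    Continuous (gaugeConn (p x) (fun _ => 0) r) :=
  h.continuous_conn.comp (f := fun t : ℝ => (x, r, t)) (by fun_prop)

end IsParallel

/-- Both factors of U have determinant 1, so U is invertible and U Uᵗ is positive definite. -/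
theorem posDef_orderedMetric {V : Mat2} {C : ℝ → Mat2} (hV : V.det = 1) (hC : Continuous C)
    (htr : ∀ t, (C t).trace = 0) :
    (orderedMetric V C).PosDef ∧ (orderedMetric V C).det = 1 := by
  have hdet : (V * orderedExp C (Real.pi / 2) 0).det = 1 := by
    rw [Matrix.det_mul, hV, det_orderedExp hC htr, mul_one]
  constructor
  · rw [orderedMetric, ← Matrix.conjTranspose_eq_transpose_of_trivial]
    refine Matrix.PosDef.mul_conjTranspose_self _ ?_
    refine Matrix.vecMul_injective_of_isUnit ?_
    rw [Matrix.isUnit_iff_isUnit_det, hdet]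
    exact isUnit_one
  · rw [orderedMetric, Matrix.det_mul, Matrix.det_transpose, hdet, mul_one]

/-- A zweibein that is once continuously differentiable has a regular connection. -/
theorem exists_regularConnection {W : ℝ → Mat2} (hW : ∀ i j, ContDiffOn ℝ 1 (fun x => W x i j)
    (Icc 0 1)) (hdet : ∀ x ∈ Icc (0 : ℝ) 1, (W x).det = 1) {r : ℝ} (hr : r ∈ Ioc (0 : ℝ) 1) :
    ContinuousOn W (Icc 0 1) ∧ (∀ x ∈ Ioo (0 : ℝ) 1, DifferentiableAt ℝ W x) ∧
      ∃ C : ℝ → Mat2, Continuous C ∧ IsRegularConnection W C r := by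
  have hc : ContinuousOn W (Icc 0 1) :=
    continuousOn_pi.2 fun i => continuousOn_pi.2 fun j => (hW i j).continuousOn
  have hde : ∀ i j, ∀ x ∈ Ioo (0 : ℝ) 1, HasDerivAt (fun x => W x i j)
      (derivWithin (fun x => W x i j) (Icc 0 1) x) x := fun i j x hx =>
    (((hW i j).differentiableOn one_ne_zero x
      (Ioo_subset_Icc_self hx)).hasDerivWithinAt).hasDerivAt (Icc_mem_nhds hx.1 hx.2)
  set W' : ℝ → Mat2 := fun x => Matrix.of fun i j => derivWithin (fun x => W x i j) (Icc 0 1) x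
    with hW'
  have hc' : ContinuousOn W' (Icc 0 1) :=
    continuousOn_pi.2 fun i => continuousOn_pi.2 fun j =>
      (hW i j).continuousOn_derivWithin (uniqueDiffOn_Icc zero_lt_one) le_rfl
  -- The connection is replaced by a continuous function on the whole line that agrees with it in
  -- the open interval, the only place where it is evaluated.
  set J : ℝ → Mat2 := fun x => (W (clamp x)).adjugate * W' (clamp x) with hJ
  have hJc : Continuous J := by
    have h1 : Continuous fun x => W (clamp x) := hc.comp_continuous continuous_clamp clamp_mem
    have h2 : Continuous fun x => W' (clamp x) := hc'.comp_continuous continuous_clamp clamp_mem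
    exact h1.matrix_adjugate.mul h2
  have hconn : ∀ x ∈ Ioo (0 : ℝ) 1, connection W x = J x := by
    intro x hx
    have hx' := Ioo_subset_Icc_self hx
    rw [connection, hJ, inv_eq_adjugate (hdet x hx')]
    simp only [clamp_of_mem hx', hW']
    congr 2
    ext i j
    exact (hde i j x hx).deriv
  refine ⟨hc, fun x hx => (hasDerivAt_matrix (M' := W' x).2 fun i j =>
    hde i j x hx).differentiableAt,
    fun t => r • (Real.cos t • ((1 / 2 : ℝ) • (J (r * Real.sin t) - (J (r * Real.sin t)).transpose))
      + (1 / 2 : ℝ) • (J (r * Real.sin t) + (J (r * Real.sin t)).transpose)), ?_, fun t ht => ?_⟩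
  · have h1 : Continuous fun t => J (r * Real.sin t) := hJc.comp (by fun_prop)
    have h2 := h1.matrix_transpose
    exact ((Real.continuous_cos.smul ((h1.sub h2).const_smul (1 / 2 : ℝ))).add
      ((h1.add h2).const_smul (1 / 2 : ℝ))).const_smul r
  · rw [connectionQ, connectionP, hconn _ (mul_sin_mem_Ioo hr ht)]

/-- `E` is well defined, regular, and independent of the zweibein. -/
theorem fieldE_regular {D : Set Transverse} {μ : ℝ × Transverse → ℂ} {ρ₀ : Transverse → ℝ}
    (h : IsRegularBranch D μ ρ₀) {m₁ : D → ℝ → ℂ} {χ : D → ℝ → ℝ} {p p₁ : D → ℝ → ℂ}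
    (hp : IsParallel (fun (θ : D) v => μ (clamp v, θ)) m₁ χ p p₁) (θ : D) {r : ℝ}
    (hr : r ∈ Ioc (0 : ℝ) 1) :
    fieldE ρ₀ μ (r, θ) = parallelE (fun (θ : D) v => μ (clamp v, θ)) χ p θ r ∧
    ∀ W : ℝ → Mat2, (∀ i j, ContDiffOn ℝ 1 (fun x => W x i j) (Icc 0 1)) →
        (∀ x ∈ Icc (0 : ℝ) 1, IsZweibein (W x) (conformalMetric (μ (x, θ)))) →
        (∀ i j, IntervalIntegrable
          (fun x => deformedConnection W (areaDensity ρ₀ θ) r x i j) volume 0 r) ∧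
        (Summable fun s : ℕ => pathOrderedTerm (deformedConnection W (areaDensity ρ₀ θ) r) s 0 r) ∧
        deformedMetric W (areaDensity ρ₀ θ) r = fieldE ρ₀ μ (r, θ) := by
  have hρ := h.rho_pos θ θ.2
  have hsub : Ioo (0 : ℝ) 1 ⊆ Icc 0 1 := Ioo_subset_Icc_self
  have hx : Continuous fun v : ℝ => (θ, v) := by fun_prop
  have e0 : fieldE ρ₀ μ (r, θ) = parallelE (fun (θ : D) v => μ (clamp v, θ)) χ p θ r :=
    fieldE_eq_gauge (m := fun v => μ (clamp v, θ)) (m₁ := m₁ θ) hr hρ (hp.cont_m.comp hx)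
      (hp.cont_m₁.comp hx) (hp.norm_lt θ) (fun v hv => by rw [clamp_of_mem hv]) (hp.deriv_m θ)
      (hp.cont_χ.comp hx).continuousOn (fun v _ => hp.deriv_χ θ v) (hp.cont_p.comp hx)
      continuous_const (fun v hv => hp.p_eq θ v (hsub hv)) (fun v _ => (sub_self _).symm)
  refine ⟨e0, fun W hW hz => ?_⟩
  obtain ⟨hc, hd, C, hC, hreg⟩ := exists_regularConnection hW (fun x hx => (hz x hx).2) hr
  have hpb := hreg.isPullback hr.1 hρ
  refine ⟨intervalIntegrable_of_isPullback hr.1 hC hpb, summable_pathOrderedTerm hr.1 hC hpb, ?_⟩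
  have hV : ∀ x ∈ Icc (0 : ℝ) 1, IsZweibein (gaugeZweibein (μ (clamp x, θ)) (χ θ x))
      (conformalMetric (μ (x, θ))) := fun x hx => by
    have := isZweibein_gaugeZweibein (hp.norm_lt θ x) (χ θ x)
    simpa only [clamp_of_mem hx] using this
  have hVd := fun x hx => hasDerivAt_gaugeZweibein (hp.deriv_m θ x hx) (hp.deriv_χ θ x)
    (hp.norm_lt θ x)
  have hVc : Continuous fun x => gaugeZweibein (μ (clamp x, θ)) (χ θ x) :=
    continuous_gaugeZweibein (hp.cont_m.comp hx) (hp.cont_χ.comp hx) (hp.norm_lt θ)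
  rw [e0]
  refine (deformedMetric_eq hr.1 hρ hC hreg).trans (Eq.symm ?_)
  exact orderedMetric_gauge (W₁ := fun x => gaugeZweibein (μ (clamp x, θ)) (χ θ x)) hr
    hVc.continuousOn hc (fun x hx => (hVd x hx).differentiableAt) hd (fun x hx => (hV x hx).2)
    (fun x hx => (hz x hx).2) (fun x hx => (hV x hx).1.trans (hz x hx).1.symm)
    (hp.continuous_conn_right θ r) hC (gaugeConn_trace _ _ _)
    (isRegularConnection_gauge hr (hp.deriv_m θ) (fun v _ => hp.deriv_χ θ v)
      (fun v _ => hp.norm_lt θ v) (fun v hv => hp.p_eq θ v (hsub hv))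
      (fun v _ => (sub_self _).symm)) hreg

end

/-! ### The response of `E` to a variation of the connection -/

section

attribute [local instance] Matrix.linftyOpNormedRing Matrix.linftyOpNormedAlgebra
  Matrix.linftyOpNormedAddCommGroup Matrix.linftyOpNormedSpace

/-- The connection in the parallel gauge. -/
def parConn {X : Type*} (p : X → ℝ → ℂ) (x : X) (r t : ℝ) : Mat2 :=
  gaugeConn (p x) (fun _ => 0) r t

/-- The derivative of `parConn` with respect to `r`. -/
def parConnDeriv {X : Type*} (p p₁ : X → ℝ → ℂ) (x : X) (r t : ℝ) : Mat2 :=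
  symMat (p x (r * Real.sin t)) + r • symMat (Real.sin t * p₁ x (r * Real.sin t))

/-- The holonomy from `t` to the deformation point. -/
def parHol {X : Type*} (p : X → ℝ → ℂ) (x : X) (r t : ℝ) : Mat2 :=
  orderedExp (parConn p x r) (Real.pi / 2) t

/-- The derivative of `parHol` with respect to `r`. -/
def parHolDeriv {X : Type*} (p p₁ : X → ℝ → ℂ) (x : X) (r t : ℝ) : Mat2 :=
  orderedExpDeriv (parConn p x r) (parConnDeriv p p₁ x r) (Real.pi / 2) t

/-- Half of the response of `U Uᵗ` to a variation `s` of the connection at the angle `t`. -/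
def response (V Y₀ Y s : Mat2) : Mat2 :=
  V * Y₀ * (Y.adjugate * s * Y) * (V * Y₀).transpose

/-- The derivative of `response`. -/
def responseDeriv (V Y₀ Y₀' Y Y' s : Mat2) : Mat2 :=
  (V * Y₀' * (Y.adjugate * s * Y) + V * Y₀ * (Y'.adjugate * s * Y + Y.adjugate * s * Y')) *
      (V * Y₀).transpose +
    V * Y₀ * (Y.adjugate * s * Y) * (V * Y₀').transpose

theorem hasDerivAt_transpose {M : ℝ → Mat2} {M' : Mat2} {t : ℝ} (h : HasDerivAt M M' t) :
    HasDerivAt (fun x => (M x).transpose) M'.transpose t := by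
  rw [hasDerivAt_matrix] at h ⊢
  exact fun i j => h j i

theorem hasDerivAt_response {V s : Mat2} {Y₀ Y : ℝ → Mat2} {Y₀' Y' : Mat2} {r : ℝ}
    (h₀ : HasDerivAt Y₀ Y₀' r) (h : HasDerivAt Y Y' r) :
    HasDerivAt (fun r => response V (Y₀ r) (Y r) s) (responseDeriv V (Y₀ r) Y₀' (Y r) Y' s) r := by
  have h1 := h₀.const_mul V
  have h2 := ((hasDerivAt_adjugate h).mul_const s).mul h
  exact (h1.mul h2).mul (hasDerivAt_transpose h1)

theorem continuous_response {Y : Type*} [TopologicalSpace Y] {V Y₀ Y₁ : Y → Mat2} (s : Mat2)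
    (hV : Continuous V) (h₀ : Continuous Y₀) (h₁ : Continuous Y₁) :
    Continuous fun y => response (V y) (Y₀ y) (Y₁ y) s :=
  ((hV.mul h₀).mul ((h₁.matrix_adjugate.mul continuous_const).mul h₁)).mul
    (hV.mul h₀).matrix_transpose

theorem continuous_responseDeriv {Y : Type*} [TopologicalSpace Y] {V Y₀ Y₀' Y₁ Y₁' : Y → Mat2}
    (s : Mat2) (hV : Continuous V) (h₀ : Continuous Y₀) (h₀' : Continuous Y₀') (h₁ : Continuous Y₁)
    (h₁' : Continuous Y₁') :
    Continuous fun y => responseDeriv (V y) (Y₀ y) (Y₀' y) (Y₁ y) (Y₁' y) s := by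
  have hs : Continuous fun _ : Y => s := continuous_const
  have hN := (h₁.matrix_adjugate.mul hs).mul h₁
  have hN' := ((h₁'.matrix_adjugate.mul hs).mul h₁).add ((h₁.matrix_adjugate.mul hs).mul h₁')
  exact ((((hV.mul h₀').mul hN).add ((hV.mul h₀).mul hN')).mul (hV.mul h₀).matrix_transpose).add
    (((hV.mul h₀).mul hN).mul (hV.mul h₀').matrix_transpose)

theorem response_add (V Y₀ Y s s' : Mat2) :
    response V Y₀ Y (s + s') = response V Y₀ Y s + response V Y₀ Y s' := by
  simp only [response, mul_add, add_mul]

theorem response_smul (V Y₀ Y s : Mat2) (k : ℝ) :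
    response V Y₀ Y (k • s) = k • response V Y₀ Y s := by
  simp only [response, mul_smul_comm, smul_mul_assoc]

namespace IsParallel

variable {X : Type*} [TopologicalSpace X] {m m₁ p p₁ : X → ℝ → ℂ} {χ : X → ℝ → ℝ}

theorem continuous_parConn (h : IsParallel m m₁ χ p p₁) :
    Continuous fun y : (X × ℝ) × ℝ => parConn p y.1.1 y.1.2 y.2 :=
  h.continuous_conn.comp (f := fun y : (X × ℝ) × ℝ => (y.1.1, y.1.2, y.2)) (by fun_prop)

theorem continuous_parConnDeriv (h : IsParallel m m₁ χ p p₁) :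
    Continuous fun y : (X × ℝ) × ℝ => parConnDeriv p p₁ y.1.1 y.1.2 y.2 := by
  have h1 : Continuous fun y : (X × ℝ) × ℝ => (y.1.1, y.1.2 * Real.sin y.2) := by fun_prop
  have h2 : Continuous fun y : (X × ℝ) × ℝ => ((Real.sin y.2 : ℝ) : ℂ) := by fun_prop
  have h3 : Continuous fun y : (X × ℝ) × ℝ => y.1.2 := by fun_prop
  exact (continuous_symMat.comp (h.cont_p.comp h1)).add
    (h3.smul (continuous_symMat.comp (h2.mul (h.cont_p₁.comp h1))))

theorem hasDerivAt_symMat {f : ℝ → ℂ} {f' : ℂ} {v : ℝ} (hf : HasDerivAt f f' v) :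
    HasDerivAt (fun v => symMat (f v)) (symMat f') v := by
  rw [hasDerivAt_matrix]
  have hre := Complex.reCLM.hasFDerivAt.comp_hasDerivAt v hf
  have him := Complex.imCLM.hasFDerivAt.comp_hasDerivAt v hf
  intro i j
  fin_cases i <;> fin_cases j
  · exact hre
  · exact him
  · exact him
  · exact hre.neg

theorem hasDerivAt_parConn (h : IsParallel m m₁ χ p p₁) (x : X) (r t : ℝ) :
    HasDerivAt (fun r => parConn p x r t) (parConnDeriv p p₁ x r t) r := by
  have h1 : HasDerivAt (fun r => p x (r * Real.sin t)) (Real.sin t * p₁ x (r * Real.sin t)) r := by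
    have h2 : HasDerivAt (fun r : ℝ => r * Real.sin t) (Real.sin t) r := by
      simpa using (hasDerivAt_id r).mul_const (Real.sin t)
    exact ((h.deriv_p x _).scomp r h2).congr_deriv (Complex.real_smul)
  have h3 := (hasDerivAt_id r).smul (hasDerivAt_symMat h1)
  have e : (fun r => parConn p x r t) = fun r => id r • symMat (p x (r * Real.sin t)) := by
    ext1 r; rw [parConn, gaugeConn_zero]; rfl
  rw [e]
  refine h3.congr_deriv ?_
  rw [parConnDeriv, one_smul, add_comm]
  rfl

theorem parConn_trace (p : X → ℝ → ℂ) (x : X) (r t : ℝ) : (parConn p x r t).trace = 0 :=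
  gaugeConn_trace _ _ _ _

variable [FirstCountableTopology X]

theorem continuous_parHol (h : IsParallel m m₁ χ p p₁) :
    Continuous fun y : X × ℝ × ℝ => parHol p y.1 y.2.1 y.2.2 :=
  (continuous_orderedExp_param (A := fun y : X × ℝ => parConn p y.1 y.2) h.continuous_parConn
    (Real.pi / 2)).comp (f := fun y : X × ℝ × ℝ => ((y.1, y.2.1), y.2.2)) (by fun_prop)

theorem continuous_parHolDeriv (h : IsParallel m m₁ χ p p₁) :
    Continuous fun y : X × ℝ × ℝ => parHolDeriv p p₁ y.1 y.2.1 y.2.2 :=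
  (continuous_orderedExpDeriv (A := fun y : X × ℝ => parConn p y.1 y.2)
    (A' := fun y : X × ℝ => parConnDeriv p p₁ y.1 y.2) h.continuous_parConn
    h.continuous_parConnDeriv (Real.pi / 2)).comp
    (f := fun y : X × ℝ × ℝ => ((y.1, y.2.1), y.2.2)) (by fun_prop)

theorem hasDerivAt_parHol (h : IsParallel m m₁ χ p p₁) (x : X) (r t : ℝ) :
    HasDerivAt (fun r => parHol p x r t) (parHolDeriv p p₁ x r t) r :=
  hasDerivAt_orderedExp_param (A := parConn p x) (A' := parConnDeriv p p₁ x)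
    (h.continuous_parConn.comp (f := fun y : ℝ × ℝ => ((x, y.1), y.2)) (by fun_prop))
    (h.continuous_parConnDeriv.comp (f := fun y : ℝ × ℝ => ((x, y.1), y.2)) (by fun_prop))
    (h.hasDerivAt_parConn x) (parConn_trace p x) (Real.pi / 2) r t

end IsParallel

/-- Half of the response at a point of a generator. -/
def parResponse {X : Type*} (m : X → ℝ → ℂ) (χ : X → ℝ → ℝ) (p : X → ℝ → ℂ) (s : Mat2)
    (x : X) (r t : ℝ) : Mat2 :=
  response (gaugeZweibein (m x 0) (χ x 0)) (parHol p x r 0) (parHol p x r t) s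

/-- The derivative of `parResponse` with respect to `r`. -/
def parResponseDeriv {X : Type*} (m : X → ℝ → ℂ) (χ : X → ℝ → ℝ) (p p₁ : X → ℝ → ℂ) (s : Mat2)
    (x : X) (r t : ℝ) : Mat2 :=
  responseDeriv (gaugeZweibein (m x 0) (χ x 0)) (parHol p x r 0) (parHolDeriv p p₁ x r 0)
    (parHol p x r t) (parHolDeriv p p₁ x r t) s

/-- Twice a component of the symmetric part of a matrix. -/
def symEntry (i j : Fin 2) (M : Mat2) : ℝ := M i j + M j i

theorem continuous_symEntry (i j : Fin 2) : Continuous (symEntry i j) := by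
  unfold symEntry; fun_prop

theorem hasDerivAt_symEntry (i j : Fin 2) {M : ℝ → Mat2} {M' : Mat2} {t : ℝ}
    (h : HasDerivAt M M' t) : HasDerivAt (fun x => symEntry i j (M x)) (symEntry i j M') t :=
  (hasDerivAt_matrix.1 h i j).add (hasDerivAt_matrix.1 h j i)

theorem symEntry_add (i j : Fin 2) (M N : Mat2) :
    symEntry i j (M + N) = symEntry i j M + symEntry i j N := by
  simp only [symEntry, Matrix.add_apply]; ring

theorem symEntry_smul (i j : Fin 2) (k : ℝ) (M : Mat2) :
    symEntry i j (k • M) = k * symEntry i j M := by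
  simp only [symEntry, Matrix.smul_apply, smul_eq_mul]; ring

namespace IsParallel

variable {X : Type*} [TopologicalSpace X] [FirstCountableTopology X]
  {m m₁ p p₁ : X → ℝ → ℂ} {χ : X → ℝ → ℝ}

theorem continuous_V (h : IsParallel m m₁ χ p p₁) :
    Continuous fun x => gaugeZweibein (m x 0) (χ x 0) :=
  continuous_gaugeZweibein (h.cont_m.comp (f := fun y : X => (y, (0 : ℝ))) (by fun_prop))
      (h.cont_χ.comp (f := fun y : X => (y, (0 : ℝ))) (by fun_prop)) fun y => h.norm_lt _ _

theorem continuous_parResponse (h : IsParallel m m₁ χ p p₁) (s : Mat2) :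
    Continuous fun y : X × ℝ × ℝ => parResponse m χ p s y.1 y.2.1 y.2.2 :=
  continuous_response s (h.continuous_V.comp continuous_fst)
    (h.continuous_parHol.comp (f := fun y : X × ℝ × ℝ => (y.1, y.2.1, (0 : ℝ))) (by fun_prop))
    h.continuous_parHol

theorem continuous_parResponseDeriv (h : IsParallel m m₁ χ p p₁) (s : Mat2) :
    Continuous fun y : X × ℝ × ℝ => parResponseDeriv m χ p p₁ s y.1 y.2.1 y.2.2 :=
  continuous_responseDeriv s (h.continuous_V.comp continuous_fst)
    (h.continuous_parHol.comp (f := fun y : X × ℝ × ℝ => (y.1, y.2.1, (0 : ℝ))) (by fun_prop))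
    (h.continuous_parHolDeriv.comp (f := fun y : X × ℝ × ℝ => (y.1, y.2.1, (0 : ℝ))) (by fun_prop))
    h.continuous_parHol h.continuous_parHolDeriv

theorem hasDerivAt_parResponse (h : IsParallel m m₁ χ p p₁) (s : Mat2) (x : X) (r t : ℝ) :
    HasDerivAt (fun r => parResponse m χ p s x r t) (parResponseDeriv m χ p p₁ s x r t) r :=
  hasDerivAt_response (h.hasDerivAt_parHol x r 0) (h.hasDerivAt_parHol x r t)

/-- The holonomy from the caustic does not depend on t, so only the conjugation Y⁻¹ s Y is
differentiated, and this gives the commutator of the connection with s. -/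
theorem hasDerivAt_parResponse_angle (h : IsParallel m m₁ χ p p₁) (s : Mat2) (x : X) (r t : ℝ) :
    HasDerivAt (fun t => parResponse m χ p s x r t)
      (parResponse m χ p (parConn p x r t * s - s * parConn p x r t) x r t) t := by
  have hA : Continuous (parConn p x r) := h.continuous_conn_right x r
  have h1 := hasDerivAt_adjugate_orderedExp hA (parConn_trace p x r) (Real.pi / 2) t
  have h2 := hasDerivAt_orderedExp hA (Real.pi / 2) t
  have h3 := (((h1.mul_const s).mul h2).const_mul
    (gaugeZweibein (m x 0) (χ x 0) * parHol p x r 0)).mul_const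
      (gaugeZweibein (m x 0) (χ x 0) * parHol p x r 0).transpose
  refine h3.congr_deriv ?_
  rw [parResponse, response]
  congr 2
  rw [parHol]
  noncomm_ring

/-- In the parallel gauge the connection is symmetric and traceless. Its commutators exchange the
two symmetric generators with the rotation generator, so that the three responses satisfy a closed
linear system with p as the only coefficient. -/
theorem deriv_one (p : X → ℝ → ℂ) (x : X) (r t : ℝ) :
    parConn p x r t * symMat 1 - symMat 1 * parConn p x r t =
      (-(2 * r * (p x (r * Real.sin t)).im)) • epsMat := by
  rw [parConn, gaugeConn_zero, smul_mul_assoc, mul_smul_comm, ← smul_sub, commutator_symMat,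
    smul_smul]
  congr 1
  simp
  ring

theorem deriv_I (p : X → ℝ → ℂ) (x : X) (r t : ℝ) :
    parConn p x r t * symMat Complex.I - symMat Complex.I * parConn p x r t =
      (2 * r * (p x (r * Real.sin t)).re) • epsMat := by
  rw [parConn, gaugeConn_zero, smul_mul_assoc, mul_smul_comm, ← smul_sub, commutator_symMat,
    smul_smul]
  congr 1
  simp
  ring

theorem deriv_eps (p : X → ℝ → ℂ) (x : X) (r t : ℝ) :
    parConn p x r t * epsMat - epsMat * parConn p x r t =
      (-(2 * r * (p x (r * Real.sin t)).im)) • symMat 1 +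
        (2 * r * (p x (r * Real.sin t)).re) • symMat Complex.I := by
  rw [parConn, gaugeConn_zero, smul_mul_assoc, mul_smul_comm, ← smul_sub, commutator_symMat_eps,
    smul_smul, symMat_eq_sum, smul_add, smul_smul, smul_smul]
  congr 2 <;> simp only [Complex.mul_re, Complex.mul_im, Complex.I_re, Complex.I_im] <;> ring

end IsParallel

/-! ### The components of the response as amplitudes -/

/-- The complex amplitude of the response. -/
def ampC {X : Type*} (m : X → ℝ → ℂ) (χ : X → ℝ → ℝ) (p : X → ℝ → ℂ) (i j : Fin 2)
    (x : X) (r t : ℝ) : ℂ :=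
  ⟨symEntry i j (parResponse m χ p (symMat 1) x r t),
    symEntry i j (parResponse m χ p (symMat Complex.I) x r t)⟩

/-- The derivative of `ampC` with respect to `r`. -/
def ampCDeriv {X : Type*} (m : X → ℝ → ℂ) (χ : X → ℝ → ℝ) (p p₁ : X → ℝ → ℂ) (i j : Fin 2)
    (x : X) (r t : ℝ) : ℂ :=
  ⟨symEntry i j (parResponseDeriv m χ p p₁ (symMat 1) x r t),
    symEntry i j (parResponseDeriv m χ p p₁ (symMat Complex.I) x r t)⟩

/-- The real amplitude of the response. -/
def ampD {X : Type*} (m : X → ℝ → ℂ) (χ : X → ℝ → ℝ) (p : X → ℝ → ℂ) (i j : Fin 2)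
    (x : X) (r t : ℝ) : ℝ :=
  symEntry i j (parResponse m χ p epsMat x r t)

/-- The derivative of `ampD` with respect to `r`. -/
def ampDDeriv {X : Type*} (m : X → ℝ → ℂ) (χ : X → ℝ → ℝ) (p p₁ : X → ℝ → ℂ) (i j : Fin 2)
    (x : X) (r t : ℝ) : ℝ :=
  symEntry i j (parResponseDeriv m χ p p₁ epsMat x r t)

theorem continuous_complex_mk {Y : Type*} [TopologicalSpace Y] {f g : Y → ℝ} (hf : Continuous f)
    (hg : Continuous g) : Continuous fun y => (⟨f y, g y⟩ : ℂ) :=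
  Complex.equivRealProdCLM.symm.continuous.comp (hf.prodMk hg)

theorem hasDerivAt_complex_mk {f g : ℝ → ℝ} {f' g' t : ℝ} (hf : HasDerivAt f f' t)
    (hg : HasDerivAt g g' t) : HasDerivAt (fun y => (⟨f y, g y⟩ : ℂ)) ⟨f', g'⟩ t := by
  have := (Complex.equivRealProdCLM.symm : ℝ × ℝ →L[ℝ] ℂ).hasFDerivAt.comp_hasDerivAt t
    (hf.prodMk hg)
  exact this

/-- The smeared response is an amplitude. -/
theorem IsParallel.isAmplitude {X : Type*} [TopologicalSpace X] [FirstCountableTopology X]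
    {m m₁ p p₁ : X → ℝ → ℂ} {χ : X → ℝ → ℝ} (h : IsParallel m m₁ χ p p₁) {φ φ₁ : X → ℝ → ℝ}
    {a b : ℝ} (ha : 0 < a) (hb : b < 1) (hφ : Continuous fun y : X × ℝ => φ y.1 y.2)
    (hφ₁ : Continuous fun y : X × ℝ => φ₁ y.1 y.2) (hd : ∀ x r, HasDerivAt (φ x) (φ₁ x r) r)
    (hz : ∀ x r, r ∉ Icc a b → φ x r = 0) (hz₁ : ∀ x r, r ∉ Icc a b → φ₁ x r = 0) (i j : Fin 2) :
    IsAmplitude p a b (fun x r t => φ x r • ampC m χ p i j x r t)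
      (fun x r t => φ x r • ampCDeriv m χ p p₁ i j x r t + φ₁ x r • ampC m χ p i j x r t)
      (fun x r t => φ x r • ampD m χ p i j x r t)
      (fun x r t => φ x r • ampDDeriv m χ p p₁ i j x r t + φ₁ x r • ampD m χ p i j x r t) := by
  have hφ' : Continuous fun y : X × ℝ × ℝ => φ y.1 y.2.1 :=
    hφ.comp (f := fun y : X × ℝ × ℝ => (y.1, y.2.1)) (by fun_prop)
  have hφ₁' : Continuous fun y : X × ℝ × ℝ => φ₁ y.1 y.2.1 :=
    hφ₁.comp (f := fun y : X × ℝ × ℝ => (y.1, y.2.1)) (by fun_prop)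
  have cS := fun s => (continuous_symEntry i j).comp (h.continuous_parResponse s)
  have cS' := fun s => (continuous_symEntry i j).comp (h.continuous_parResponseDeriv s)
  have cC : Continuous fun y : X × ℝ × ℝ => ampC m χ p i j y.1 y.2.1 y.2.2 :=
    continuous_complex_mk (cS _) (cS _)
  have cC' : Continuous fun y : X × ℝ × ℝ => ampCDeriv m χ p p₁ i j y.1 y.2.1 y.2.2 :=
    continuous_complex_mk (cS' _) (cS' _)
  have cD : Continuous fun y : X × ℝ × ℝ => ampD m χ p i j y.1 y.2.1 y.2.2 := cS _
  have cD' : Continuous fun y : X × ℝ × ℝ => ampDDeriv m χ p p₁ i j y.1 y.2.1 y.2.2 := cS' _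
  refine ⟨ha, hb, h.cont_p, hφ'.smul cC, (hφ'.smul cC').add (hφ₁'.smul cC), hφ'.smul cD,
    (hφ'.smul cD').add (hφ₁'.smul cD), fun x r t => ?_, fun x r t => ?_, fun x r t => ?_,
    fun x r t => ?_, fun x r => ?_, fun x r hr t => ?_, fun x r hr t => ?_, fun x r hr t => ?_⟩
  · exact (hd x r).smul (hasDerivAt_complex_mk (hasDerivAt_symEntry i j
      (h.hasDerivAt_parResponse _ x r t)) (hasDerivAt_symEntry i j
      (h.hasDerivAt_parResponse _ x r t)))
  · exact (hd x r).smul (hasDerivAt_symEntry i j (h.hasDerivAt_parResponse _ x r t))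
  · have h1 := hasDerivAt_symEntry i j (h.hasDerivAt_parResponse_angle (symMat 1) x r t)
    have h2 := hasDerivAt_symEntry i j (h.hasDerivAt_parResponse_angle (symMat Complex.I) x r t)
    refine ((hasDerivAt_complex_mk h1 h2).const_smul (φ x r)).congr_deriv ?_
    simp only [IsParallel.deriv_one, IsParallel.deriv_I, parResponse, response_smul, symEntry_smul,
      ampD]
    apply Complex.ext <;> simp <;> ring
  · have h1 := hasDerivAt_symEntry i j (h.hasDerivAt_parResponse_angle epsMat x r t)
    refine (h1.const_smul (φ x r)).congr_deriv ?_
    simp only [IsParallel.deriv_eps, parResponse, response_smul, response_add, symEntry_smul,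
      symEntry_add, ampC, smul_eq_mul]
    simp
    ring
  -- At the deformation point the holonomy Y is 1, and the response to the rotation generator is an
  -- antisymmetric matrix, which has no symmetric part.
  · have e : ampD m χ p i j x r (Real.pi / 2) = 0 := by
      have h1 : parHol p x r (Real.pi / 2) = 1 := orderedExp_self _
      have h2 : (parResponse m χ p epsMat x r (Real.pi / 2)).transpose =
          -parResponse m χ p epsMat x r (Real.pi / 2) := by
        rw [parResponse, response, h1]
        simp only [Matrix.adjugate_one, one_mul, mul_one, Matrix.transpose_mul,
          Matrix.transpose_transpose, epsMat_transpose]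
        noncomm_ring
      have h3 := congrFun (congrFun h2 i) j
      rw [Matrix.transpose_apply, Matrix.neg_apply] at h3
      rw [ampD, symEntry, h3, add_neg_cancel]
    rw [e, smul_zero]
  · rw [hz x r hr, zero_smul]
  · rw [hz x r hr, hz₁ x r hr, zero_smul, zero_smul, add_zero]
  · rw [hz x r hr, zero_smul]

/-! ### The invariant pairing at the caustic -/

/-- The sum on the left is the Casimir element of sl(2), with the sign given by the signature (+, +,
-) of the trace form. It is invariant under conjugation, which makes the right side independent of
V. -/
theorem casimir {V : Mat2} (hV : V.det = 1) (i j k l : Fin 2) :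
    (V * symMat 1 * V.adjugate) i j * (V * symMat 1 * V.adjugate) k l +
      (V * symMat Complex.I * V.adjugate) i j * (V * symMat Complex.I * V.adjugate) k l -
      (V * epsMat * V.adjugate) i j * (V * epsMat * V.adjugate) k l = 8 * omegaTensor i j k l := by
  rw [Matrix.det_fin_two] at hV
  fin_cases i <;> fin_cases j <;> fin_cases k <;> fin_cases l <;>
    simp [Matrix.mul_apply, Matrix.adjugate_fin_two, Fin.sum_univ_two, symMat, epsMat, omegaTensor,
      kron] <;>
    grind

/-- Multilinearity: each of the two symmetrizations doubles the number of terms, which accounts for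
the four summands of the quadratic tensor. Symmetry of E₁ and E₂ brings their indices into the
required order. -/
theorem quadraticTensor_eq {T₁ T₂ T₃ E₁ E₂ : Mat2} (h₁ : E₁.transpose = E₁)
    (h₂ : E₂.transpose = E₂)
    (hC : ∀ i j k l, T₁ i j * T₁ k l + T₂ i j * T₂ k l - T₃ i j * T₃ k l = 8 * omegaTensor i j k l)
    (a b c d : Fin 2) :
    symEntry a b (T₁ * E₁) * symEntry c d (T₁ * E₂) +
      symEntry a b (T₂ * E₁) * symEntry c d (T₂ * E₂) -
      symEntry a b (T₃ * E₁) * symEntry c d (T₃ * E₂) = 8 * quadraticTensor E₁ E₂ a b c d := by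
  have s₁ : ∀ i j, E₁ i j = E₁ j i := fun i j => congrFun (congrFun h₁ j) i
  have s₂ : ∀ i j, E₂ i j = E₂ j i := fun i j => congrFun (congrFun h₂ j) i
  simp only [symEntry, Matrix.mul_apply, quadraticTensor, Fin.sum_univ_two, s₁ a 0, s₁ a 1,
    s₂ c 0, s₂ c 1]
  linear_combination E₁ 0 b * E₂ 0 d * hC a 0 c 0 + E₁ 0 b * E₂ 1 d * hC a 0 c 1 +
    E₁ 1 b * E₂ 0 d * hC a 1 c 0 + E₁ 1 b * E₂ 1 d * hC a 1 c 1 +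
    E₁ 0 a * E₂ 0 d * hC b 0 c 0 + E₁ 0 a * E₂ 1 d * hC b 0 c 1 +
    E₁ 1 a * E₂ 0 d * hC b 1 c 0 + E₁ 1 a * E₂ 1 d * hC b 1 c 1 +
    E₁ 0 b * E₂ 0 c * hC a 0 d 0 + E₁ 0 b * E₂ 1 c * hC a 0 d 1 +
    E₁ 1 b * E₂ 0 c * hC a 1 d 0 + E₁ 1 b * E₂ 1 c * hC a 1 d 1 +
    E₁ 0 a * E₂ 0 c * hC b 0 d 0 + E₁ 0 a * E₂ 1 c * hC b 0 d 1 +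
    E₁ 1 a * E₂ 0 c * hC b 1 d 0 + E₁ 1 a * E₂ 1 c * hC b 1 d 1

theorem quadraticTensor_eq_explicit {E₁ E₂ : Mat2} (h₁ : E₁.transpose = E₁)
    (h₂ : E₂.transpose = E₂) (a b c d : Fin 2) :
    quadraticTensor E₁ E₂ a b c d = quadraticExplicit E₁ E₂ a b c d := by
  have s₁ : E₁ 1 0 = E₁ 0 1 := congrFun (congrFun h₁ 0) 1
  have s₂ : E₂ 1 0 = E₂ 0 1 := congrFun (congrFun h₂ 0) 1
  fin_cases a <;> fin_cases b <;> fin_cases c <;> fin_cases d <;>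
    simp [quadraticTensor, quadraticExplicit, symPairs, omegaTensor, kron, Fin.sum_univ_two, s₁,
      s₂] <;> ring

theorem parallelE_transpose {X : Type*} (m : X → ℝ → ℂ) (χ : X → ℝ → ℝ) (p : X → ℝ → ℂ) (x : X)
    (r : ℝ) : (parallelE m χ p x r).transpose = parallelE m χ p x r := by
  rw [parallelE, orderedMetric, Matrix.transpose_mul, Matrix.transpose_transpose]

/-- At the caustic the holonomies cancel: V Y₀ (Y₀⁻¹ s Y₀) = (V s V⁻¹) V Y₀. The dependence on r is
then carried by E(r) alone. -/
theorem IsParallel.parResponse_zero {X : Type*} [TopologicalSpace X]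
    {m m₁ p p₁ : X → ℝ → ℂ} {χ : X → ℝ → ℝ} (h : IsParallel m m₁ χ p p₁) (s : Mat2) (x : X)
    (r : ℝ) : parResponse m χ p s x r 0 =
      gaugeZweibein (m x 0) (χ x 0) * s * (gaugeZweibein (m x 0) (χ x 0)).adjugate *
        parallelE m χ p x r := by
  rw [parResponse, response, parallelE, orderedMetric]
  set V := gaugeZweibein (m x 0) (χ x 0) with hV
  change V * parHol p x r 0 * _ * _ =
    V * s * V.adjugate * (V * parHol p x r 0 * (V * parHol p x r 0).transpose)
  have h1 : parHol p x r 0 * (parHol p x r 0).adjugate = 1 :=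
    orderedExp_mul_adjugate (h.continuous_conn_right x r) (gaugeConn_trace _ _ _) _ _
  have h2 : V.adjugate * V = 1 := by rw [Matrix.adjugate_mul, h.det_zweibein, one_smul]
  have e1 : V * parHol p x r 0 * ((parHol p x r 0).adjugate * s * parHol p x r 0) =
      V * (parHol p x r 0 * (parHol p x r 0).adjugate) * s * parHol p x r 0 := by noncomm_ring
  have e2 : V * s * V.adjugate * (V * parHol p x r 0 * (V * parHol p x r 0).transpose) =
      V * s * (V.adjugate * V) * parHol p x r 0 * (V * parHol p x r 0).transpose := by noncomm_ring
  rw [e1, h1, e2, h2, mul_one, mul_one]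

/-- The Casimir identity is applied to the conjugated generators V s V⁻¹, which are common to both
deformation points because they belong to the same caustic point. -/
theorem IsParallel.causticPairing_eq {X : Type*} [TopologicalSpace X]
    {m m₁ p p₁ : X → ℝ → ℂ} {χ : X → ℝ → ℝ} (h : IsParallel m m₁ χ p p₁) (φ ψ : X → ℝ → ℝ)
    (i j k l : Fin 2) (x : X) (r₁ r₂ : ℝ) :
    IsAmplitude.causticPairing (fun r t => φ x r • ampC m χ p i j x r t)
      (fun r t => φ x r • ampD m χ p i j x r t) (fun r t => ψ x r • ampC m χ p k l x r t)
      (fun r t => ψ x r • ampD m χ p k l x r t) r₁ r₂ =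
    φ x r₁ * ψ x r₂ * (8 * quadraticTensor (parallelE m χ p x r₁) (parallelE m χ p x r₂) i j k l) := by
  rw [← quadraticTensor_eq (parallelE_transpose m χ p x r₁) (parallelE_transpose m χ p x r₂)
    (casimir (h.det_zweibein x)), IsAmplitude.causticPairing, real_inner_smul_left,
    real_inner_smul_right, Complex.inner]
  simp only [ampC, ampD, h.parResponse_zero, smul_eq_mul, Complex.mul_re, Complex.conj_re,
    Complex.conj_im]
  ring

end

/-! ### The variation of `E` -/

/-- The symmetric part of a flatness condition: varying the connection of a zweibein is the same as
differentiating the infinitesimal change of the zweibein covariantly. The last term is the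
commutator with the rotation that this change contains. `gaugeQ_variation` is the antisymmetric
part. -/
theorem gaugeP_variation {m : ℂ} (hm : ‖m‖ < 1) (m₁ η η₁ : ℂ) (χ : ℝ) :
    gaugePDeriv m η m₁ η₁ χ 0 = gaugePDeriv m m₁ η η₁ χ (gaugeQ m m₁) -
      2 * (gaugeQ m η : ℂ) * (Complex.I * gaugeP m m₁ χ) := by
  have hg := one_sub_norm_sq_pos hm
  have hgc : (1 - (‖m‖ : ℂ) ^ 2) ≠ 0 := by exact_mod_cast hg.ne'
  have h1 : ∀ z : ℂ, ((2 * (conj m * z).re : ℝ) : ℂ) = conj m * z + m * conj z := fun z => by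
    apply Complex.ext <;> simp <;> ring
  have h2 : ∀ z : ℂ, ((2 * (conj m * z).im : ℝ) : ℂ) * Complex.I = conj m * z - m * conj z :=
    fun z => by apply Complex.ext <;> simp; ring
  have e1 := h1 η
  have e2 := h1 m₁
  have e3 := h2 η
  have e4 := h2 m₁
  simp only [gaugePDeriv, gaugeP, gaugeQ]
  push_cast at e1 e2 e3 e4 ⊢
  field_simp
  linear_combination m₁ * e1 - η * e4 - η * e2 + m₁ * e3

theorem gaugeQ_variation {m : ℂ} (hm : ‖m‖ < 1) (m₁ η η₁ : ℂ) (χ : ℝ) :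
    -gaugeQDeriv m η m₁ η₁ = 2 * (conj (gaugeP m m₁ χ) * gaugeP m η χ).im -
      gaugeQDeriv m m₁ η η₁ := by
  have hg := one_sub_norm_sq_pos hm
  have hE : conj (Complex.exp (2 * χ * Complex.I)) * Complex.exp (2 * χ * Complex.I) = 1 := by
    rw [← Complex.exp_conj, ← Complex.exp_add]
    simp [map_ofNat]
  have h1 : conj (gaugeP m m₁ χ) * gaugeP m η χ =
      (((1 - ‖m‖ ^ 2) ^ 2)⁻¹ : ℝ) * (conj m₁ * η) := by
    simp only [gaugeP, map_div₀, map_mul, Complex.conj_ofReal]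
    have hgc : ((1 - ‖m‖ ^ 2 : ℝ) : ℂ) ≠ 0 := by exact_mod_cast hg.ne'
    rw [Complex.ofReal_inv, Complex.ofReal_pow]
    field_simp
    linear_combination conj m₁ * η * hE
  have hn : ‖m‖ ^ 2 = m.re ^ 2 + m.im ^ 2 := by
    rw [← Complex.normSq_eq_norm_sq, Complex.normSq_apply]; ring
  rw [h1, Complex.im_ofReal_mul]
  simp only [gaugeQDeriv, gaugeQ, Complex.mul_im, Complex.mul_re, Complex.conj_re, Complex.conj_im]
  field_simp
  rw [hn]
  ring

/-! ### The varied field and its derivative -/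

section

attribute [local instance] Matrix.linftyOpNormedRing Matrix.linftyOpNormedAlgebra
  Matrix.linftyOpNormedAddCommGroup Matrix.linftyOpNormedSpace

/-- By Duhamel's formula only the values between the endpoints matter. This discards the artificial
continuation outside [0, 1]. -/
theorem orderedExp_congr {A B : ℝ → Mat2} (hA : Continuous A) (hB : Continuous B)
    (htr : ∀ t, (A t).trace = 0) {t T : ℝ} (htT : t ≤ T) (h : ∀ z ∈ Icc t T, A z = B z) :
    orderedExp A T t = orderedExp B T t := by
  rw [duhamel hA hB htr T t]
  have : ∫ z in t..T, (orderedExp A T z).adjugate * (B z - A z) * orderedExp B T z =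
      ∫ z in t..T, (0 : Mat2) := by
    refine intervalIntegral.integral_congr fun z hz => ?_
    rw [uIcc_of_le htT] at hz
    simp only [h z hz, sub_self, mul_zero, zero_mul]
  rw [this]
  simp

/-- A linear variation of a family of functions on generators. -/
def varM {X : Type*} (m η : X → ℝ → ℂ) (ε : ℝ → ℝ) (y : ℝ × X) (v : ℝ) : ℂ :=
  m y.2 v + (ε y.1 : ℂ) * η y.2 v

/-- A variation of a family of Beltrami coefficients in the parallel gauge. -/
structure IsVariationFamily {X : Type*} [TopologicalSpace X] (m m₁ : X → ℝ → ℂ) (χ : X → ℝ → ℝ)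
    (p p₁ η η₁ : X → ℝ → ℂ) (ε ε' : ℝ → ℝ) : Prop where
  base : IsParallel m m₁ χ p p₁
  cont_η : Continuous fun y : X × ℝ => η y.1 y.2
  cont_η₁ : Continuous fun y : X × ℝ => η₁ y.1 y.2
  deriv_η : ∀ x, ∀ v ∈ Ioo (0 : ℝ) 1, HasDerivAt (η x) (η₁ x v) v
  deriv_ε : ∀ s, HasDerivAt ε (ε' s) s
  cont_ε' : Continuous ε'
  ε_zero : ε 0 = 0
  ε'_zero : ε' 0 = 1
  norm_lt : ∀ y v, ‖varM m η ε y v‖ < 1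

section

variable {X : Type*} (m m₁ : X → ℝ → ℂ) (χ : X → ℝ → ℝ) (η η₁ : X → ℝ → ℂ) (ε ε' : ℝ → ℝ)

/-- The symmetric part of the varied connection. -/
def varP (y : ℝ × X) (v : ℝ) : ℂ := gaugeP (varM m η ε y v) (varM m₁ η₁ ε y v) (χ y.2 v)

/-- The antisymmetric part of the varied connection. -/
def varK (y : ℝ × X) (v : ℝ) : ℝ :=
  gaugeQ (m y.2 v) (m₁ y.2 v) - gaugeQ (varM m η ε y v) (varM m₁ η₁ ε y v)

/-- The derivative of `varP` along the variation. -/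
def varPDeriv (y : ℝ × X) (v : ℝ) : ℂ :=
  gaugePDeriv (varM m η ε y v) (ε' y.1 * η y.2 v) (varM m₁ η₁ ε y v) (ε' y.1 * η₁ y.2 v) (χ y.2 v) 0

/-- The derivative of `varK` along the variation. -/
def varKDeriv (y : ℝ × X) (v : ℝ) : ℝ :=
  -gaugeQDeriv (varM m η ε y v) (ε' y.1 * η y.2 v) (varM m₁ η₁ ε y v) (ε' y.1 * η₁ y.2 v)

/-- The varied connection. -/
def varConn (y : ℝ × X) (r t : ℝ) : Mat2 := gaugeConn (varP m m₁ χ η η₁ ε y) (varK m m₁ η η₁ ε y) r t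

/-- The derivative of `varConn` along the variation. -/
def varConnDeriv (y : ℝ × X) (r t : ℝ) : Mat2 :=
  gaugeConn (varPDeriv m m₁ χ η η₁ ε ε' y) (varKDeriv m m₁ η η₁ ε ε' y) r t

/-- The varied zweibein at the caustic. -/
def varV (y : ℝ × X) : Mat2 := gaugeZweibein (varM m η ε y 0) (χ y.2 0)

/-- The derivative of `varV` along the variation. -/
def varVDeriv (y : ℝ × X) : Mat2 :=
  varV m χ η ε y * (symMat (gaugeP (varM m η ε y 0) (ε' y.1 * η y.2 0) (χ y.2 0)) +
    (0 - gaugeQ (varM m η ε y 0) (ε' y.1 * η y.2 0)) • epsMat)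

/-- The varied `E`. -/
def varE (y : ℝ × X) (r : ℝ) : Mat2 := orderedMetric (varV m χ η ε y) (varConn m m₁ χ η η₁ ε y r)

/-- The varied deformed zweibein. -/
def varU (y : ℝ × X) (r : ℝ) : Mat2 :=
  varV m χ η ε y * orderedExp (varConn m m₁ χ η η₁ ε y r) (Real.pi / 2) 0

/-- The derivative of `varU` along the variation. -/
def varUDeriv (y : ℝ × X) (r : ℝ) : Mat2 :=
  varVDeriv m χ η ε ε' y * orderedExp (varConn m m₁ χ η η₁ ε y r) (Real.pi / 2) 0 +
    varV m χ η ε y * orderedExpDeriv (varConn m m₁ χ η η₁ ε y r) (varConnDeriv m m₁ χ η η₁ ε ε' y r)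
      (Real.pi / 2) 0

/-- The derivative of `varE` along the variation. -/
def varEDeriv (y : ℝ × X) (r : ℝ) : Mat2 :=
  varUDeriv m m₁ χ η η₁ ε ε' y r * (varU m m₁ χ η η₁ ε y r).transpose +
    varU m m₁ χ η η₁ ε y r * (varUDeriv m m₁ χ η η₁ ε ε' y r).transpose

end

namespace IsVariationFamily

variable {X : Type*} [TopologicalSpace X] {m m₁ p p₁ η η₁ : X → ℝ → ℂ} {χ : X → ℝ → ℝ}
  {ε ε' : ℝ → ℝ}

theorem cont_ε (h : IsVariationFamily m m₁ χ p p₁ η η₁ ε ε') : Continuous ε :=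
  continuous_iff_continuousAt.2 fun s => (h.deriv_ε s).continuousAt

theorem continuous_varM {f g : X → ℝ → ℂ} (h : IsVariationFamily m m₁ χ p p₁ η η₁ ε ε')
    (hf : Continuous fun y : X × ℝ => f y.1 y.2) (hg : Continuous fun y : X × ℝ => g y.1 y.2) :
    Continuous fun y : (ℝ × X) × ℝ => varM f g ε y.1 y.2 := by
  have h1 : Continuous fun y : (ℝ × X) × ℝ => (y.1.2, y.2) := by fun_prop
  have h2 : Continuous fun y : (ℝ × X) × ℝ => (ε y.1.1 : ℂ) :=
    Complex.continuous_ofReal.comp (h.cont_ε.comp (by fun_prop))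
  exact (hf.comp h1).add (h2.mul (hg.comp h1))

theorem continuous_ε'_mul {g : X → ℝ → ℂ} (h : IsVariationFamily m m₁ χ p p₁ η η₁ ε ε')
    (hg : Continuous fun y : X × ℝ => g y.1 y.2) :
    Continuous fun y : (ℝ × X) × ℝ => (ε' y.1.1 : ℂ) * g y.1.2 y.2 := by
  have h1 : Continuous fun y : (ℝ × X) × ℝ => (y.1.2, y.2) := by fun_prop
  have h2 : Continuous fun y : (ℝ × X) × ℝ => (ε' y.1.1 : ℂ) :=
    Complex.continuous_ofReal.comp (h.cont_ε'.comp (by fun_prop))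
  exact h2.mul (hg.comp h1)

theorem continuous_χ (h : IsVariationFamily m m₁ χ p p₁ η η₁ ε ε') :
    Continuous fun y : (ℝ × X) × ℝ => χ y.1.2 y.2 :=
  h.base.cont_χ.comp (f := fun y : (ℝ × X) × ℝ => (y.1.2, y.2)) (by fun_prop)

theorem continuous_varP (h : IsVariationFamily m m₁ χ p p₁ η η₁ ε ε') :
    Continuous fun y : (ℝ × X) × ℝ => varP m m₁ χ η η₁ ε y.1 y.2 :=
  continuous_gaugeP (h.continuous_varM h.base.cont_m h.cont_η)
    (h.continuous_varM h.base.cont_m₁ h.cont_η₁) h.continuous_χ fun _ => h.norm_lt _ _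

theorem continuous_varK (h : IsVariationFamily m m₁ χ p p₁ η η₁ ε ε') :
    Continuous fun y : (ℝ × X) × ℝ => varK m m₁ η η₁ ε y.1 y.2 := by
  have h1 : Continuous fun y : (ℝ × X) × ℝ => (y.1.2, y.2) := by fun_prop
  exact (continuous_gaugeQ (h.base.cont_m.comp h1) (h.base.cont_m₁.comp h1)
    fun y => h.base.norm_lt _ _).sub
    (continuous_gaugeQ (h.continuous_varM h.base.cont_m h.cont_η)
    (h.continuous_varM h.base.cont_m₁ h.cont_η₁) fun _ => h.norm_lt _ _)

theorem continuous_varPDeriv (h : IsVariationFamily m m₁ χ p p₁ η η₁ ε ε') :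
    Continuous fun y : (ℝ × X) × ℝ => varPDeriv m m₁ χ η η₁ ε ε' y.1 y.2 :=
  continuous_gaugePDeriv (h.continuous_varM h.base.cont_m h.cont_η) (h.continuous_ε'_mul h.cont_η)
    (h.continuous_varM h.base.cont_m₁ h.cont_η₁) (h.continuous_ε'_mul h.cont_η₁) h.continuous_χ
    continuous_const fun _ => h.norm_lt _ _

theorem continuous_varKDeriv (h : IsVariationFamily m m₁ χ p p₁ η η₁ ε ε') :
    Continuous fun y : (ℝ × X) × ℝ => varKDeriv m m₁ η η₁ ε ε' y.1 y.2 :=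
  (continuous_gaugeQDeriv (h.continuous_varM h.base.cont_m h.cont_η) (h.continuous_ε'_mul h.cont_η)
    (h.continuous_varM h.base.cont_m₁ h.cont_η₁) (h.continuous_ε'_mul h.cont_η₁)
    fun _ => h.norm_lt _ _).neg

theorem continuous_varConn (h : IsVariationFamily m m₁ χ p p₁ η η₁ ε ε') :
    Continuous fun y : ((ℝ × X) × ℝ) × ℝ => varConn m m₁ χ η η₁ ε y.1.1 y.1.2 y.2 :=
  (continuous_gaugeConn h.continuous_varP h.continuous_varK).comp
    (f := fun y : ((ℝ × X) × ℝ) × ℝ => (y.1.1, y.1.2, y.2)) (by fun_prop)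

theorem continuous_varConnDeriv (h : IsVariationFamily m m₁ χ p p₁ η η₁ ε ε') :
    Continuous fun y : ((ℝ × X) × ℝ) × ℝ => varConnDeriv m m₁ χ η η₁ ε ε' y.1.1 y.1.2 y.2 :=
  (continuous_gaugeConn h.continuous_varPDeriv h.continuous_varKDeriv).comp
    (f := fun y : ((ℝ × X) × ℝ) × ℝ => (y.1.1, y.1.2, y.2)) (by fun_prop)

theorem continuous_varV (h : IsVariationFamily m m₁ χ p p₁ η η₁ ε ε') :
    Continuous fun y : ℝ × X => varV m χ η ε y :=
  continuous_gaugeZweibein ((h.continuous_varM h.base.cont_m h.cont_η).comp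
      (f := fun y : ℝ × X => (y, (0 : ℝ))) (by fun_prop))
    (h.continuous_χ.comp (f := fun y : ℝ × X => (y, (0 : ℝ))) (by fun_prop)) fun _ => h.norm_lt _ _

theorem continuous_varVDeriv (h : IsVariationFamily m m₁ χ p p₁ η η₁ ε ε') :
    Continuous fun y : ℝ × X => varVDeriv m χ η ε ε' y := by
  have h0 : Continuous fun y : ℝ × X => (y, (0 : ℝ)) := by fun_prop
  have h1 := (h.continuous_varM h.base.cont_m h.cont_η).comp h0
  have h2 := (h.continuous_ε'_mul h.cont_η).comp h0
  exact h.continuous_varV.mul ((continuous_symMat.comp (continuous_gaugeP h1 h2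
    (h.continuous_χ.comp h0) fun _ => h.norm_lt _ _)).add ((continuous_const.sub
      (continuous_gaugeQ h1 h2 fun _ => h.norm_lt _ _)).smul continuous_const))

variable [FirstCountableTopology X]

theorem continuous_varE (h : IsVariationFamily m m₁ χ p p₁ η η₁ ε ε') :
    Continuous fun y : (ℝ × X) × ℝ => varE m m₁ χ η η₁ ε y.1 y.2 :=
  continuous_orderedMetric (V := fun y : (ℝ × X) × ℝ => varV m χ η ε y.1)
    (C := fun y : (ℝ × X) × ℝ => varConn m m₁ χ η η₁ ε y.1 y.2)
    (h.continuous_varV.comp continuous_fst) h.continuous_varConn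

theorem continuous_varEDeriv (h : IsVariationFamily m m₁ χ p p₁ η η₁ ε ε') :
    Continuous fun y : (ℝ × X) × ℝ => varEDeriv m m₁ χ η η₁ ε ε' y.1 y.2 := by
  have h0 : Continuous fun y : (ℝ × X) × ℝ => (y, (0 : ℝ)) := by fun_prop
  have hY := (continuous_orderedExp_param
    (A := fun y : (ℝ × X) × ℝ => varConn m m₁ χ η η₁ ε y.1 y.2) h.continuous_varConn
    (Real.pi / 2)).comp h0
  have hY' := (continuous_orderedExpDeriv
    (A := fun y : (ℝ × X) × ℝ => varConn m m₁ χ η η₁ ε y.1 y.2)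
    (A' := fun y : (ℝ × X) × ℝ => varConnDeriv m m₁ χ η η₁ ε ε' y.1 y.2) h.continuous_varConn
    h.continuous_varConnDeriv (Real.pi / 2)).comp h0
  have hV := h.continuous_varV.comp (continuous_fst (X := ℝ × X) (Y := ℝ))
  have hV' := h.continuous_varVDeriv.comp (continuous_fst (X := ℝ × X) (Y := ℝ))
  have hU := hV.mul hY
  have hU' := (hV'.mul hY).add (hV.mul hY')
  exact (hU'.mul hU.matrix_transpose).add (hU.mul hU'.matrix_transpose)

theorem hasDerivAt_varM {f g : X → ℝ → ℂ} (h : IsVariationFamily m m₁ χ p p₁ η η₁ ε ε') (x : X)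
    (s v : ℝ) : HasDerivAt (fun s => varM f g ε (s, x) v) (ε' s * g x v) s :=
  ((h.deriv_ε s).ofReal_comp.mul_const (g x v)).const_add (f x v)

theorem hasDerivAt_varConn (h : IsVariationFamily m m₁ χ p p₁ η η₁ ε ε') (x : X) (r s t : ℝ) :
    HasDerivAt (fun s => varConn m m₁ χ η η₁ ε (s, x) r t)
      (varConnDeriv m m₁ χ η η₁ ε ε' (s, x) r t) s := by
  have hP : ∀ v, HasDerivAt (fun s => varP m m₁ χ η η₁ ε (s, x) v)
      (varPDeriv m m₁ χ η η₁ ε ε' (s, x) v) s := fun v =>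
    hasDerivAt_gaugeP (h.hasDerivAt_varM x s v) (h.hasDerivAt_varM x s v)
      (hasDerivAt_const s (χ x v)) (h.norm_lt _ _)
  have hK : ∀ v, HasDerivAt (fun s => varK m m₁ η η₁ ε (s, x) v)
      (varKDeriv m m₁ η η₁ ε ε' (s, x) v) s := fun v => by
    have := (hasDerivAt_gaugeQ (h.hasDerivAt_varM (f := m) (g := η) x s v)
      (h.hasDerivAt_varM (f := m₁) (g := η₁) x s v) (h.norm_lt _ _)).const_sub
        (gaugeQ (m x v) (m₁ x v))
    exact this
  exact ((((hK _).smul_const epsMat).const_smul (Real.cos t)).add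
    (IsParallel.hasDerivAt_symMat (hP _))).const_smul r

theorem hasDerivAt_varV (h : IsVariationFamily m m₁ χ p p₁ η η₁ ε ε') (x : X) (s : ℝ) :
    HasDerivAt (fun s => varV m χ η ε (s, x)) (varVDeriv m χ η ε ε' (s, x)) s :=
  hasDerivAt_gaugeZweibein (h.hasDerivAt_varM x s 0) (hasDerivAt_const s (χ x 0)) (h.norm_lt _ _)

theorem hasDerivAt_orderedExp_varConn (h : IsVariationFamily m m₁ χ p p₁ η η₁ ε ε') (x : X)
    (r s : ℝ) :
    HasDerivAt (fun s => orderedExp (varConn m m₁ χ η η₁ ε (s, x) r) (Real.pi / 2) 0)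
      (orderedExpDeriv (varConn m m₁ χ η η₁ ε (s, x) r) (varConnDeriv m m₁ χ η η₁ ε ε' (s, x) r)
        (Real.pi / 2) 0) s := by
  have hc : Continuous fun y : ℝ × ℝ => (((y.1, x), r), y.2) := by fun_prop
  have h1 : Continuous fun y : ℝ × ℝ => varConn m m₁ χ η η₁ ε (y.1, x) r y.2 :=
    h.continuous_varConn.comp (f := fun y : ℝ × ℝ => (((y.1, x), r), y.2)) hc
  have h2 : Continuous fun y : ℝ × ℝ => varConnDeriv m m₁ χ η η₁ ε ε' (y.1, x) r y.2 :=
    h.continuous_varConnDeriv.comp (f := fun y : ℝ × ℝ => (((y.1, x), r), y.2)) hc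
  have h3 : ∀ s t, (varConn m m₁ χ η η₁ ε (s, x) r t).trace = 0 :=
    fun _ _ => gaugeConn_trace _ _ _ _
  exact hasDerivAt_orderedExp_param (A := fun s => varConn m m₁ χ η η₁ ε (s, x) r)
    (A' := fun s => varConnDeriv m m₁ χ η η₁ ε ε' (s, x) r) h1 h2 (h.hasDerivAt_varConn x r) h3
    (Real.pi / 2) s 0

theorem hasDerivAt_varE (h : IsVariationFamily m m₁ χ p p₁ η η₁ ε ε') (x : X) (r s : ℝ) :
    HasDerivAt (fun s => varE m m₁ χ η η₁ ε (s, x) r)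
      (varEDeriv m m₁ χ η η₁ ε ε' (s, x) r) s := by
  have hU : HasDerivAt (fun s => varU m m₁ χ η η₁ ε (s, x) r)
      (varUDeriv m m₁ χ η η₁ ε ε' (s, x) r) s :=
    (h.hasDerivAt_varV x s).mul (h.hasDerivAt_orderedExp_varConn x r s)
  exact hU.mul (hasDerivAt_transpose hU)

end IsVariationFamily

/-- The function that the functional derivative is integrated against. -/
def varY {X : Type*} (m : X → ℝ → ℂ) (χ : X → ℝ → ℝ) (η : X → ℝ → ℂ) (x : X) (v : ℝ) : ℂ :=
  v * gaugeP (m x v) (η x v) (χ x v)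

/-- The derivative of `varY` along the generator. -/
def varYDeriv {X : Type*} (m m₁ : X → ℝ → ℂ) (χ : X → ℝ → ℝ) (η η₁ : X → ℝ → ℂ) (x : X)
    (v : ℝ) : ℂ :=
  gaugeP (m x v) (η x v) (χ x v) + v * gaugePDeriv (m x v) (m₁ x v) (η x v) (η₁ x v) (χ x v)
    (gaugeQ (m x v) (m₁ x v))

namespace IsVariationFamily

variable {X : Type*} [TopologicalSpace X] {m m₁ p p₁ η η₁ : X → ℝ → ℂ} {χ : X → ℝ → ℝ}
  {ε ε' : ℝ → ℝ}

theorem continuous_varY (h : IsVariationFamily m m₁ χ p p₁ η η₁ ε ε') :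
    Continuous fun y : X × ℝ => varY m χ η y.1 y.2 := by
  have h1 := continuous_gaugeP h.base.cont_m h.cont_η h.base.cont_χ fun y => h.base.norm_lt _ _
  have h2 : Continuous fun y : X × ℝ => (y.2 : ℂ) := by fun_prop
  exact h2.mul h1

theorem continuous_varYDeriv (h : IsVariationFamily m m₁ χ p p₁ η η₁ ε ε') :
    Continuous fun y : X × ℝ => varYDeriv m m₁ χ η η₁ y.1 y.2 := by
  have h1 := continuous_gaugeP h.base.cont_m h.cont_η h.base.cont_χ fun y => h.base.norm_lt _ _
  have h2 : Continuous fun y : X × ℝ => (y.2 : ℂ) := by fun_prop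
  have h3 := continuous_gaugeQ h.base.cont_m h.base.cont_m₁ fun y => h.base.norm_lt _ _
  exact h1.add (h2.mul (continuous_gaugePDeriv h.base.cont_m h.base.cont_m₁ h.cont_η h.cont_η₁
    h.base.cont_χ h3 fun y => h.base.norm_lt _ _))

theorem hasDerivAt_gaugeP_η (h : IsVariationFamily m m₁ χ p p₁ η η₁ ε ε') (x : X) {v : ℝ}
    (hv : v ∈ Ioo (0 : ℝ) 1) : HasDerivAt (fun v => gaugeP (m x v) (η x v) (χ x v))
      (gaugePDeriv (m x v) (m₁ x v) (η x v) (η₁ x v) (χ x v) (gaugeQ (m x v) (m₁ x v))) v :=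
  hasDerivAt_gaugeP (h.base.deriv_m x v hv) (h.deriv_η x v hv) (h.base.deriv_χ x v)
    (h.base.norm_lt x v)

theorem hasDerivAt_varY (h : IsVariationFamily m m₁ χ p p₁ η η₁ ε ε') (x : X) {v : ℝ}
    (hv : v ∈ Ioo (0 : ℝ) 1) : HasDerivAt (varY m χ η x) (varYDeriv m m₁ χ η η₁ x v) v := by
  refine ((hasDerivAt_id v).ofReal_comp.mul (h.hasDerivAt_gaugeP_η x hv)).congr_deriv ?_
  rw [varYDeriv]
  simp

theorem varM_zero {f g : X → ℝ → ℂ} (h : IsVariationFamily m m₁ χ p p₁ η η₁ ε ε') (x : X)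
    (v : ℝ) : varM f g ε (0, x) v = f x v := by
  simp [varM, h.ε_zero]

variable [FirstCountableTopology X]

/-- Integration by parts along the generator, in the space of deformed connections. -/
theorem integral_varConnDeriv (h : IsVariationFamily m m₁ χ p p₁ η η₁ ε ε') (x : X) {r : ℝ}
    (hr : r ∈ Ioc (0 : ℝ) 1) :
    ∫ t in (0 : ℝ)..(Real.pi / 2), (parHol p x r t).adjugate *
        varConnDeriv m m₁ χ η η₁ ε ε' (0, x) r t * parHol p x r t =
      (-gaugeQ (m x r) (η x r)) • epsMat - (parHol p x r 0).adjugate *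
        (symMat (gaugeP (m x 0) (η x 0) (χ x 0)) + (0 - gaugeQ (m x 0) (η x 0)) • epsMat) *
          parHol p x r 0 +
      ∫ t in (0 : ℝ)..(Real.pi / 2), (parHol p x r t).adjugate *
        symMat (Real.sin t * varYDeriv m m₁ χ η η₁ x (r * Real.sin t)) * parHol p x r t := by
  have hpi : (0 : ℝ) ≤ Real.pi / 2 := by positivity
  have hxc : ∀ {Z : Type} [TopologicalSpace Z] {f : X → ℝ → Z},
      (Continuous fun y : X × ℝ => f y.1 y.2) → Continuous fun t : ℝ => f x (r * Real.sin t) :=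
    fun hf => hf.comp (f := fun t : ℝ => (x, r * Real.sin t)) (by fun_prop)
  have hY : Continuous (parHol p x r) :=
    h.base.continuous_parHol.comp (f := fun t : ℝ => (x, r, t)) (by fun_prop)
  have hw := hxc (f := fun x v => gaugeP (m x v) (η x v) (χ x v))
    (continuous_gaugeP h.base.cont_m h.cont_η h.base.cont_χ fun y => h.base.norm_lt _ _)
  have hq := hxc (f := fun x v => gaugeQ (m x v) (η x v))
    (continuous_gaugeQ h.base.cont_m h.cont_η fun y => h.base.norm_lt _ _)
  have hy := hxc (f := varYDeriv m m₁ χ η η₁) h.continuous_varYDeriv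
  have hd : Continuous (varConnDeriv m m₁ χ η η₁ ε ε' (0, x) r) :=
    h.continuous_varConnDeriv.comp (f := fun t : ℝ => ((((0 : ℝ), x), r), t)) (by fun_prop)
  have hsin : Continuous fun t : ℝ => ((Real.sin t : ℝ) : ℂ) := by fun_prop
  have hi1 : Continuous fun t => (parHol p x r t).adjugate *
      varConnDeriv m m₁ χ η η₁ ε ε' (0, x) r t * parHol p x r t :=
    (hY.matrix_adjugate.mul hd).mul hY
  have hi2 : Continuous fun t => (parHol p x r t).adjugate *
      symMat (Real.sin t * varYDeriv m m₁ χ η η₁ x (r * Real.sin t)) * parHol p x r t :=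
    (hY.matrix_adjugate.mul (continuous_symMat.comp (hsin.mul hy))).mul hY
  have hA : Continuous (parConn p x r) := h.base.continuous_conn_right x r
  -- With w = `gaugeP` of the variation, the conjugated change of the zweibein is taken with weight
  -- cos t on its symmetric part. Its derivative contains r cos² t w' - sin t w where the varied
  -- connection has r w'; the deficit is sin t (w + v w') with v = r sin t, that is sin t times the
  -- derivative of v w. All other terms agree by the flatness identities.
  have hftc := intervalIntegral.integral_eq_sub_of_hasDerivAt_of_le (a := 0) (b := Real.pi / 2)
    (f := fun t => (parHol p x r t).adjugate *
      (Real.cos t • symMat (gaugeP (m x (r * Real.sin t)) (η x (r * Real.sin t))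
        (χ x (r * Real.sin t))) +
        (-gaugeQ (m x (r * Real.sin t)) (η x (r * Real.sin t))) • epsMat) * parHol p x r t)
    (f' := fun t => (parHol p x r t).adjugate * varConnDeriv m m₁ χ η η₁ ε ε' (0, x) r t *
      parHol p x r t - (parHol p x r t).adjugate *
        symMat (Real.sin t * varYDeriv m m₁ χ η η₁ x (r * Real.sin t)) * parHol p x r t) hpi
    (((hY.matrix_adjugate.mul ((Real.continuous_cos.smul (continuous_symMat.comp hw)).add
      (hq.neg.smul continuous_const))).mul hY).continuousOn)
    (fun t ht => by
      have hv := mul_sin_mem_Ioo hr ht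
      have hm := h.base.norm_lt x (r * Real.sin t)
      have h1 := hasDerivAt_adjugate_orderedExp hA (IsParallel.parConn_trace p x r) (Real.pi / 2) t
      have h2 := hasDerivAt_orderedExp hA (Real.pi / 2) t
      have h3 := (h.hasDerivAt_gaugeP_η x hv).scomp t (hasDerivAt_mul_sin r t)
      have h4 := (hasDerivAt_gaugeQ (h.base.deriv_m x _ hv) (h.deriv_η x _ hv) hm).scomp t
        (hasDerivAt_mul_sin r t)
      have h5 := ((Real.hasDerivAt_cos t).smul (IsParallel.hasDerivAt_symMat h3)).add
        ((h4.neg).smul_const epsMat)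
      refine ((h1.mul h5).mul h2).congr_deriv ?_
      simp only [varConnDeriv, gaugeConn, varPDeriv, varKDeriv, h.varM_zero, h.ε'_zero,
        Complex.ofReal_one, one_mul]
      rw [gaugeP_variation hm, gaugeQ_variation hm (χ := χ x (r * Real.sin t)),
        ← h.base.p_eq x _ (Ioo_subset_Icc_self hv), varYDeriv]
      set v := r * Real.sin t with hv'
      set w := gaugeP (m x v) (η x v) (χ x v)
      set w' := gaugePDeriv (m x v) (m₁ x v) (η x v) (η₁ x v) (χ x v) (gaugeQ (m x v) (m₁ x v))
      set q := gaugeQ (m x v) (η x v)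
      set q' := gaugeQDeriv (m x v) (m₁ x v) (η x v) (η₁ x v)
      set Y := parHol p x r t
      have hAt : parConn p x r t = r • symMat (p x v) := by rw [parConn, gaugeConn_zero]
      have c1 : parConn p x r t * symMat w - symMat w * parConn p x r t =
          (r * (2 * (conj (p x v) * w).im)) • epsMat := by
        rw [hAt, smul_mul_assoc, mul_smul_comm, ← smul_sub, commutator_symMat, smul_smul]
      have c2 : parConn p x r t * epsMat - epsMat * parConn p x r t =
          (2 * r) • symMat (Complex.I * p x v) := by
        rw [hAt, smul_mul_assoc, mul_smul_comm, ← smul_sub, commutator_symMat_eps, smul_smul,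
          mul_comm]
      have e1 : ∀ (M M' A Y Z : Mat2), (Z * A * M + Z * M') * Y + Z * M * -(A * Y) =
          Z * (A * M - M * A + M') * Y := by
        intro M M' A Y Z; noncomm_ring
      have e2 : ∀ (M M' Y Z : Mat2), Z * M * Y - Z * M' * Y = Z * (M - M') * Y := by
        intro M M' Y Z; noncomm_ring
      change (Y.adjugate * parConn p x r t * _ + Y.adjugate * _) * Y +
        Y.adjugate * _ * -(parConn p x r t * Y) = _
      rw [e1, e2]
      congr 2
      have e3 : parConn p x r t * (Real.cos t • symMat w + (-q) • epsMat) -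
          (Real.cos t • symMat w + (-q) • epsMat) * parConn p x r t =
          Real.cos t • (parConn p x r t * symMat w - symMat w * parConn p x r t) -
            q • (parConn p x r t * epsMat - epsMat * parConn p x r t) := by
        simp only [mul_add, add_mul, mul_smul_comm, smul_mul_assoc, smul_sub, neg_smul, mul_neg,
          neg_mul]
        abel
      change parConn p x r t * (Real.cos t • symMat w + (-q) • epsMat) -
          (Real.cos t • symMat w + (-q) • epsMat) * parConn p x r t +
          (Real.cos t • symMat ((r * Real.cos t) • w') + (-Real.sin t) • symMat w +
            (-((r * Real.cos t) • q')) • epsMat) = _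
      rw [e3, c1, c2]
      have hs := Real.sin_sq_add_cos_sq t
      clear_value w w' q q' Y
      ext i j
      fin_cases i <;> fin_cases j <;> simp [symMat, epsMat, hv', -Complex.ofReal_cos, -Complex.ofReal_sin]
      · linear_combination r * w'.re * hs
      · linear_combination r * w'.im * hs
      · linear_combination r * w'.im * hs
      · linear_combination -r * w'.re * hs)
    ((hi1.sub hi2).intervalIntegrable _ _)
  rw [intervalIntegral.integral_sub (hi1.intervalIntegrable _ _) (hi2.intervalIntegrable _ _)] at hftc
  rw [sub_eq_iff_eq_add] at hftc
  rw [hftc]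
  have hT : parHol p x r (Real.pi / 2) = 1 := orderedExp_self _
  simp only [hT, Real.sin_pi_div_two, Real.cos_pi_div_two, Real.sin_zero, Real.cos_zero, mul_zero,
    mul_one, zero_smul, zero_add, one_smul, Matrix.adjugate_one, one_mul, zero_sub]

/-- The derivative of `E` along a variation. -/
theorem varEDeriv_zero (h : IsVariationFamily m m₁ χ p p₁ η η₁ ε ε') (x : X) {r : ℝ}
    (hr : r ∈ Ioc (0 : ℝ) 1) (i j : Fin 2) :
    varEDeriv m m₁ χ η η₁ ε ε' (0, x) r i j =
      ∫ t in (0 : ℝ)..(Real.pi / 2), Real.sin t * inner ℝ (ampC m χ p i j x r t)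
        (varYDeriv m m₁ χ η η₁ x (r * Real.sin t)) := by
  have hpi : (0 : ℝ) ≤ Real.pi / 2 := by positivity
  have hcA : Continuous (varConn m m₁ χ η η₁ ε (0, x) r) :=
    h.continuous_varConn.comp (f := fun t : ℝ => ((((0 : ℝ), x), r), t)) (by fun_prop)
  have hA : Continuous (parConn p x r) := h.base.continuous_conn_right x r
  have hconn : ∀ t ∈ Icc 0 (Real.pi / 2), parConn p x r t = varConn m m₁ χ η η₁ ε (0, x) r t := by
    intro t ht
    have hv := mul_sin_mem_Icc ⟨hr.1.le, hr.2⟩ ht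
    simp only [parConn, varConn, gaugeConn, varP, varK, h.varM_zero, sub_self, h.base.p_eq x _ hv]
  have hhol : ∀ t ∈ Icc 0 (Real.pi / 2),
      orderedExp (varConn m m₁ χ η η₁ ε (0, x) r) (Real.pi / 2) t = parHol p x r t := fun t ht =>
    (orderedExp_congr hA hcA (IsParallel.parConn_trace p x r) ht.2
      fun z hz => hconn z ⟨ht.1.trans hz.1, hz.2⟩).symm
  have h0 : (0 : ℝ) ∈ Icc 0 (Real.pi / 2) := ⟨le_rfl, hpi⟩
  have hint : ∫ t in (0 : ℝ)..(Real.pi / 2),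
      (orderedExp (varConn m m₁ χ η η₁ ε (0, x) r) (Real.pi / 2) t).adjugate *
        varConnDeriv m m₁ χ η η₁ ε ε' (0, x) r t *
        orderedExp (varConn m m₁ χ η η₁ ε (0, x) r) (Real.pi / 2) t =
      ∫ t in (0 : ℝ)..(Real.pi / 2), (parHol p x r t).adjugate *
        varConnDeriv m m₁ χ η η₁ ε ε' (0, x) r t * parHol p x r t := by
    refine intervalIntegral.integral_congr fun t ht => ?_
    rw [uIcc_of_le hpi] at ht
    simp only [hhol t ht]
  set V := gaugeZweibein (m x 0) (χ x 0) with hV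
  set Y₀ := parHol p x r 0 with hY₀
  set R := ∫ t in (0 : ℝ)..(Real.pi / 2), (parHol p x r t).adjugate *
        symMat (Real.sin t * varYDeriv m m₁ χ η η₁ x (r * Real.sin t)) * parHol p x r t with hR
  have hU : varU m m₁ χ η η₁ ε (0, x) r = V * Y₀ := by
    rw [varU, hhol 0 h0, varV, h.varM_zero]
  have hYY : Y₀ * Y₀.adjugate = 1 :=
    orderedExp_mul_adjugate hA (IsParallel.parConn_trace p x r) _ _
  -- The boundary term at the caustic is the conjugate of the variation of V(0) and cancels it, so
  -- the remaining change of U acts from the right.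
  have hU' : varUDeriv m m₁ χ η η₁ ε ε' (0, x) r =
      V * Y₀ * ((-gaugeQ (m x r) (η x r)) • epsMat + R) := by
    rw [varUDeriv, orderedExpDeriv, hint, hhol 0 h0, h.integral_varConnDeriv x hr, varVDeriv, varV]
    simp only [h.varM_zero, h.ε'_zero, Complex.ofReal_one, one_mul]
    rw [← hV, ← hY₀, ← hR]
    set S := symMat (gaugeP (m x 0) (η x 0) (χ x 0)) + (0 - gaugeQ (m x 0) (η x 0)) • epsMat
    have e1 : ∀ (V Y Z S Q R : Mat2), V * S * Y + V * (Y * (Q - Z * S * Y + R)) =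
        V * S * Y - V * (Y * Z) * S * Y + V * Y * (Q + R) := by
      intro V Y Z S Q R; noncomm_ring
    rw [e1, hYY, mul_one, sub_self, zero_add]
  -- A rotation acting on U from the right does not change U Uᵗ, so the boundary term at the
  -- deformation point drops out.
  have hE : varEDeriv m m₁ χ η η₁ ε ε' (0, x) r =
      V * Y₀ * R * (V * Y₀).transpose + (V * Y₀ * R * (V * Y₀).transpose).transpose := by
    rw [varEDeriv, hU, hU']
    have e1 : ∀ (U R : Mat2) (k : ℝ), U * (k • epsMat + R) * U.transpose +
        U * (U * (k • epsMat + R)).transpose =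
          U * R * U.transpose + (U * R * U.transpose).transpose := by
      intro U R k
      ext i j
      simp only [Matrix.mul_apply, Fin.sum_univ_two, Matrix.transpose_apply, Matrix.add_apply,
        Matrix.smul_apply, epsMat, smul_eq_mul, Matrix.of_apply, Matrix.cons_val_zero,
        Matrix.cons_val_one, Matrix.cons_val', Matrix.cons_val_fin_one]
      ring
    exact e1 _ _ _
  have hcont : Continuous fun t => (parHol p x r t).adjugate *
        symMat (Real.sin t * varYDeriv m m₁ χ η η₁ x (r * Real.sin t)) * parHol p x r t := by
    have hY : Continuous (parHol p x r) :=
      h.base.continuous_parHol.comp (f := fun t : ℝ => (x, r, t)) (by fun_prop)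
    have hy : Continuous fun t => varYDeriv m m₁ χ η η₁ x (r * Real.sin t) :=
      h.continuous_varYDeriv.comp (f := fun t : ℝ => (x, r * Real.sin t)) (by fun_prop)
    have hsin : Continuous fun t : ℝ => ((Real.sin t : ℝ) : ℂ) := by fun_prop
    exact (hY.matrix_adjugate.mul (continuous_symMat.comp (hsin.mul hy))).mul hY
  -- The passage to a component of the symmetrized response is a linear functional, which commutes
  -- with the integral over the angle.
  let L : Mat2 →ₗ[ℝ] ℝ :=
    { toFun := fun M => symEntry i j (V * Y₀ * M * (V * Y₀).transpose)
      map_add' := fun M N => by rw [mul_add, add_mul, symEntry_add]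
      map_smul' := fun k M => by
        rw [mul_smul_comm, smul_mul_assoc, symEntry_smul]; rfl }
  have hL := (LinearMap.toContinuousLinearMap L).intervalIntegral_comp_comm (μ := volume)
    (hcont.intervalIntegrable 0 (Real.pi / 2))
  have hL2 : varEDeriv m m₁ χ η η₁ ε ε' (0, x) r i j = L R := by
    rw [hE]; rfl
  rw [hL2]
  refine Eq.trans hL.symm (intervalIntegral.integral_congr fun t _ => ?_)
  set y := varYDeriv m m₁ χ η η₁ x (r * Real.sin t)
  change symEntry i j (parResponse m χ p (symMat (Real.sin t * y)) x r t) = _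
  rw [symMat_smul, symMat_eq_sum]
  simp only [parResponse, response_smul, response_add, symEntry_smul, symEntry_add]
  rw [Complex.inner]
  simp only [ampC, parResponse, Complex.mul_re, Complex.conj_re, Complex.conj_im]
  ring

end IsVariationFamily

end

/-! ### From deformation point and angle to the field point -/

theorem kern_polar (c : ℝ → ℝ → ℂ) {r t : ℝ} (hr : 0 < r) (ht : t ∈ Ioo 0 (Real.pi / 2)) :
    kern c (r * Real.sin t) (r * Real.cos t) = (Real.sin t / r) • c r t := by
  have h1 : (r * Real.sin t) ^ 2 + (r * Real.cos t) ^ 2 = r ^ 2 := by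
    linear_combination r ^ 2 * Real.sin_sq_add_cos_sq t
  have h2 : Real.arcsin (r * Real.sin t / r) = t := by
    rw [mul_div_cancel_left₀ _ hr.ne', Real.arcsin_sin (by linarith [ht.1, Real.pi_pos]) ht.2.le]
  rw [kern, h1, Real.sqrt_sq hr.le, h2]
  congr 1
  field_simp

theorem measurable_kern {c : ℝ → ℝ → ℂ} (hc : Continuous fun y : ℝ × ℝ => c y.1 y.2) :
    Measurable fun z : ℝ × ℝ => kern c z.2 z.1 := by
  have h1 : Measurable fun z : ℝ × ℝ =>
      (√(z.2 ^ 2 + z.1 ^ 2), Real.arcsin (z.2 / √(z.2 ^ 2 + z.1 ^ 2))) := by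
    refine Measurable.prodMk (by fun_prop) (Real.measurable_arcsin.comp (by fun_prop))
  have h2 := hc.measurable.comp h1
  have h3 : Measurable fun z : ℝ × ℝ => z.2 / (z.2 ^ 2 + z.1 ^ 2) := by fun_prop
  exact h3.smul h2

theorem kern_eq_zero {c : ℝ → ℝ → ℂ} {a b : ℝ} (hb : b < 1)
    (h0 : ∀ r, r ∉ Icc a b → ∀ t, c r t = 0) {q s : ℝ} (h : 1 ≤ q ^ 2 + s ^ 2) :
    kern c q s = 0 := by
  rw [kern, h0, smul_zero]
  intro hm
  have : 1 ≤ √(q ^ 2 + s ^ 2) := Real.one_le_sqrt.2 h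
  linarith [hm.2]

/-- Polar coordinates in the plane of deformation parameter and field point. -/
theorem integral_polar {c : ℝ → ℝ → ℂ} {a b C : ℝ} (hc : Continuous fun y : ℝ × ℝ => c y.1 y.2)
    (hb : b < 1) (h0 : ∀ r, r ∉ Icc a b → ∀ t, c r t = 0)
    (hC : ∀ q s, 0 ≤ q → 0 ≤ s → ‖kern c q s‖ ≤ C * q) {y : ℝ → ℂ} (hy : Continuous y) :
    ∫ r, (∫ t in (0 : ℝ)..(Real.pi / 2), Real.sin t * inner ℝ (c r t) (y (r * Real.sin t)))
        ∂unitMeasure =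
      ∫ q, inner ℝ (funKernel c 0 q) (y q) ∂unitMeasure := by
  have hpi : (0 : ℝ) ≤ Real.pi / 2 := by positivity
  let g : ℝ × ℝ → ℝ := fun z => inner ℝ (kern c z.2 z.1) (y z.2)
  let f : ℝ × ℝ → ℝ := (Ioi (0 : ℝ) ×ˢ Ioi (0 : ℝ)).indicator g
  let F : ℝ × ℝ → ℝ := fun z => Real.sin z.2 * inner ℝ (c z.1 z.2) (y (z.1 * Real.sin z.2))
  have hmI : MeasurableSet (Ioi (0 : ℝ) ×ˢ Ioi (0 : ℝ)) := measurableSet_Ioi.prod measurableSet_Ioi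
  have hgm : Measurable g := (measurable_kern hc).inner (hy.measurable.comp measurable_snd)
  obtain ⟨B, hB⟩ := (isCompact_Icc (a := (0 : ℝ)) (b := 1)).exists_bound_of_continuousOn
    hy.continuousOn
  have hgi : Integrable g (unitMeasure.prod unitMeasure) := by
    refine Integrable.of_bound hgm.aestronglyMeasurable (C * B) ?_
    filter_upwards [ae_unitMeasure_prod] with z hz
    have hC0 : 0 ≤ C := by
      have := hC 1 0 zero_le_one le_rfl
      linarith [norm_nonneg (kern c 1 0)]
    refine IsAmplitude.norm_inner_le_mul ((hC _ _ hz.2.1.le hz.1.1.le).trans ?_)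
      (hB _ ⟨hz.2.1.le, hz.2.2.le⟩)
    nlinarith [hz.2.2]
  have hprod : unitMeasure.prod unitMeasure =
      (volume : Measure (ℝ × ℝ)).restrict (Ioo (0 : ℝ) 1 ×ˢ Ioo (0 : ℝ) 1) :=
    Measure.prod_restrict _ _
  -- In Cartesian coordinates (s, q): the kernel vanishes for q² + s² ≥ 1, so the quadrant may be
  -- replaced by the unit square, and the s-integral is the functional kernel.
  have hA : ∫ z, f z = ∫ q, inner ℝ (funKernel c 0 q) (y q) ∂unitMeasure := by
    have e1 : ∫ z, f z = ∫ z, g z ∂unitMeasure.prod unitMeasure := by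
      rw [integral_indicator hmI, hprod]
      refine (setIntegral_eq_of_subset_of_forall_sdiff_eq_zero hmI
        (prod_mono Ioo_subset_Ioi_self Ioo_subset_Ioi_self) fun z hz => ?_)
      have : kern c z.2 z.1 = 0 := by
        refine kern_eq_zero hb h0 ?_
        obtain ⟨⟨h1, h2⟩, h3⟩ := hz
        simp only [mem_Ioi] at h1 h2
        by_contra hlt
        push Not at hlt
        exact h3 ⟨⟨h1, by nlinarith⟩, ⟨h2, by nlinarith⟩⟩
      simp only [g, this, inner_zero_left]
    rw [e1, integral_prod_symm _ hgi]
    refine integral_congr_ae ?_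
    filter_upwards [ae_unitMeasure] with q hq
    have hk : Integrable (fun s => kern c q s) unitMeasure := by
      refine Integrable.of_bound ((measurable_kern hc).comp
        (f := fun s : ℝ => (s, q)) (by fun_prop)).aestronglyMeasurable (C * q) ?_
      filter_upwards [ae_unitMeasure] with s hs
      exact hC q s hq.1.le hs.1.le
    have e2 : funKernel c 0 q = ∫ s, kern c q s ∂unitMeasure := by
      rw [funKernel, intervalIntegral.integral_of_le zero_le_one, integral_Ioc_eq_integral_Ioo]
      rfl
    simp only [g]
    rw [e2, real_inner_comm, ← integral_inner hk]
    exact integral_congr_ae (Eventually.of_forall fun s => real_inner_comm _ _)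
  have hT : MeasurableSet (Ioo (0 : ℝ) 1 ×ˢ Ioo (0 : ℝ) (Real.pi / 2)) :=
    measurableSet_Ioo.prod measurableSet_Ioo
  have hFc : Continuous F := by
    have h1 : Continuous fun z : ℝ × ℝ => y (z.1 * Real.sin z.2) := hy.comp (by fun_prop)
    have h2 : Continuous fun z : ℝ × ℝ => Real.sin z.2 := by fun_prop
    exact h2.mul (hc.inner h1)
  have hFi : IntegrableOn F (Ioo (0 : ℝ) 1 ×ˢ Ioo (0 : ℝ) (Real.pi / 2))
      ((volume : Measure ℝ).prod volume) :=
    (hFc.continuousOn.integrableOn_compact (isCompact_Icc.prod isCompact_Icc)).mono_set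
      (prod_mono Ioo_subset_Icc_self Ioo_subset_Icc_self)
  -- In polar coordinates: the quadrant corresponds to 0 < t < π/2, and the Jacobian r cancels the
  -- 1/r in the kernel at (r sin t, r cos t), leaving sin t.
  have hBp : ∫ z, f z = ∫ z in Ioo (0 : ℝ) 1 ×ˢ Ioo (0 : ℝ) (Real.pi / 2), F z := by
    rw [← integral_comp_polarCoord_symm f]
    have hsub : Ioo (0 : ℝ) 1 ×ˢ Ioo (0 : ℝ) (Real.pi / 2) ⊆ polarCoord.target := by
      rw [polarCoord_target]
      refine prod_mono Ioo_subset_Ioi_self (Ioo_subset_Ioo ?_ ?_) <;> linarith [Real.pi_pos]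
    have key : ∀ z ∈ polarCoord.target, z.2 ∈ Ioo 0 (Real.pi / 2) →
        z.1 • f (polarCoord.symm z) = F z := by
      intro z hz hz2
      rw [polarCoord_target] at hz
      have hz1 : 0 < z.1 := hz.1
      have hmem : polarCoord.symm z ∈ Ioi (0 : ℝ) ×ˢ Ioi (0 : ℝ) := by
        rw [polarCoord_symm_apply]
        exact ⟨mul_pos hz1 (Real.cos_pos_of_mem_Ioo ⟨by linarith [hz2.1, Real.pi_pos], hz2.2⟩),
          mul_pos hz1 (Real.sin_pos_of_pos_of_lt_pi hz2.1 (by linarith [hz2.2, Real.pi_pos]))⟩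
      simp only [f, indicator_of_mem hmem, g, F]
      rw [polarCoord_symm_apply]
      simp only
      rw [kern_polar c hz1 hz2, real_inner_smul_left, smul_eq_mul]
      field_simp
    refine (setIntegral_eq_of_subset_of_forall_sdiff_eq_zero
      polarCoord.open_target.measurableSet hsub fun z hz => ?_).trans
      (setIntegral_congr_fun hT fun z hz => key z (hsub hz) hz.2)
    by_cases h2 : z.2 ∈ Ioo 0 (Real.pi / 2)
    · rw [key z hz.1 h2]
      have : c z.1 z.2 = 0 := by
        refine h0 _ (fun hm => hz.2 ⟨⟨?_, hm.2.trans_lt hb⟩, h2⟩) _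
        have := hz.1
        rw [polarCoord_target] at this
        exact this.1
      simp only [F, this, inner_zero_left, mul_zero]
    · have hz1 := hz.1
      rw [polarCoord_target] at hz1
      have hz0 : (0 : ℝ) < z.1 := hz1.1
      simp only [f]
      rw [indicator_of_notMem, smul_zero]
      rw [polarCoord_symm_apply]
      rintro ⟨h3, h4⟩
      simp only [mem_Ioi] at h3 h4
      have hc3 := pos_of_mul_pos_right h3 hz0.le
      have hs4 := pos_of_mul_pos_right h4 hz0.le
      apply h2
      have hp := hz1.2
      constructor
      · by_contra hle
        push Not at hle
        linarith [Real.sin_nonpos_of_nonpos_of_neg_pi_le hle hp.1.le]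
      · by_contra hle
        push Not at hle
        linarith [Real.cos_nonpos_of_pi_div_two_le_of_le hle (by linarith [hp.2])]
  rw [← hA, hBp, Measure.volume_eq_prod, setIntegral_prod _ hFi]
  refine integral_congr_ae (Eventually.of_forall fun r => ?_)
  simp only
  rw [intervalIntegral.integral_of_le hpi, integral_Ioc_eq_integral_Ioo]

namespace IsAmplitude

variable {X : Type*} [TopologicalSpace X] [FirstCountableTopology X] {p : X → ℝ → ℂ} {a b : ℝ}
  {c cr : X → ℝ → ℝ → ℂ} {d dr : X → ℝ → ℝ → ℝ}

/-- The pairing of an amplitude with a variation, by way of the functional derivative. -/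
theorem integral_angle (h : IsAmplitude p a b c cr d dr) (x : X) {y y' : ℝ → ℂ}
    (hy : Continuous y) (hy' : Continuous y') (hd : ∀ v ∈ Ioo (0 : ℝ) 1, HasDerivAt y (y' v) v) :
    ∫ r, (∫ t in (0 : ℝ)..(Real.pi / 2), Real.sin t * inner ℝ (c x r t) (y' (r * Real.sin t)))
        ∂unitMeasure =
      -∫ q, inner ℝ (funKernelDeriv (c x) (cr x) (angleDeriv p d x) 0 q) (y q) ∂unitMeasure := by
  obtain ⟨C, hC0, hC⟩ := h.exists_kern_bound (isCompact_singleton (x := x))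
  have hk := fun q s hq hs => (hC x rfl q s hq hs).1
  have hk' := fun q s hq hs => (hC x rfl q s hq hs).2
  have h01 : (0 : ℝ) ∈ Icc (0 : ℝ) 1 := ⟨le_rfl, zero_le_one⟩
  rw [integral_polar (h.cont_c.comp (f := fun y : ℝ × ℝ => (x, y)) (by fun_prop)) h.b_lt
    (h.c_zero x) hk hy']
  set k := funKernel (c x) 0
  set k' := funKernelDeriv (c x) (cr x) (angleDeriv p d x) 0
  have hkc : ContinuousOn k (Icc 0 1) :=
    (h.continuousOn_funKernel_Icc x h01).mono Icc_subset_Ici_self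
  have hkc' : ContinuousOn k' (Ioo 0 1) :=
    (h.continuousOn_funKernelDeriv 0 x).mono Ioo_subset_Ioi_self
  have hi1 : Integrable (fun q => inner ℝ (k q) (y' q)) unitMeasure :=
    ((hkc.inner hy'.continuousOn).integrableOn_compact isCompact_Icc).mono_set Ioo_subset_Icc_self
  obtain ⟨B, hB⟩ := (isCompact_Icc (a := (0 : ℝ)) (b := 1)).exists_bound_of_continuousOn
    hy.continuousOn
  have hi2 : Integrable (fun q => inner ℝ (k' q) (y q)) unitMeasure := by
    refine Integrable.of_bound ((hkc'.inner hy.continuousOn).aestronglyMeasurable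
      measurableSet_Ioo) (C * B) ?_
    filter_upwards [ae_unitMeasure] with q hq
    exact norm_inner_le_mul (norm_funKernelDeriv_le hk' h01 hq.1.le) (hB q ⟨hq.1.le, hq.2.le⟩)
  have hconv : ∀ f : ℝ → ℝ, ∫ q, f q ∂unitMeasure = ∫ q in (0 : ℝ)..1, f q := fun f => by
    rw [intervalIntegral.integral_of_le zero_le_one, integral_Ioc_eq_integral_Ioo]; rfl
  have hk1 : k 1 = 0 := h.funKernel_eq_zero x h.b_lt
  have hk0 : k 0 = 0 := funKernel_zero x
  have hint : IntervalIntegrable (fun q => inner ℝ (k q) (y' q) + inner ℝ (k' q) (y q)) volume 0 1 := by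
    rw [intervalIntegrable_iff_integrableOn_Ioo_of_le zero_le_one]
    exact hi1.add hi2
  -- The kernel vanishes at both ends, so variations need no boundary conditions, neither at the
  -- caustic nor at v = 1.
  have hftc := intervalIntegral.integral_eq_sub_of_hasDerivAt_of_le (a := 0) (b := 1)
    (f := fun q => inner ℝ (k q) (y q)) zero_le_one (hkc.inner hy.continuousOn)
    (fun q hq => (h.hasDerivAt_funKernel x h01 hq.1).inner ℝ (hd q hq)) hint
  rw [hk1, hk0, inner_zero_left, inner_zero_left, sub_zero, ← hconv, integral_add hi1 hi2] at hftc
  linarith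

end IsAmplitude

/-! ### Functions on the branch -/

open Classical in
/-- The function on the branch with given values on the generators. -/
def onBranch {E : Type*} [Zero E] (D : Set Transverse) (g : D → ℝ → E) (y : ℝ × Transverse) : E :=
  if h : y.2 ∈ D then g ⟨y.2, h⟩ y.1 else 0

theorem onBranch_apply {E : Type*} [Zero E] {D : Set Transverse} (g : D → ℝ → E) {θ : Transverse}
    (hθ : θ ∈ D) (v : ℝ) : onBranch D g (v, θ) = g ⟨θ, hθ⟩ v := by
  rw [onBranch, dif_pos hθ]

theorem continuousOn_onBranch {E : Type*} [Zero E] [TopologicalSpace E] {D : Set Transverse}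
    {S : Set ℝ} {g : D → ℝ → E} (hg : Continuous fun y : D × S => g y.1 y.2) :
    ContinuousOn (onBranch D g) (S ×ˢ D) := by
  rw [continuousOn_iff_continuous_domRestrict]
  have h1 : Continuous fun z : ↥(S ×ˢ D) => ((⟨z.1.2, z.2.2⟩ : D), (⟨z.1.1, z.2.1⟩ : S)) := by
    fun_prop
  refine (hg.comp h1).congr fun z => ?_
  obtain ⟨⟨v, θ⟩, hz⟩ := z
  exact (onBranch_apply g hz.2 v).symm

theorem continuousOn_onBranch_univ {E : Type*} [Zero E] [TopologicalSpace E] {D : Set Transverse}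
    {g : D → ℝ → E} (hg : Continuous fun y : D × ℝ => g y.1 y.2) (S : Set ℝ) :
    ContinuousOn (onBranch D g) (S ×ˢ D) :=
  continuousOn_onBranch (hg.comp (f := fun y : D × S => (y.1, (y.2 : ℝ))) (by fun_prop))

theorem restrict_branch (D : Set Transverse) :
    (volume : Measure (ℝ × Transverse)).restrict (Icc (0 : ℝ) 1 ×ˢ D) =
      unitMeasure.prod (volume.restrict D) := by
  rw [Measure.volume_eq_prod, ← Measure.prod_restrict, ← Measure.restrict_congr_set Ioo_ae_eq_Icc]
  rfl

theorem restrict_pairDomain (D : Set Transverse) :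
    (volume : Measure (Transverse × ℝ × ℝ)).restrict (pairDomain D) =
      (volume.restrict D).prod (unitMeasure.prod unitMeasure) := by
  rw [pairDomain, Measure.volume_eq_prod, ← Measure.prod_restrict, Measure.volume_eq_prod,
    ← Measure.prod_restrict, ← Measure.restrict_congr_set Ioo_ae_eq_Icc]
  rfl

theorem integrable_of_indicator_bound {α E : Type*} [MeasurableSpace α] {ν : Measure α}
    [NormedAddCommGroup E] {f : α → E} (hf : AEStronglyMeasurable f ν) {S : Set α}
    (hS : MeasurableSet S) (hfin : ν S < ⊤) {C : ℝ} (h0 : ∀ᵐ x ∂ν, x ∉ S → f x = 0)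
    (hC : ∀ᵐ x ∂ν, x ∈ S → ‖f x‖ ≤ C) : Integrable f ν := by
  refine Integrable.mono' (g := S.indicator fun _ => C)
    ((integrableOn_const hfin.ne).integrable_indicator hS) hf ?_
  filter_upwards [h0, hC] with x h0 hC
  by_cases hx : x ∈ S
  · rw [indicator_of_mem hx]; exact hC hx
  · rw [indicator_of_notMem hx, h0 hx, norm_zero]

/-- Integrability on the branch. -/
theorem integrable_onBranch {E : Type*} [NormedAddCommGroup E] {D K : Set Transverse}
    (hD : IsOpen D) (hK : IsCompact K) {f : ℝ × Transverse → E}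
    (hf : ContinuousOn f (Ioo 0 1 ×ˢ D)) {C : ℝ}
    (hC : ∀ v ∈ Ioo (0 : ℝ) 1, ∀ θ ∈ K, ‖f (v, θ)‖ ≤ C) (h0 : ∀ v, ∀ θ ∉ K, f (v, θ) = 0) :
    Integrable f (unitMeasure.prod (volume.restrict D)) := by
  refine integrable_of_indicator_bound (S := univ ×ˢ K) (C := C) ?_
    (MeasurableSet.univ.prod hK.measurableSet) ?_ ?_ ?_
  · have : unitMeasure.prod (volume.restrict D) =
        (volume : Measure (ℝ × Transverse)).restrict (Ioo (0 : ℝ) 1 ×ˢ D) := Measure.prod_restrict _ _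
    rw [this]
    exact hf.aestronglyMeasurable (measurableSet_Ioo.prod hD.measurableSet)
  · rw [Measure.prod_prod]
    exact ENNReal.mul_lt_top (measure_lt_top _ _)
      ((Measure.restrict_apply_le _ _).trans_lt hK.measure_lt_top)
  · filter_upwards with y hy
    exact h0 y.1 y.2 fun h => hy ⟨trivial, h⟩
  · filter_upwards [Measure.quasiMeasurePreserving_fst.ae ae_unitMeasure] with y hy hyK
    exact hC y.1 hy y.2 hyK.2

theorem exists_compact_interval {K : Set ℝ} (hK : IsCompact K) (h : K ⊆ Ioo 0 1) :
    ∃ a b : ℝ, 0 < a ∧ b < 1 ∧ K ⊆ Icc a b := by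
  -- The point 1/2 is adjoined so that a smallest and a largest element exist even when K is empty.
  have hK' : IsCompact (insert (1 / 2) K) := hK.insert _
  have hsub : insert (1 / 2) K ⊆ Ioo (0 : ℝ) 1 := insert_subset (by norm_num) h
  obtain ⟨a, ha⟩ := hK'.exists_isLeast (insert_nonempty _ _)
  obtain ⟨b, hb⟩ := hK'.exists_isGreatest (insert_nonempty _ _)
  exact ⟨a, b, (hsub ha.1).1, (hsub hb.1).2, fun x hx =>
    ⟨ha.2 (mem_insert_of_mem _ hx), hb.2 (mem_insert_of_mem _ hx)⟩⟩

theorem isCompact_preimage_val {D K : Set Transverse} (hK : IsCompact K) (hKD : K ⊆ D) :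
    IsCompact ((↑) ⁻¹' K : Set D) := by
  rw [Subtype.isCompact_iff, Subtype.image_preimage_coe, inter_eq_right.2 hKD]
  exact hK

/-- The derivative along the generator. -/
theorem hasDerivAt_generator {E : Type*} [NormedAddCommGroup E] [NormedSpace ℝ E]
    {f : ℝ × Transverse → E} (hf : ContDiff ℝ ∞ f) (θ : Transverse) (v : ℝ) :
    HasDerivAt (fun x => f (x, θ)) (fderiv ℝ f (v, θ) (1, 0)) v :=
  ((hf.differentiable (by simp)) (v, θ)).hasFDerivAt.comp_hasDerivAt v
    ((hasDerivAt_id v).prodMk (hasDerivAt_const v θ))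

theorem continuous_fderiv_generator {E : Type*} [NormedAddCommGroup E] [NormedSpace ℝ E]
    {f : ℝ × Transverse → E} (hf : ContDiff ℝ ∞ f) :
    Continuous fun y => fderiv ℝ f y (1, 0) :=
  (hf.continuous_fderiv (by simp)).clm_apply continuous_const

/-! ### The varied data -/

/-- The parameter is passed through τ sin(s/τ), which has derivative 1 at s = 0 and stays within
[-τ, τ]. The varied coefficient thus stays in the unit disc for every real s, and continuity
statements need no restriction on s. -/
theorem exists_isVariationFamily {D : Set Transverse} {μ η : ℝ × Transverse → ℂ}
    {ρ₀ : Transverse → ℝ} (h : IsRegularBranch D μ ρ₀) {m₁ : D → ℝ → ℂ} {χ : D → ℝ → ℝ}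
    {p p₁ : D → ℝ → ℂ} (hp : IsParallel (fun (θ : D) v => μ (clamp v, θ)) m₁ χ p p₁)
    (hη : IsVariation D η) :
    ∃ τ : ℝ, 0 < τ ∧ IsVariationFamily (fun (θ : D) v => μ (clamp v, θ)) m₁ χ p p₁
      (fun θ v => η (v, θ)) (fun θ v => fderiv ℝ η (v, θ) (1, 0))
      (fun s => τ * Real.sin (s / τ)) (fun s => Real.cos (s / τ)) := by
  set K := Prod.snd '' tsupport η with hKdef
  have hK : IsCompact K := hη.compact.image continuous_snd
  have hKD : K ⊆ D := by
    rintro _ ⟨y, hy, rfl⟩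
    exact (hη.support hy).2
  have hcμ : ContinuousOn (fun y => 1 / (1 - ‖μ y‖)) (Icc 0 1 ×ˢ K) := by
    refine continuousOn_const.div (continuousOn_const.sub
      ((h.smooth_mu.continuousOn.mono (prod_mono le_rfl hKD)).norm)) fun y hy => ?_
    have := h.norm_mu_lt y ⟨hy.1, hKD hy.2⟩
    linarith
  obtain ⟨C, hC⟩ := (isCompact_Icc.prod hK).exists_bound_of_continuousOn hcμ
  obtain ⟨B, hB⟩ := hη.smooth.continuous.bounded_above_of_compact_support hη.compact
  have hB0 : 0 ≤ B := (norm_nonneg _).trans (hB 0)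
  set C' := max C 1 with hC'
  have hC'1 : 1 ≤ C' := le_max_right _ _
  -- `C'` bounds 1/(1 - |μ|) on the generators where η is supported and `B` bounds |η|, so τ B <
  -- 1/C' ≤ 1 - |μ|.
  have hτ : 0 < 1 / (C' * (B + 1)) := by positivity
  set τ := 1 / (C' * (B + 1)) with hτdef
  refine ⟨τ, hτ, hp, ?_, ?_, ?_, ?_, ?_, by simp, by simp, ?_⟩
  · exact hη.smooth.continuous.comp (f := fun y : D × ℝ => (y.2, (y.1 : Transverse))) (by fun_prop)
  · exact (continuous_fderiv_generator hη.smooth).comp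
      (f := fun y : D × ℝ => (y.2, (y.1 : Transverse))) (by fun_prop)
  · exact fun θ v _ => hasDerivAt_generator hη.smooth θ v
  · intro s
    have h1 := ((hasDerivAt_id s).div_const τ).sin.const_mul τ
    refine h1.congr_deriv ?_
    simp only [id]
    field_simp
  · fun_prop
  · rintro ⟨s, θ⟩ v
    simp only [varM]
    by_cases hθ : (θ : Transverse) ∈ K
    · have h1 := hC (clamp v, θ) ⟨clamp_mem v, hθ⟩
      have h2 := h.norm_mu_lt (clamp v, θ) ⟨clamp_mem v, θ.2⟩
      have h3 : 0 < 1 - ‖μ (clamp v, θ)‖ := by linarith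
      rw [Real.norm_of_nonneg (by positivity)] at h1
      have h4 : 1 / C' ≤ 1 - ‖μ (clamp v, θ)‖ := by
        rw [div_le_comm₀ (by positivity) h3]
        exact h1.trans (le_max_left _ _)
      have h5 : ‖((τ * Real.sin (s / τ) : ℝ) : ℂ) * η (v, θ)‖ ≤ τ * B := by
        rw [norm_mul, Complex.norm_real, Real.norm_eq_abs, abs_mul, abs_of_pos hτ]
        have := Real.abs_sin_le_one (s / τ)
        refine mul_le_mul ?_ (hB _) (norm_nonneg _) hτ.le
        nlinarith
      have h6 : τ * B < 1 / C' := by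
        rw [hτdef, div_mul_eq_mul_div, div_lt_div_iff₀ (by positivity) (by positivity)]
        nlinarith
      linarith [norm_add_le (μ (clamp v, θ)) (((τ * Real.sin (s / τ) : ℝ) : ℂ) * η (v, θ))]
    · have h0 : η (v, θ) = 0 := by
        by_contra hne
        exact hθ ⟨_, subset_tsupport _ hne, rfl⟩
      rw [h0, mul_zero, add_zero]
      exact h.norm_mu_lt _ ⟨clamp_mem v, θ.2⟩

/-- The varied `E` in the gauge that is parallel for the unvaried data. -/
theorem fieldE_variation {D : Set Transverse} {μ η : ℝ × Transverse → ℂ}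
    {ρ₀ : Transverse → ℝ} (h : IsRegularBranch D μ ρ₀) {m₁ η₁ : D → ℝ → ℂ} {χ : D → ℝ → ℝ}
    {p p₁ : D → ℝ → ℂ} {ε ε' : ℝ → ℝ}
    (hv : IsVariationFamily (fun (θ : D) v => μ (clamp v, θ)) m₁ χ p p₁
      (fun θ v => η (v, θ)) η₁ ε ε') (θ : D) (s : ℝ) {r : ℝ} (hr : r ∈ Ioc (0 : ℝ) 1) :
    fieldE ρ₀ (fun y => μ y + (ε s : ℂ) * η y) (r, θ) =
      varE (fun (θ : D) v => μ (clamp v, θ)) m₁ χ (fun θ v => η (v, θ)) η₁ ε (s, θ) r := by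
  have hx : ∀ {Z : Type} [TopologicalSpace Z] {f : ℝ × D → ℝ → Z},
      (Continuous fun y : (ℝ × D) × ℝ => f y.1 y.2) → Continuous (f (s, θ)) :=
    fun hf => hf.comp (f := fun v : ℝ => ((s, θ), v)) (by fun_prop)
  have hχ : Continuous (χ θ) := hv.base.cont_χ.comp (f := fun v : ℝ => (θ, v)) (by fun_prop)
  -- The angle χ of the unvaried data is kept fixed. The varied connection therefore acquires an
  -- antisymmetric part, but χ itself need not be varied.
  refine fieldE_eq_gauge (m := varM (fun (θ : D) v => μ (clamp v, θ)) (fun θ v => η (v, θ)) ε (s, θ))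
    (m₁ := varM m₁ η₁ ε (s, θ)) (χ' := fun v => gaugeQ (μ (clamp v, θ)) (m₁ θ v)) hr
    (h.rho_pos θ θ.2) (hx (hv.continuous_varM hv.base.cont_m hv.cont_η))
    (hx (hv.continuous_varM hv.base.cont_m₁ hv.cont_η₁)) (hv.norm_lt _)
    (fun v hv' => ?_) (fun v hv' => ?_) hχ.continuousOn
    (fun v _ => hv.base.deriv_χ θ v) (hx hv.continuous_varP) (hx hv.continuous_varK)
    (fun v _ => rfl) (fun v _ => rfl)
  · simp only [varM, clamp_of_mem hv']
  · exact (hv.base.deriv_m θ v hv').add ((hv.deriv_η θ v hv').const_mul _)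

/-! ### Smeared amplitudes -/

section

variable {D : Set Transverse} (m : D → ℝ → ℂ) (χ : D → ℝ → ℝ) (p p₁ : D → ℝ → ℂ)
  (φ : ℝ × Transverse → ℝ) (i j : Fin 2)

/-- The smeared amplitude. -/
def smearC (θ : D) (r t : ℝ) : ℂ := φ (r, θ) • ampC m χ p i j θ r t

/-- The derivative of `smearC` with respect to the deformation point. -/
def smearCDeriv (θ : D) (r t : ℝ) : ℂ :=
  φ (r, θ) • ampCDeriv m χ p p₁ i j θ r t + fderiv ℝ φ (r, θ) (1, 0) • ampC m χ p i j θ r t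

/-- The antisymmetric part of the smeared amplitude. -/
def smearD (θ : D) (r t : ℝ) : ℝ := φ (r, θ) • ampD m χ p i j θ r t

/-- The derivative of `smearD` with respect to the deformation point. -/
def smearDDeriv (θ : D) (r t : ℝ) : ℝ :=
  φ (r, θ) • ampDDeriv m χ p p₁ i j θ r t + fderiv ℝ φ (r, θ) (1, 0) • ampD m χ p i j θ r t

/-- The kernel of the smeared amplitude. -/
def smearKernel (θ : D) (v : ℝ) : ℂ := funKernel (smearC m χ p φ i j θ) 0 v

/-- The derivative of `smearKernel`. -/
def smearKernelDeriv (θ : D) (v : ℝ) : ℂ :=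
  funKernelDeriv (smearC m χ p φ i j θ) (smearCDeriv m χ p p₁ φ i j θ)
    (IsAmplitude.angleDeriv p (smearD m χ p φ i j) θ) 0 v

/-- The functional derivative of the smeared `E` on each generator. -/
def branchDeriv (θ : D) (v : ℝ) : ℂ :=
  -(1 / 2) * v * conj (smearKernelDeriv m χ p p₁ φ i j θ v) * gaugeP (m θ v) 1 (χ θ v)

end

theorem isAmplitude_smear {D : Set Transverse} {m m₁ : D → ℝ → ℂ} {χ : D → ℝ → ℝ}
    {p p₁ : D → ℝ → ℂ} (hp : IsParallel m m₁ χ p p₁) {φ : ℝ × Transverse → ℝ}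
    (hφ : IsTestFunction D φ) {a b : ℝ} (ha : 0 < a) (hb : b < 1)
    (hab : Prod.fst '' tsupport φ ⊆ Icc a b) (i j : Fin 2) :
    IsAmplitude p a b (smearC m χ p φ i j) (smearCDeriv m χ p p₁ φ i j) (smearD m χ p φ i j)
      (smearDDeriv m χ p p₁ φ i j) := by
  have hc : Continuous fun y : D × ℝ => (y.2, (y.1 : Transverse)) := by fun_prop
  have hz : ∀ (x : D) (r : ℝ), r ∉ Icc a b → (r, (x : Transverse)) ∉ tsupport φ :=
    fun x r hr hmem => hr (hab ⟨_, hmem, rfl⟩)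
  exact hp.isAmplitude (φ := fun x r => φ (r, x)) (φ₁ := fun x r => fderiv ℝ φ (r, x) (1, 0)) ha hb
    (hφ.smooth.continuous.comp hc) ((continuous_fderiv_generator hφ.smooth).comp hc)
    (fun x r => hasDerivAt_generator hφ.smooth x r)
    (fun x r hr => image_eq_zero_of_notMem_tsupport (hz x r hr))
    (fun x r hr => by
      have : fderiv ℝ φ (r, x) = 0 :=
        image_eq_zero_of_notMem_tsupport fun h => hz x r hr (tsupport_fderiv_subset ℝ h)
      rw [this]; rfl) i j

theorem IsTestFunction.exists_interval {D : Set Transverse} {φ ψ : ℝ × Transverse → ℝ}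
    (hφ : IsTestFunction D φ) (hψ : IsTestFunction D ψ) :
    ∃ a b : ℝ, 0 < a ∧ b < 1 ∧ Prod.fst '' tsupport φ ⊆ Icc a b ∧
      Prod.fst '' tsupport ψ ⊆ Icc a b := by
  obtain ⟨a, b, ha, hb, h⟩ := exists_compact_interval
    ((hφ.compact.image continuous_fst).union (hψ.compact.image continuous_fst)) (by
      rintro _ (⟨y, hy, rfl⟩ | ⟨y, hy, rfl⟩)
      · exact (hφ.support hy).1
      · exact (hψ.support hy).1)
  exact ⟨a, b, ha, hb, subset_union_left.trans h, subset_union_right.trans h⟩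

theorem ae_branch {D : Set Transverse} (hD : IsOpen D) :
    ∀ᵐ y ∂unitMeasure.prod ((volume : Measure Transverse).restrict D), y.1 ∈ Ioo (0 : ℝ) 1 ∧ y.2 ∈ D :=
  (Measure.quasiMeasurePreserving_fst.ae ae_unitMeasure).and
    (Measure.quasiMeasurePreserving_snd.ae (ae_restrict_mem hD.measurableSet))

theorem integrable_smear {D : Set Transverse} (hD : IsOpen D) {φ : ℝ × Transverse → ℝ}
    (hφ : IsTestFunction D φ) {g : D → ℝ → ℝ} (hg : Continuous fun y : D × ℝ => g y.1 y.2) :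
    Integrable (fun y => φ y * onBranch D g y) (unitMeasure.prod (volume.restrict D)) := by
  have hK : IsCompact (Prod.snd '' tsupport φ) := hφ.compact.image continuous_snd
  have hKD : Prod.snd '' tsupport φ ⊆ D := by
    rintro _ ⟨y, hy, rfl⟩
    exact (hφ.support hy).2
  have hc : ∀ S : Set ℝ, ContinuousOn (fun y => φ y * onBranch D g y) (S ×ˢ D) := fun S =>
    hφ.smooth.continuous.continuousOn.mul (continuousOn_onBranch_univ hg S)
  obtain ⟨C, hC⟩ := ((isCompact_Icc (a := (0 : ℝ)) (b := 1)).prod hK).exists_bound_of_continuousOn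
    ((hc (Icc 0 1)).mono (prod_mono le_rfl hKD))
  refine integrable_onBranch hD hK (hc _) (fun v hv θ hθ => hC (v, θ) ⟨Ioo_subset_Icc_self hv, hθ⟩)
    fun v θ hθ => ?_
  have : φ (v, θ) = 0 := image_eq_zero_of_notMem_tsupport fun hmem => hθ ⟨_, hmem, rfl⟩
  rw [this, zero_mul]

/-! ### The functional derivative of the smeared field -/

section

variable {D : Set Transverse} {μ η : ℝ × Transverse → ℂ} {ρ₀ : Transverse → ℝ}
  {m₁ η₁ : D → ℝ → ℂ} {χ : D → ℝ → ℝ} {p p₁ : D → ℝ → ℂ} {ε ε' : ℝ → ℝ}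

theorem smearedE_variation (hD : IsOpen D) (h : IsRegularBranch D μ ρ₀)
    (hv : IsVariationFamily (fun (θ : D) v => μ (clamp v, θ)) m₁ χ p p₁
      (fun θ v => η (v, θ)) η₁ ε ε') (φ : ℝ × Transverse → ℝ) (i j : Fin 2) (s : ℝ) :
    smearedE D ρ₀ φ i j (fun y => μ y + (ε s : ℂ) * η y) =
      ∫ y, φ y * onBranch D (fun θ v => varE (fun (θ : D) v => μ (clamp v, θ)) m₁ χ
        (fun θ v => η (v, θ)) η₁ ε (s, θ) v i j) y ∂unitMeasure.prod (volume.restrict D) := by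
  rw [smearedE, restrict_branch]
  refine integral_congr_ae ?_
  filter_upwards [ae_branch hD] with y hy
  obtain ⟨r, θ⟩ := y
  rw [onBranch_apply _ hy.2, ← fieldE_variation h hv ⟨θ, hy.2⟩ s ⟨hy.1.1, hy.1.2.le⟩]

/-- Differentiation under the integral: the derivative of E is continuous, hence bounded for |s| ≤ 1
over the compact set of generators that meet the support of φ. -/
theorem hasDerivAt_smeared (hD : IsOpen D) {m : D → ℝ → ℂ} {η : D → ℝ → ℂ}
    (hv : IsVariationFamily m m₁ χ p p₁ η η₁ ε ε') {φ : ℝ × Transverse → ℝ}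
    (hφ : IsTestFunction D φ) (i j : Fin 2) :
    HasDerivAt (fun s => ∫ y, φ y * onBranch D (fun θ v => varE m m₁ χ η η₁ ε (s, θ) v i j) y
        ∂unitMeasure.prod (volume.restrict D))
      (∫ y, φ y * onBranch D (fun θ v => varEDeriv m m₁ χ η η₁ ε ε' (0, θ) v i j) y
        ∂unitMeasure.prod (volume.restrict D)) 0 := by
  have hK : IsCompact (Prod.snd '' tsupport φ) := hφ.compact.image continuous_snd
  have hKD : Prod.snd '' tsupport φ ⊆ D := by
    rintro _ ⟨y, hy, rfl⟩
    exact (hφ.support hy).2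
  have hE : Continuous fun y : (ℝ × D) × ℝ => varE m m₁ χ η η₁ ε y.1 y.2 i j :=
    (continuous_apply j).comp ((continuous_apply i).comp hv.continuous_varE)
  have hE' : Continuous fun y : (ℝ × D) × ℝ => varEDeriv m m₁ χ η η₁ ε ε' y.1 y.2 i j :=
    (continuous_apply j).comp ((continuous_apply i).comp hv.continuous_varEDeriv)
  have hs : ∀ {f : ℝ × D → ℝ → ℝ}, (Continuous fun y : (ℝ × D) × ℝ => f y.1 y.2) → ∀ s : ℝ,
      Continuous fun y : D × ℝ => f (s, y.1) y.2 := fun hf s =>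
    hf.comp (f := fun y : D × ℝ => ((s, y.1), y.2)) (by fun_prop)
  have hE1 := hs (f := fun y v => varE m m₁ χ η η₁ ε y v i j) hE
  have hE1' := hs (f := fun y v => varEDeriv m m₁ χ η η₁ ε ε' y v i j) hE'
  obtain ⟨C, hC⟩ := (((isCompact_Icc (a := (-1 : ℝ)) (b := 1)).prod
    (isCompact_preimage_val hK hKD)).prod
      (isCompact_Icc (a := (0 : ℝ)) (b := 1))).exists_bound_of_continuousOn hE'.continuousOn
  refine (hasDerivAt_integral_of_dominated_loc_of_deriv_le (s := Ioo (-1) 1)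
    (F' := fun s y => φ y * onBranch D (fun θ v => varEDeriv m m₁ χ η η₁ ε ε' (s, θ) v i j) y)
    (bound := fun y => |φ y| * C) (Ioo_mem_nhds (by norm_num) one_pos) ?_ ?_ ?_ ?_ ?_ ?_).2
  · exact Eventually.of_forall fun s =>
      (integrable_smear hD hφ (g := fun θ v => varE m m₁ χ η η₁ ε (s, θ) v i j) (hE1 s)).aestronglyMeasurable
  · exact integrable_smear hD hφ (g := fun θ v => varE m m₁ χ η η₁ ε (0, θ) v i j) (hE1 0)
  · exact (integrable_smear hD hφ
      (g := fun θ v => varEDeriv m m₁ χ η η₁ ε ε' (0, θ) v i j) (hE1' 0)).aestronglyMeasurable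
  · filter_upwards [ae_branch hD] with y hy s hs'
    obtain ⟨r, θ⟩ := y
    rw [norm_mul, Real.norm_eq_abs]
    by_cases hz : φ (r, θ) = 0
    · simp [hz]
    · refine mul_le_mul_of_nonneg_left ?_ (abs_nonneg _)
      rw [onBranch_apply _ hy.2]
      exact hC ((s, ⟨θ, hy.2⟩), r) ⟨⟨Ioo_subset_Icc_self hs', ⟨_, subset_tsupport _ hz, rfl⟩⟩,
        Ioo_subset_Icc_self hy.1⟩
  · rw [← restrict_branch]
    exact ((hφ.smooth.continuous.integrable_of_hasCompactSupport hφ.compact).abs.mul_const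
      C).integrableOn
  · filter_upwards [ae_branch hD] with y hy s hs'
    obtain ⟨r, θ⟩ := y
    simp only [onBranch_apply _ hy.2]
    have := hv.hasDerivAt_varE ⟨θ, hy.2⟩ r s
    rw [hasDerivAt_matrix] at this
    exact (this i j).const_mul _

theorem gaugeP_eq_mul (m η : ℂ) (χ : ℝ) : gaugeP m η χ = η * gaugeP m 1 χ := by
  simp only [gaugeP]; ring

/-- The smeared field is real, so its two functional derivatives are conjugate and together
contribute twice a real part; this fixes the factor 1/2 in `branchDeriv`. -/
theorem branchDeriv_pairing (m : D → ℝ → ℂ) (χ : D → ℝ → ℝ) (p p₁ : D → ℝ → ℂ)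
    (φ : ℝ × Transverse → ℝ) (i j : Fin 2) (η : D → ℝ → ℂ) (θ : D) (v : ℝ) :
    branchDeriv m χ p p₁ φ i j θ v * η θ v + conj (branchDeriv m χ p p₁ φ i j θ v) * conj (η θ v) =
      ((-inner ℝ (smearKernelDeriv m χ p p₁ φ i j θ v) (varY m χ η θ v) : ℝ) : ℂ) := by
  rw [← map_mul, Complex.add_conj, branchDeriv, varY, gaugeP_eq_mul (m θ v) (η θ v), Complex.inner]
  congr 1
  have : -(1 / 2) * (v : ℂ) * conj (smearKernelDeriv m χ p p₁ φ i j θ v) * gaugeP (m θ v) 1 (χ θ v) *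
      η θ v = ((-(1 / 2) : ℝ) : ℂ) * (conj (smearKernelDeriv m χ p p₁ φ i j θ v) *
        (v * (η θ v * gaugeP (m θ v) 1 (χ θ v)))) := by
    push_cast; ring
  rw [this, Complex.re_ofReal_mul]
  ring_nf

theorem continuous_branchDeriv {m : D → ℝ → ℂ} (hp : IsParallel m m₁ χ p p₁)
    {φ : ℝ × Transverse → ℝ} (hφ : IsTestFunction D φ) (i j : Fin 2) :
    Continuous fun y : D × Ioi (0 : ℝ) => branchDeriv m χ p p₁ φ i j y.1 y.2 := by
  obtain ⟨a, b, ha, hb, hab, -⟩ := hφ.exists_interval hφ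
  have hA := isAmplitude_smear hp hφ ha hb hab i j
  have h1 : Continuous fun y : D × Ioi (0 : ℝ) => smearKernelDeriv m χ p p₁ φ i j y.1 y.2 :=
    hA.continuous_funKernelDeriv 0
  have hc : Continuous fun y : D × Ioi (0 : ℝ) => (y.1, (y.2 : ℝ)) := by fun_prop
  have h2 : Continuous fun y : D × Ioi (0 : ℝ) => gaugeP (m y.1 y.2) 1 (χ y.1 y.2) :=
    continuous_gaugeP (hp.cont_m.comp hc) continuous_const (hp.cont_χ.comp hc)
      fun _ => hp.norm_lt _ _
  have h3 : Continuous fun y : D × Ioi (0 : ℝ) => -(1 / 2) * ((y.2 : ℝ) : ℂ) := by fun_prop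
  exact (h3.mul (Complex.continuous_conj.comp h1)).mul h2

theorem exists_branchDeriv_bound {m : D → ℝ → ℂ} (hp : IsParallel m m₁ χ p p₁)
    {φ : ℝ × Transverse → ℝ} (hφ : IsTestFunction D φ) (i j : Fin 2) {K : Set Transverse}
    (hK : IsCompact K) (hKD : K ⊆ D) :
    ∃ C, 0 ≤ C ∧ ∀ v ∈ Ioo (0 : ℝ) 1, ∀ θ ∈ K,
      ‖onBranch D (smearKernelDeriv m χ p p₁ φ i j) (v, θ)‖ ≤ C ∧
      ‖onBranch D (branchDeriv m χ p p₁ φ i j) (v, θ)‖ ≤ C * v := by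
  obtain ⟨a, b, ha, hb, hab, -⟩ := hφ.exists_interval hφ
  have hA := isAmplitude_smear hp hφ ha hb hab i j
  obtain ⟨C₁, hC₁0, hC₁⟩ := hA.exists_kern_bound (isCompact_preimage_val hK hKD)
  have h2 : Continuous fun y : D × ℝ => gaugeP (m y.1 y.2) 1 (χ y.1 y.2) :=
    continuous_gaugeP hp.cont_m continuous_const hp.cont_χ fun _ => hp.norm_lt _ _
  obtain ⟨C₂, hC₂⟩ := ((isCompact_preimage_val hK hKD).prod
    (isCompact_Icc (a := (0 : ℝ)) (b := 1))).exists_bound_of_continuousOn h2.continuousOn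
  have hle : 0 ≤ C₁ * (max C₂ 0) := by positivity
  refine ⟨C₁ + C₁ * (max C₂ 0), by positivity, fun v hv θ hθ => ?_⟩
  have hv0 := hv.1
  have e1 : ‖smearKernelDeriv m χ p p₁ φ i j ⟨θ, hKD hθ⟩ v‖ ≤ C₁ :=
    IsAmplitude.norm_funKernelDeriv_le
      (fun q s hq hs => (hC₁ ⟨θ, hKD hθ⟩ hθ q s hq hs).2) ⟨le_rfl, zero_le_one⟩ hv.1.le
  have e2 : ‖gaugeP (m ⟨θ, hKD hθ⟩ v) 1 (χ ⟨θ, hKD hθ⟩ v)‖ ≤ max C₂ 0 :=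
    (hC₂ (⟨θ, hKD hθ⟩, v) ⟨hθ, Ioo_subset_Icc_self hv⟩).trans (le_max_left _ _)
  rw [onBranch_apply _ (hKD hθ), onBranch_apply _ (hKD hθ)]
  refine ⟨by linarith, ?_⟩
  rw [branchDeriv]
  simp only [norm_mul, Complex.norm_conj, Complex.norm_real, Real.norm_eq_abs, abs_of_pos hv0]
  have e3 : ‖(-(1 / 2) : ℂ)‖ ≤ 1 := by norm_num
  calc _ ≤ 1 * v * C₁ * max C₂ 0 := by gcongr
    _ ≤ _ := by nlinarith [mul_nonneg hC₁0 hv0.le]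

theorem integrable_branchDeriv_mul (hD : IsOpen D) {m : D → ℝ → ℂ} (hp : IsParallel m m₁ χ p p₁)
    {φ : ℝ × Transverse → ℝ} (hφ : IsTestFunction D φ) (i j : Fin 2) (hη : IsVariation D η) :
    Integrable (fun y => onBranch D (branchDeriv m χ p p₁ φ i j) y * η y)
      (unitMeasure.prod (volume.restrict D)) := by
  have hK : IsCompact (Prod.snd '' tsupport η) := hη.compact.image continuous_snd
  have hKD : Prod.snd '' tsupport η ⊆ D := by
    rintro _ ⟨y, hy, rfl⟩
    exact (hη.support hy).2
  obtain ⟨B, hB⟩ := hη.smooth.continuous.bounded_above_of_compact_support hη.compact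
  obtain ⟨C, hC0, hC⟩ := exists_branchDeriv_bound hp hφ i j hK hKD
  refine integrable_onBranch hD hK (C := C * B) ?_ (fun v hv θ hθ => ?_) fun v θ hθ => ?_
  · exact ((continuousOn_onBranch (continuous_branchDeriv hp hφ i j)).mono
      (prod_mono Ioo_subset_Ioi_self le_rfl)).mul hη.smooth.continuous.continuousOn
  · rw [norm_mul]
    refine mul_le_mul ((hC v hv θ hθ).2.trans ?_) (hB _) (norm_nonneg _) hC0
    nlinarith [hv.2]
  · have : η (v, θ) = 0 := image_eq_zero_of_notMem_tsupport fun hmem => hθ ⟨_, hmem, rfl⟩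
    rw [this, mul_zero]

/-- The functional derivatives of the smeared `E`. -/
theorem hasFunctionalDerivs_smearedE (hD : IsOpen D) (h : IsRegularBranch D μ ρ₀)
    (hp : IsParallel (fun (θ : D) v => μ (clamp v, θ)) m₁ χ p p₁) {φ : ℝ × Transverse → ℝ}
    (hφ : IsTestFunction D φ) (i j : Fin 2) :
    HasFunctionalDerivs D (smearedE D ρ₀ φ i j) μ
      (onBranch D (branchDeriv (fun (θ : D) v => μ (clamp v, θ)) χ p p₁ φ i j))
      (fun y => conj (onBranch D (branchDeriv (fun (θ : D) v => μ (clamp v, θ)) χ p p₁ φ i j) y)) := by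
  intro η hη
  set m : D → ℝ → ℂ := fun θ v => μ (clamp v, θ) with hm
  set f := onBranch D (branchDeriv m χ p p₁ φ i j) with hf
  have hi := integrable_branchDeriv_mul hD hp hφ i j hη
  have hi' : Integrable (fun y => conj (f y) * conj (η y)) (unitMeasure.prod (volume.restrict D)) := by
    refine (Complex.conjCLE.toContinuousLinearMap.integrable_comp hi).congr ?_
    filter_upwards with y
    simp [hf]
  rw [IntegrableOn, IntegrableOn, restrict_branch]
  refine ⟨hi, hi', ?_⟩
  obtain ⟨τ, hτ, hv⟩ := exists_isVariationFamily h hp hη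
  set ηD : D → ℝ → ℂ := fun θ v => η (v, θ) with hηD
  set η₁ : D → ℝ → ℂ := fun θ v => fderiv ℝ η (v, θ) (1, 0) with hη₁
  have hd := hasDerivAt_smeared hD hv hφ i j
  -- On each generator the response formula is integrated against φ over the deformation points, and
  -- `integral_angle` moves the derivative from y to the kernel.
  have hval : ∫ y, φ y * onBranch D (fun θ v => varEDeriv m m₁ χ ηD η₁
      (fun s => τ * Real.sin (s / τ)) (fun s => Real.cos (s / τ)) (0, θ) v i j) y
        ∂unitMeasure.prod (volume.restrict D) =
      ∫ y, onBranch D (fun θ v => -inner ℝ (smearKernelDeriv m χ p p₁ φ i j θ v)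
        (varY m χ ηD θ v)) y ∂unitMeasure.prod (volume.restrict D) := by
    have hE' : Continuous fun y : D × ℝ => varEDeriv m m₁ χ ηD η₁
        (fun s => τ * Real.sin (s / τ)) (fun s => Real.cos (s / τ)) (0, y.1) y.2 i j :=
      ((continuous_apply j).comp ((continuous_apply i).comp hv.continuous_varEDeriv)).comp
        (f := fun y : D × ℝ => (((0 : ℝ), y.1), y.2)) (by fun_prop)
    have hint2 : Integrable (onBranch D (fun θ v => -inner ℝ (smearKernelDeriv m χ p p₁ φ i j θ v)
        (varY m χ ηD θ v))) (unitMeasure.prod (volume.restrict D)) := by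
      refine (hi.add hi').re.congr ?_
      filter_upwards [ae_branch hD] with y hy
      obtain ⟨v, θ⟩ := y
      simp only [Pi.add_apply, hf, onBranch_apply _ hy.2]
      have := branchDeriv_pairing m χ p p₁ φ i j ηD ⟨θ, hy.2⟩ v
      simp only [hηD] at this ⊢
      rw [this]
      rfl
    rw [integral_prod_symm _ (integrable_smear hD hφ hE'), integral_prod_symm _ hint2]
    refine integral_congr_ae ?_
    filter_upwards [ae_restrict_mem hD.measurableSet] with θ hθ
    simp only [onBranch_apply _ hθ]
    obtain ⟨a, b, ha, hb, hab, -⟩ := hφ.exists_interval hφ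
    have hA := isAmplitude_smear hp hφ ha hb hab i j
    have hx : ∀ {f : D → ℝ → ℂ}, (Continuous fun y : D × ℝ => f y.1 y.2) →
        Continuous (f ⟨θ, hθ⟩) := fun hf =>
      hf.comp (f := fun v : ℝ => ((⟨θ, hθ⟩ : D), v)) (by fun_prop)
    have hang := hA.integral_angle ⟨θ, hθ⟩ (y := varY m χ ηD ⟨θ, hθ⟩)
      (y' := varYDeriv m m₁ χ ηD η₁ ⟨θ, hθ⟩)
      (hx hv.continuous_varY) (hx hv.continuous_varYDeriv)
      fun v hv' => hv.hasDerivAt_varY ⟨θ, hθ⟩ hv'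
    rw [integral_neg]
    refine Eq.trans (integral_congr_ae ?_) hang
    filter_upwards [ae_unitMeasure] with r hr
    rw [hv.varEDeriv_zero ⟨θ, hθ⟩ ⟨hr.1, hr.2.le⟩ i j, ← intervalIntegral.integral_const_mul]
    refine intervalIntegral.integral_congr fun t _ => ?_
    simp only [smearC, real_inner_smul_left]
    ring
  have hgoal : ((∫ y, φ y * onBranch D (fun θ v => varEDeriv m m₁ χ ηD η₁
      (fun s => τ * Real.sin (s / τ)) (fun s => Real.cos (s / τ)) (0, θ) v i j) y
        ∂unitMeasure.prod (volume.restrict D) : ℝ) : ℂ) =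
      ∫ y, (f y * η y + conj (f y) * conj (η y)) ∂unitMeasure.prod (volume.restrict D) := by
    rw [hval]
    refine integral_complex_ofReal.symm.trans (integral_congr_ae ?_)
    filter_upwards [ae_branch hD] with y hy
    obtain ⟨v, θ⟩ := y
    simp only [hf, onBranch_apply _ hy.2]
    exact (branchDeriv_pairing m χ p p₁ φ i j ηD ⟨θ, hy.2⟩ v).symm
  rw [← hgoal]
  refine HasDerivAt.ofReal_comp ?_
  -- The value t of the linear parameter is reached at s = τ arcsin(t/τ) for |t| < τ, a
  -- reparametrization with unit derivative at 0.
  have hs : HasDerivAt (fun t : ℝ => τ * Real.arcsin (t / τ)) 1 0 := by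
    have h1 := HasDerivAt.comp (h₂ := Real.arcsin) (h := fun t : ℝ => t / τ) (0 : ℝ)
      (Real.hasDerivAt_arcsin (x := 0 / τ) (by simp) (by simp))
      ((hasDerivAt_id (0 : ℝ)).div_const τ)
    refine (h1.const_mul τ).congr_deriv ?_
    simp [hτ.ne']
  have h0 : τ * Real.arcsin (0 / τ) = 0 := by simp
  have hcomp := HasDerivAt.scomp (0 : ℝ) (g₁ := fun s => ∫ y, φ y * onBranch D (fun θ v =>
    varE m m₁ χ ηD η₁ (fun s => τ * Real.sin (s / τ)) (s, θ) v i j) y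
      ∂unitMeasure.prod (volume.restrict D)) (h := fun t : ℝ => τ * Real.arcsin (t / τ))
    (by rw [h0]; exact hd) hs
  rw [one_smul] at hcomp
  refine hcomp.congr_of_eventuallyEq ?_
  filter_upwards [Ioo_mem_nhds (neg_lt_zero.2 hτ) hτ] with t ht
  have ht' : τ * Real.sin (τ * Real.arcsin (t / τ) / τ) = t := by
    rw [mul_div_cancel_left₀ _ hτ.ne', Real.sin_arcsin]
    · field_simp
    · rw [le_div_iff₀ hτ]; linarith [ht.1]
    · rw [div_le_iff₀ hτ]; linarith [ht.2]
  have := smearedE_variation hD h hv φ i j (τ * Real.arcsin (t / τ))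
  rw [ht'] at this
  exact this

end

/-! ### The step kernel -/

/-- `k'` is a bounded derivative of a function that vanishes at both ends of the unit interval. -/
structure IsUnitPrimitive (k k' : ℝ → ℂ) (C : ℝ) : Prop where
  cont : ContinuousOn k (Icc 0 1)
  cont' : ContinuousOn k' (Ioo 0 1)
  deriv : ∀ v ∈ Ioo (0 : ℝ) 1, HasDerivAt k (k' v) v
  zero : k 0 = 0
  one : k 1 = 0
  bound : ∀ v ∈ Ioo (0 : ℝ) 1, ‖k' v‖ ≤ C

namespace IsUnitPrimitive

variable {k k' k₁ k₁' k₂ k₂' : ℝ → ℂ} {C C₁ C₂ : ℝ}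

theorem integrable' (h : IsUnitPrimitive k k' C) : Integrable k' unitMeasure := by
  refine Integrable.of_bound (h.cont'.aestronglyMeasurable measurableSet_Ioo) C ?_
  filter_upwards [ae_unitMeasure] with v hv using h.bound v hv

theorem integrable (h : IsUnitPrimitive k k' C) : Integrable k unitMeasure :=
  (h.cont.integrableOn_compact isCompact_Icc).mono_set Ioo_subset_Icc_self

/-- The step function integrates k' from the caustic up to v, and k vanishes at the caustic. -/
theorem integral_step (h : IsUnitPrimitive k k' C) {v : ℝ} (hv : v ∈ Ioo (0 : ℝ) 1) :
    ∫ u, (if u ≤ v then k' u else 0) ∂unitMeasure = k v := by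
  have e1 : (fun u => if u ≤ v then k' u else 0) = (Iic v).indicator k' := by
    ext u; simp [indicator, mem_Iic]
  have e2 : Iic v ∩ Ioo (0 : ℝ) 1 = Ioc 0 v := by
    ext u; simp only [mem_inter_iff, mem_Iic, mem_Ioo, mem_Ioc]
    constructor
    · rintro ⟨h1, h2, h3⟩; exact ⟨h2, h1⟩
    · rintro ⟨h1, h2⟩; exact ⟨h2, h1, h2.trans_lt hv.2⟩
  have hi : IntervalIntegrable k' volume 0 v := by
    rw [intervalIntegrable_iff_integrableOn_Ioc_of_le hv.1.le]
    have hsub : Ioc (0 : ℝ) v ⊆ Ioo 0 1 := fun u hu => ⟨hu.1, hu.2.trans_lt hv.2⟩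
    exact h.integrable'.mono_measure (Measure.restrict_mono hsub le_rfl)
  rw [e1, integral_indicator measurableSet_Iic, unitMeasure,
    Measure.restrict_restrict measurableSet_Iic, e2, ← intervalIntegral.integral_of_le hv.1.le,
    intervalIntegral.integral_eq_sub_of_hasDerivAt_of_le hv.1.le
      (h.cont.mono (Icc_subset_Icc le_rfl hv.2.le))
      (fun u hu => h.deriv u ⟨hu.1, hu.2.trans hv.2⟩) hi, h.zero, sub_zero]

theorem integrable_stepKernel (h₁ : IsUnitPrimitive k₁ k₁' C₁) (h₂ : IsUnitPrimitive k₂ k₂' C₂) :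
    Integrable (fun y : ℝ × ℝ => if y.2 ≤ y.1 then conj (k₁' y.1) * k₂' y.2 else 0)
      (unitMeasure.prod unitMeasure) := by
  have h : Integrable (fun y : ℝ × ℝ => conj (k₁' y.1) * k₂' y.2) (unitMeasure.prod unitMeasure) :=
    (Complex.conjCLE.toContinuousLinearMap.integrable_comp h₁.integrable').mul_prod h₂.integrable'
  have hm : MeasurableSet {y : ℝ × ℝ | y.2 ≤ y.1} := measurableSet_le measurable_snd measurable_fst
  refine (h.indicator hm).congr (Eventually.of_forall fun y => ?_)
  simp [indicator]

theorem integral_stepKernel (h₁ : IsUnitPrimitive k₁ k₁' C₁) (h₂ : IsUnitPrimitive k₂ k₂' C₂) :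
    ∫ y : ℝ × ℝ, (if y.2 ≤ y.1 then conj (k₁' y.1) * k₂' y.2 else 0)
      ∂unitMeasure.prod unitMeasure = ∫ v, conj (k₁' v) * k₂ v ∂unitMeasure := by
  rw [integral_prod _ (h₁.integrable_stepKernel h₂)]
  refine integral_congr_ae ?_
  filter_upwards [ae_unitMeasure] with v hv
  rw [← h₂.integral_step hv, ← integral_const_mul]
  refine integral_congr_ae (Eventually.of_forall fun u => ?_)
  simp only [mul_ite, mul_zero]

theorem integral_conj_mul_symm (h₁ : IsUnitPrimitive k₁ k₁' C₁) (h₂ : IsUnitPrimitive k₂ k₂' C₂) :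
    ∫ v, conj (k₂' v) * k₁ v ∂unitMeasure = -∫ v, conj (k₂ v) * k₁' v ∂unitMeasure := by
  obtain ⟨B₁, hB₁⟩ := (isCompact_Icc (a := (0 : ℝ)) (b := 1)).exists_bound_of_continuousOn h₁.cont
  obtain ⟨B₂, hB₂⟩ := (isCompact_Icc (a := (0 : ℝ)) (b := 1)).exists_bound_of_continuousOn h₂.cont
  have hi1 : Integrable (fun v => conj (k₂' v) * k₁ v) unitMeasure := by
    refine (Complex.conjCLE.toContinuousLinearMap.integrable_comp h₂.integrable').mul_bdd (c := B₁)
      h₁.integrable.aestronglyMeasurable ?_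
    filter_upwards [ae_unitMeasure] with v hv using hB₁ v (Ioo_subset_Icc_self hv)
  have hi2 : Integrable (fun v => conj (k₂ v) * k₁' v) unitMeasure := by
    refine h₁.integrable'.bdd_mul (c := B₂)
      (Complex.continuous_conj.comp_aestronglyMeasurable h₂.integrable.aestronglyMeasurable) ?_
    filter_upwards [ae_unitMeasure] with v hv
    rw [Complex.norm_conj]
    exact hB₂ v (Ioo_subset_Icc_self hv)
  have hint : IntervalIntegrable (fun v => conj (k₂' v) * k₁ v + conj (k₂ v) * k₁' v) volume 0 1 := by
    rw [intervalIntegrable_iff_integrableOn_Ioo_of_le zero_le_one]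
    exact hi1.add hi2
  have hftc := intervalIntegral.integral_eq_sub_of_hasDerivAt_of_le (a := 0) (b := 1)
    (f := fun v => conj (k₂ v) * k₁ v) zero_le_one
    ((Complex.continuous_conj.comp_continuousOn h₂.cont).mul h₁.cont)
    (fun v hv => (h₂.deriv v hv).star.mul (h₁.deriv v hv)) hint
  rw [h₁.zero, h₁.one, mul_zero, mul_zero, sub_zero, intervalIntegral.integral_of_le zero_le_one,
    integral_Ioc_eq_integral_Ioo] at hftc
  have := (integral_add hi1 hi2).symm.trans hftc
  exact eq_neg_of_add_eq_zero_left this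

/-- The first term yields ∫ k̄₁' k₂. The second yields ∫ k̄₂' k₁ = -∫ k̄₂ k₁', because both
functions vanish at both ends. The difference is an integral plus its conjugate, hence twice a real
inner product. -/
theorem integral_antisymm (h₁ : IsUnitPrimitive k₁ k₁' C₁) (h₂ : IsUnitPrimitive k₂ k₂' C₂) :
    ∫ y : ℝ × ℝ, ((if y.2 ≤ y.1 then conj (k₁' y.1) * k₂' y.2 else 0) -
      (if y.1 ≤ y.2 then conj (k₂' y.2) * k₁' y.1 else 0)) ∂unitMeasure.prod unitMeasure =
      ((2 * ∫ v, inner ℝ (k₁' v) (k₂ v) ∂unitMeasure : ℝ) : ℂ) := by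
  have hi := h₁.integrable_stepKernel h₂
  have hi' : Integrable (fun y : ℝ × ℝ => if y.1 ≤ y.2 then conj (k₂' y.2) * k₁' y.1 else 0)
      (unitMeasure.prod unitMeasure) := (h₂.integrable_stepKernel h₁).swap
  have e : ∫ y : ℝ × ℝ, (if y.1 ≤ y.2 then conj (k₂' y.2) * k₁' y.1 else 0)
      ∂unitMeasure.prod unitMeasure = ∫ v, conj (k₂' v) * k₁ v ∂unitMeasure := by
    rw [← h₂.integral_stepKernel h₁]
    exact integral_prod_swap (μ := unitMeasure) (ν := unitMeasure)
      (fun y : ℝ × ℝ => if y.2 ≤ y.1 then conj (k₂' y.1) * k₁' y.2 else 0)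
  obtain ⟨B₂, hB₂⟩ := (isCompact_Icc (a := (0 : ℝ)) (b := 1)).exists_bound_of_continuousOn h₂.cont
  have hi2 : Integrable (fun v => conj (k₁' v) * k₂ v) unitMeasure := by
    refine (Complex.conjCLE.toContinuousLinearMap.integrable_comp h₁.integrable').mul_bdd (c := B₂)
      h₂.integrable.aestronglyMeasurable ?_
    filter_upwards [ae_unitMeasure] with v hv using hB₂ v (Ioo_subset_Icc_self hv)
  have hi3 : Integrable (fun v => conj (k₂ v) * k₁' v) unitMeasure := by
    refine (Complex.conjCLE.toContinuousLinearMap.integrable_comp hi2).congr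
      (Eventually.of_forall fun v => ?_)
    simp [mul_comm]
  rw [integral_sub hi hi', h₁.integral_stepKernel h₂, e, h₁.integral_conj_mul_symm h₂, sub_neg_eq_add,
    ← integral_add hi2 hi3, ← integral_const_mul]
  refine Eq.trans (integral_congr_ae (Eventually.of_forall fun v => ?_)) integral_complex_ofReal
  simp only [Complex.inner]
  apply Complex.ext <;> simp <;> ring

end IsUnitPrimitive

/-! ### The bracket kernel in the parallel gauge -/

section

variable {D : Set Transverse} {μ : ℝ × Transverse → ℂ} {ρ₀ : Transverse → ℝ}
  {m₁ : D → ℝ → ℂ} {χ : D → ℝ → ℝ} {p p₁ : D → ℝ → ℂ}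

/-- The integrand is 2i times the rotation rate of the symmetric zweibein: the phase in the bracket
is the holonomy that the parallel gauge removes. -/
theorem phaseIntegral_eq (hp : IsParallel (fun (θ : D) v => μ (clamp v, θ)) m₁ χ p p₁) (θ : D)
    {v₁ v₂ : ℝ} (h₁ : v₁ ∈ Ioo (0 : ℝ) 1) (h₂ : v₂ ∈ Ioo (0 : ℝ) 1) :
    phaseIntegral μ θ v₁ v₂ = 2 * Complex.I * (χ θ v₂ - χ θ v₁) := by
  have hsub : uIcc v₁ v₂ ⊆ Ioo 0 1 := by
    intro v hv
    rw [mem_uIcc] at hv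
    rcases hv with hv | hv
    · exact ⟨h₁.1.trans_le hv.1, hv.2.trans_lt h₂.2⟩
    · exact ⟨h₂.1.trans_le hv.1, hv.2.trans_lt h₁.2⟩
  have hx : Continuous fun v : ℝ => (θ, v) := by fun_prop
  have hc : Continuous fun v => gaugeQ (μ (clamp v, θ)) (m₁ θ v) :=
    continuous_gaugeQ (hp.cont_m.comp hx) (hp.cont_m₁.comp hx) fun v => hp.norm_lt θ v
  have hftc := intervalIntegral.integral_eq_sub_of_hasDerivAt (a := v₁) (b := v₂)
    (fun v _ => hp.deriv_χ θ v) (hc.intervalIntegrable _ _)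
  rw [← Complex.ofReal_sub, ← hftc, ← intervalIntegral.integral_ofReal,
    ← intervalIntegral.integral_const_mul, phaseIntegral]
  refine intervalIntegral.integral_congr fun v hv => ?_
  have hv1 := hsub hv
  have hd : deriv (fun x => μ (x, θ)) v = m₁ θ v := by
    refine ((hp.deriv_m θ v hv1).congr_of_eventuallyEq ?_).deriv
    filter_upwards [Icc_mem_nhds hv1.1 hv1.2] with x hx
    rw [clamp_of_mem hx]
  simp only [hd, gaugeQ, clamp_of_mem (Ioo_subset_Icc_self hv1)]
  rw [Complex.ofReal_div, ← mul_div_assoc]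
  congr 1
  apply Complex.ext <;> simp; ring

/-- The factors v₁ v₂/((1-|μ₁|²)(1-|μ₂|²)) from the functional derivatives cancel the weights of the
kernel up to 1/ρ₀, the phases e^{2iχ₁} and e^{-2iχ₂} cancel e^{2i(χ₂-χ₁)}, and 4 · (1/2)² = 1.
Dependence on the points survives only through the step function and the two kernels. -/
theorem branchDeriv_bracketKernel (G : ℝ) (h : IsRegularBranch D μ ρ₀)
    (hp : IsParallel (fun (θ : D) v => μ (clamp v, θ)) m₁ χ p p₁) (φ ψ : ℝ × Transverse → ℝ)
    (i j k l : Fin 2) (θ : D) {v₁ v₂ : ℝ} (h₁ : v₁ ∈ Ioo (0 : ℝ) 1) (h₂ : v₂ ∈ Ioo (0 : ℝ) 1) :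
    branchDeriv (fun (θ : D) v => μ (clamp v, θ)) χ p p₁ φ i j θ v₁ * bracketKernel G ρ₀ μ θ v₁ v₂ *
      conj (branchDeriv (fun (θ : D) v => μ (clamp v, θ)) χ p p₁ ψ k l θ v₂) =
    ((Real.pi * G / ρ₀ θ : ℝ) : ℂ) * (if v₂ ≤ v₁ then
      conj (smearKernelDeriv (fun (θ : D) v => μ (clamp v, θ)) χ p p₁ φ i j θ v₁) *
        smearKernelDeriv (fun (θ : D) v => μ (clamp v, θ)) χ p p₁ ψ k l θ v₂ else 0) := by
  rw [bracketKernel]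
  split_ifs with hle
  · have hρ := h.rho_pos θ θ.2
    have c₁ := clamp_of_mem (Ioo_subset_Icc_self h₁)
    have c₂ := clamp_of_mem (Ioo_subset_Icc_self h₂)
    have g₁ := one_sub_norm_sq_pos (hp.norm_lt θ v₁)
    have g₂ := one_sub_norm_sq_pos (hp.norm_lt θ v₂)
    simp only [c₁, c₂] at g₁ g₂
    have hs : ∀ v : ℝ, 0 < v → √(areaDensity ρ₀ θ v) = √(ρ₀ θ) * v := fun v hv => by
      rw [areaDensity, Real.sqrt_mul hρ.le, Real.sqrt_sq hv.le]
    have hr : √(ρ₀ θ) * √(ρ₀ θ) = ρ₀ θ := Real.mul_self_sqrt hρ.le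
    have hr0 : √(ρ₀ θ) ≠ 0 := (Real.sqrt_pos.2 hρ).ne'
    have hE : Complex.exp (2 * χ θ v₁ * Complex.I) *
        Complex.exp (2 * Complex.I * (χ θ v₂ - χ θ v₁)) *
          conj (Complex.exp (2 * χ θ v₂ * Complex.I)) = 1 := by
      rw [← Complex.exp_conj, ← Complex.exp_add, ← Complex.exp_add]
      simp only [map_mul, map_ofNat, Complex.conj_ofReal, Complex.conj_I]
      rw [← Complex.exp_zero]
      congr 1
      ring
    rw [phaseIntegral_eq hp θ h₁ h₂, hs v₁ h₁.1, hs v₂ h₂.1]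
    set K₁ := smearKernelDeriv (fun (θ : D) v => μ (clamp v, θ)) χ p p₁ φ i j θ v₁ with hK₁
    set K₂ := smearKernelDeriv (fun (θ : D) v => μ (clamp v, θ)) χ p p₁ ψ k l θ v₂ with hK₂
    have hco : 4 * Real.pi * G * ((1 - ‖μ (v₁, θ)‖ ^ 2) / (√(ρ₀ θ) * v₁)) *
        ((1 - ‖μ (v₂, θ)‖ ^ 2) / (√(ρ₀ θ) * v₂)) =
        4 * (Real.pi * G / ρ₀ θ) * ((1 - ‖μ (v₁, θ)‖ ^ 2) / v₁) * ((1 - ‖μ (v₂, θ)‖ ^ 2) / v₂) := by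
      have : ∀ s ρ A B v w : ℝ, s * s = ρ → s ≠ 0 → 4 * Real.pi * G * (A / (s * v)) * (B / (s * w)) =
          4 * (Real.pi * G / ρ) * (A / v) * (B / w) := by
        rintro s _ A B v w rfl hs
        field_simp
      exact this _ _ _ _ _ _ hr hr0
    rw [hco]
    simp only [branchDeriv, gaugeP, ← hK₁, ← hK₂, c₁, c₂, map_mul, map_div₀, Complex.conj_ofReal,
      Complex.conj_conj, map_neg, map_one, mul_one]
    set g := Real.pi * G / ρ₀ θ
    set n₁ := 1 - ‖μ (v₁, θ)‖ ^ 2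
    set n₂ := 1 - ‖μ (v₂, θ)‖ ^ 2
    have hn₁ : (n₁ : ℂ) ≠ 0 := by exact_mod_cast g₁.ne'
    have hn₂ : (n₂ : ℂ) ≠ 0 := by exact_mod_cast g₂.ne'
    have hv₁ : (v₁ : ℂ) ≠ 0 := by exact_mod_cast h₁.1.ne'
    have hv₂ : (v₂ : ℂ) ≠ 0 := by exact_mod_cast h₂.1.ne'
    have h2 : conj (2 : ℂ) = 2 := map_ofNat _ _
    rw [h2]
    push_cast
    generalize Complex.exp (2 * χ θ v₁ * Complex.I) = e₁ at hE ⊢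
    generalize Complex.exp (2 * Complex.I * (χ θ v₂ - χ θ v₁)) = e₂ at hE ⊢
    generalize conj (Complex.exp (2 * χ θ v₂ * Complex.I)) = e₃ at hE ⊢
    field_simp
    linear_combination 4 * (g : ℂ) * conj K₁ * K₂ * hE
  · simp

end

/-! ### Pairs of points on the same generator -/

/-- The measure on pairs of points on the same generator. -/
def pairMeasure (D : Set Transverse) : Measure (Transverse × ℝ × ℝ) :=
  (volume.restrict D).prod (unitMeasure.prod unitMeasure)

section

variable {D : Set Transverse}

theorem ae_pairMeasure (hD : IsOpen D) :
    ∀ᵐ q ∂pairMeasure D, q.1 ∈ D ∧ q.2.1 ∈ Ioo (0 : ℝ) 1 ∧ q.2.2 ∈ Ioo (0 : ℝ) 1 :=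
  (Measure.quasiMeasurePreserving_fst.ae (ae_restrict_mem hD.measurableSet)).and
    (Measure.quasiMeasurePreserving_snd.ae ae_unitMeasure_prod)

/-- The data are controlled on the branch only, so measurability is derived from continuity on the
interior, which has full measure. -/
theorem aestronglyMeasurable_pairMeasure {E : Type*} [TopologicalSpace E]
    [TopologicalSpace.PseudoMetrizableSpace E] [SecondCountableTopology E] (hD : IsOpen D)
    {f : Transverse × ℝ × ℝ → E} (hf : ContinuousOn f (D ×ˢ (Ioo 0 1 ×ˢ Ioo 0 1))) :
    AEStronglyMeasurable f (pairMeasure D) := by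
  have e : pairMeasure D = (volume : Measure (Transverse × ℝ × ℝ)).restrict
      (D ×ˢ (Ioo (0 : ℝ) 1 ×ˢ Ioo (0 : ℝ) 1)) := by
    rw [pairMeasure, Measure.volume_eq_prod, ← Measure.prod_restrict, Measure.volume_eq_prod,
      ← Measure.prod_restrict]
    rfl
  rw [e]
  exact hf.aestronglyMeasurable
    (hD.measurableSet.prod (measurableSet_Ioo.prod measurableSet_Ioo))

theorem continuousOn_pair_fst {E : Type*} [TopologicalSpace E] {f : ℝ × Transverse → E}
    (hf : ContinuousOn f (Ioo 0 1 ×ˢ D)) :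
    ContinuousOn (fun q : Transverse × ℝ × ℝ => f (q.2.1, q.1)) (D ×ˢ (Ioo 0 1 ×ˢ Ioo 0 1)) :=
  hf.comp (f := fun q : Transverse × ℝ × ℝ => (q.2.1, q.1)) (by fun_prop)
    fun _ hq => ⟨hq.2.1, hq.1⟩

theorem continuousOn_pair_snd {E : Type*} [TopologicalSpace E] {f : ℝ × Transverse → E}
    (hf : ContinuousOn f (Ioo 0 1 ×ˢ D)) :
    ContinuousOn (fun q : Transverse × ℝ × ℝ => f (q.2.2, q.1)) (D ×ˢ (Ioo 0 1 ×ˢ Ioo 0 1)) :=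
  hf.comp (f := fun q : Transverse × ℝ × ℝ => (q.2.2, q.1)) (by fun_prop)
    fun _ hq => ⟨hq.2.2, hq.1⟩

theorem integrable_pairMeasure {E : Type*} [NormedAddCommGroup E] {K : Set Transverse}
    (hK : IsCompact K) (hD : IsOpen D) {f : Transverse × ℝ × ℝ → E}
    (hf : AEStronglyMeasurable f (pairMeasure D)) {C : ℝ}
    (hC : ∀ θ ∈ K, ∀ y : ℝ × ℝ, y.1 ∈ Ioo (0 : ℝ) 1 → y.2 ∈ Ioo (0 : ℝ) 1 → ‖f (θ, y)‖ ≤ C)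
    (h0 : ∀ θ ∉ K, ∀ y, f (θ, y) = 0) : Integrable f (pairMeasure D) := by
  refine integrable_of_indicator_bound (S := K ×ˢ univ) (C := C) hf
    (hK.measurableSet.prod MeasurableSet.univ) ?_ ?_ ?_
  · rw [pairMeasure, Measure.prod_prod]
    exact ENNReal.mul_lt_top ((Measure.restrict_apply_le _ _).trans_lt hK.measure_lt_top)
      (measure_lt_top _ _)
  · filter_upwards with q hq
    exact h0 q.1 (fun h => hq ⟨h, trivial⟩) q.2
  · filter_upwards [ae_pairMeasure hD] with q hq hqK
    exact hC q.1 hqK.1 q.2 hq.2.1 hq.2.2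

theorem IsTestFunction.isCompact_generators {φ : ℝ × Transverse → ℝ} (hφ : IsTestFunction D φ) :
    IsCompact (Prod.snd '' tsupport φ) ∧ Prod.snd '' tsupport φ ⊆ D := by
  refine ⟨hφ.compact.image continuous_snd, ?_⟩
  rintro _ ⟨y, hy, rfl⟩
  exact (hφ.support hy).2

theorem eq_zero_of_notMem_generators {φ : ℝ × Transverse → ℝ} {θ : Transverse}
    (hθ : θ ∉ Prod.snd '' tsupport φ) (v : ℝ) : φ (v, θ) = 0 :=
  image_eq_zero_of_notMem_tsupport fun h => hθ ⟨_, h, rfl⟩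

theorem smearKernelDeriv_eq_zero (m : D → ℝ → ℂ) (χ : D → ℝ → ℝ) (p p₁ : D → ℝ → ℂ)
    {φ : ℝ × Transverse → ℝ} (i j : Fin 2) {θ : D} (hθ : (θ : Transverse) ∉ Prod.snd '' tsupport φ)
    (v : ℝ) : smearKernelDeriv m χ p p₁ φ i j θ v = 0 := by
  have h0 := eq_zero_of_notMem_generators hθ
  have h1 : ∀ r : ℝ, fderiv ℝ φ (r, θ) = 0 := fun r =>
    image_eq_zero_of_notMem_tsupport fun h => hθ ⟨_, tsupport_fderiv_subset ℝ h, rfl⟩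
  simp [smearKernelDeriv, funKernelDeriv, kernDeriv, smearC, smearCDeriv, smearD,
    IsAmplitude.angleDeriv, h0, h1]

end

/-! ### The bracket of smeared fields -/

section

variable {D : Set Transverse} {μ : ℝ × Transverse → ℂ} {ρ₀ : Transverse → ℝ}
  {m₁ : D → ℝ → ℂ} {χ : D → ℝ → ℝ} {p p₁ : D → ℝ → ℂ} {φ ψ : ℝ × Transverse → ℝ}

theorem continuousOn_inv_rho (h : IsRegularBranch D μ ρ₀) (G : ℝ) :
    ContinuousOn (fun θ => Real.pi * G / ρ₀ θ) D :=
  continuousOn_const.div h.smooth_rho.continuousOn fun θ hθ => (h.rho_pos θ hθ).ne'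

theorem isUnitPrimitive_smearKernel {m : D → ℝ → ℂ} (hp : IsParallel m m₁ χ p p₁)
    (hφ : IsTestFunction D φ) (i j : Fin 2) (θ : D) :
    ∃ C, IsUnitPrimitive (smearKernel m χ p φ i j θ) (smearKernelDeriv m χ p p₁ φ i j θ) C := by
  obtain ⟨a, b, ha, hb, hab, -⟩ := hφ.exists_interval hφ
  have hA := isAmplitude_smear hp hφ ha hb hab i j
  obtain ⟨C, hC0, hC⟩ := hA.exists_kern_bound (isCompact_singleton (x := θ))
  have h01 : (0 : ℝ) ∈ Icc (0 : ℝ) 1 := ⟨le_rfl, zero_le_one⟩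
  exact ⟨C,
    { cont := (hA.continuousOn_funKernel_Icc θ h01).mono Icc_subset_Ici_self
      cont' := (hA.continuousOn_funKernelDeriv 0 θ).mono Ioo_subset_Ioi_self
      deriv := fun v hv => hA.hasDerivAt_funKernel θ h01 hv.1
      zero := IsAmplitude.funKernel_zero θ
      one := hA.funKernel_eq_zero θ hA.b_lt
      bound := fun v hv => IsAmplitude.norm_funKernelDeriv_le
        (fun q s hq hs => (hC θ rfl q s hq hs).2) h01 hv.1.le }⟩

open Classical in
theorem integrable_stepPair (hD : IsOpen D) (h : IsRegularBranch D μ ρ₀) {m : D → ℝ → ℂ}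
    (hp : IsParallel m m₁ χ p p₁) (hφ : IsTestFunction D φ) (hψ : IsTestFunction D ψ)
    (G : ℝ) (i j k l : Fin 2) {S : Set (ℝ × ℝ)} (hS : MeasurableSet S) :
    Integrable (fun q : Transverse × ℝ × ℝ => ((Real.pi * G / ρ₀ q.1 : ℝ) : ℂ) * (if q.2 ∈ S then
      conj (onBranch D (smearKernelDeriv m χ p p₁ φ i j) (q.2.1, q.1)) *
        onBranch D (smearKernelDeriv m χ p p₁ ψ k l) (q.2.2, q.1) else 0)) (pairMeasure D) := by
  obtain ⟨hK, hKD⟩ := hφ.isCompact_generators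
  have hc : ∀ {φ : ℝ × Transverse → ℝ}, IsTestFunction D φ → ∀ i j,
      ContinuousOn (onBranch D (smearKernelDeriv m χ p p₁ φ i j)) (Ioo 0 1 ×ˢ D) := by
    intro φ hφ i j
    obtain ⟨a, b, ha, hb, hab, -⟩ := hφ.exists_interval hφ
    have hA := isAmplitude_smear hp hφ ha hb hab i j
    have h1 : Continuous fun y : D × Ioi (0 : ℝ) => smearKernelDeriv m χ p p₁ φ i j y.1 y.2 :=
      hA.continuous_funKernelDeriv 0
    exact (continuousOn_onBranch h1).mono (prod_mono Ioo_subset_Ioi_self le_rfl)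
  obtain ⟨C₁, hC₁0, hC₁⟩ := exists_branchDeriv_bound hp hφ i j hK hKD
  obtain ⟨C₂, hC₂0, hC₂⟩ := exists_branchDeriv_bound hp hψ k l hK hKD
  obtain ⟨C₀, hC₀⟩ := hK.exists_bound_of_continuousOn ((continuousOn_inv_rho h G).mono hKD)
  refine integrable_pairMeasure hK hD (C := C₀ * (C₁ * C₂)) ?_ (fun θ hθ y hy₁ hy₂ => ?_)
    fun θ hθ y => ?_
  · refine AEStronglyMeasurable.mul (aestronglyMeasurable_pairMeasure hD ?_) ?_
    · exact Complex.continuous_ofReal.comp_continuousOn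
        ((continuousOn_inv_rho h G).comp (f := Prod.fst) (by fun_prop) fun q hq => hq.1)
    · have := (aestronglyMeasurable_pairMeasure hD ((Complex.continuous_conj.comp_continuousOn
        (continuousOn_pair_fst (hc hφ i j))).mul (continuousOn_pair_snd (hc hψ k l)))).indicator
          (s := Prod.snd ⁻¹' S) (measurable_snd hS)
      refine this.congr (Eventually.of_forall fun q => ?_)
      simp [indicator]
  · have hC00 : 0 ≤ C₀ := (norm_nonneg _).trans (hC₀ θ hθ)
    rw [norm_mul, Complex.norm_real]
    refine mul_le_mul (hC₀ θ hθ) ?_ (norm_nonneg _) hC00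
    split_ifs
    · rw [norm_mul, Complex.norm_conj]
      exact mul_le_mul (hC₁ _ hy₁ θ hθ).1 (hC₂ _ hy₂ θ hθ).1 (norm_nonneg _) hC₁0
    · rw [norm_zero]; positivity
  · have : onBranch D (smearKernelDeriv m χ p p₁ φ i j) (y.1, θ) = 0 := by
      by_cases hθD : θ ∈ D
      · rw [onBranch_apply _ hθD]
        exact smearKernelDeriv_eq_zero m χ p p₁ i j (θ := ⟨θ, hθD⟩) hθ _
      · rw [onBranch, dif_neg hθD]
    simp [this]

/-- The smeared quadratic tensor. -/
def pairForm (ρ₀ : Transverse → ℝ) (μ : ℝ × Transverse → ℂ) (φ ψ : ℝ × Transverse → ℝ)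
    (i j k l : Fin 2) (θ : Transverse) (y : ℝ × ℝ) : ℝ :=
  φ (y.1, θ) * ψ (y.2, θ) *
    quadraticTensor (fieldE ρ₀ μ (y.1, θ)) (fieldE ρ₀ μ (y.2, θ)) i j k l

/-- The integrand of the bracket, as a function on ordered pairs. -/
def bracketDensity (G : ℝ) (ρ₀ : Transverse → ℝ) (μ : ℝ × Transverse → ℂ)
    (φ ψ : ℝ × Transverse → ℝ) (i j k l : Fin 2) (θ : Transverse) (y : ℝ × ℝ) : ℝ :=
  Real.pi * G / ρ₀ θ * (-(16 / (y.2 ^ 2 - y.1 ^ 2)) *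
    (pairForm ρ₀ μ φ ψ i j k l θ y - pairForm ρ₀ μ φ ψ i j k l θ y.swap))

/-- Exchanging the two points together with their index pairs is a symmetry, visible in the explicit
form. It reduces the antisymmetrization over amplitudes to one over points. -/
theorem quadraticTensor_swap {E₁ E₂ : Mat2} (h₁ : E₁.transpose = E₁) (h₂ : E₂.transpose = E₂)
    (i j k l : Fin 2) : quadraticTensor E₁ E₂ k l i j = quadraticTensor E₂ E₁ i j k l := by
  rw [quadraticTensor_eq_explicit h₁ h₂, quadraticTensor_eq_explicit h₂ h₁]
  simp only [quadraticExplicit, symPairs]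
  ring

theorem causticPairing_sub (h : IsRegularBranch D μ ρ₀)
    (hp : IsParallel (fun (θ : D) v => μ (clamp v, θ)) m₁ χ p p₁) (φ ψ : ℝ × Transverse → ℝ)
    (i j k l : Fin 2) (θ : D) {y : ℝ × ℝ} (h₁ : y.1 ∈ Ioo (0 : ℝ) 1) (h₂ : y.2 ∈ Ioo (0 : ℝ) 1) :
    IsAmplitude.causticPairing (smearC (fun (θ : D) v => μ (clamp v, θ)) χ p φ i j θ)
        (smearD (fun (θ : D) v => μ (clamp v, θ)) χ p φ i j θ)
        (smearC (fun (θ : D) v => μ (clamp v, θ)) χ p ψ k l θ)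
        (smearD (fun (θ : D) v => μ (clamp v, θ)) χ p ψ k l θ) y.1 y.2 -
      IsAmplitude.causticPairing (smearC (fun (θ : D) v => μ (clamp v, θ)) χ p ψ k l θ)
        (smearD (fun (θ : D) v => μ (clamp v, θ)) χ p ψ k l θ)
        (smearC (fun (θ : D) v => μ (clamp v, θ)) χ p φ i j θ)
        (smearD (fun (θ : D) v => μ (clamp v, θ)) χ p φ i j θ) y.1 y.2 =
      8 * (pairForm ρ₀ μ φ ψ i j k l θ y - pairForm ρ₀ μ φ ψ i j k l θ y.swap) := by
  have e₁ := hp.causticPairing_eq (fun x r => φ (r, x)) (fun x r => ψ (r, x)) i j k l θ y.1 y.2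
  have e₂ := hp.causticPairing_eq (fun x r => ψ (r, x)) (fun x r => φ (r, x)) k l i j θ y.1 y.2
  have E₁ := (fieldE_regular h hp θ ⟨h₁.1, h₁.2.le⟩).1
  have E₂ := (fieldE_regular h hp θ ⟨h₂.1, h₂.2.le⟩).1
  rw [quadraticTensor_swap (parallelE_transpose _ χ p θ y.1) (parallelE_transpose _ χ p θ y.2)] at e₂
  rw [← E₁, ← E₂] at e₁ e₂
  refine (congrArg₂ (· - ·) e₁ e₂).trans ?_
  simp only [pairForm, Prod.fst_swap, Prod.snd_swap]
  ring

/-- The bracket on one generator. -/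
theorem integral_bracket_generator (h : IsRegularBranch D μ ρ₀)
    (hp : IsParallel (fun (θ : D) v => μ (clamp v, θ)) m₁ χ p p₁) (hφ : IsTestFunction D φ)
    (hψ : IsTestFunction D ψ) (G : ℝ) (i j k l : Fin 2) (θ : D) :
    Real.pi * G / ρ₀ θ * (2 * ∫ v, inner ℝ
      (smearKernelDeriv (fun (θ : D) v => μ (clamp v, θ)) χ p p₁ φ i j θ v)
      (smearKernel (fun (θ : D) v => μ (clamp v, θ)) χ p ψ k l θ v) ∂unitMeasure) =
    ∫ y in orderedPairs, bracketDensity G ρ₀ μ φ ψ i j k l θ y ∂unitMeasure.prod unitMeasure := by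
  obtain ⟨a, b, ha, hb, hab₁, hab₂⟩ := hφ.exists_interval hψ
  have := (isAmplitude_smear hp hφ ha hb hab₁ i j).two_mul_pairing
    (isAmplitude_smear hp hψ ha hb hab₂ k l) θ
  refine (congrArg (fun z => Real.pi * G / ρ₀ θ * z) this).trans ?_
  rw [← integral_const_mul]
  refine integral_congr_ae ?_
  filter_upwards [ae_restrict_of_ae ae_unitMeasure_prod] with y hy
  rw [causticPairing_sub h hp φ ψ i j k l θ hy.1 hy.2, bracketDensity]
  ring

/-- Domination of the integrand of the bracket. -/
theorem exists_bracketDensity_bound (h : IsRegularBranch D μ ρ₀)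
    (hp : IsParallel (fun (θ : D) v => μ (clamp v, θ)) m₁ χ p p₁) (hφ : IsTestFunction D φ)
    (hψ : IsTestFunction D ψ) (G : ℝ) (i j k l : Fin 2) {K : Set Transverse} (hK : IsCompact K)
    (hKD : K ⊆ D) :
    ∃ C, 0 ≤ C ∧ ∀ θ ∈ K, ∀ y : ℝ × ℝ, y.1 ∈ Ioo (0 : ℝ) 1 → y.2 ∈ Ioo (0 : ℝ) 1 → y.1 < y.2 →
      |bracketDensity G ρ₀ μ φ ψ i j k l θ y| ≤ C * (√(y.2 - y.1))⁻¹ := by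
  obtain ⟨a, b, ha, hb, hab₁, hab₂⟩ := hφ.exists_interval hψ
  have hA := isAmplitude_smear hp hφ ha hb hab₁ i j
  have hB := isAmplitude_smear hp hψ ha hb hab₂ k l
  obtain ⟨C, hC0, hC⟩ := hA.abs_closedForm_sub_le hB (isCompact_preimage_val hK hKD)
  obtain ⟨C₀, hC₀⟩ := hK.exists_bound_of_continuousOn ((continuousOn_inv_rho h G).mono hKD)
  refine ⟨|C₀| * C, by positivity, fun θ hθ y h₁ h₂ hlt => ?_⟩
  -- The density is the pointwise limit δ → 0 of the cut-off expressions, up to the factor πG/ρ₀; it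
  -- inherits their bound, which is uniform in δ.
  have hlim := ((hA.tendsto_closedForm hB ⟨θ, hKD hθ⟩ h₁.1 hlt).sub
    (hB.tendsto_closedForm hA ⟨θ, hKD hθ⟩ h₁.1 hlt)).abs
  have hle := le_of_tendsto hlim (by
    filter_upwards [Ioo_mem_nhdsGT ha] with δ hδ
    exact hC ⟨θ, hKD hθ⟩ hθ δ hδ y.1 h₁ y.2 h₂ hlt)
  have hsub := causticPairing_sub h hp φ ψ i j k l ⟨θ, hKD hθ⟩ h₁ h₂
  rw [bracketDensity, abs_mul, mul_assoc]
  refine mul_le_mul ((hC₀ θ hθ).trans (le_abs_self _)) (le_trans (le_of_eq ?_) hle) (abs_nonneg _)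
    (abs_nonneg _)
  congr 1
  have e : ∀ z a b : ℝ, -(2 / z * a) - -(2 / z * b) = -(2 / z) * (a - b) := fun z a b => by ring
  rw [e, hsub]
  ring

end

/-! ### Integrability of the bracket density, and the bracket itself -/

section

variable {D : Set Transverse} {μ : ℝ × Transverse → ℂ} {ρ₀ : Transverse → ℝ}
  {m₁ : D → ℝ → ℂ} {χ : D → ℝ → ℝ} {p p₁ : D → ℝ → ℂ} {φ ψ : ℝ × Transverse → ℝ}

theorem continuous_quadraticTensor (i j k l : Fin 2) :
    Continuous fun z : Mat2 × Mat2 => quadraticTensor z.1 z.2 i j k l := by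
  unfold quadraticTensor
  fun_prop

theorem continuousOn_fieldE (h : IsRegularBranch D μ ρ₀)
    (hp : IsParallel (fun (θ : D) v => μ (clamp v, θ)) m₁ χ p p₁) :
    ContinuousOn (fieldE ρ₀ μ) (Ioc 0 1 ×ˢ D) := by
  refine (continuousOn_onBranch_univ hp.continuous_parallelE (Ioc 0 1)).congr fun y hy => ?_
  obtain ⟨v, θ⟩ := y
  rw [onBranch_apply _ hy.2]
  exact (fieldE_regular h hp ⟨θ, hy.2⟩ hy.1).1

theorem continuousOn_pairForm (h : IsRegularBranch D μ ρ₀)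
    (hp : IsParallel (fun (θ : D) v => μ (clamp v, θ)) m₁ χ p p₁) (hφ : IsTestFunction D φ)
    (hψ : IsTestFunction D ψ) (i j k l : Fin 2) :
    ContinuousOn (fun q : Transverse × ℝ × ℝ => pairForm ρ₀ μ φ ψ i j k l q.1 q.2)
      (D ×ˢ (Ioo 0 1 ×ˢ Ioo 0 1)) := by
  have hE := (continuousOn_fieldE h hp).mono (prod_mono Ioo_subset_Ioc_self le_rfl)
  have h1 := continuousOn_pair_fst (D := D) hφ.smooth.continuous.continuousOn
  have h2 := continuousOn_pair_snd (D := D) hψ.smooth.continuous.continuousOn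
  have h3 := (continuous_quadraticTensor i j k l).comp_continuousOn
    ((continuousOn_pair_fst hE).prodMk (continuousOn_pair_snd hE))
  exact (h1.mul h2).mul h3

theorem exists_pairForm_bound (h : IsRegularBranch D μ ρ₀)
    (hp : IsParallel (fun (θ : D) v => μ (clamp v, θ)) m₁ χ p p₁) (hφ : IsTestFunction D φ)
    (hψ : IsTestFunction D ψ) (i j k l : Fin 2) {K : Set Transverse} (hK : IsCompact K)
    (hKD : K ⊆ D) :
    ∃ C, 0 ≤ C ∧ ∀ θ ∈ K, ∀ y : ℝ × ℝ, y.1 ∈ Ioo (0 : ℝ) 1 → y.2 ∈ Ioo (0 : ℝ) 1 →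
      |pairForm ρ₀ μ φ ψ i j k l θ y| ≤ C := by
  have hc : Continuous fun y : D × ℝ × ℝ => φ (y.2.1, y.1) * ψ (y.2.2, y.1) *
      quadraticTensor (parallelE (fun (θ : D) v => μ (clamp v, θ)) χ p y.1 y.2.1)
        (parallelE (fun (θ : D) v => μ (clamp v, θ)) χ p y.1 y.2.2) i j k l := by
    have h1 := hp.continuous_parallelE.comp (f := fun y : D × ℝ × ℝ => (y.1, y.2.1)) (by fun_prop)
    have h2 := hp.continuous_parallelE.comp (f := fun y : D × ℝ × ℝ => (y.1, y.2.2)) (by fun_prop)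
    have h3 := hφ.smooth.continuous.comp
      (f := fun y : D × ℝ × ℝ => (y.2.1, (y.1 : Transverse))) (by fun_prop)
    have h4 := hψ.smooth.continuous.comp
      (f := fun y : D × ℝ × ℝ => (y.2.2, (y.1 : Transverse))) (by fun_prop)
    have h5 := (continuous_quadraticTensor i j k l).comp (h1.prodMk h2)
    exact (h3.mul h4).mul h5
  obtain ⟨C, hC⟩ := ((isCompact_preimage_val hK hKD).prod ((isCompact_Icc (a := (0 : ℝ))
    (b := 1)).prod (isCompact_Icc (a := (0 : ℝ)) (b := 1)))).exists_bound_of_continuousOn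
      hc.continuousOn
  refine ⟨|C|, abs_nonneg _, fun θ hθ y h₁ h₂ => ?_⟩
  have := hC (⟨θ, hKD hθ⟩, y) ⟨hθ, Ioo_subset_Icc_self h₁, Ioo_subset_Icc_self h₂⟩
  rw [pairForm, (fieldE_regular h hp ⟨θ, hKD hθ⟩ ⟨h₁.1, h₁.2.le⟩).1,
    (fieldE_regular h hp ⟨θ, hKD hθ⟩ ⟨h₂.1, h₂.2.le⟩).1]
  exact this.trans (le_abs_self _)

theorem pairForm_eq_zero (ρ₀ : Transverse → ℝ) (μ : ℝ × Transverse → ℂ) (ψ : ℝ × Transverse → ℝ)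
    (i j k l : Fin 2) {θ : Transverse} (hθ : θ ∉ Prod.snd '' tsupport φ) (y : ℝ × ℝ) :
    pairForm ρ₀ μ φ ψ i j k l θ y = 0 := by
  rw [pairForm, eq_zero_of_notMem_generators hθ, zero_mul, zero_mul]

/-- The measure on ordered pairs of points on the same generator. -/
def orderedPairMeasure (D : Set Transverse) : Measure (Transverse × ℝ × ℝ) :=
  (volume.restrict D).prod ((unitMeasure.prod unitMeasure).restrict orderedPairs)

theorem orderedPairMeasure_eq (D : Set Transverse) :
    orderedPairMeasure D = (pairMeasure D).restrict (univ ×ˢ orderedPairs) := by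
  rw [pairMeasure, ← Measure.prod_restrict, Measure.restrict_univ]
  rfl

theorem ae_orderedPairMeasure (hD : IsOpen D) : ∀ᵐ q ∂orderedPairMeasure D,
    q.1 ∈ D ∧ q.2.1 ∈ Ioo (0 : ℝ) 1 ∧ q.2.2 ∈ Ioo (0 : ℝ) 1 ∧ q.2.1 < q.2.2 := by
  rw [orderedPairMeasure_eq]
  filter_upwards [ae_restrict_of_ae (ae_pairMeasure hD),
    ae_restrict_mem (MeasurableSet.univ.prod measurableSet_orderedPairs)] with q h1 h2
  exact ⟨h1.1, h1.2.1, h1.2.2, h2.2⟩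

/-- Dominated by a constant on a compact set of generators times (y₂ - y₁)^(-1/2). -/
theorem integrable_bracketDensity (hD : IsOpen D) (h : IsRegularBranch D μ ρ₀)
    (hp : IsParallel (fun (θ : D) v => μ (clamp v, θ)) m₁ χ p p₁) (hφ : IsTestFunction D φ)
    (hψ : IsTestFunction D ψ) (G : ℝ) (i j k l : Fin 2) :
    Integrable (fun q : Transverse × ℝ × ℝ => bracketDensity G ρ₀ μ φ ψ i j k l q.1 q.2)
      (orderedPairMeasure D) := by
  set K := Prod.snd '' tsupport φ ∪ Prod.snd '' tsupport ψ with hKdef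
  have hK : IsCompact K := hφ.isCompact_generators.1.union hψ.isCompact_generators.1
  have hKD : K ⊆ D := union_subset hφ.isCompact_generators.2 hψ.isCompact_generators.2
  obtain ⟨C, hC0, hC⟩ := exists_bracketDensity_bound h hp hφ hψ G i j k l hK hKD
  have hb : Integrable (fun q : Transverse × ℝ × ℝ => K.indicator (fun _ => C) q.1 *
      (√(q.2.2 - q.2.1))⁻¹) (orderedPairMeasure D) := by
    refine Integrable.mul_prod (f := K.indicator fun _ => C)
      (g := fun y : ℝ × ℝ => (√(y.2 - y.1))⁻¹) ?_ integrable_inv_sqrt_sub.integrableOn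
    refine IntegrableOn.integrable_indicator (integrableOn_const ?_) hK.measurableSet
    exact ((Measure.restrict_apply_le _ _).trans_lt hK.measure_lt_top).ne
  refine hb.mono' ?_ ?_
  · rw [orderedPairMeasure_eq]
    have h1 := continuousOn_pairForm h hp hφ hψ i j k l
    have h0 : Continuous fun q : Transverse × ℝ × ℝ => (q.1, q.2.swap) := by fun_prop
    have h2 := h1.comp (f := fun q : Transverse × ℝ × ℝ => (q.1, q.2.swap))
      (s := D ×ˢ (Ioo 0 1 ×ˢ Ioo 0 1)) h0.continuousOn fun q hq => ⟨hq.1, hq.2.2, hq.2.1⟩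
    have h3 : Measurable fun q : Transverse × ℝ × ℝ => -(16 / (q.2.2 ^ 2 - q.2.1 ^ 2)) := by
      fun_prop
    exact ((aestronglyMeasurable_pairMeasure hD ((continuousOn_inv_rho h G).comp (f := Prod.fst)
      (by fun_prop) fun q hq => hq.1)).mul (h3.aestronglyMeasurable.mul
        (aestronglyMeasurable_pairMeasure hD (h1.sub h2)))).restrict
  · filter_upwards [ae_orderedPairMeasure hD] with q hq
    by_cases hqK : q.1 ∈ K
    · rw [indicator_of_mem hqK]
      exact hC q.1 hqK q.2 hq.2.1 hq.2.2.1 hq.2.2.2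
    · rw [indicator_of_notMem hqK, zero_mul, bracketDensity,
        pairForm_eq_zero _ _ _ _ _ _ _ (fun hm => hqK (Or.inl hm)),
        pairForm_eq_zero _ _ _ _ _ _ _ (fun hm => hqK (Or.inl hm))]
      simp

/-- The bracket of the smeared fields. -/
def bracketValue (G : ℝ) (D : Set Transverse) (ρ₀ : Transverse → ℝ) (μ : ℝ × Transverse → ℂ)
    (φ ψ : ℝ × Transverse → ℝ) (i j k l : Fin 2) : ℝ :=
  ∫ q, bracketDensity G ρ₀ μ φ ψ i j k l q.1 q.2 ∂orderedPairMeasure D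

/-- Absolute convergence holds because each functional derivative carries a factor v that
compensates 1/√ρ at the caustic, leaving bounded kernels with a step function. The value is obtained
generator by generator. -/
theorem hasPoissonBracket_smearedE (hD : IsOpen D) (h : IsRegularBranch D μ ρ₀)
    (hp : IsParallel (fun (θ : D) v => μ (clamp v, θ)) m₁ χ p p₁) (hφ : IsTestFunction D φ)
    (hψ : IsTestFunction D ψ) (G : ℝ) (i j k l : Fin 2) :
    HasPoissonBracket G D ρ₀ μ (smearedE D ρ₀ φ i j) (smearedE D ρ₀ ψ k l)
      (bracketValue G D ρ₀ μ φ ψ i j k l : ℂ) := by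
  set m : D → ℝ → ℂ := fun θ v => μ (clamp v, θ) with hm
  set f₁ := onBranch D (branchDeriv m χ p p₁ φ i j) with hf₁
  set f₂ := onBranch D (branchDeriv m χ p p₁ ψ k l) with hf₂
  set κ₁ := onBranch D (smearKernelDeriv m χ p p₁ φ i j) with hκ₁
  set κ₂ := onBranch D (smearKernelDeriv m χ p p₁ ψ k l) with hκ₂
  have hiA := integrable_stepPair hD h hp hφ hψ G i j k l
    (measurableSet_le measurable_snd measurable_fst)
  have hiB := integrable_stepPair hD h hp hψ hφ G k l i j
    (measurableSet_le measurable_snd measurable_fst)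
  have hsw : MeasurePreserving (fun q : Transverse × ℝ × ℝ => (q.1, q.2.swap)) (pairMeasure D)
      (pairMeasure D) :=
    (MeasurePreserving.id _).prod Measure.measurePreserving_swap
  have hiB' := hsw.integrable_comp_of_integrable hiB
  have eA : (fun q : Transverse × ℝ × ℝ => f₁ (q.2.1, q.1) * bracketKernel G ρ₀ μ q.1 q.2.1 q.2.2 *
      conj (f₂ (q.2.2, q.1))) =ᵐ[pairMeasure D] fun q => ((Real.pi * G / ρ₀ q.1 : ℝ) : ℂ) *
        (if q.2.2 ≤ q.2.1 then conj (κ₁ (q.2.1, q.1)) * κ₂ (q.2.2, q.1) else 0) := by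
    filter_upwards [ae_pairMeasure hD] with q hq
    simp only [hf₁, hf₂, hκ₁, hκ₂, onBranch_apply _ hq.1]
    exact branchDeriv_bracketKernel G h hp φ ψ i j k l ⟨q.1, hq.1⟩ hq.2.1 hq.2.2
  have eB : (fun q : Transverse × ℝ × ℝ => conj (f₁ (q.2.1, q.1)) *
      bracketKernel G ρ₀ μ q.1 q.2.2 q.2.1 * f₂ (q.2.2, q.1)) =ᵐ[pairMeasure D]
      fun q => ((Real.pi * G / ρ₀ q.1 : ℝ) : ℂ) *
        (if q.2.1 ≤ q.2.2 then conj (κ₂ (q.2.2, q.1)) * κ₁ (q.2.1, q.1) else 0) := by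
    filter_upwards [ae_pairMeasure hD] with q hq
    simp only [hf₁, hf₂, hκ₁, hκ₂, onBranch_apply _ hq.1]
    rw [← branchDeriv_bracketKernel G h hp ψ φ k l i j ⟨q.1, hq.1⟩ hq.2.2 hq.2.1]
    ring
  refine ⟨f₁, fun y => conj (f₁ y), f₂, fun y => conj (f₂ y),
    hasFunctionalDerivs_smearedE hD h hp hφ i j, hasFunctionalDerivs_smearedE hD h hp hψ k l, ?_, ?_, ?_⟩
  · rw [IntegrableOn, restrict_pairDomain]
    exact hiA.congr eA.symm
  · rw [IntegrableOn, restrict_pairDomain]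
    exact hiB'.congr eB.symm
  · rw [restrict_pairDomain]
    refine Eq.trans ?_ (integral_congr_ae (eA.sub eB)).symm
    rw [bracketValue, orderedPairMeasure, integral_prod _ (integrable_bracketDensity hD h hp hφ hψ G i j k l)]
    refine Eq.trans ?_ (integral_prod _ (hiA.sub hiB')).symm
    refine integral_complex_ofReal.symm.trans (integral_congr_ae ?_)
    filter_upwards [ae_restrict_mem hD.measurableSet] with θ hθ
    obtain ⟨C₁, hk₁⟩ := isUnitPrimitive_smearKernel hp hφ i j ⟨θ, hθ⟩
    obtain ⟨C₂, hk₂⟩ := isUnitPrimitive_smearKernel hp hψ k l ⟨θ, hθ⟩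
    have e := integral_bracket_generator h hp hφ hψ G i j k l ⟨θ, hθ⟩
    simp only at e
    rw [← e, Complex.ofReal_mul, ← hk₁.integral_antisymm hk₂, ← integral_const_mul]
    refine integral_congr_ae (Eventually.of_forall fun y => ?_)
    simp only [Pi.sub_apply, Function.comp_apply, Prod.fst_swap, Prod.snd_swap, onBranch_apply _ hθ,
      mul_sub]

end

/-! ### The principal value -/

section

variable {D : Set Transverse} {μ : ℝ × Transverse → ℂ} {ρ₀ : Transverse → ℝ}
  {m₁ : D → ℝ → ℂ} {χ : D → ℝ → ℝ} {p p₁ : D → ℝ → ℂ} {φ ψ : ℝ × Transverse → ℝ}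

/-- The difference of the area densities of a pair of points. -/
def densityGap (ρ₀ : Transverse → ℝ) (q : Transverse × ℝ × ℝ) : ℝ :=
  areaDensity ρ₀ q.1 q.2.1 - areaDensity ρ₀ q.1 q.2.2

theorem densityGap_eq (ρ₀ : Transverse → ℝ) (q : Transverse × ℝ × ℝ) :
    densityGap ρ₀ q = ρ₀ q.1 * (q.2.1 ^ 2 - q.2.2 ^ 2) := by
  simp only [densityGap, areaDensity]; ring

/-- The integrand of the principal value, cut off near coinciding points. -/
def cutIntegrand (G : ℝ) (ρ₀ : Transverse → ℝ) (μ : ℝ × Transverse → ℂ)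
    (φ ψ : ℝ × Transverse → ℝ) (i j k l : Fin 2) (ε : ℝ) (q : Transverse × ℝ × ℝ) : ℝ :=
  {q | ε < |densityGap ρ₀ q|}.indicator
    (fun q => 16 * Real.pi * G / densityGap ρ₀ q * pairForm ρ₀ μ φ ψ i j k l q.1 q.2) q

theorem aemeasurable_densityGap (hD : IsOpen D) (h : IsRegularBranch D μ ρ₀) :
    AEMeasurable (densityGap ρ₀) (pairMeasure D) := by
  refine (aestronglyMeasurable_pairMeasure hD ?_).aemeasurable
  have h1 : ContinuousOn (fun q : Transverse × ℝ × ℝ => ρ₀ q.1) (D ×ˢ (Ioo 0 1 ×ˢ Ioo 0 1)) :=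
    h.smooth_rho.continuousOn.comp (f := Prod.fst) (by fun_prop) fun q hq => hq.1
  refine (h1.mul (g := fun q : Transverse × ℝ × ℝ => q.2.1 ^ 2 - q.2.2 ^ 2) (by fun_prop)).congr
    fun q _ => densityGap_eq ρ₀ q

theorem nullMeasurableSet_densityGap (hD : IsOpen D) (h : IsRegularBranch D μ ρ₀) (ε : ℝ) :
    NullMeasurableSet {q | ε < |densityGap ρ₀ q|} (pairMeasure D) :=
  nullMeasurableSet_lt aemeasurable_const (aemeasurable_densityGap hD h).abs

theorem integrable_cutIntegrand (hD : IsOpen D) (h : IsRegularBranch D μ ρ₀)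
    (hp : IsParallel (fun (θ : D) v => μ (clamp v, θ)) m₁ χ p p₁) (hφ : IsTestFunction D φ)
    (hψ : IsTestFunction D ψ) (G : ℝ) (i j k l : Fin 2) {ε : ℝ} (hε : 0 < ε) :
    Integrable (cutIntegrand G ρ₀ μ φ ψ i j k l ε) (pairMeasure D) := by
  obtain ⟨hK, hKD⟩ := hφ.isCompact_generators
  obtain ⟨C, hC0, hC⟩ := exists_pairForm_bound h hp hφ hψ i j k l hK hKD
  refine integrable_pairMeasure hK hD (C := |16 * Real.pi * G| / ε * C) ?_
    (fun θ hθ y h₁ h₂ => ?_) fun θ hθ y => ?_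
  · refine AEStronglyMeasurable.indicator₀ ?_ (nullMeasurableSet_densityGap hD h ε)
    exact ((aemeasurable_const.div (aemeasurable_densityGap hD h)).aestronglyMeasurable).mul
      (aestronglyMeasurable_pairMeasure hD (continuousOn_pairForm h hp hφ hψ i j k l))
  · rw [cutIntegrand]
    by_cases hm : (θ, y) ∈ {q | ε < |densityGap ρ₀ q|}
    · rw [indicator_of_mem hm, norm_mul, Real.norm_eq_abs, abs_div]
      have hm' : ε < |densityGap ρ₀ (θ, y)| := hm
      refine mul_le_mul ?_ (hC θ hθ y h₁ h₂) (norm_nonneg _) (by positivity)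
      exact div_le_div_of_nonneg_left (abs_nonneg _) hε hm'.le
    · rw [indicator_of_notMem hm, norm_zero]
      positivity
  · rw [cutIntegrand, indicator_apply]
    split_ifs
    · rw [pairForm_eq_zero _ _ _ _ _ _ _ hθ, mul_zero]
    · rfl

/-- The difference of the area densities is odd under exchange of the points while the excised
region is symmetric, so folding produces the antisymmetrized tensor, which is the bracket density.
-/
theorem cutIntegrand_add_swap (h : IsRegularBranch D μ ρ₀) (G : ℝ) (φ ψ : ℝ × Transverse → ℝ)
    (i j k l : Fin 2) (ε : ℝ) {θ : Transverse} (hθ : θ ∈ D) (y : ℝ × ℝ) :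
    cutIntegrand G ρ₀ μ φ ψ i j k l ε (θ, y) + cutIntegrand G ρ₀ μ φ ψ i j k l ε (θ, y.swap) =
      {q | ε < |densityGap ρ₀ q|}.indicator
        (fun q => bracketDensity G ρ₀ μ φ ψ i j k l q.1 q.2) (θ, y) := by
  have hρ := (h.rho_pos θ hθ).ne'
  have hs : densityGap ρ₀ (θ, y.swap) = -densityGap ρ₀ (θ, y) := by
    simp only [densityGap, Prod.fst_swap, Prod.snd_swap]; ring
  simp only [cutIntegrand, indicator_apply]
  have hiff : (θ, y.swap) ∈ {q | ε < |densityGap ρ₀ q|} ↔ (θ, y) ∈ {q | ε < |densityGap ρ₀ q|} := by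
    change ε < |densityGap ρ₀ (θ, y.swap)| ↔ ε < |densityGap ρ₀ (θ, y)|
    rw [hs, abs_neg]
  rw [if_congr hiff rfl rfl]
  split_ifs
  · rw [hs, densityGap_eq, bracketDensity]
    simp only
    have e : y.2 ^ 2 - y.1 ^ 2 = -(y.1 ^ 2 - y.2 ^ 2) := by ring
    rw [e]
    generalize y.1 ^ 2 - y.2 ^ 2 = z
    -- On the diagonal both sides are 0, since division by zero gives 0.
    rcases eq_or_ne z 0 with rfl | hz
    · simp
    · field_simp
      ring
  · rw [add_zero]

theorem integral_cutIntegrand (hD : IsOpen D) (h : IsRegularBranch D μ ρ₀)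
    (hp : IsParallel (fun (θ : D) v => μ (clamp v, θ)) m₁ χ p p₁) (hφ : IsTestFunction D φ)
    (hψ : IsTestFunction D ψ) (G : ℝ) (i j k l : Fin 2) {ε : ℝ} (hε : 0 < ε) :
    ∫ q, cutIntegrand G ρ₀ μ φ ψ i j k l ε q ∂pairMeasure D =
      ∫ q, {q | ε < |densityGap ρ₀ q|}.indicator
        (fun q => bracketDensity G ρ₀ μ φ ψ i j k l q.1 q.2) q ∂orderedPairMeasure D := by
  have hi := integrable_cutIntegrand hD h hp hφ hψ G i j k l hε
  have hn : NullMeasurableSet {q | ε < |densityGap ρ₀ q|} (orderedPairMeasure D) := by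
    rw [orderedPairMeasure_eq]
    exact (nullMeasurableSet_densityGap hD h ε).mono_ac
      (Measure.absolutelyContinuous_of_le Measure.restrict_le_self)
  have hi' := (integrable_bracketDensity hD h hp hφ hψ G i j k l).indicator₀ hn
  rw [orderedPairMeasure] at hi' ⊢
  rw [integral_prod _ hi', pairMeasure, integral_prod _ hi]
  refine integral_congr_ae ?_
  filter_upwards [ae_restrict_mem hD.measurableSet, hi.prod_right_ae] with θ hθ hiθ
  rw [integral_eq_orderedPairs hiθ]
  refine integral_congr_ae (Eventually.of_forall fun y => ?_)
  exact cutIntegrand_add_swap h G φ ψ i j k l ε hθ y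

/-- After folding, the integrand is the bracket density times an indicator that increases to 1 off
the diagonal. Its absolute value serves as the dominating function, so the principal value exists
and equals the bracket. -/
theorem tendsto_integral_cutIntegrand (hD : IsOpen D) (h : IsRegularBranch D μ ρ₀)
    (hp : IsParallel (fun (θ : D) v => μ (clamp v, θ)) m₁ χ p p₁) (hφ : IsTestFunction D φ)
    (hψ : IsTestFunction D ψ) (G : ℝ) (i j k l : Fin 2) :
    Tendsto (fun ε => ∫ q, cutIntegrand G ρ₀ μ φ ψ i j k l ε q ∂pairMeasure D) (𝓝[>] 0)
      (𝓝 (bracketValue G D ρ₀ μ φ ψ i j k l)) := by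
  have hi := integrable_bracketDensity hD h hp hφ hψ G i j k l
  refine Tendsto.congr' (f₁ := fun ε => ∫ q, {q | ε < |densityGap ρ₀ q|}.indicator
    (fun q => bracketDensity G ρ₀ μ φ ψ i j k l q.1 q.2) q ∂orderedPairMeasure D) ?_ ?_
  · filter_upwards [self_mem_nhdsWithin] with ε hε
    exact (integral_cutIntegrand hD h hp hφ hψ G i j k l hε).symm
  · refine tendsto_integral_filter_of_dominated_convergence _ ?_ ?_ hi.norm ?_
    · refine Eventually.of_forall fun ε => ?_
      refine hi.aestronglyMeasurable.indicator₀ ?_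
      rw [orderedPairMeasure_eq]
      exact (nullMeasurableSet_densityGap hD h ε).mono_ac
        (Measure.absolutelyContinuous_of_le Measure.restrict_le_self)
    · refine Eventually.of_forall fun ε => Eventually.of_forall fun q => ?_
      exact norm_indicator_le_norm_self _ _
    · filter_upwards [ae_orderedPairMeasure hD] with q hq
      have hne : 0 < |densityGap ρ₀ q| := by
        rw [abs_pos, densityGap_eq]
        refine mul_ne_zero (h.rho_pos _ hq.1).ne' (ne_of_lt ?_)
        nlinarith [hq.2.1.1, hq.2.2.2]
      refine tendsto_const_nhds.congr' ?_
      filter_upwards [Ioo_mem_nhdsGT hne] with ε hε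
      exact (indicator_of_mem (s := {q | ε < |densityGap ρ₀ q|}) hε.2
        fun q => bracketDensity G ρ₀ μ φ ψ i j k l q.1 q.2).symm

/-- The principal value on the right side of the bracket. -/
theorem hasPrincipalValue_bracketValue (hD : IsOpen D) (h : IsRegularBranch D μ ρ₀)
    (hp : IsParallel (fun (θ : D) v => μ (clamp v, θ)) m₁ χ p p₁) (hφ : IsTestFunction D φ)
    (hψ : IsTestFunction D ψ) (G : ℝ) (i j k l : Fin 2)
    {K : ℝ × Transverse → ℝ × Transverse → ℝ}
    (hK : ∀ θ ∈ D, ∀ v₁ ∈ Ioo (0 : ℝ) 1, ∀ v₂ ∈ Ioo (0 : ℝ) 1, K (v₁, θ) (v₂, θ) =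
      quadraticTensor (fieldE ρ₀ μ (v₁, θ)) (fieldE ρ₀ μ (v₂, θ)) i j k l) :
    HasPrincipalValue D ρ₀ (16 * Real.pi * G) K φ ψ (bracketValue G D ρ₀ μ φ ψ i j k l) := by
  have hr : ∀ ε, (volume : Measure (Transverse × ℝ × ℝ)).restrict (excisedDomain D ρ₀ ε) =
      (pairMeasure D).restrict {q | ε < |densityGap ρ₀ q|} := fun ε => by
    have e := restrict_pairDomain D
    have hn := nullMeasurableSet_densityGap hD h ε
    rw [pairMeasure, ← e] at hn ⊢
    rw [Measure.restrict_restrict₀ hn, excisedDomain, inter_comm]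
    rfl
  -- The tensor `K` is prescribed at interior points only, which suffices because the ends v = 0 and
  -- v = 1 form a null set.
  have hcongr : (fun q : Transverse × ℝ × ℝ =>
      16 * Real.pi * G / (areaDensity ρ₀ q.1 q.2.1 - areaDensity ρ₀ q.1 q.2.2) *
        K (q.2.1, q.1) (q.2.2, q.1) * (φ (q.2.1, q.1) * ψ (q.2.2, q.1))) =ᵐ[pairMeasure D]
      fun q => 16 * Real.pi * G / densityGap ρ₀ q * pairForm ρ₀ μ φ ψ i j k l q.1 q.2 := by
    filter_upwards [ae_pairMeasure hD] with q hq
    rw [hK q.1 hq.1 _ hq.2.1 _ hq.2.2, pairForm, densityGap]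
    ring
  refine ⟨fun ε hε => ?_, ?_⟩
  · rw [IntegrableOn, hr]
    have hi := integrable_cutIntegrand hD h hp hφ hψ G i j k l hε
    refine (hi.restrict (s := {q | ε < |densityGap ρ₀ q|})).congr ?_
    filter_upwards [ae_restrict_mem₀ (nullMeasurableSet_densityGap hD h ε),
      ae_restrict_of_ae hcongr] with q hq hc
    rw [hc, cutIntegrand, indicator_of_mem (s := {q | ε < |densityGap ρ₀ q|}) hq]
  · refine (tendsto_integral_cutIntegrand hD h hp hφ hψ G i j k l).congr fun ε => ?_
    rw [hr, integral_congr_ae (ae_restrict_of_ae hcongr),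
      ← integral_indicator₀ (nullMeasurableSet_densityGap hD h ε)]
    rfl

end

end NullSheet

end

theorem mainTheorem8 (G : ℝ) (D : Set NullSheet.Transverse) (hD : IsOpen D)
    (μ : ℝ × NullSheet.Transverse → ℂ) (ρ₀ : NullSheet.Transverse → ℝ)
    (h : NullSheet.IsRegularBranch D μ ρ₀) :
    -- the map `μ ↦ E` is well defined on each generator and does not depend on the zweibein
    (∀ θ ∈ D, ∀ r ∈ Ioc (0 : ℝ) 1,
      (∀ W : ℝ → NullSheet.Mat2,
        (∀ i j, ContDiffOn ℝ 1 (fun x => W x i j) (Icc 0 1)) →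
        (∀ x ∈ Icc (0 : ℝ) 1,
          NullSheet.IsZweibein (W x) (NullSheet.conformalMetric (μ (x, θ)))) →
        (∀ i j, IntervalIntegrable
          (fun x => NullSheet.deformedConnection W (NullSheet.areaDensity ρ₀ θ) r x i j)
          volume 0 r) ∧
        Summable (fun s : ℕ => NullSheet.pathOrderedTerm
          (NullSheet.deformedConnection W (NullSheet.areaDensity ρ₀ θ) r) s 0 r) ∧
        NullSheet.deformedMetric W (NullSheet.areaDensity ρ₀ θ) r
          = NullSheet.fieldE ρ₀ μ (r, θ)) ∧
      (NullSheet.fieldE ρ₀ μ (r, θ)).PosDef ∧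
      (NullSheet.fieldE ρ₀ μ (r, θ)).det = 1) ∧
    (∀ a b, ContinuousOn (fun p => NullSheet.fieldE ρ₀ μ p a b) (Ioc 0 1 ×ˢ D)) ∧
    -- the Poisson bracket of `E` with `E`, as a distribution, in both of its forms
    (∀ φ ψ : ℝ × NullSheet.Transverse → ℝ,
      NullSheet.IsTestFunction D φ → NullSheet.IsTestFunction D ψ →
      ∀ a b c d : Fin 2, ∃ B : ℝ,
        NullSheet.HasPoissonBracket G D ρ₀ μ
          (NullSheet.smearedE D ρ₀ φ a b) (NullSheet.smearedE D ρ₀ ψ c d) (B : ℂ) ∧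
        NullSheet.HasPrincipalValue D ρ₀ (16 * Real.pi * G)
          (fun p q => NullSheet.quadraticTensor (NullSheet.fieldE ρ₀ μ p)
            (NullSheet.fieldE ρ₀ μ q) a b c d) φ ψ B ∧
        NullSheet.HasPrincipalValue D ρ₀ (16 * Real.pi * G)
          (fun p q => NullSheet.quadraticExplicit (NullSheet.fieldE ρ₀ μ p)
            (NullSheet.fieldE ρ₀ μ q) a b c d) φ ψ B) := by
  obtain ⟨m₁, χ, p, p₁, hp⟩ := NullSheet.exists_isParallel hD h
  refine ⟨fun θ hθ r hr => ?_, fun a b => ?_, fun φ ψ hφ hψ a b c d => ?_⟩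
  · obtain ⟨hE, hW⟩ := NullSheet.fieldE_regular h hp ⟨θ, hθ⟩ hr
    have hpos := NullSheet.posDef_orderedMetric (hp.det_zweibein ⟨θ, hθ⟩)
      (hp.continuous_conn_right ⟨θ, hθ⟩ r) fun t => NullSheet.gaugeConn_trace _ _ _ _
    simp only at hE
    rw [hE] at hW ⊢
    exact ⟨hW, hpos⟩
  · exact (continuous_apply b).comp_continuousOn
      ((continuous_apply a).comp_continuousOn (NullSheet.continuousOn_fieldE h hp))
  -- One number serves for the bracket and for both principal values; the two tensors agree because
  -- E is symmetric.
  · refine ⟨NullSheet.bracketValue G D ρ₀ μ φ ψ a b c d,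
      NullSheet.hasPoissonBracket_smearedE hD h hp hφ hψ G a b c d,
      NullSheet.hasPrincipalValue_bracketValue hD h hp hφ hψ G a b c d fun _ _ _ _ _ _ => rfl,
      NullSheet.hasPrincipalValue_bracketValue hD h hp hφ hψ G a b c d fun θ hθ v₁ hv₁ v₂ hv₂ => ?_⟩
    rw [(NullSheet.fieldE_regular h hp ⟨θ, hθ⟩ ⟨hv₁.1, hv₁.2.le⟩).1,
      (NullSheet.fieldE_regular h hp ⟨θ, hθ⟩ ⟨hv₂.1, hv₂.2.le⟩).1]
    exact (NullSheet.quadraticTensor_eq_explicit (NullSheet.parallelE_transpose _ χ p ⟨θ, hθ⟩ v₁)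
      (NullSheet.parallelE_transpose _ χ p ⟨θ, hθ⟩ v₂) a b c d).symm
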